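/- **Setting.** Let $\mathcal H_R$ be a complex separable Hilbert space and $t\mapsto e^{-itH_R}$ a strongly continuous unitary group with self-adjoint generator $H_R$; let $\Omega_R\in\mathcal H_R$ be a unit vector with $H_R\Omega_R=0$ and $\omega_R=|\Omega_R\rangle\langle\Omega_R|$. Let $\mathcal H_S$ be a finite-dimensional complex Hilbert space, let $H_S,W$ be self-adjoint operators on $\mathcal H_S$, and let $V$ be a bounded self-adjoint operator on $\mathcal H_R$ with $\operatorname{tr}(V\omega_R)=0$. Put $\mathcal H=\mathcal H_S\otimes\mathcal H_R$ and let $\mathcal T(\mathcal H)$ be the Banach space of trace class operators on $\mathcal H$. On $\mathcal T(\mathcal H)$ let $P\rho=\operatorname{tr}_R(\rho)\otimes\omega_R$, $Q=1-P$, $\mathcal L_S\rho=[H_S\otimes 1,\rho]$, $\mathcal L_{SR}\rho=[W\otimes V,\rho]$, and $e^{-it\mathcal L_0}\rho=e^{-itH_0}\rho\,e^{itH_0}$ with $H_0=H_S\otimes1+1\otimes H_R$. For a bounded operator $X$ on $\mathcal T(\mathcal H)$, $e^{-it(\mathcal L_0+X)}$ denotes the strongly continuous group generated by $-i\mathcal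 L_0-iX$. For $\lambda\in\mathbb R\setminus\{0\}$ and $\tau\ge0$ put $$U^\lambda(\tau)=e^{i\frac{\tau}{\lambda^2}\mathcal L_S}\,P\,e^{-i\frac{\tau}{\lambda^2}(\mathcal L_0+\lambda\mathcal L_{SR})}\,P,$$ $$K^\lambda(\tau)=\int_0^{\tau/\lambda^2}P e^{is\mathcal L_0}\mathcal L_{SR}\,Q\,e^{-is(\mathcal L_0+\lambda Q\mathcal L_{SR}Q)}\,Q\mathcal L_{SR}P\,ds .$$ **Clustering.** Let $V(t)=e^{itH_R}Ve^{-itH_R}$. For $n\ge1$, $A\subset\{0,\dots,n+1\}$ and $z=(z_0,\dots,z_{n+1})$ let $$\mathcal G_n(A,z)=\sum_d(-1)^{|d|+1}\prod_{s=1}^{|d|}\operatorname{tr}\Bigl(\prod_{k\in d_s^A}V(z_k)\,\omega_R\Bigr),$$ where $d=(d_1,\dots,d_{|d|})$ runs over the partitions of the sequence $(0,1,\dots,n+1)$ into contiguous subsequences of length at least $2$, $d_s^A$ lists first the elements of $d_s$ in $A$ in increasing order and then the other elements of $d_s$ in decreasing order, and products are taken in the order of the list. The triple $(H_R,V,\omega_R)$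 has the *clustering property* if there are $f:\mathbb R\to[0,\infty)$ and $\epsilon\in(0,1)$ with $\int_{\mathbb R}f(s)(1+|s|)^\epsilon ds<\infty$, and $C>0$, such that for all $n\ge1$, all $A\subset\{0,\dots,n+1\}$ and all $0=z_0\le z_1\le\dots\le z_{n+1}$ $$|\mathcal G_n(A,z)|\le\frac{C^{n+2}}{[n/2]!}\sum_p\ \prod_{l=0}^{[(n+1)/2]}f\bigl(z_{p(l)}-z_{p(l+1)}\bigr),$$ where $p$ runs over the permutations of $\{0,\dots,n+1\}$ with $|p(1)-p(0)|\ge2$, and $[x]$ is the integer part of $x$. **Theorem.** Assume that $\varphi(t)=\operatorname{tr}(V(t)V\omega_R)$ is in $L^1(\mathbb R)$ and that $(H_R,V,\omega_R)$ has the clustering property. With $\mathcal L_{SR}(s)=e^{is\mathcal L_0}\mathcal L_{SR}e^{-is\mathcal L_0}$, the integrals defining $K^\lambda(\tau)$ and $$K=\int_0^\infty P\mathcal L_{SR}(s)\,Q\mathcal L_{SR}P\,ds$$ converge absolutely in operator norm, so that $K^\lambda(\tau)$ and $K$ are bounded operators on $\mathcal T(\mathcal H)$, and, in operator norm, $$\lim_{\lambda\to0}K^\lambda(\tau)=K\quad\text{uniformly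 in }\tau\in[\tau_0,\tau_1],\text{ for all }0<\tau_0<\tau_1 .$$ Moreover the limit $K^\natural=\lim_{T\to+\infty}\frac1T\int_0^Te^{is\mathcal L_S}Ke^{-is\mathcal L_S}\,ds$ exists in operator norm, and $$\lim_{\lambda\to0}U^\lambda(\tau)=e^{-\tau K^\natural}P\quad\text{uniformly in }\tau\in[0,\tau_1],\text{ for all }\tau_1>0 .$$ -/

import Mathlib

open MeasureTheory Filter Topology Set
open scoped TensorProduct InnerProductSpace

noncomputable section

namespace VanHove

/-! ## Trace class operators -/

section TraceClass

variable {H : Type*} [NormedAddCommGroup H] [InnerProductSpace ℂ H]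

/-- `T = ∑ₙ |xₙ⟩⟨yₙ|` (in operator norm) with `∑ₙ ‖xₙ‖ ‖yₙ‖ < ∞`. -/
structure IsNuclearRep (T : H →L[ℂ] H) (x y : ℕ → H) : Prop where
  summable : Summable fun n => ‖x n‖ * ‖y n‖
  hasSum : HasSum (fun n => InnerProductSpace.rankOne ℂ (x n) (y n)) T

/-- The cost `∑ₙ ‖xₙ‖ ‖yₙ‖` of a representation. -/
def repCost (x y : ℕ → H) : ℝ := ∑' n, ‖x n‖ * ‖y n‖

theorem repCost_nonneg (x y : ℕ → H) : 0 ≤ repCost x y :=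
  tsum_nonneg fun _ => by positivity

theorem IsNuclearRep.add {S T : H →L[ℂ] H} {x y x' y' : ℕ → H}
    (h : IsNuclearRep S x y) (h' : IsNuclearRep T x' y') :
    ∃ a b : ℕ → H, IsNuclearRep (S + T) a b ∧ repCost a b = repCost x y + repCost x' y' := by
  obtain ⟨e⟩ : Nonempty (ℕ ≃ ℕ ⊕ ℕ) := ⟨Equiv.natSumNatEquivNat.symm⟩
  have hs : HasSum (fun i : ℕ ⊕ ℕ => ‖Sum.elim x x' i‖ * ‖Sum.elim y y' i‖)
      (repCost x y + repCost x' y') :=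
    HasSum.sum h.summable.hasSum h'.summable.hasSum
  have hT : HasSum (fun i : ℕ ⊕ ℕ =>
      InnerProductSpace.rankOne ℂ (Sum.elim x x' i) (Sum.elim y y' i)) (S + T) :=
    HasSum.sum h.hasSum h'.hasSum
  have hs' := (e.hasSum_iff).2 hs
  have hT' := (e.hasSum_iff).2 hT
  exact ⟨fun n => Sum.elim x x' (e n), fun n => Sum.elim y y' (e n), ⟨hs'.summable, hT'⟩,
    hs'.tsum_eq⟩

theorem IsNuclearRep.smul {T : H →L[ℂ] H} {x y : ℕ → H} (c : ℂ) (h : IsNuclearRep T x y) :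
    IsNuclearRep (c • T) (fun n => c • x n) y ∧
      repCost (fun n => c • x n) y = ‖c‖ * repCost x y := by
  refine ⟨⟨?_, ?_⟩, ?_⟩
  · simpa [norm_smul, mul_assoc] using h.summable.mul_left ‖c‖
  · simpa using h.hasSum.const_smul c
  · simp only [repCost, norm_smul, mul_assoc, tsum_mul_left]

theorem isNuclearRep_rankOne (x y : H) :
    IsNuclearRep (InnerProductSpace.rankOne ℂ x y)
      (fun n => if n = 0 then x else 0) (fun n => if n = 0 then y else 0) := by
  refine ⟨summable_of_ne_finset_zero (s := {0}) fun n hn => ?_, ?_⟩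
  · have : n ≠ 0 := by simpa using hn
    simp [this]
  · have := hasSum_single (f := fun n : ℕ => InnerProductSpace.rankOne ℂ
      (if n = 0 then x else 0) (if n = 0 then y else 0)) 0 (fun n hn => by simp [hn])
    simpa using this

variable (H) in
/-- The trace class operators on `H`, as a subspace of the bounded operators: the operators that
are absolutely convergent series of rank-one operators. -/
def traceClass : Submodule ℂ (H →L[ℂ] H) where
  carrier := {T | ∃ x y : ℕ → H, IsNuclearRep T x y}
  add_mem' := by
    rintro S T ⟨x, y, h⟩ ⟨x', y', h'⟩
    obtain ⟨a, b, hab, -⟩ := h.add h'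
    exact ⟨a, b, hab⟩
  zero_mem' := ⟨0, 0, by simp, by simp⟩
  smul_mem' := by
    rintro c T ⟨x, y, h⟩
    exact ⟨_, y, (h.smul c).1⟩

theorem rankOne_mem_traceClass (x y : H) : InnerProductSpace.rankOne ℂ x y ∈ traceClass H :=
  ⟨_, _, isNuclearRep_rankOne x y⟩

variable (H) in
/-- The Banach space `𝒯(H)` of trace class operators, with the trace norm
`‖T‖₁ = inf {∑ₙ ‖xₙ‖ ‖yₙ‖ : T = ∑ₙ |xₙ⟩⟨yₙ|}`. -/
def TraceClass : Type _ := ↥(traceClass H)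

namespace TraceClass

instance : AddCommGroup (TraceClass H) := inferInstanceAs (AddCommGroup ↥(traceClass H))

instance : Module ℂ (TraceClass H) := inferInstanceAs (Module ℂ ↥(traceClass H))

variable (H) in
/-- The underlying bounded operator, linearly. -/
def valₗ : TraceClass H →ₗ[ℂ] (H →L[ℂ] H) := (traceClass H).subtype

/-- The underlying bounded operator of a trace class operator. -/
def val (T : TraceClass H) : H →L[ℂ] H := valₗ H T

theorem val_injective : Function.Injective (val : TraceClass H → H →L[ℂ] H) :=
  Subtype.val_injective

theorem exists_rep (T : TraceClass H) : ∃ x y : ℕ → H, IsNuclearRep T.val x y := T.2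

/-- The trace norm. -/
instance : Norm (TraceClass H) :=
  ⟨fun T => sInf {c | ∃ x y : ℕ → H, IsNuclearRep T.val x y ∧ c = repCost x y}⟩

theorem norm_def (T : TraceClass H) :
    ‖T‖ = sInf {c | ∃ x y : ℕ → H, IsNuclearRep T.val x y ∧ c = repCost x y} := rfl

theorem norm_le {T : TraceClass H} {x y : ℕ → H} (h : IsNuclearRep T.val x y) :
    ‖T‖ ≤ repCost x y :=
  csInf_le ⟨0, by rintro c ⟨x, y, -, rfl⟩; exact repCost_nonneg x y⟩ ⟨x, y, h, rfl⟩

theorem le_norm {T : TraceClass H} {r : ℝ}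
    (h : ∀ x y : ℕ → H, IsNuclearRep T.val x y → r ≤ repCost x y) : r ≤ ‖T‖ := by
  obtain ⟨x, y, hxy⟩ := T.exists_rep
  exact le_csInf ⟨_, x, y, hxy, rfl⟩ (by rintro c ⟨x, y, hxy, rfl⟩; exact h x y hxy)

theorem opNorm_le (T : TraceClass H) : ‖T.val‖ ≤ ‖T‖ :=
  le_norm fun _ _ h => h.hasSum.norm_le_of_bounded h.summable.hasSum fun _ => by simp

theorem norm_smul_le' (c : ℂ) (T : TraceClass H) : ‖c • T‖ ≤ ‖c‖ * ‖T‖ := by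
  rcases eq_or_ne c 0 with rfl | hc
  · obtain ⟨x, y, h⟩ := T.exists_rep
    have := norm_le (T := (0 : ℂ) • T) (h.smul 0).1
    rw [(h.smul 0).2] at this
    simpa using this
  · have hc' : 0 < ‖c‖ := norm_pos_iff.2 hc
    rw [mul_comm, ← div_le_iff₀ hc']
    refine le_norm fun x y h => ?_
    rw [div_le_iff₀ hc', mul_comm, ← (h.smul c).2]
    exact norm_le (T := c • T) (h.smul c).1

theorem core : NormedSpace.Core ℂ (TraceClass H) where
  norm_nonneg T := le_norm fun x y _ => repCost_nonneg x y
  norm_smul c T := by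
    refine le_antisymm (norm_smul_le' c T) ?_
    rcases eq_or_ne c 0 with rfl | hc
    · simpa using le_norm fun x y _ => repCost_nonneg x y
    · have := norm_smul_le' c⁻¹ (c • T)
      rw [smul_smul, inv_mul_cancel₀ hc, one_smul, norm_inv] at this
      rwa [← le_inv_mul_iff₀ (norm_pos_iff.2 hc)]
  norm_triangle S T := by
    rw [← sub_le_iff_le_add]
    refine le_norm fun x y h => ?_
    rw [sub_le_comm]
    refine le_norm fun x' y' h' => ?_
    rw [sub_le_iff_le_add, add_comm]
    obtain ⟨a, b, hab, hc⟩ := h'.add h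
    have := norm_le (T := T + S) hab
    rw [hc] at this
    linarith [this, (by rw [add_comm S T] : ‖S + T‖ = ‖T + S‖)]
  norm_eq_zero_iff T := by
    constructor
    · intro h
      have := T.opNorm_le
      rw [h, norm_le_zero_iff] at this
      exact val_injective (this.trans (map_zero (valₗ H)).symm)
    · rintro rfl
      refine le_antisymm ?_ (le_norm fun x y _ => repCost_nonneg x y)
      simpa using norm_smul_le' 0 (0 : TraceClass H)

instance : NormedAddCommGroup (TraceClass H) := NormedAddCommGroup.ofCore core

instance : NormedSpace ℂ (TraceClass H) := NormedSpace.ofCore core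

section Sandwich

variable [CompleteSpace H]

theorem _root_.VanHove.IsNuclearRep.sandwich {T : H →L[ℂ] H} {x y : ℕ → H}
    (h : IsNuclearRep T x y) (A B : H →L[ℂ] H) :
    IsNuclearRep (A ∘L T ∘L B) (fun n => A (x n)) (fun n => ContinuousLinearMap.adjoint B (y n)) ∧
      repCost (fun n => A (x n)) (fun n => ContinuousLinearMap.adjoint B (y n))
        ≤ ‖A‖ * ‖B‖ * repCost x y := by
  have hle : ∀ n, ‖A (x n)‖ * ‖ContinuousLinearMap.adjoint B (y n)‖
      ≤ ‖A‖ * ‖B‖ * (‖x n‖ * ‖y n‖) := fun n => by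
    have h1 := A.le_opNorm (x n)
    have h2 := (ContinuousLinearMap.adjoint B).le_opNorm (y n)
    rw [LinearIsometryEquiv.norm_map] at h2
    calc _ ≤ (‖A‖ * ‖x n‖) * (‖B‖ * ‖y n‖) := by gcongr
      _ = _ := by ring
  have hs : Summable fun n => ‖A (x n)‖ * ‖ContinuousLinearMap.adjoint B (y n)‖ :=
    Summable.of_nonneg_of_le (fun n => by positivity) hle (h.summable.mul_left _)
  refine ⟨⟨hs, ?_⟩, ?_⟩
  · have h1 := h.hasSum.mapL ((ContinuousLinearMap.compL ℂ H H H).flip B)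
    have h2 := h1.mapL (ContinuousLinearMap.compL ℂ H H H A)
    simpa [InnerProductSpace.rankOne_comp, InnerProductSpace.comp_rankOne] using h2
  · rw [repCost, repCost, ← tsum_mul_left]
    exact hs.tsum_le_tsum hle (h.summable.mul_left _)

theorem sandwich_mem (A B : H →L[ℂ] H) (T : TraceClass H) : A ∘L T.val ∘L B ∈ traceClass H := by
  obtain ⟨x, y, h⟩ := T.exists_rep
  exact ⟨_, _, (h.sandwich A B).1⟩

theorem norm_sandwich_le (A B : H →L[ℂ] H) (T T' : TraceClass H)
    (hT' : T'.val = A ∘L T.val ∘L B) : ‖T'‖ ≤ ‖A‖ * ‖B‖ * ‖T‖ := by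
  have key : ∀ x y : ℕ → H, IsNuclearRep T.val x y → ‖T'‖ ≤ ‖A‖ * ‖B‖ * repCost x y :=
    fun x y h => (norm_le (hT' ▸ (h.sandwich A B).1)).trans (h.sandwich A B).2
  rcases (by positivity : 0 ≤ ‖A‖ * ‖B‖).eq_or_lt with h0 | h0
  · obtain ⟨x, y, h⟩ := T.exists_rep
    have := key x y h
    rw [← h0, zero_mul] at this ⊢
    exact this
  · rw [mul_comm, ← div_le_iff₀ h0]
    refine le_norm fun x y h => ?_
    rw [div_le_iff₀ h0, mul_comm]
    exact key x y h

/-- The bounded operator `T ↦ A T B` on `𝒯(H)`, for bounded operators `A` and `B` on `H`. -/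
def sandwich (A B : H →L[ℂ] H) : TraceClass H →L[ℂ] TraceClass H :=
  LinearMap.mkContinuous
    { toFun := fun T => ⟨A ∘L T.val ∘L B, sandwich_mem A B T⟩
      map_add' := fun S T => val_injective (by
        change A ∘L (valₗ H (S + T)) ∘L B = A ∘L valₗ H S ∘L B + A ∘L valₗ H T ∘L B
        rw [map_add, ContinuousLinearMap.add_comp, ContinuousLinearMap.comp_add])
      map_smul' := fun c T => val_injective (by
        change A ∘L (valₗ H (c • T)) ∘L B = c • (A ∘L valₗ H T ∘L B)
        rw [map_smul, ContinuousLinearMap.smul_comp, ContinuousLinearMap.comp_smul]) }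
    (‖A‖ * ‖B‖) (fun T => norm_sandwich_le A B T _ rfl)

theorem sandwich_val (A B : H →L[ℂ] H) (T : TraceClass H) :
    (sandwich A B T).val = A ∘L T.val ∘L B := rfl

/-- The bounded operator `T ↦ [A, T] = A T - T A` on `𝒯(H)`. -/
def commutator (A : H →L[ℂ] H) : TraceClass H →L[ℂ] TraceClass H :=
  sandwich A 1 - sandwich 1 A

end Sandwich

section Complete

variable [CompleteSpace H]

theorem exists_hasSum_val {T : ℕ → TraceClass H} {x y : ℕ → ℕ → H}
    (h : ∀ k, IsNuclearRep (T k).val (x k) (y k)) (hs : Summable fun k => repCost (x k) (y k)) :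
    ∃ S : TraceClass H, HasSum (fun k => (T k).val) S.val ∧
      ‖S‖ ≤ ∑' k, repCost (x k) (y k) := by
  obtain ⟨e⟩ := nonempty_equiv_of_countable (α := ℕ) (β := ℕ × ℕ)
  have hc : Summable fun p : ℕ × ℕ => ‖x p.1 p.2‖ * ‖y p.1 p.2‖ :=
    (summable_prod_of_nonneg (fun _ => by positivity)).2 ⟨fun k => (h k).summable, hs⟩
  have hr : Summable fun p : ℕ × ℕ => InnerProductSpace.rankOne ℂ (x p.1 p.2) (y p.1 p.2) :=
    Summable.of_norm (by simpa using hc)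
  have hc' := (e.summable_iff).2 hc
  have hr' := (e.hasSum_iff).2 hr.hasSum
  have hrep : IsNuclearRep (∑' p : ℕ × ℕ, InnerProductSpace.rankOne ℂ (x p.1 p.2) (y p.1 p.2))
      (fun n => x (e n).1 (e n).2) (fun n => y (e n).1 (e n).2) := ⟨hc', hr'⟩
  obtain ⟨S, hS⟩ : ∃ S : TraceClass H,
      S.val = ∑' p : ℕ × ℕ, InnerProductSpace.rankOne ℂ (x p.1 p.2) (y p.1 p.2) :=
    ⟨⟨_, _, _, hrep⟩, rfl⟩
  rw [← hS] at hrep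
  have hsum := hr.hasSum.prod_fiberwise fun k => (h k).hasSum
  rw [← hS] at hsum
  have hcost : repCost (fun n => x (e n).1 (e n).2) (fun n => y (e n).1 (e n).2)
      = ∑' k, repCost (x k) (y k) := by
    have h1 := e.tsum_eq fun p : ℕ × ℕ => ‖x p.1 p.2‖ * ‖y p.1 p.2‖
    have h2 := hc.tsum_prod' fun k => (h k).summable
    unfold repCost
    rw [h1, h2]
  exact ⟨S, hsum, hcost ▸ norm_le hrep⟩

instance : CompleteSpace (TraceClass H) := by
  refine NormedAddCommGroup.completeSpace_of_summable_imp_tendsto fun T hT => ?_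
  have hex : ∀ k, ∃ x y : ℕ → H, IsNuclearRep (T k).val x y ∧
      repCost x y ≤ ‖T k‖ + (1 / 2) ^ k := fun k => by
    by_contra! hcon
    have := le_norm fun x y h => (hcon x y h).le
    have h2 : (0 : ℝ) < (1 / 2) ^ k := by positivity
    linarith
  choose x y h hle using hex
  have hs : Summable fun k => repCost (x k) (y k) :=
    Summable.of_nonneg_of_le (fun k => repCost_nonneg _ _) hle
      (hT.add (summable_geometric_of_lt_one (by norm_num) (by norm_num)))
  obtain ⟨S, hS, -⟩ := exists_hasSum_val h hs
  refine ⟨S, ?_⟩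
  rw [tendsto_iff_norm_sub_tendsto_zero]
  refine squeeze_zero (fun _ => norm_nonneg _) (fun n => ?_)
    (tendsto_sum_nat_add fun k => repCost (x k) (y k))
  obtain ⟨S', hS', hn⟩ := exists_hasSum_val (fun k => h (k + n)) ((summable_nat_add_iff n).2 hs)
  have : S - ∑ i ∈ Finset.range n, T i = S' := by
    apply val_injective
    have h1 := (hasSum_nat_add_iff' n).2 hS
    have h2 : (S - ∑ i ∈ Finset.range n, T i).val
        = S.val - ∑ i ∈ Finset.range n, (T i).val := by
      change valₗ H _ = valₗ H S - ∑ i ∈ Finset.range n, valₗ H (T i)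
      rw [map_sub, map_sum]
    rw [h2]
    exact h1.unique hS'
  rw [norm_sub_rev, this]
  exact hn

end Complete

theorem sum_rankOne_le {ι : Type*} {u v : ι → H} (hu : Orthonormal ℂ u) (hv : Orthonormal ℂ v)
    (s : Finset ι) (x y : H) :
    ∑ k ∈ s, ‖⟪u k, InnerProductSpace.rankOne ℂ x y (v k)⟫_ℂ‖ ≤ ‖x‖ * ‖y‖ := by
  have h1 := hu.sum_inner_products_le x (s := s)
  have h2 := hv.sum_inner_products_le y (s := s)
  calc ∑ k ∈ s, ‖⟪u k, InnerProductSpace.rankOne ℂ x y (v k)⟫_ℂ‖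
      = ∑ k ∈ s, ‖⟪u k, x⟫_ℂ‖ * ‖⟪v k, y⟫_ℂ‖ := by
        refine Finset.sum_congr rfl fun k _ => ?_
        rw [InnerProductSpace.rankOne_apply, inner_smul_right, norm_mul, mul_comm,
          norm_inner_symm y]
    _ ≤ √(∑ k ∈ s, ‖⟪u k, x⟫_ℂ‖ ^ 2) * √(∑ k ∈ s, ‖⟪v k, y⟫_ℂ‖ ^ 2) :=
        Real.sum_mul_le_sqrt_mul_sqrt _ _ _
    _ ≤ √(‖x‖ ^ 2) * √(‖y‖ ^ 2) := by gcongr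
    _ = ‖x‖ * ‖y‖ := by rw [Real.sqrt_sq (norm_nonneg _), Real.sqrt_sq (norm_nonneg _)]

theorem sum_inner_le {ι : Type*} {u v : ι → H} (hu : Orthonormal ℂ u) (hv : Orthonormal ℂ v)
    (s : Finset ι) (T : TraceClass H) : ∑ k ∈ s, ‖⟪u k, T.val (v k)⟫_ℂ‖ ≤ ‖T‖ := by
  refine le_norm fun x y h => ?_
  have hc : Continuous fun S : H →L[ℂ] H => ∑ k ∈ s, ‖⟪u k, S (v k)⟫_ℂ‖ := by fun_prop
  refine le_of_tendsto ((hc.tendsto _).comp h.hasSum) (Eventually.of_forall fun F => ?_)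
  calc ∑ k ∈ s, ‖⟪u k, (∑ n ∈ F, InnerProductSpace.rankOne ℂ (x n) (y n)) (v k)⟫_ℂ‖
      ≤ ∑ k ∈ s, ∑ n ∈ F, ‖⟪u k, InnerProductSpace.rankOne ℂ (x n) (y n) (v k)⟫_ℂ‖ := by
        refine Finset.sum_le_sum fun k _ => ?_
        rw [sum_apply, inner_sum]
        exact norm_sum_le _ _
    _ = ∑ n ∈ F, ∑ k ∈ s, ‖⟪u k, InnerProductSpace.rankOne ℂ (x n) (y n) (v k)⟫_ℂ‖ :=
        Finset.sum_comm
    _ ≤ ∑ n ∈ F, ‖x n‖ * ‖y n‖ := Finset.sum_le_sum fun n _ => sum_rankOne_le hu hv s _ _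
    _ ≤ repCost x y := h.summable.sum_le_tsum F fun n _ => by positivity

theorem summable_inner {ι : Type*} {u v : ι → H} (hu : Orthonormal ℂ u) (hv : Orthonormal ℂ v)
    (T : TraceClass H) : Summable fun k => ⟪u k, T.val (v k)⟫_ℂ :=
  (summable_of_sum_le (fun _ => norm_nonneg _) fun s => sum_inner_le hu hv s T).of_norm

/-- For orthonormal families `u` and `v`, the bounded functional `T ↦ ∑ₖ ⟨uₖ, T vₖ⟩`. -/
def sumInner {ι : Type*} {u v : ι → H} (hu : Orthonormal ℂ u) (hv : Orthonormal ℂ v) :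
    TraceClass H →L[ℂ] ℂ :=
  LinearMap.mkContinuous
    { toFun := fun T => ∑' k, ⟪u k, T.val (v k)⟫_ℂ
      map_add' := fun S T => by
        rw [← (summable_inner hu hv S).tsum_add (summable_inner hu hv T)]
        refine tsum_congr fun k => ?_
        rw [← inner_add_right]
        rfl
      map_smul' := fun c T => by
        rw [RingHom.id_apply, smul_eq_mul, ← tsum_mul_left]
        refine tsum_congr fun k => ?_
        rw [← inner_smul_right]
        rfl }
    1 (fun T => by
      have h : Summable fun k => ‖⟪u k, T.val (v k)⟫_ℂ‖ :=
        summable_of_sum_le (fun _ => norm_nonneg _) fun s => sum_inner_le hu hv s T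
      rw [one_mul]
      exact (norm_tsum_le_tsum_norm h).trans
        (h.tsum_le_of_sum_le fun s => sum_inner_le hu hv s T))

end TraceClass

end TraceClass

/-! ## Hilbert bases and traces -/

section Trace

variable (H : Type*) [NormedAddCommGroup H] [InnerProductSpace ℂ H] [CompleteSpace H]

/-- The index set of a chosen Hilbert basis of `H`. -/
def basisIndex : Set H := (exists_hilbertBasis ℂ H).choose

/-- A chosen Hilbert basis of `H`. -/
def basis : HilbertBasis (basisIndex H) ℂ H := (exists_hilbertBasis ℂ H).choose_spec.choose

variable {H} in
/-- The trace `∑ₖ ⟨eₖ, T eₖ⟩` over a Hilbert basis (meaningful for trace class `T`). -/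
def trace (T : H →L[ℂ] H) : ℂ := ∑' k, ⟪basis H k, T (basis H k)⟫_ℂ

end Trace

/-! ## The tensor product of a finite-dimensional and an arbitrary Hilbert space -/

section Tensor

variable {E F : Type*} [NormedAddCommGroup E] [InnerProductSpace ℂ E] [FiniteDimensional ℂ E]
  [NormedAddCommGroup F] [InnerProductSpace ℂ F]

variable (E F) in
/-- `y ↦ ∑ᵢ eᵢ ⊗ yᵢ` identifies the Hilbert sum of `dim E` copies of `F` with `E ⊗ F`. -/
def sumTensor : PiLp 2 (fun _ : Fin (Module.finrank ℂ E) => F) →ₗᵢ[ℂ] E ⊗[ℂ] F where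
  toFun y := ∑ i, stdOrthonormalBasis ℂ E i ⊗ₜ[ℂ] y i
  map_add' y z := by simp [TensorProduct.tmul_add, Finset.sum_add_distrib]
  map_smul' c y := by simp [Finset.smul_sum]
  norm_map' y := by
    have h := (stdOrthonormalBasis ℂ E).orthonormal
    rw [orthonormal_iff_ite] at h
    rw [← sq_eq_sq₀ (norm_nonneg _) (norm_nonneg _), PiLp.norm_sq_eq_of_L2,
      @norm_sq_eq_re_inner ℂ]
    simp only [LinearMap.coe_mk, AddHom.coe_mk, sum_inner, inner_sum, TensorProduct.inner_tmul, h,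
      ite_mul, one_mul, zero_mul, Finset.sum_ite_eq', Finset.mem_univ, if_true,
      map_sum]
    exact Finset.sum_congr rfl fun i _ => (@norm_sq_eq_re_inner ℂ _ _ _ _ _).symm

theorem sumTensor_surjective : Function.Surjective (sumTensor E F) := by
  intro v
  induction v using TensorProduct.induction_on with
  | zero => exact ⟨0, map_zero _⟩
  | add a b ha hb =>
    obtain ⟨y, rfl⟩ := ha
    obtain ⟨z, rfl⟩ := hb
    exact ⟨y + z, map_add _ _ _⟩
  | tmul a b =>
    refine ⟨WithLp.toLp 2 fun i => ⟪stdOrthonormalBasis ℂ E i, a⟫_ℂ • b, ?_⟩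
    change ∑ i, stdOrthonormalBasis ℂ E i ⊗ₜ[ℂ] (⟪stdOrthonormalBasis ℂ E i, a⟫_ℂ • b) = a ⊗ₜ b
    simp_rw [← TensorProduct.smul_tmul, ← TensorProduct.sum_tmul]
    rw [(stdOrthonormalBasis ℂ E).sum_repr']

/-- `E ⊗ F` is complete, hence a Hilbert space. -/
instance instCompleteSpaceTensor [CompleteSpace F] : CompleteSpace (E ⊗[ℂ] F) :=
  let e := LinearIsometryEquiv.ofSurjective (sumTensor E F) sumTensor_surjective
  (completeSpace_congr (e := e.toEquiv) e.isometry.isUniformEmbedding).1 inferInstance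

/-- The bounded operator `A ⊗ B` on `E ⊗ F`. -/
def tensorOp (A : E →L[ℂ] E) (B : F →L[ℂ] F) : E ⊗[ℂ] F →L[ℂ] E ⊗[ℂ] F :=
  LinearMap.mkContinuous (TensorProduct.map (A : E →ₗ[ℂ] E) (B : F →ₗ[ℂ] F))
    (∑ i, ‖A (stdOrthonormalBasis ℂ E i)‖ * ‖B‖) (fun v => by
      obtain ⟨y, rfl⟩ := sumTensor_surjective v
      rw [LinearIsometry.norm_map]
      change ‖TensorProduct.map _ _ (∑ i, stdOrthonormalBasis ℂ E i ⊗ₜ[ℂ] y i)‖ ≤ _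
      rw [map_sum, Finset.sum_mul]
      refine (norm_sum_le _ _).trans (Finset.sum_le_sum fun i _ => ?_)
      rw [TensorProduct.map_tmul, TensorProduct.norm_tmul, mul_assoc]
      refine mul_le_mul_of_nonneg_left ?_ (norm_nonneg _)
      exact (B.le_opNorm _).trans (mul_le_mul_of_nonneg_left (PiLp.norm_apply_le y i)
        (norm_nonneg _)))

@[simp] theorem tensorOp_tmul (A : E →L[ℂ] E) (B : F →L[ℂ] F) (a : E) (b : F) :
    tensorOp A B (a ⊗ₜ b) = A a ⊗ₜ B b := rfl

theorem orthonormal_tmul [CompleteSpace F] (i : Fin (Module.finrank ℂ E)) :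
    Orthonormal ℂ fun k => stdOrthonormalBasis ℂ E i ⊗ₜ[ℂ] basis F k := by
  classical
  have h' := (basis F).orthonormal
  rw [orthonormal_iff_ite] at h' ⊢
  intro k l
  simp [TensorProduct.inner_tmul, h']

variable (E F) in
/-- The partial trace over the second factor: with orthonormal bases `eᵢ` of `E` and `fₖ` of `F`,
`⟨eᵢ, tr_F(ρ) eⱼ⟩ = ∑ₖ ⟨eᵢ ⊗ fₖ, ρ (eⱼ ⊗ fₖ)⟩`. -/
def partialTrace [CompleteSpace F] : TraceClass (E ⊗[ℂ] F) →L[ℂ] (E →L[ℂ] E) :=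
  ∑ i, ∑ j, (TraceClass.sumInner (orthonormal_tmul (E := E) (F := F) i)
    (orthonormal_tmul j)).smulRight
      (InnerProductSpace.rankOne ℂ (stdOrthonormalBasis ℂ E i) (stdOrthonormalBasis ℂ E j))

theorem tensorOp_rankOne_mem (σ : E →L[ℂ] E) (Ω : F) :
    tensorOp σ (InnerProductSpace.rankOne ℂ Ω Ω) ∈ traceClass (E ⊗[ℂ] F) := by
  have : tensorOp σ (InnerProductSpace.rankOne ℂ Ω Ω) = ∑ i, InnerProductSpace.rankOne ℂ
      (σ (stdOrthonormalBasis ℂ E i) ⊗ₜ[ℂ] Ω) (stdOrthonormalBasis ℂ E i ⊗ₜ[ℂ] Ω) := by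
    apply ContinuousLinearMap.coe_injective
    refine TensorProduct.ext' fun a b => ?_
    simp only [ContinuousLinearMap.coe_coe, tensorOp_tmul, sum_apply,
      InnerProductSpace.rankOne_apply, TensorProduct.inner_tmul]
    conv_lhs => rw [← (stdOrthonormalBasis ℂ E).sum_repr' a]
    simp only [map_sum, map_smul, TensorProduct.sum_tmul, TensorProduct.tmul_smul,
      ← TensorProduct.smul_tmul', Finset.smul_sum, smul_smul]
    exact Finset.sum_congr rfl fun i _ => by rw [mul_comm]
  rw [this]
  exact Submodule.sum_mem _ fun i _ => rankOne_mem_traceClass _ _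

/-- The linear map `σ ↦ σ ⊗ |Ω⟩⟨Ω|` into the trace class operators. -/
def tensorState (Ω : F) : (E →L[ℂ] E) →ₗ[ℂ] TraceClass (E ⊗[ℂ] F) where
  toFun σ := ⟨tensorOp σ (InnerProductSpace.rankOne ℂ Ω Ω), tensorOp_rankOne_mem σ Ω⟩
  map_add' σ σ' := TraceClass.val_injective (by
    apply ContinuousLinearMap.coe_injective
    refine TensorProduct.ext' fun a b => ?_
    exact TensorProduct.add_tmul _ _ _)
  map_smul' c σ := TraceClass.val_injective (by
    apply ContinuousLinearMap.coe_injective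
    refine TensorProduct.ext' fun a b => ?_
    exact (TensorProduct.smul_tmul' c _ _).symm)

end Tensor

/-! ## One-parameter groups -/

section Groups

/-- A strongly continuous one-parameter unitary group `t ↦ e^{-itH}`. -/
structure UnitaryGroup (H : Type*) [NormedAddCommGroup H] [InnerProductSpace ℂ H] where
  toFun : ℝ → H ≃ₗᵢ[ℂ] H
  map_add : ∀ s t ψ, toFun (s + t) ψ = toFun s (toFun t ψ)
  continuous : ∀ ψ, Continuous fun t => toFun t ψ

namespace UnitaryGroup

variable {H : Type*} [NormedAddCommGroup H] [InnerProductSpace ℂ H] (U : UnitaryGroup H)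

/-- `e^{-itH}` as a bounded operator. -/
def op (t : ℝ) : H →L[ℂ] H := (U.toFun t).toContinuousLinearEquiv

/-- The self-adjoint generator `H` of `t ↦ e^{-itH}`: its domain consists of the vectors `ψ` for
which `t ↦ e^{-itH} ψ` is differentiable at `0`, and `H ψ = i d/dt e^{-itH} ψ` at `t = 0`. -/
def generator : H →ₗ.[ℂ] H where
  domain :=
    { carrier := {ψ | DifferentiableAt ℝ (fun t => U.toFun t ψ) 0}
      add_mem' := fun {ψ χ} hψ hχ => by
        simpa using DifferentiableAt.fun_add (f := fun t => U.toFun t ψ)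
          (g := fun t => U.toFun t χ) hψ hχ
      zero_mem' := by simp
      smul_mem' := fun c ψ hψ => by
        simpa using DifferentiableAt.fun_const_smul (f := fun t => U.toFun t ψ) hψ c }
  toFun :=
    { toFun := fun ψ => Complex.I • deriv (fun t => U.toFun t ψ.1) 0
      map_add' := fun ψ χ => by
        have := deriv_fun_add (f := fun t => U.toFun t ψ.1) (g := fun t => U.toFun t χ.1) ψ.2 χ.2
        simp only [Submodule.coe_add, _root_.map_add, this, smul_add]
      map_smul' := fun c ψ => by
        have := deriv_fun_const_smul (f := fun t => U.toFun t ψ.1) c ψ.2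
        simp only [Submodule.coe_smul, map_smul, this, RingHom.id_apply]
        rw [smul_comm] }

/-- The Heisenberg evolution `V(t) = e^{itH} V e^{-itH}`. -/
def heisenberg (V : H →L[ℂ] H) (t : ℝ) : H →L[ℂ] H := U.op (-t) ∘L V ∘L U.op t

end UnitaryGroup

variable {B : Type*} [NormedAddCommGroup B] [NormedSpace ℂ B]

/-- `t ↦ T t` is a strongly continuous one-parameter group of bounded operators on `B`. -/
structure IsC0Group (T : ℝ → B →L[ℂ] B) : Prop where
  zero : T 0 = 1
  add : ∀ s t, T (s + t) = T s ∘L T t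
  continuous : ∀ ρ, Continuous fun t => T t ρ

/-- `ρ` is in the domain of the generator `G` of `t ↦ T t = e^{tG}`, and `G ρ = η`. -/
def HasGenerator (T : ℝ → B →L[ℂ] B) (ρ η : B) : Prop :=
  HasDerivAt (fun t : ℝ => T t ρ) η 0

/-- `T'` is the strongly continuous group generated by `G + A` (with the same domain as `G`), where
`G` is the generator of `T` and `A` is bounded. -/
def IsPerturbedGroup (T : ℝ → B →L[ℂ] B) (A : B →L[ℂ] B) (T' : ℝ → B →L[ℂ] B) : Prop :=
  IsC0Group T' ∧ ∀ ρ η, HasGenerator T' ρ (η + A ρ) ↔ HasGenerator T ρ η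

open Classical in
/-- The group `t ↦ e^{t(G + A)}`, where `G` generates the strongly continuous group `T` and `A` is
bounded. -/
def perturbedGroup (T : ℝ → B →L[ℂ] B) (A : B →L[ℂ] B) : ℝ → B →L[ℂ] B :=
  if h : ∃ T', IsPerturbedGroup T A T' then h.choose else 0

end Groups

/-! ## The clustering property -/

section Clustering

variable {R : Type*} [NormedAddCommGroup R] [InnerProductSpace ℂ R] [CompleteSpace R]

/-- The increasing sequence of the elements of the `s`-th block of the partition `d` of
`(0, …, N-1)` into contiguous subsequences, rearranged by `A`: first the elements in `A` in
increasing order, then the others in decreasing order. -/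
def rearrangedBlock {N : ℕ} (d : Composition N) (s : Fin d.length) (A : Finset (Fin N)) :
    List (Fin N) :=
  (List.ofFn (d.embedding s)).filter (fun k => k ∈ A) ++
    ((List.ofFn (d.embedding s)).filter (fun k => k ∉ A)).reverse

/-- The `(n+2)`-point connected correlation function `𝒢ₙ(A, z)`: the sum, over the partitions `d` of
`(0, …, n+1)` into contiguous subsequences of length at least `2`, of
`(-1)^{|d|+1} ∏ₛ tr((∏_{k ∈ dₛᴬ} V(zₖ)) ω)`. -/
def connectedCorrelation (U : UnitaryGroup R) (V ω : R →L[ℂ] R) (n : ℕ)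
    (A : Finset (Fin (n + 2))) (z : Fin (n + 2) → ℝ) : ℂ :=
  ∑ d : Composition (n + 2) with ∀ k ∈ d.blocks, 2 ≤ k,
    (-1) ^ (d.length + 1) * ∏ s : Fin d.length,
      trace (((rearrangedBlock d s A).map fun k => U.heisenberg V (z k)).prod ∘L ω)

/-- The clustering property of `(H_R, V, ω)`, where `U t = e^{-itH_R}`. -/
def ClusteringProperty (U : UnitaryGroup R) (V ω : R →L[ℂ] R) : Prop :=
  ∃ f : ℝ → ℝ, (∀ s, 0 ≤ f s) ∧
    (∃ ε : ℝ, 0 < ε ∧ ε < 1 ∧ Integrable fun s => f s * (1 + |s|) ^ ε) ∧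
    ∃ C : ℝ, 0 < C ∧ ∀ n : ℕ, 1 ≤ n → ∀ (A : Finset (Fin (n + 2))) (z : Fin (n + 2) → ℝ),
      z 0 = 0 → Monotone z →
        ‖connectedCorrelation U V ω n A z‖ ≤ C ^ (n + 2) / (n / 2).factorial *
          ∑ p : Equiv.Perm (Fin (n + 2)) with 2 ≤ |((p 1 : ℕ) : ℤ) - ((p 0 : ℕ) : ℤ)|,
            ∏ l : Fin ((n + 1) / 2 + 1),
              f (z (p ⟨l, by omega⟩) - z (p ⟨l + 1, by omega⟩))

end Clustering

/-! ## The weakly coupled system -/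

/-- A finite-dimensional system `S` coupled to a reservoir `R`: the Hamiltonian is
`H_S ⊗ 1 + 1 ⊗ H_R + λ W ⊗ V`, and `Ω` is the reference vector of the reservoir. -/
structure Model (S R : Type*) [NormedAddCommGroup S] [InnerProductSpace ℂ S]
    [FiniteDimensional ℂ S] [NormedAddCommGroup R] [InnerProductSpace ℂ R] [CompleteSpace R] where
  /-- the Hamiltonian of the system -/
  hamS : S →L[ℂ] S
  hamS_symm : (hamS : S →ₗ[ℂ] S).IsSymmetric
  /-- the unitary group `e^{-itH_R}` of the reservoir -/
  U : UnitaryGroup R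
  /-- the reference vector of the reservoir -/
  Ω : R
  norm_Ω : ‖Ω‖ = 1
  invariant : ∃ h : Ω ∈ U.generator.domain, U.generator ⟨Ω, h⟩ = 0
  W : S →L[ℂ] S
  W_symm : (W : S →ₗ[ℂ] S).IsSymmetric
  V : R →L[ℂ] R
  V_selfAdjoint : IsSelfAdjoint V
  trace_V : trace (V ∘L InnerProductSpace.rankOne ℂ Ω Ω) = 0

namespace Model

variable {S R : Type*} [NormedAddCommGroup S] [InnerProductSpace ℂ S]
  [FiniteDimensional ℂ S] [NormedAddCommGroup R] [InnerProductSpace ℂ R] [CompleteSpace R]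
  (M : Model S R)

/-- The reference state `ω_R = |Ω⟩⟨Ω|` of the reservoir. -/
def ω : R →L[ℂ] R := InnerProductSpace.rankOne ℂ M.Ω M.Ω

/-- The two-point function `φ(t) = tr(V(t) V ω_R)`. -/
def φ (t : ℝ) : ℂ := trace (M.U.heisenberg M.V t ∘L M.V ∘L M.ω)

/-- The projection `P ρ = tr_R(ρ) ⊗ ω_R`. -/
def P : TraceClass (S ⊗[ℂ] R) →L[ℂ] TraceClass (S ⊗[ℂ] R) :=
  (tensorState M.Ω).toContinuousLinearMap ∘L partialTrace S R

/-- The projection `Q = 1 - P`. -/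
def Q : TraceClass (S ⊗[ℂ] R) →L[ℂ] TraceClass (S ⊗[ℂ] R) := 1 - M.P

/-- The system Liouvillian `𝓛_S ρ = [H_S ⊗ 1, ρ]`. -/
def liouS : TraceClass (S ⊗[ℂ] R) →L[ℂ] TraceClass (S ⊗[ℂ] R) :=
  TraceClass.commutator (tensorOp M.hamS 1)

/-- The interaction Liouvillian `𝓛_SR ρ = [W ⊗ V, ρ]`. -/
def liouSR : TraceClass (S ⊗[ℂ] R) →L[ℂ] TraceClass (S ⊗[ℂ] R) :=
  TraceClass.commutator (tensorOp M.W M.V)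

/-- The group `e^{-it𝓛_S}`. -/
def expS (t : ℝ) : TraceClass (S ⊗[ℂ] R) →L[ℂ] TraceClass (S ⊗[ℂ] R) :=
  NormedSpace.exp ((-(Complex.I * (t : ℂ))) • M.liouS)

/-- The free unitary group `e^{-itH₀} = e^{-itH_S} ⊗ e^{-itH_R}`, `H₀ = H_S ⊗ 1 + 1 ⊗ H_R`. -/
def freeOp (t : ℝ) : S ⊗[ℂ] R →L[ℂ] S ⊗[ℂ] R :=
  tensorOp (NormedSpace.exp ((-(Complex.I * (t : ℂ))) • M.hamS)) (M.U.op t)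

/-- The free group `e^{-it𝓛₀} ρ = e^{-itH₀} ρ e^{itH₀}` of isometries of `𝒯(H_S ⊗ H_R)`. -/
def expFree (t : ℝ) : TraceClass (S ⊗[ℂ] R) →L[ℂ] TraceClass (S ⊗[ℂ] R) :=
  TraceClass.sandwich (M.freeOp t) (M.freeOp (-t))

/-- The full evolution `e^{-it(𝓛₀ + λ 𝓛_SR)}`. -/
def expFull (lam t : ℝ) : TraceClass (S ⊗[ℂ] R) →L[ℂ] TraceClass (S ⊗[ℂ] R) :=
  perturbedGroup M.expFree ((-(Complex.I * (lam : ℂ))) • M.liouSR) t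

/-- The group `e^{-it(𝓛₀ + λ Q 𝓛_SR Q)}`. -/
def expQ (lam t : ℝ) : TraceClass (S ⊗[ℂ] R) →L[ℂ] TraceClass (S ⊗[ℂ] R) :=
  perturbedGroup M.expFree ((-(Complex.I * (lam : ℂ))) • (M.Q ∘L M.liouSR ∘L M.Q)) t

/-- The reduced dynamics in the interaction picture,
`U^λ(τ) = e^{i(τ/λ²)𝓛_S} P e^{-i(τ/λ²)(𝓛₀ + λ𝓛_SR)} P`. -/
def reducedDynamics (lam τ : ℝ) : TraceClass (S ⊗[ℂ] R) →L[ℂ] TraceClass (S ⊗[ℂ] R) :=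
  M.expS (-(τ / lam ^ 2)) ∘L M.P ∘L M.expFull lam (τ / lam ^ 2) ∘L M.P

/-- The integrand `P e^{is𝓛₀} 𝓛_SR Q e^{-is(𝓛₀ + λQ𝓛_SR Q)} Q 𝓛_SR P` of `K^λ`. -/
def memoryIntegrand (lam s : ℝ) : TraceClass (S ⊗[ℂ] R) →L[ℂ] TraceClass (S ⊗[ℂ] R) :=
  M.P ∘L M.expFree (-s) ∘L M.liouSR ∘L M.Q ∘L M.expQ lam s ∘L M.Q ∘L M.liouSR ∘L M.P

/-- The memory kernel
`K^λ(τ) = ∫₀^{τ/λ²} P e^{is𝓛₀} 𝓛_SR Q e^{-is(𝓛₀ + λQ𝓛_SR Q)} Q 𝓛_SR P ds`. -/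
def memoryKernel (lam τ : ℝ) : TraceClass (S ⊗[ℂ] R) →L[ℂ] TraceClass (S ⊗[ℂ] R) :=
  ∫ s in (0 : ℝ)..(τ / lam ^ 2), M.memoryIntegrand lam s

/-- The integrand `P 𝓛_SR(s) Q 𝓛_SR P` of `K`, with `𝓛_SR(s) = e^{is𝓛₀} 𝓛_SR e^{-is𝓛₀}`. -/
def limitIntegrand (s : ℝ) : TraceClass (S ⊗[ℂ] R) →L[ℂ] TraceClass (S ⊗[ℂ] R) :=
  M.P ∘L (M.expFree (-s) ∘L M.liouSR ∘L M.expFree s) ∘L M.Q ∘L M.liouSR ∘L M.P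

/-- `K = ∫₀^∞ P 𝓛_SR(s) Q 𝓛_SR P ds`. -/
def limitKernel : TraceClass (S ⊗[ℂ] R) →L[ℂ] TraceClass (S ⊗[ℂ] R) :=
  ∫ s in Ioi (0 : ℝ), M.limitIntegrand s

/-- The time average `T⁻¹ ∫₀ᵀ e^{is𝓛_S} X e^{-is𝓛_S} ds`. -/
def timeAverage (X : TraceClass (S ⊗[ℂ] R) →L[ℂ] TraceClass (S ⊗[ℂ] R)) (T : ℝ) :
    TraceClass (S ⊗[ℂ] R) →L[ℂ] TraceClass (S ⊗[ℂ] R) :=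
  T⁻¹ • ∫ s in (0 : ℝ)..T, M.expS (-s) ∘L X ∘L M.expS s

end Model

end VanHove

end

/-! The crux is the convergence of the memory kernel; the reduced dynamics then follows by
averaging.

Expand the group generated by L₀ + λQL_SR Q in its Dyson series. The n-th term of K^λ(τ) is λⁿ times
an integral over 0 = z₀ < z₁ < ⋯ < z_{n+1} < T with T = τ/λ². The factors Q = 1 - P between the
Liouvillians subtract disconnected parts: P L(z_{n+1}) Q ⋯ Q L(z₀) P is a signed sum, over the sets
A of times at which the commutator acts from the right, of the connected correlation of A times a
bounded operator of the system (`P_liouI_iterQ`). The term n = 0 involves only φ ∈ L¹ and tends to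
K.

For n ≥ 1 the clustering property bounds the correlation by chains with [(n+1)/2]+1 links.
Integration over ordered times absorbs the sum over permutations, and each chain leaves [n/2] free
times besides the fixed z₀. The term is thus at most |λ|ⁿ T^{[n/2]} = |λ|^{n mod 2} τ^{[n/2]} up to
Dⁿ⁺²/[n/2]!, which is summable (`IsMajorant.exists_termBound_le`). Odd terms vanish as λ → 0. Even
terms, n = 2k, are of borderline order, and `IsMajorant.tendsto_connIntegral` shows that the
integrated correlation is nevertheless o(Tᵏ). There are three cases: (a) If no k+2 consecutive times
have small gaps, every chain has a long link and contributes a tail of a convergent integral. (b) If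
such a cluster avoids z₀, the correlation is, up to complex conjugation, ⟨ζ, V(z₀)Ω⟩ with bounded ζ,
and integrability of φ makes its integral over z₀ of order √T instead of T. (c) If z₀, …, z_{k+1}
are clustered, the correlation is expanded in moments. The last operator may be put on either side
of the inner product, so that one side has at least as many late as early times. Cauchy–Schwarz on
that side leads to moments of a doubled family of times, where some connected block must link a late
time; the gain is again √T. Dominated convergence in n then gives convergence of the kernel
(`IsMajorant.eventually_norm_memoryKernel_sub_le`).

Finally, U^λ solves a Volterra equation with kernel K^λ(τ-σ) conjugated by the free evolution at
time σ/λ² (`reducedDynamics_eq`). Replacing K^λ by K costs an L¹ norm that tends to 0. The range of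
P is finite-dimensional, so the conjugated K is an operator-valued trigonometric polynomial: its
mean K♮ plus the derivative of a bounded function. Integration by parts makes the oscillating part
O(λ²), and Grönwall's inequality concludes (`norm_reducedDynamics_sub_le`). -/

noncomputable section

namespace VanHove

/-! ## Bounded perturbations of one-parameter groups -/

section Perturbation

variable {B : Type*} [NormedAddCommGroup B] [NormedSpace ℂ B]

/-- A strongly continuous family of operators, bounded by `M`. -/
structure IsBoundedFamily (A : ℝ → B →L[ℂ] B) (M : ℝ) : Prop where
  continuous : ∀ ρ, Continuous fun s => A s ρ
  bound : ∀ s, ‖A s‖ ≤ M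

theorem IsBoundedFamily.nonneg {A : ℝ → B →L[ℂ] B} {M : ℝ} (hA : IsBoundedFamily A M) : 0 ≤ M :=
  (norm_nonneg _).trans (hA.bound 0)

/-- Convergence is only strong, so the uniform bound `M` does the work of norm convergence: it
controls `c s (y s - v)`. -/
theorem tendsto_clm_apply_of_bound {α : Type*} {l : Filter α} {c : α → B →L[ℂ] B} {c₀ : B →L[ℂ] B}
    {y : α → B} {v : B} {M : ℝ} (hc : Tendsto (fun s => c s v) l (𝓝 (c₀ v)))
    (hb : ∀ᶠ s in l, ‖c s‖ ≤ M) (hy : Tendsto y l (𝓝 v)) :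
    Tendsto (fun s => c s (y s)) l (𝓝 (c₀ v)) := by
  have h1 : Tendsto (fun s => c s (y s - v)) l (𝓝 0) := by
    rw [tendsto_zero_iff_norm_tendsto_zero]
    have h2 : Tendsto (fun s => M * ‖y s - v‖) l (𝓝 0) := by
      have := (tendsto_iff_norm_sub_tendsto_zero.1 hy).const_mul M
      simpa using this
    refine squeeze_zero' (Eventually.of_forall fun _ => norm_nonneg _) ?_ h2
    filter_upwards [hb] with s hs
    exact ((c s).le_opNorm _).trans (by gcongr)
  simpa using h1.add hc

theorem IsBoundedFamily.continuous_apply {A : ℝ → B →L[ℂ] B} {M : ℝ} (hA : IsBoundedFamily A M)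
    {X : Type*} [TopologicalSpace X] {g : X → ℝ} (hg : Continuous g) {y : X → B}
    (hy : Continuous y) : Continuous fun s => A (g s) (y s) :=
  continuous_iff_continuousAt.2 fun x =>
    tendsto_clm_apply_of_bound (c := fun s => A (g s)) (c₀ := A (g x))
      (((hA.continuous (y x)).comp hg).tendsto x)
      (Eventually.of_forall fun s => hA.bound (g s)) (hy.tendsto x)

/-- A product rule for operators differentiable on the single vector `u x` only. Writing `u s = u x
+ (u s - u x)`, the second part needs just strong continuity and local boundedness of `c`. -/
theorem hasDerivAt_clm_apply_of_bound {c : ℝ → B →L[ℂ] B} {u : ℝ → B} {u' w : B} {x M : ℝ}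
    (hb : ∀ᶠ s in 𝓝 x, ‖c s‖ ≤ M) (hc : Tendsto (fun s => c s u') (𝓝 x) (𝓝 (c x u')))
    (hw : HasDerivAt (fun s => c s (u x)) w x) (hu : HasDerivAt u u' x) :
    HasDerivAt (fun s => c s (u s)) (w + c x u') x := by
  have h1 : HasDerivAt (fun s => c s (u s - u x)) (c x u') x := by
    rw [hasDerivAt_iff_tendsto_slope] at hu ⊢
    have h2 := tendsto_clm_apply_of_bound (c := c) (c₀ := c x)
      (hc.mono_left (nhdsWithin_le_nhds (s := {x}ᶜ)))
      (hb.filter_mono nhdsWithin_le_nhds) hu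
    refine h2.congr fun s => ?_
    simp [slope_def_module, (c s).map_smul_of_tower]
  have := hw.add h1
  refine this.congr_of_eventuallyEq (Eventually.of_forall fun s => ?_)
  simp

/-- The iterated integrals `∫_{0 < s₁ < ⋯ < sₙ < t} A(sₙ) ⋯ A(s₁) ρ`. -/
def dyson (A : ℝ → B →L[ℂ] B) (ρ : B) : ℕ → ℝ → B
  | 0 => fun _ => ρ
  | n + 1 => fun t => ∫ s in (0 : ℝ)..t, A s (dyson A ρ n s)

variable {A : ℝ → B →L[ℂ] B} {M : ℝ}

theorem IsBoundedFamily.continuous_dyson (hA : IsBoundedFamily A M) (ρ : B) :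
    ∀ n, Continuous (dyson A ρ n)
  | 0 => continuous_const
  | n + 1 => intervalIntegral.continuous_primitive
      (fun _ _ => (hA.continuous_apply continuous_id
        (hA.continuous_dyson ρ n)).intervalIntegrable _ _) 0

theorem IsBoundedFamily.norm_dyson_le_of_nonneg (hA : IsBoundedFamily A M) (ρ : B) (n : ℕ) :
    ∀ t, 0 ≤ t → ‖dyson A ρ n t‖ ≤ (M * t) ^ n / n.factorial * ‖ρ‖ := by
  have hM := hA.nonneg
  induction n with
  | zero => intro t _; simp [dyson]
  | succ n ih =>
    intro t ht
    have h1 : ‖∫ s in (0 : ℝ)..t, A s (dyson A ρ n s)‖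
        ≤ ∫ s in (0 : ℝ)..t, M * ((M * s) ^ n / n.factorial * ‖ρ‖) := by
      refine intervalIntegral.norm_integral_le_of_norm_le ht (ae_of_all _ fun s hs => ?_)
        (by apply Continuous.intervalIntegrable; fun_prop)
      refine ((A s).le_opNorm _).trans ?_
      have := ih s hs.1.le
      have := hA.bound s
      gcongr
    refine h1.trans (le_of_eq ?_)
    have h2 : ∀ s : ℝ, M * ((M * s) ^ n / n.factorial * ‖ρ‖)
        = (M ^ (n + 1) / n.factorial * ‖ρ‖) * s ^ n := fun s => by ring
    simp_rw [h2]
    rw [intervalIntegral.integral_const_mul, integral_pow, Nat.factorial_succ]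
    have : (n.factorial : ℝ) ≠ 0 := by positivity
    have : (n + 1 : ℝ) ≠ 0 := by positivity
    push_cast
    rw [zero_pow (by omega), mul_pow]
    field_simp
    ring

/-- Time reversal, which reduces the factorial estimates to `t ≥ 0`. -/
theorem dyson_neg (A : ℝ → B →L[ℂ] B) (ρ : B) (n : ℕ) :
    ∀ t, dyson A ρ n (-t) = dyson (fun s => -A (-s)) ρ n t := by
  induction n with
  | zero => intro t; rfl
  | succ n ih =>
    intro t
    simp only [dyson]
    simp_rw [← ih]
    have := intervalIntegral.integral_comp_neg (a := 0) (b := t)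
      (fun s => A s (dyson A ρ n s))
    rw [neg_zero] at this
    rw [intervalIntegral.integral_symm, ← this, ← intervalIntegral.integral_neg]
    rfl

theorem IsBoundedFamily.neg_comp_neg (hA : IsBoundedFamily A M) :
    IsBoundedFamily (fun s => -A (-s)) M :=
  ⟨fun ρ => ((hA.continuous ρ).comp continuous_neg).neg, fun s => by
    rw [norm_neg]; exact hA.bound _⟩

theorem IsBoundedFamily.norm_dyson_le (hA : IsBoundedFamily A M) (ρ : B) (n : ℕ) (t : ℝ) :
    ‖dyson A ρ n t‖ ≤ (M * |t|) ^ n / n.factorial * ‖ρ‖ := by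
  rcases le_total 0 t with ht | ht
  · rw [abs_of_nonneg ht]
    exact hA.norm_dyson_le_of_nonneg ρ n t ht
  · have h := hA.neg_comp_neg.norm_dyson_le_of_nonneg ρ n (-t) (by linarith)
    rw [← dyson_neg, neg_neg] at h
    rwa [abs_of_nonpos ht]

theorem IsBoundedFamily.summable_bound (_hA : IsBoundedFamily A M) (R : ℝ) (c : ℝ) :
    Summable fun n : ℕ => (M * R) ^ n / n.factorial * c :=
  (Real.summable_pow_div_factorial _).mul_right _

variable [CompleteSpace B]

theorem IsBoundedFamily.summable_dyson (hA : IsBoundedFamily A M) (ρ : B) (t : ℝ) :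
    Summable fun n => dyson A ρ n t :=
  Summable.of_norm_bounded (hA.summable_bound |t| ‖ρ‖) fun n => hA.norm_dyson_le ρ n t

omit [CompleteSpace B] in
theorem IsBoundedFamily.norm_dyson_le_of_abs_le (hA : IsBoundedFamily A M) (ρ : B) (n : ℕ)
    {t R : ℝ} (h : |t| ≤ R) : ‖dyson A ρ n t‖ ≤ (M * R) ^ n / n.factorial * ‖ρ‖ := by
  have hM := hA.nonneg
  refine (hA.norm_dyson_le ρ n t).trans ?_
  gcongr

theorem IsBoundedFamily.continuous_tsum_dyson (hA : IsBoundedFamily A M) (ρ : B) :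
    Continuous fun t => ∑' n, dyson A ρ n t := by
  refine continuous_iff_continuousAt.2 fun x => ?_
  have : ContinuousOn (fun t => ∑' n, dyson A ρ n t) (Icc (-(|x| + 1)) (|x| + 1)) :=
    continuousOn_tsum (fun n => (hA.continuous_dyson ρ n).continuousOn)
      (hA.summable_bound (|x| + 1) ‖ρ‖)
      fun n t ht => hA.norm_dyson_le_of_abs_le ρ n (abs_le.2 ht)
  refine this.continuousAt (Icc_mem_nhds ?_ ?_)
  · linarith [neg_abs_le x]
  · linarith [le_abs_self x]

theorem IsBoundedFamily.hasSum_integral_dyson (hA : IsBoundedFamily A M) (ρ : B)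
    {A' : ℝ → B →L[ℂ] B} {M' : ℝ} (hA' : IsBoundedFamily A' M') (t : ℝ) :
    HasSum (fun n => ∫ s in (0 : ℝ)..t, A' s (dyson A ρ n s))
      (∫ s in (0 : ℝ)..t, A' s (∑' n, dyson A ρ n s)) := by
  refine intervalIntegral.hasSum_integral_of_dominated_convergence
    (fun n _ => M' * ((M * |t|) ^ n / n.factorial * ‖ρ‖)) (fun n => ?_) (fun n => ?_)
    (ae_of_all _ fun s _ => (hA.summable_bound _ _).mul_left _) (by simp) ?_
  · exact (hA'.continuous_apply continuous_id (hA.continuous_dyson ρ n)).aestronglyMeasurable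
  · refine ae_of_all _ fun s hs => ((A' s).le_opNorm _).trans ?_
    have h1 : |s| ≤ |t| := by
      rcases le_total 0 t with ht | ht
      · rw [uIoc_of_le ht] at hs
        rw [abs_of_nonneg ht, abs_of_nonneg hs.1.le]; exact hs.2
      · rw [uIoc_of_ge ht] at hs
        rw [abs_of_nonpos ht, abs_of_nonpos hs.2]; linarith [hs.1]
    have := hA'.nonneg
    have h2 := hA.norm_dyson_le_of_abs_le ρ n h1
    have h3 := hA'.bound s
    gcongr
  · exact ae_of_all _ fun s _ => (hA.summable_dyson ρ s).hasSum.mapL (A' s)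

theorem IsBoundedFamily.tsum_dyson_eq (hA : IsBoundedFamily A M) (ρ : B) (t : ℝ) :
    ∑' n, dyson A ρ n t = ρ + ∫ s in (0 : ℝ)..t, A s (∑' n, dyson A ρ n s) := by
  rw [(hA.summable_dyson ρ t).tsum_eq_zero_add]
  congr 1
  exact (hA.hasSum_integral_dyson ρ hA t).tsum_eq

theorem IsBoundedFamily.hasDerivAt_tsum_dyson (hA : IsBoundedFamily A M) (ρ : B) (t : ℝ) :
    HasDerivAt (fun t => ∑' n, dyson A ρ n t) (A t (∑' n, dyson A ρ n t)) t := by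
  have hc : Continuous fun s => A s (∑' n, dyson A ρ n s) :=
    hA.continuous_apply continuous_id (hA.continuous_tsum_dyson ρ)
  have := (intervalIntegral.integral_hasDerivAt_right (hc.intervalIntegrable 0 t)
    (hc.stronglyMeasurableAtFilter _ _) hc.continuousAt).const_add ρ
  exact this.congr_of_eventuallyEq (Eventually.of_forall fun s => hA.tsum_dyson_eq ρ s)

omit [CompleteSpace B] in
theorem IsBoundedFamily.ode_unique (hA : IsBoundedFamily A M) {y z : ℝ → B}
    (hy : ∀ t, HasDerivAt y (A t (y t)) t) (hz : ∀ t, HasDerivAt z (A t (z t)) t)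
    (h0 : y 0 = z 0) : y = z := by
  refine ODE_solution_unique_univ (v := fun t x => A t x) (K := M.toNNReal) (s := fun _ => univ)
    (t₀ := 0) (fun t => ?_) (fun t => ⟨hy t, mem_univ _⟩) (fun t => ⟨hz t, mem_univ _⟩) h0
  refine LipschitzWith.lipschitzOnWith ((A t).lipschitz.weaken ?_)
  rw [← NNReal.coe_le_coe, Real.coe_toNNReal _ hA.nonneg]
  exact hA.bound t

omit [CompleteSpace B] in
theorem IsBoundedFamily.dyson_add (hA : IsBoundedFamily A M) (ρ η : B) (n : ℕ) (t : ℝ) :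
    dyson A (ρ + η) n t = dyson A ρ n t + dyson A η n t := by
  induction n generalizing t with
  | zero => rfl
  | succ n ih =>
    simp only [dyson, ih, map_add]
    exact intervalIntegral.integral_add
      ((hA.continuous_apply continuous_id (hA.continuous_dyson ρ n)).intervalIntegrable _ _)
      ((hA.continuous_apply continuous_id (hA.continuous_dyson η n)).intervalIntegrable _ _)

omit [CompleteSpace B] in
theorem dyson_smul (A : ℝ → B →L[ℂ] B) (c : ℂ) (ρ : B) (n : ℕ) (t : ℝ) :
    dyson A (c • ρ) n t = c • dyson A ρ n t := by
  induction n generalizing t with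
  | zero => rfl
  | succ n ih =>
    simp only [dyson, ih, map_smul]
    exact intervalIntegral.integral_smul _ _

/-- The propagator of `y'(t) = A(t) y(t)`. -/
def propagator (hA : IsBoundedFamily A M) (t : ℝ) : B →L[ℂ] B :=
  LinearMap.mkContinuous
    { toFun := fun ρ => ∑' n, dyson A ρ n t
      map_add' := fun ρ η => by
        simp_rw [hA.dyson_add]
        exact (hA.summable_dyson ρ t).tsum_add (hA.summable_dyson η t)
      map_smul' := fun c ρ => by
        simp_rw [dyson_smul]
        exact tsum_const_smul'' c }
    (Real.exp (M * |t|)) (fun ρ => by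
      refine tsum_of_norm_bounded ?_ fun n => hA.norm_dyson_le ρ n t
      rw [Real.exp_eq_exp_ℝ]
      exact (NormedSpace.expSeries_div_hasSum_exp (M * |t|)).mul_right _)

theorem propagator_apply (hA : IsBoundedFamily A M) (t : ℝ) (ρ : B) :
    propagator hA t ρ = ∑' n, dyson A ρ n t := rfl

theorem norm_propagator_le (hA : IsBoundedFamily A M) (t : ℝ) :
    ‖propagator hA t‖ ≤ Real.exp (M * |t|) :=
  LinearMap.mkContinuous_norm_le _ (Real.exp_pos _).le _

theorem propagator_zero (hA : IsBoundedFamily A M) : propagator hA 0 = 1 := by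
  ext ρ
  rw [propagator_apply, hA.tsum_dyson_eq]
  simp

theorem hasDerivAt_propagator (hA : IsBoundedFamily A M) (ρ : B) (t : ℝ) :
    HasDerivAt (fun t => propagator hA t ρ) (A t (propagator hA t ρ)) t :=
  hA.hasDerivAt_tsum_dyson ρ t

end Perturbation

/-! ### Strongly continuous groups and their generators -/

section Groups

variable {B : Type*} [NormedAddCommGroup B] [NormedSpace ℂ B]
  {T T' : ℝ → B →L[ℂ] B}

theorem IsC0Group.apply_add (hT : IsC0Group T) (s t : ℝ) (ρ : B) : T (s + t) ρ = T s (T t ρ) := by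
  rw [hT.add]; rfl

theorem IsC0Group.neg_apply_apply (hT : IsC0Group T) (t : ℝ) (ρ : B) : T (-t) (T t ρ) = ρ := by
  rw [← hT.apply_add, neg_add_cancel, hT.zero]; rfl

theorem IsC0Group.apply_neg_apply (hT : IsC0Group T) (t : ℝ) (ρ : B) : T t (T (-t) ρ) = ρ := by
  rw [← hT.apply_add, add_neg_cancel, hT.zero]; rfl

theorem IsC0Group.hasDerivAt (hT : IsC0Group T) {ρ η : B} (h : HasGenerator T ρ η) (t : ℝ) :
    HasDerivAt (fun s => T s ρ) (T t η) t := by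
  have h1 : HasDerivAt (fun s : ℝ => T (s - t) ρ) η t := by
    have h' : HasDerivAt (fun t : ℝ => T t ρ) η (t - t) := by rw [sub_self]; exact h
    simpa using h'.comp_sub_const t t
  have h2 := ((T t).restrictScalars ℝ).hasFDerivAt.comp_hasDerivAt t h1
  refine h2.congr_of_eventuallyEq (Eventually.of_forall fun s => ?_)
  change T s ρ = T t (T (s - t) ρ)
  rw [← hT.apply_add, add_sub_cancel]

theorem IsC0Group.hasGenerator_apply (hT : IsC0Group T) {ρ η : B} (h : HasGenerator T ρ η)
    (t : ℝ) : HasGenerator T (T t ρ) (T t η) := by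
  have h2 := ((T t).restrictScalars ℝ).hasFDerivAt.comp_hasDerivAt (0 : ℝ) h
  refine h2.congr_of_eventuallyEq (Eventually.of_forall fun s => ?_)
  change T s (T t ρ) = T t (T s ρ)
  rw [← hT.apply_add, ← hT.apply_add, add_comm]

variable [CompleteSpace B]

/-- The domain of the generator is dense: the averages of `T s ρ` over `[0, h]` lie in it by the
group law, and they tend to `ρ` as `h → 0`. -/
theorem IsC0Group.exists_generator_approx (hT : IsC0Group T) (ρ : B) {ε : ℝ} (hε : 0 < ε) :
    ∃ ρ' η, HasGenerator T ρ' η ∧ ‖ρ' - ρ‖ < ε := by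
  have hc := hT.continuous ρ
  have hd : HasDerivAt (fun h : ℝ => ∫ s in (0 : ℝ)..h, T s ρ) (T 0 ρ) 0 :=
    intervalIntegral.integral_hasDerivAt_right (hc.intervalIntegrable 0 0)
      (hc.stronglyMeasurableAtFilter _ _) hc.continuousAt
  rw [hT.zero] at hd
  have hs := (hasDerivAt_iff_tendsto_slope.1 hd).eventually (Metric.ball_mem_nhds _ hε)
  obtain ⟨h, hh, hne⟩ := (hs.and self_mem_nhdsWithin).exists
  refine ⟨(h⁻¹ : ℝ) • ∫ s in (0 : ℝ)..h, T s ρ, (h⁻¹ : ℝ) • (T h ρ - T 0 ρ), ?_, ?_⟩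
  · have key : ∀ t, T t ((h⁻¹ : ℝ) • ∫ s in (0 : ℝ)..h, T s ρ)
        = (h⁻¹ : ℝ) • ((∫ s in (0 : ℝ)..(h + t), T s ρ) - ∫ s in (0 : ℝ)..t, T s ρ) := by
      intro t
      rw [(T t).map_smul_of_tower, ← (T t).intervalIntegral_comp_comm (hc.intervalIntegrable _ _)]
      congr 1
      simp_rw [← hT.apply_add]
      rw [intervalIntegral.integral_comp_add_left (fun s => T s ρ),
        intervalIntegral.integral_interval_sub_left (hc.intervalIntegrable _ _)
        (hc.intervalIntegrable _ _), add_zero, add_comm]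
    have d1 : HasDerivAt (fun t : ℝ => ∫ s in (0 : ℝ)..(h + t), T s ρ) (T h ρ) 0 := by
      have : HasDerivAt (fun t : ℝ => ∫ s in (0 : ℝ)..t, T s ρ) (T (h + 0) ρ) (h + 0) :=
        intervalIntegral.integral_hasDerivAt_right (hc.intervalIntegrable _ _)
          (hc.stronglyMeasurableAtFilter _ _) hc.continuousAt
      simpa using this.comp_const_add h 0
    have d2 : HasDerivAt (fun t : ℝ => ∫ s in (0 : ℝ)..t, T s ρ) (T 0 ρ) 0 := by
      rw [hT.zero]; exact hd
    exact ((d1.sub d2).const_smul (h⁻¹ : ℝ)).congr_of_eventuallyEq (Eventually.of_forall key)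
  · rw [dist_eq_norm] at hh
    simpa [slope_def_module] using hh

/-- A strongly continuous group is determined by its generator. -/
theorem IsC0Group.eq_of_generator (hT : IsC0Group T) (hT' : IsC0Group T') {c : ℝ → ℝ}
    (hc : Continuous c) (hb : ∀ t, ‖T t‖ ≤ c t)
    (h : ∀ ρ η, HasGenerator T' ρ η → HasGenerator T ρ η) : T = T' := by
  have h1 : ∀ ρ η, HasGenerator T' ρ η → ∀ t, T t ρ = T' t ρ := by
    intro ρ η hρ t
    have hd : ∀ s, HasDerivAt (fun s => T (t - s) (T' s ρ)) 0 s := by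
      intro s
      have hb' : ∀ᶠ r in 𝓝 s, ‖T (t - r)‖ ≤ c (t - s) + 1 := by
        have : ContinuousAt (fun r => c (t - r)) s := by fun_prop
        filter_upwards [this.eventually (gt_mem_nhds (lt_add_one _))] with r hr
        exact (hb _).trans hr.le
      have hw : HasDerivAt (fun r => T (t - r) (T' s ρ)) (-(T (t - s) (T' s η))) s := by
        have := (hT.hasDerivAt (h _ _ (hT'.hasGenerator_apply hρ s)) (t - s)).comp_const_sub t s
        exact this
      have := hasDerivAt_clm_apply_of_bound (c := fun r => T (t - r)) hb'
        (by
          have : Continuous fun r => T (t - r) (T' s η) := (hT.continuous _).comp (by fun_prop)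
          exact this.tendsto s) hw (hT'.hasDerivAt hρ s)
      simpa using this
    have h2 := is_const_of_deriv_eq_zero (f := fun s => T (t - s) (T' s ρ))
      (fun s => (hd s).differentiableAt) (fun s => (hd s).deriv) 0 t
    simpa [hT.zero, hT'.zero] using h2
  funext t
  ext ρ
  refine eq_of_forall_dist_le fun ε hε => ?_
  obtain ⟨ρ', η, hη, hlt⟩ := hT'.exists_generator_approx ρ
    (show 0 < ε / (‖T t‖ + ‖T' t‖ + 1) by positivity)
  have e1 : T t ρ - T' t ρ = T' t (ρ' - ρ) - T t (ρ' - ρ) := by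
    rw [map_sub, map_sub, h1 _ _ hη]; abel
  rw [dist_eq_norm, e1]
  calc _ ≤ ‖T' t‖ * ‖ρ' - ρ‖ + ‖T t‖ * ‖ρ' - ρ‖ :=
        (norm_sub_le _ _).trans (add_le_add ((T' t).le_opNorm _) ((T t).le_opNorm _))
    _ ≤ (‖T t‖ + ‖T' t‖ + 1) * ‖ρ' - ρ‖ := by nlinarith [norm_nonneg (ρ' - ρ)]
    _ ≤ ε := by
        rw [lt_div_iff₀ (by positivity)] at hlt
        linarith

/-- The interaction picture `T(-s) A T(s)` of `A`. -/
def interaction (T : ℝ → B →L[ℂ] B) (A : B →L[ℂ] B) (s : ℝ) : B →L[ℂ] B := T (-s) ∘L A ∘L T s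

omit [CompleteSpace B] in
theorem IsC0Group.isBoundedFamily (hT : IsC0Group T) (hb : ∀ t, ‖T t‖ ≤ 1) :
    IsBoundedFamily T 1 := ⟨hT.continuous, hb⟩

omit [CompleteSpace B] in
theorem IsC0Group.isBoundedFamily_interaction (hT : IsC0Group T) (hb : ∀ t, ‖T t‖ ≤ 1)
    (A : B →L[ℂ] B) : IsBoundedFamily (interaction T A) ‖A‖ where
  continuous ρ := (hT.isBoundedFamily hb).continuous_apply continuous_neg
    (A.continuous.comp (hT.continuous ρ))
  bound s := by
    calc ‖T (-s) ∘L A ∘L T s‖ ≤ ‖T (-s)‖ * (‖A‖ * ‖T s‖) :=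
          (ContinuousLinearMap.opNorm_comp_le _ _).trans
            (by gcongr; exact ContinuousLinearMap.opNorm_comp_le _ _)
      _ ≤ 1 * (‖A‖ * 1) := by gcongr <;> exact hb _
      _ = ‖A‖ := by ring

/-- The perturbed group, in terms of the propagator of the interaction picture. -/
def dysonGroup (hT : IsC0Group T) (hb : ∀ t, ‖T t‖ ≤ 1) (A : B →L[ℂ] B) (t : ℝ) : B →L[ℂ] B :=
  T t ∘L propagator (hT.isBoundedFamily_interaction hb A) t

variable (hT : IsC0Group T) (hb : ∀ t, ‖T t‖ ≤ 1) (A : B →L[ℂ] B)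

theorem norm_dysonGroup_le (t : ℝ) : ‖dysonGroup hT hb A t‖ ≤ Real.exp (‖A‖ * |t|) := by
  refine (ContinuousLinearMap.opNorm_comp_le _ _).trans ?_
  calc _ ≤ 1 * Real.exp (‖A‖ * |t|) := by
        gcongr
        · exact hb t
        · exact norm_propagator_le _ _
    _ = _ := one_mul _

/-- The group law is uniqueness for the interaction picture equation: the solution restarted at time
`t` and transported by `T t` solves the same equation with initial value `dysonGroup hT hb A t ρ`.
-/
theorem isC0Group_dysonGroup : IsC0Group (dysonGroup hT hb A) where
  zero := by
    unfold dysonGroup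
    rw [hT.zero, propagator_zero]
    rfl
  add s t := by
    have hA := hT.isBoundedFamily_interaction hb A
    ext ρ
    have key := hA.ode_unique (y := fun s => T t (propagator hA (s + t) ρ))
      (z := fun s => propagator hA s (dysonGroup hT hb A t ρ)) (fun s => ?_)
      (fun s => hasDerivAt_propagator hA _ s) ?_
    · have := congrFun key s
      change T (s + t) (propagator hA (s + t) ρ) = T s (propagator hA s (dysonGroup hT hb A t ρ))
      rw [← this, hT.apply_add]
    · have h1 := (hasDerivAt_propagator hA ρ (s + t)).comp_add_const s t
      have h2 := ((T t).restrictScalars ℝ).hasFDerivAt.comp_hasDerivAt s h1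
      refine HasDerivAt.congr_deriv h2 ?_
      change T t (T (-(s + t)) (A (T (s + t) _))) = T (-s) (A (T s (T t _)))
      rw [← hT.apply_add, ← hT.apply_add]
      congr 2
      ring
    · simp only [zero_add, propagator_zero]
      rfl
  continuous ρ := (hT.isBoundedFamily hb).continuous_apply continuous_id
    (continuous_iff_continuousAt.2 fun t =>
      (hasDerivAt_propagator (hT.isBoundedFamily_interaction hb A) ρ t).continuousAt)

/-- The difference `dysonGroup t ρ - T t ρ` is differentiable at `0` with derivative `A ρ` for every
`ρ`, in the domain or not. Hence the two generators have the same domain and differ by `A`. -/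
theorem isPerturbedGroup_dysonGroup : IsPerturbedGroup T A (dysonGroup hT hb A) := by
  refine ⟨isC0Group_dysonGroup hT hb A, fun ρ η => ?_⟩
  have hA := hT.isBoundedFamily_interaction hb A
  have hd : HasDerivAt (fun t => T t (propagator hA t ρ - ρ)) (A ρ) 0 := by
    have h1 : HasDerivAt (fun t => propagator hA t ρ - ρ) (A ρ) 0 := by
      have := (hasDerivAt_propagator hA ρ 0).sub_const ρ
      simpa [propagator_zero, interaction, hT.zero] using this
    have := hasDerivAt_clm_apply_of_bound (c := T) (x := 0) (w := 0) (Eventually.of_forall hb)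
      ((hT.continuous _).tendsto 0) (by simpa [propagator_zero] using hasDerivAt_const _ _) h1
    simpa [hT.zero] using this
  have e : ∀ t, dysonGroup hT hb A t ρ = T t ρ + T t (propagator hA t ρ - ρ) := fun t => by
    rw [← map_add, add_sub_cancel]; rfl
  constructor
  · intro h
    have := HasDerivAt.sub h hd
    rw [add_sub_cancel_right] at this
    refine this.congr_of_eventuallyEq (Eventually.of_forall fun t => ?_)
    simp [e]
  · intro h
    exact (HasDerivAt.add h hd).congr_of_eventuallyEq (Eventually.of_forall e)

/-- The group selected by choice has the same generator as the Dyson group, and generators determine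
groups, so all later estimates may use the Dyson series. -/
theorem perturbedGroup_eq_dysonGroup : perturbedGroup T A = dysonGroup hT hb A := by
  have hex : ∃ T', IsPerturbedGroup T A T' := ⟨_, isPerturbedGroup_dysonGroup hT hb A⟩
  rw [perturbedGroup, dif_pos hex]
  symm
  refine (isC0Group_dysonGroup hT hb A).eq_of_generator hex.choose_spec.1
    (c := fun t => Real.exp (‖A‖ * |t|)) (by fun_prop) (norm_dysonGroup_le hT hb A)
    fun ρ η h => ?_
  have h1 := hex.choose_spec.2 ρ (η - A ρ)
  have h2 := (isPerturbedGroup_dysonGroup hT hb A).2 ρ (η - A ρ)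
  rw [sub_add_cancel] at h1 h2
  exact h2.2 (h1.1 h)

end Groups

end VanHove

end

noncomputable section

namespace VanHove

/-! ## Rank-one operators in the trace class -/

section KetBra

variable {H : Type*} [NormedAddCommGroup H] [InnerProductSpace ℂ H]

/-- The trace class operator `|x⟩⟨y|`. -/
def ketBra (x y : H) : TraceClass H := ⟨InnerProductSpace.rankOne ℂ x y, rankOne_mem_traceClass x y⟩

theorem ketBra_val (x y : H) : (ketBra x y).val = InnerProductSpace.rankOne ℂ x y := rfl

theorem norm_ketBra_le (x y : H) : ‖ketBra x y‖ ≤ ‖x‖ * ‖y‖ := by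
  have := TraceClass.norm_le (T := ketBra x y) (isNuclearRep_rankOne x y)
  refine this.trans (le_of_eq ?_)
  rw [repCost, tsum_eq_single 0 (fun n hn => by simp [hn])]
  simp

theorem TraceClass.val_add (S T : TraceClass H) : (S + T).val = S.val + T.val := rfl
theorem TraceClass.val_smul (c : ℂ) (T : TraceClass H) : (c • T).val = c • T.val := rfl
theorem TraceClass.val_sub (S T : TraceClass H) : (S - T).val = S.val - T.val := rfl

theorem TraceClass.val_sum {ι : Type*} (s : Finset ι) (T : ι → TraceClass H) :
    (∑ i ∈ s, T i).val = ∑ i ∈ s, (T i).val := map_sum (TraceClass.valₗ H) _ _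

theorem ketBra_add_left (x x' y : H) : ketBra (x + x') y = ketBra x y + ketBra x' y :=
  TraceClass.val_injective (by simp [TraceClass.val_add, ketBra_val])

theorem ketBra_add_right (x y y' : H) : ketBra x (y + y') = ketBra x y + ketBra x y' :=
  TraceClass.val_injective (by simp [TraceClass.val_add, ketBra_val])

theorem ketBra_smul_left (c : ℂ) (x y : H) : ketBra (c • x) y = c • ketBra x y :=
  TraceClass.val_injective (by simp [TraceClass.val_smul, ketBra_val])

theorem ketBra_smul_right (c : ℂ) (x y : H) :
    ketBra x (c • y) = (starRingEnd ℂ) c • ketBra x y :=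
  TraceClass.val_injective (by simp [TraceClass.val_smul, ketBra_val])

theorem ketBra_zero_left (y : H) : ketBra 0 y = 0 := by
  simpa using ketBra_smul_left 0 0 y

theorem ketBra_zero_right (x : H) : ketBra x 0 = 0 := by
  simpa using ketBra_smul_right 0 x 0

variable (H) in
/-- `(x, y) ↦ |x⟩⟨y|` as a bounded real-bilinear map. -/
def ketBraL : H →L[ℝ] H →L[ℝ] TraceClass H :=
  LinearMap.mkContinuous₂
    (LinearMap.mk₂ ℝ ketBra ketBra_add_left
      (fun c x y => by simpa using ketBra_smul_left (c : ℂ) x y)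
      ketBra_add_right (fun c x y => by simpa using ketBra_smul_right (c : ℂ) x y)) 1 (fun x y => by
        rw [one_mul]; exact norm_ketBra_le x y)

theorem _root_.Continuous.ketBra {X : Type*} [TopologicalSpace X] {f g : X → H}
    (hf : Continuous f) (hg : Continuous g) : Continuous fun s => VanHove.ketBra (f s) (g s) :=
  (ketBraL H).continuous₂.comp (hf.prodMk hg)

/-- A nuclear representation, given in operator norm, also converges in trace norm: its tail
represents the remainder, at the cost of the tail of a convergent series. Hence bounded operators on
the trace class are determined by rank-one operators. -/
theorem hasSum_ketBra {T : TraceClass H} {x y : ℕ → H} (h : IsNuclearRep T.val x y) :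
    HasSum (fun n => ketBra (x n) (y n)) T := by
  have hs : Summable fun n => ‖ketBra (x n) (y n)‖ :=
    Summable.of_nonneg_of_le (fun _ => norm_nonneg _) (fun n => norm_ketBra_le _ _) h.summable
  rw [hasSum_iff_tendsto_nat_of_summable_norm hs, tendsto_iff_norm_sub_tendsto_zero]
  refine squeeze_zero (fun _ => norm_nonneg _) (fun n => ?_)
    (tendsto_sum_nat_add fun k => ‖x k‖ * ‖y k‖)
  rw [norm_sub_rev]
  refine TraceClass.norm_le (x := fun k => x (k + n)) (y := fun k => y (k + n)) ⟨?_, ?_⟩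
  · exact (summable_nat_add_iff n).2 h.summable
  · rw [TraceClass.val_sub, TraceClass.val_sum]
    exact (hasSum_nat_add_iff' n).2 h.hasSum

theorem clm_ext_ketBra {E : Type*} [NormedAddCommGroup E] [NormedSpace ℂ E]
    {f g : TraceClass H →L[ℂ] E} (h : ∀ x y, f (ketBra x y) = g (ketBra x y)) : f = g := by
  ext T
  obtain ⟨x, y, hT⟩ := T.exists_rep
  have h1 := (hasSum_ketBra hT).mapL f
  have h2 := (hasSum_ketBra hT).mapL g
  simp_rw [h] at h1
  exact h1.unique h2

theorem continuous_of_ketBra {E X : Type*} [NormedAddCommGroup E] [NormedSpace ℂ E]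
    [CompleteSpace E]
    [TopologicalSpace X] {f : X → TraceClass H →L[ℂ] E} {M : ℝ}
    (hM : ∀ t, ‖f t‖ ≤ M) (h : ∀ x y, Continuous fun t => f t (ketBra x y)) (T : TraceClass H) :
    Continuous fun t => f t T := by
  obtain ⟨x, y, hT⟩ := T.exists_rep
  have h1 : (fun t => f t T) = fun t => ∑' n, f t (ketBra (x n) (y n)) :=
    funext fun t => ((hasSum_ketBra hT).mapL (f t)).tsum_eq.symm
  rw [h1]
  refine continuous_tsum (fun n => h _ _) (hT.summable.mul_left M) fun n t => ?_
  refine ((f t).le_opNorm _).trans ?_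
  have := (norm_nonneg _).trans (hM t)
  exact mul_le_mul (hM t) (norm_ketBra_le _ _) (norm_nonneg _) this

variable [CompleteSpace H]

theorem sandwich_ketBra (A B : H →L[ℂ] H) (x y : H) :
    TraceClass.sandwich A B (ketBra x y) = ketBra (A x) (ContinuousLinearMap.adjoint B y) :=
  TraceClass.val_injective (by
    rw [TraceClass.sandwich_val, ketBra_val, ketBra_val, InnerProductSpace.rankOne_comp,
      InnerProductSpace.comp_rankOne])

theorem norm_sandwich_le_mul (A B : H →L[ℂ] H) : ‖TraceClass.sandwich A B‖ ≤ ‖A‖ * ‖B‖ :=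
  LinearMap.mkContinuous_norm_le _ (by positivity) _

theorem commutator_ketBra (A : H →L[ℂ] H) (x y : H) :
    TraceClass.commutator A (ketBra x y)
      = ketBra (A x) y - ketBra x (ContinuousLinearMap.adjoint A y) := by
  have h1 : ContinuousLinearMap.adjoint (1 : H →L[ℂ] H) = 1 := ContinuousLinearMap.adjoint_id
  rw [TraceClass.commutator, sub_apply, sandwich_ketBra, sandwich_ketBra, h1]
  rfl

end KetBra

/-! ## Tensor products -/

section Tensor

variable {S R : Type*} [NormedAddCommGroup S] [InnerProductSpace ℂ S] [FiniteDimensional ℂ S]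
  [NormedAddCommGroup R] [InnerProductSpace ℂ R]

omit [FiniteDimensional ℂ S] in
theorem clm_ext_tmul {E : Type*} [NormedAddCommGroup E] [NormedSpace ℂ E]
    {f g : TraceClass (S ⊗[ℂ] R) →L[ℂ] E}
    (h : ∀ a x b y, f (ketBra (a ⊗ₜ x) (b ⊗ₜ y)) = g (ketBra (a ⊗ₜ x) (b ⊗ₜ y))) : f = g := by
  refine clm_ext_ketBra fun u v => ?_
  induction u using TensorProduct.induction_on with
  | zero => simp [ketBra_zero_left]
  | add u u' hu hu' => simp [ketBra_add_left, hu, hu']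
  | tmul a x =>
    induction v using TensorProduct.induction_on with
    | zero => simp [ketBra_zero_right]
    | add u u' hu hu' => simp [ketBra_add_right, hu, hu']
    | tmul b y => exact h a x b y

omit [FiniteDimensional ℂ S] in
theorem tensorOp_ext {A B : S ⊗[ℂ] R →L[ℂ] S ⊗[ℂ] R}
    (h : ∀ a x, A (a ⊗ₜ x) = B (a ⊗ₜ x)) : A = B :=
  ContinuousLinearMap.coe_injective (TensorProduct.ext' h)

omit [FiniteDimensional ℂ S] in
theorem continuous_tmul {X : Type*} [TopologicalSpace X] {f : X → S} {g : X → R}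
    (hf : Continuous f) (hg : Continuous g) : Continuous fun s => f s ⊗ₜ[ℂ] g s :=
  continuous_iff_continuousAt.2 fun s => by
    rw [ContinuousAt, tendsto_iff_norm_sub_tendsto_zero]
    have e : ∀ r, f r ⊗ₜ[ℂ] g r - f s ⊗ₜ[ℂ] g s
        = (f r - f s) ⊗ₜ[ℂ] g r + f s ⊗ₜ[ℂ] (g r - g s) := fun r => by
      rw [TensorProduct.sub_tmul, TensorProduct.tmul_sub]; abel
    refine squeeze_zero (fun _ => norm_nonneg _) (fun r => ?_)
      (g := fun r => ‖f r - f s‖ * ‖g r‖ + ‖f s‖ * ‖g r - g s‖) ?_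
    · rw [e]
      refine (norm_add_le _ _).trans_eq ?_
      rw [TensorProduct.norm_tmul, TensorProduct.norm_tmul]
    · have : Continuous fun r => ‖f r - f s‖ * ‖g r‖ + ‖f s‖ * ‖g r - g s‖ := by fun_prop
      simpa using this.tendsto s

variable [CompleteSpace R]

/-- The adjoints of the factors enter through inner products, so that the symmetry of `hamS` and `W`
can be used directly. -/
theorem adjoint_tensorOp {A A' : S →L[ℂ] S} {B B' : R →L[ℂ] R}
    (hA : ∀ a b, ⟪A a, b⟫_ℂ = ⟪a, A' b⟫_ℂ) (hB : ∀ x y, ⟪B x, y⟫_ℂ = ⟪x, B' y⟫_ℂ) :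
    ContinuousLinearMap.adjoint (tensorOp A B) = tensorOp A' B' := by
  symm
  rw [ContinuousLinearMap.eq_adjoint_iff]
  intro u v
  induction u using TensorProduct.induction_on with
  | zero => simp
  | add u u' hu hu' => simp [inner_add_left, hu, hu']
  | tmul a x =>
    induction v using TensorProduct.induction_on with
    | zero => simp
    | add u u' hu hu' => simp only [map_add, inner_add_right, hu, hu']
    | tmul b y =>
      rw [tensorOp_tmul, tensorOp_tmul, TensorProduct.inner_tmul, TensorProduct.inner_tmul]
      have h1 : ⟪A' a, b⟫_ℂ = ⟪a, A b⟫_ℂ := by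
        rw [← inner_conj_symm, ← hA, inner_conj_symm]
      have h2 : ⟪B' x, y⟫_ℂ = ⟪x, B y⟫_ℂ := by
        rw [← inner_conj_symm, ← hB, inner_conj_symm]
      rw [h1, h2]

theorem sumInner_tmul (i j : Fin (Module.finrank ℂ S)) (a b : S) (x y : R) :
    TraceClass.sumInner (orthonormal_tmul (E := S) (F := R) i) (orthonormal_tmul j)
      (ketBra (a ⊗ₜ x) (b ⊗ₜ y))
      = ⟪stdOrthonormalBasis ℂ S i, a⟫_ℂ * ⟪b, stdOrthonormalBasis ℂ S j⟫_ℂ * ⟪y, x⟫_ℂ := by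
  change ∑' k, ⟪stdOrthonormalBasis ℂ S i ⊗ₜ[ℂ] basis R k,
    InnerProductSpace.rankOne ℂ (a ⊗ₜ[ℂ] x) (b ⊗ₜ[ℂ] y)
      (stdOrthonormalBasis ℂ S j ⊗ₜ[ℂ] basis R k)⟫_ℂ = _
  simp_rw [InnerProductSpace.rankOne_apply, inner_smul_right, TensorProduct.inner_tmul]
  rw [← (basis R).tsum_inner_mul_inner y x, ← tsum_mul_left]
  exact tsum_congr fun k => by ring

theorem partialTrace_tmul (a b : S) (x y : R) :
    partialTrace S R (ketBra (a ⊗ₜ x) (b ⊗ₜ y))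
      = ⟪y, x⟫_ℂ • InnerProductSpace.rankOne ℂ a b := by
  simp only [partialTrace, sum_apply, ContinuousLinearMap.smulRight_apply, sumInner_tmul]
  conv_rhs => rw [← (stdOrthonormalBasis ℂ S).sum_repr' a, ← (stdOrthonormalBasis ℂ S).sum_repr' b]
  simp only [map_sum, map_smul, sum_apply, smul_apply, map_smulₛₗ, Finset.smul_sum, smul_smul,
    inner_conj_symm]
  rw [Finset.sum_comm]
  refine Finset.sum_congr rfl fun i _ => Finset.sum_congr rfl fun j _ => ?_
  congr 1
  ring

omit [CompleteSpace R] in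
theorem tensorState_rankOne (a b : S) (Ω : R) :
    tensorState Ω (InnerProductSpace.rankOne ℂ a b) = ketBra (a ⊗ₜ Ω) (b ⊗ₜ Ω) := by
  refine TraceClass.val_injective (tensorOp_ext fun c x => ?_)
  change tensorOp _ _ (c ⊗ₜ x) = InnerProductSpace.rankOne ℂ (a ⊗ₜ[ℂ] Ω) (b ⊗ₜ[ℂ] Ω) (c ⊗ₜ[ℂ] x)
  rw [tensorOp_tmul, InnerProductSpace.rankOne_apply, InnerProductSpace.rankOne_apply,
    InnerProductSpace.rankOne_apply, TensorProduct.inner_tmul, TensorProduct.smul_tmul_smul]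

end Tensor

end VanHove

end

noncomputable section

namespace VanHove

theorem _root_.HasDerivAt.clm_apply_const {E F : Type*} [NormedAddCommGroup E] [NormedSpace ℂ E]
    [NormedAddCommGroup F] [NormedSpace ℂ F] {c : ℝ → E →L[ℂ] F} {c' : E →L[ℂ] F} {t : ℝ}
    (hc : HasDerivAt c c' t) (x : E) : HasDerivAt (fun s => c s x) (c' x) t :=
  ((ContinuousLinearMap.apply ℂ F x).restrictScalars ℝ).hasFDerivAt.comp_hasDerivAt t hc

/-! ### Unitary groups and the Heisenberg evolution -/

namespace UnitaryGroup

variable {H : Type*} [NormedAddCommGroup H] [InnerProductSpace ℂ H] (U : UnitaryGroup H)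

theorem op_add_apply (s t : ℝ) (x : H) : U.op (s + t) x = U.op s (U.op t x) := U.map_add s t x

/-- The group law makes `U.op 0` idempotent; being injective, it is the identity. -/
theorem op_zero_apply (x : H) : U.op 0 x = x := by
  have h := U.op_add_apply 0 0 x
  rw [add_zero] at h
  exact (U.toFun 0).injective h.symm

theorem op_zero : U.op 0 = 1 := ContinuousLinearMap.ext U.op_zero_apply

theorem op_neg_op (t : ℝ) (x : H) : U.op (-t) (U.op t x) = x := by
  rw [← U.op_add_apply, neg_add_cancel, op_zero_apply]

theorem op_op_neg (t : ℝ) (x : H) : U.op t (U.op (-t) x) = x := by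
  rw [← U.op_add_apply, add_neg_cancel, op_zero_apply]

theorem norm_op_apply (t : ℝ) (x : H) : ‖U.op t x‖ = ‖x‖ := (U.toFun t).norm_map x

theorem inner_op_op (t : ℝ) (x y : H) : ⟪U.op t x, U.op t y⟫_ℂ = ⟪x, y⟫_ℂ :=
  (U.toFun t).inner_map_map x y

theorem inner_op_left (t : ℝ) (x y : H) : ⟪U.op t x, y⟫_ℂ = ⟪x, U.op (-t) y⟫_ℂ := by
  rw [← U.inner_op_op (-t), op_neg_op]

theorem norm_op_le (t : ℝ) : ‖U.op t‖ ≤ 1 :=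
  ContinuousLinearMap.opNorm_le_bound _ zero_le_one fun x => by rw [norm_op_apply, one_mul]

theorem isC0Group : IsC0Group U.op where
  zero := U.op_zero
  add s t := ContinuousLinearMap.ext (U.op_add_apply s t)
  continuous := U.continuous

theorem op_eq_self_of_generator_eq_zero {x : H} (h : ∃ hx : x ∈ U.generator.domain,
    U.generator ⟨x, hx⟩ = 0) (t : ℝ) : U.op t x = x := by
  obtain ⟨hx, h0⟩ := h
  have hd : HasGenerator U.op x 0 := by
    have h1 : DifferentiableAt ℝ (fun t => U.toFun t x) 0 := hx
    have h2 : Complex.I • deriv (fun t => U.toFun t x) 0 = 0 := h0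
    have h3 : deriv (fun t => U.toFun t x) 0 = 0 := (smul_eq_zero.1 h2).resolve_left Complex.I_ne_zero
    have := h1.hasDerivAt
    rwa [h3] at this
  have hd' : ∀ s, HasDerivAt (fun s => U.op s x) 0 s := fun s => by
    simpa using U.isC0Group.hasDerivAt hd s
  have := is_const_of_deriv_eq_zero (fun s => (hd' s).differentiableAt) (fun s => (hd' s).deriv) t 0
  rw [this, op_zero_apply]

theorem heisenberg_apply (V : H →L[ℂ] H) (t : ℝ) (x : H) :
    U.heisenberg V t x = U.op (-t) (V (U.op t x)) := rfl

theorem norm_heisenberg_apply_le (V : H →L[ℂ] H) (t : ℝ) (x : H) :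
    ‖U.heisenberg V t x‖ ≤ ‖V‖ * ‖x‖ := by
  rw [heisenberg_apply, norm_op_apply]
  exact (V.le_opNorm _).trans (by rw [norm_op_apply])

theorem isBoundedFamily_heisenberg (V : H →L[ℂ] H) : IsBoundedFamily (U.heisenberg V) ‖V‖ where
  continuous x := (U.isC0Group.isBoundedFamily U.norm_op_le).continuous_apply continuous_neg
    (V.continuous.comp (U.continuous x))
  bound t := ContinuousLinearMap.opNorm_le_bound _ (norm_nonneg _) (U.norm_heisenberg_apply_le V t)

theorem heisenberg_add (V : H →L[ℂ] H) (s t : ℝ) (x : H) :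
    U.heisenberg V (s + t) x = U.op (-t) (U.heisenberg V s (U.op t x)) := by
  rw [heisenberg_apply, heisenberg_apply, ← U.op_add_apply, ← U.op_add_apply, neg_add_rev]

theorem inner_heisenberg [CompleteSpace H] {V : H →L[ℂ] H} (hV : IsSelfAdjoint V) (t : ℝ)
    (x y : H) : ⟪U.heisenberg V t x, y⟫_ℂ = ⟪x, U.heisenberg V t y⟫_ℂ := by
  rw [heisenberg_apply, heisenberg_apply, inner_op_left, neg_neg,
    ← U.inner_op_op t x, op_op_neg]
  exact hV.isSymmetric _ _

end UnitaryGroup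

/-! ### Free evolution, projections and Liouvillians of the model -/

namespace Model

variable {S R : Type*} [NormedAddCommGroup S] [InnerProductSpace ℂ S]
  [FiniteDimensional ℂ S] [NormedAddCommGroup R] [InnerProductSpace ℂ R] [CompleteSpace R]
  (M : Model S R)

theorem op_Ω (t : ℝ) : M.U.op t M.Ω = M.Ω := M.U.op_eq_self_of_generator_eq_zero M.invariant t

/-- `e^{-itH_S}`. -/
def expH (t : ℝ) : S →L[ℂ] S :=
  NormedSpace.exp ((-(Complex.I * (t : ℂ))) • M.hamS)

theorem expH_zero : M.expH 0 = 1 := by simp [expH]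

theorem expH_eq (t : ℝ) : M.expH t = NormedSpace.exp (t • (-Complex.I • M.hamS)) := by
  rw [expH]
  congr 1
  rw [← Complex.coe_smul, smul_smul]
  congr 1
  ring

theorem hasDerivAt_expH (t : ℝ) : HasDerivAt M.expH ((-Complex.I • M.hamS) * M.expH t) t := by
  have : CompleteSpace S := FiniteDimensional.complete ℂ S
  have := hasDerivAt_exp_smul_const' (𝕂 := ℝ) (-Complex.I • M.hamS) t
  simp_rw [← expH_eq] at this
  exact this

theorem expH_add (s t : ℝ) : M.expH (s + t) = M.expH s * M.expH t := by
  have : CompleteSpace S := FiniteDimensional.complete ℂ S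
  rw [expH_eq, expH_eq, expH_eq, add_smul]
  let _ := NormedAlgebra.restrictScalars ℚ ℂ (S →L[ℂ] S)
  exact NormedSpace.exp_add_of_commute (((Commute.refl _).smul_left _).smul_right _)

theorem expH_add_apply (s t : ℝ) (a : S) : M.expH (s + t) a = M.expH s (M.expH t a) := by
  rw [expH_add]; rfl

theorem expH_neg_expH (t : ℝ) (a : S) : M.expH (-t) (M.expH t a) = a := by
  rw [← expH_add_apply, neg_add_cancel, expH_zero]; rfl

theorem inner_expH (t : ℝ) (a b : S) : ⟪M.expH t a, b⟫_ℂ = ⟪a, M.expH (-t) b⟫_ℂ := by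
  have : CompleteSpace S := FiniteDimensional.complete ℂ S
  have hs : IsSelfAdjoint M.hamS :=
    ContinuousLinearMap.isSelfAdjoint_iff_isSymmetric.2 M.hamS_symm
  have h : star (M.expH t) = M.expH (-t) := by
    rw [expH, expH, NormedSpace.star_exp, star_smul, hs.star_eq]
    simp
  rw [← h, ContinuousLinearMap.star_eq_adjoint, ContinuousLinearMap.adjoint_inner_right]

theorem norm_expH_apply (t : ℝ) (a : S) : ‖M.expH t a‖ = ‖a‖ := by
  rw [@norm_eq_sqrt_re_inner ℂ, @norm_eq_sqrt_re_inner ℂ _ _ _ _ a, inner_expH, expH_neg_expH]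

theorem continuous_expH : Continuous M.expH :=
  continuous_iff_continuousAt.2 fun t => (M.hasDerivAt_expH t).continuousAt

/-- The coupling operator `W(t)` of the system in the interaction picture. -/
def Wt (t : ℝ) : S →L[ℂ] S := M.expH (-t) ∘L M.W ∘L M.expH t

/-- The coupling operator `V(t)` of the reservoir. -/
abbrev Vt (t : ℝ) : R →L[ℂ] R := M.U.heisenberg M.V t

theorem norm_Wt_apply_le (t : ℝ) (a : S) : ‖M.Wt t a‖ ≤ ‖M.W‖ * ‖a‖ := by
  change ‖M.expH (-t) (M.W (M.expH t a))‖ ≤ _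
  rw [norm_expH_apply]
  exact (M.W.le_opNorm _).trans (by rw [norm_expH_apply])

theorem inner_Vt (t : ℝ) (x y : R) : ⟪M.Vt t x, y⟫_ℂ = ⟪x, M.Vt t y⟫_ℂ :=
  M.U.inner_heisenberg M.V_selfAdjoint t x y

theorem freeOp_tmul (t : ℝ) (a : S) (x : R) :
    M.freeOp t (a ⊗ₜ x) = M.expH t a ⊗ₜ M.U.op t x := rfl

theorem adjoint_freeOp (t : ℝ) : ContinuousLinearMap.adjoint (M.freeOp t) = M.freeOp (-t) :=
  adjoint_tensorOp (M.inner_expH t) (M.U.inner_op_left t)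

theorem freeOp_neg_comp (t : ℝ) : M.freeOp (-t) ∘L M.freeOp t = 1 :=
  tensorOp_ext fun a x => by
    change M.freeOp (-t) (M.freeOp t (a ⊗ₜ x)) = _
    rw [freeOp_tmul, freeOp_tmul, expH_neg_expH, UnitaryGroup.op_neg_op]
    rfl

theorem norm_freeOp_apply (t : ℝ) (v : S ⊗[ℂ] R) : ‖M.freeOp t v‖ = ‖v‖ := by
  have : ⟪M.freeOp t v, M.freeOp t v⟫_ℂ = ⟪v, v⟫_ℂ := by
    rw [← ContinuousLinearMap.adjoint_inner_right, adjoint_freeOp]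
    have h := congrArg (fun A : S ⊗[ℂ] R →L[ℂ] S ⊗[ℂ] R => A v) (M.freeOp_neg_comp t)
    exact congrArg _ h
  rw [@norm_eq_sqrt_re_inner ℂ, @norm_eq_sqrt_re_inner ℂ _ _ _ _ v, this]

theorem norm_freeOp_le (t : ℝ) : ‖M.freeOp t‖ ≤ 1 :=
  ContinuousLinearMap.opNorm_le_bound _ zero_le_one fun x => by rw [norm_freeOp_apply, one_mul]

theorem expFree_ketBra (t : ℝ) (u v : S ⊗[ℂ] R) :
    M.expFree t (ketBra u v) = ketBra (M.freeOp t u) (M.freeOp t v) := by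
  rw [expFree, sandwich_ketBra, adjoint_freeOp, neg_neg]

theorem expFree_tmul (t : ℝ) (a b : S) (x y : R) :
    M.expFree t (ketBra (a ⊗ₜ x) (b ⊗ₜ y))
      = ketBra (M.expH t a ⊗ₜ M.U.op t x) (M.expH t b ⊗ₜ M.U.op t y) :=
  M.expFree_ketBra t _ _

theorem norm_expFree_le (t : ℝ) : ‖M.expFree t‖ ≤ 1 := by
  refine (norm_sandwich_le_mul _ _).trans ?_
  calc _ ≤ (1 : ℝ) * 1 := by gcongr <;> exact M.norm_freeOp_le _
    _ = 1 := one_mul 1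

theorem continuous_freeOp (v : S ⊗[ℂ] R) : Continuous fun t => M.freeOp t v := by
  induction v using TensorProduct.induction_on with
  | zero => simpa using continuous_const
  | add u u' hu hu' => simp only [map_add]; exact hu.add hu'
  | tmul a x =>
    exact continuous_tmul (M.continuous_expH.clm_apply continuous_const) (M.U.continuous x)

theorem isC0Group_expFree : IsC0Group M.expFree where
  zero := clm_ext_tmul fun a x b y => by
    rw [expFree_tmul, expH_zero, UnitaryGroup.op_zero]; rfl
  add s t := clm_ext_tmul fun a x b y => by
    change _ = M.expFree s (M.expFree t _)
    rw [expFree_tmul, expFree_tmul, expFree_tmul]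
    simp only [expH_add_apply, UnitaryGroup.op_add_apply]
  continuous := continuous_of_ketBra M.norm_expFree_le fun u v => by
    simp_rw [expFree_ketBra]
    exact (M.continuous_freeOp u).ketBra (M.continuous_freeOp v)

theorem P_tmul (a b : S) (x y : R) :
    M.P (ketBra (a ⊗ₜ x) (b ⊗ₜ y)) = ⟪y, x⟫_ℂ • ketBra (a ⊗ₜ M.Ω) (b ⊗ₜ M.Ω) := by
  change tensorState M.Ω (partialTrace S R _) = _
  rw [partialTrace_tmul, map_smul, tensorState_rankOne]

theorem inner_Ω_Ω : ⟪M.Ω, M.Ω⟫_ℂ = 1 := by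
  rw [inner_self_eq_norm_sq_to_K, M.norm_Ω]; simp

theorem P_Ω (a b : S) : M.P (ketBra (a ⊗ₜ M.Ω) (b ⊗ₜ M.Ω)) = ketBra (a ⊗ₜ M.Ω) (b ⊗ₜ M.Ω) := by
  rw [P_tmul, inner_Ω_Ω, one_smul]

theorem P_comp_P : M.P ∘L M.P = M.P := clm_ext_tmul fun a x b y => by
  change M.P (M.P _) = _
  rw [P_tmul, map_smul, P_Ω]

theorem P_P (ρ : TraceClass (S ⊗[ℂ] R)) : M.P (M.P ρ) = M.P ρ :=
  congrArg (fun A : TraceClass (S ⊗[ℂ] R) →L[ℂ] TraceClass (S ⊗[ℂ] R) => A ρ) M.P_comp_P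

theorem Q_apply (ρ : TraceClass (S ⊗[ℂ] R)) : M.Q ρ = ρ - M.P ρ := rfl

theorem P_Q (ρ : TraceClass (S ⊗[ℂ] R)) : M.P (M.Q ρ) = 0 := by
  rw [Q_apply, map_sub, P_P, sub_self]

theorem Q_P (ρ : TraceClass (S ⊗[ℂ] R)) : M.Q (M.P ρ) = 0 := by
  rw [Q_apply, P_P, sub_self]

theorem Q_Q (ρ : TraceClass (S ⊗[ℂ] R)) : M.Q (M.Q ρ) = M.Q ρ := by
  rw [Q_apply M (M.Q ρ), P_Q, sub_zero]

/-- Invariance of `Ω` and unitarity of the reservoir evolution make the partial trace and `ω_R`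
compatible with the free evolution. -/
theorem P_comp_expFree (t : ℝ) : M.P ∘L M.expFree t = M.expFree t ∘L M.P :=
  clm_ext_tmul fun a x b y => by
    change M.P (M.expFree t _) = M.expFree t (M.P _)
    rw [expFree_tmul, P_tmul, P_tmul, map_smul, expFree_tmul, op_Ω, UnitaryGroup.inner_op_op]

theorem P_expFree (t : ℝ) (ρ : TraceClass (S ⊗[ℂ] R)) :
    M.P (M.expFree t ρ) = M.expFree t (M.P ρ) :=
  congrArg (fun A : TraceClass (S ⊗[ℂ] R) →L[ℂ] TraceClass (S ⊗[ℂ] R) => A ρ) (M.P_comp_expFree t)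

theorem Q_expFree (t : ℝ) (ρ : TraceClass (S ⊗[ℂ] R)) :
    M.Q (M.expFree t ρ) = M.expFree t (M.Q ρ) := by
  rw [Q_apply, Q_apply, map_sub, P_expFree]

theorem liouSR_tmul (a b : S) (x y : R) :
    M.liouSR (ketBra (a ⊗ₜ x) (b ⊗ₜ y))
      = ketBra (M.W a ⊗ₜ M.V x) (b ⊗ₜ y) - ketBra (a ⊗ₜ x) (M.W b ⊗ₜ M.V y) := by
  rw [liouSR, commutator_ketBra, adjoint_tensorOp M.W_symm M.V_selfAdjoint.isSymmetric]
  rfl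

theorem inner_V_Ω : ⟪M.Ω, M.V M.Ω⟫_ℂ = 0 := by
  have h := M.trace_V
  rw [trace] at h
  simp only [ContinuousLinearMap.comp_apply, InnerProductSpace.rankOne_apply, map_smul,
    inner_smul_right] at h
  rw [← (basis R).tsum_inner_mul_inner]
  exact h

/-- The interaction Liouvillian `𝓛_SR(s)` in the interaction picture. -/
abbrev liouI (s : ℝ) : TraceClass (S ⊗[ℂ] R) →L[ℂ] TraceClass (S ⊗[ℂ] R) :=
  interaction M.expFree M.liouSR s

theorem liouI_tmul (s : ℝ) (a b : S) (x y : R) :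
    M.liouI s (ketBra (a ⊗ₜ x) (b ⊗ₜ y))
      = ketBra (M.Wt s a ⊗ₜ M.Vt s x) (b ⊗ₜ y) - ketBra (a ⊗ₜ x) (M.Wt s b ⊗ₜ M.Vt s y) := by
  change M.expFree (-s) (M.liouSR (M.expFree s _)) = _
  rw [expFree_tmul, liouSR_tmul, map_sub, expFree_tmul, expFree_tmul, expH_neg_expH, expH_neg_expH,
    UnitaryGroup.op_neg_op, UnitaryGroup.op_neg_op]
  rfl

theorem inner_Vt_Ω (s : ℝ) : ⟪M.Ω, M.Vt s M.Ω⟫_ℂ = 0 := by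
  rw [UnitaryGroup.heisenberg_apply, op_Ω, ← M.inner_V_Ω, ← M.U.inner_op_op s, op_Ω,
    UnitaryGroup.op_op_neg]

/-- Both terms of the commutator acquire the factor `⟪Ω, V(s) Ω⟫`, which is `tr(V ω_R) = 0`. This
removes the first order in `λ` from the equation for the projected state. -/
theorem P_liouI_P (s : ℝ) (ρ : TraceClass (S ⊗[ℂ] R)) : M.P (M.liouI s (M.P ρ)) = 0 := by
  have : M.P ∘L M.liouI s ∘L M.P = 0 := clm_ext_tmul fun a x b y => by
    change M.P (M.liouI s (M.P _)) = 0
    rw [P_tmul, map_smul, map_smul, liouI_tmul, map_sub, P_tmul, P_tmul, inner_Vt_Ω, M.inner_Vt,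
      inner_Vt_Ω]
    simp
  exact congrArg (fun A : TraceClass (S ⊗[ℂ] R) →L[ℂ] TraceClass (S ⊗[ℂ] R) => A ρ) this

theorem liouS_tmul (a b : S) (x y : R) :
    M.liouS (ketBra (a ⊗ₜ x) (b ⊗ₜ y))
      = ketBra (M.hamS a ⊗ₜ x) (b ⊗ₜ y) - ketBra (a ⊗ₜ x) (M.hamS b ⊗ₜ y) := by
  rw [liouS, commutator_ketBra, adjoint_tensorOp (B' := 1) M.hamS_symm (fun _ _ => rfl)]
  rfl

theorem hasDerivAt_expS (t : ℝ) : HasDerivAt M.expS ((-Complex.I • M.liouS) * M.expS t) t := by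
  have e : ∀ t : ℝ, M.expS t = NormedSpace.exp (t • (-Complex.I • M.liouS)) := fun t => by
    rw [expS]
    congr 1
    rw [← Complex.coe_smul, smul_smul]
    congr 1
    ring
  have := hasDerivAt_exp_smul_const' (𝕂 := ℝ) (-Complex.I • M.liouS) t
  simp_rw [← e] at this
  exact this

theorem expS_zero : M.expS 0 = 1 := by simp [expS]

/-- The exponential of a commutator is identified without a power series: both sides solve the same
linear equation. -/
theorem expS_tmul (t : ℝ) (a b : S) (x y : R) :
    M.expS t (ketBra (a ⊗ₜ x) (b ⊗ₜ y)) = ketBra (M.expH t a ⊗ₜ x) (M.expH t b ⊗ₜ y) := by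
  have hA : IsBoundedFamily (fun _ : ℝ => -Complex.I • M.liouS) ‖-Complex.I • M.liouS‖ :=
    ⟨fun _ => continuous_const, fun _ => le_rfl⟩
  have h := hA.ode_unique (y := fun t => M.expS t (ketBra (a ⊗ₜ x) (b ⊗ₜ y)))
    (z := fun t => ketBra (M.expH t a ⊗ₜ x) (M.expH t b ⊗ₜ y)) (fun t => ?_) (fun t => ?_) ?_
  · exact congrFun h t
  · exact (M.hasDerivAt_expS t).clm_apply_const _
  -- The map is conjugate-linear in `b`, so the product rule is applied to it as a real bilinear
  -- map.
  · let f : S →L[ℝ] S →L[ℝ] TraceClass (S ⊗[ℂ] R) :=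
      LinearMap.mkContinuous₂ (LinearMap.mk₂ ℝ (fun a b => ketBra (a ⊗ₜ[ℂ] x) (b ⊗ₜ[ℂ] y))
        (fun a a' b => by rw [TensorProduct.add_tmul, ketBra_add_left])
        (fun c a b => by
          rw [← Complex.coe_smul, ← TensorProduct.smul_tmul', ketBra_smul_left, Complex.coe_smul])
        (fun a b b' => by rw [TensorProduct.add_tmul, ketBra_add_right])
        (fun c a b => by
          rw [← Complex.coe_smul, ← TensorProduct.smul_tmul', ketBra_smul_right, Complex.conj_ofReal,
            Complex.coe_smul]))
        (‖x‖ * ‖y‖) (fun a b => (norm_ketBra_le _ _).trans (by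
          rw [TensorProduct.norm_tmul, TensorProduct.norm_tmul]
          exact le_of_eq (by ring)))
    have hf := (f.hasFDerivAt.comp_hasDerivAt t ((M.hasDerivAt_expH t).clm_apply_const a)).clm_apply
      ((M.hasDerivAt_expH t).clm_apply_const b)
    refine HasDerivAt.congr_deriv hf ?_
    change ketBra ((-Complex.I • M.hamS (M.expH t a)) ⊗ₜ[ℂ] x) (M.expH t b ⊗ₜ[ℂ] y)
      + ketBra (M.expH t a ⊗ₜ[ℂ] x) ((-Complex.I • M.hamS (M.expH t b)) ⊗ₜ[ℂ] y) = _
    rw [smul_apply, liouS_tmul, ← TensorProduct.smul_tmul', ← TensorProduct.smul_tmul',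
      ketBra_smul_left, ketBra_smul_right, smul_sub, map_neg, Complex.conj_I]
    module
  · simp [expS_zero, expH_zero]

/-- On the range of `P` the reservoir part evolves trivially. This allows `e^{-it𝓛_S}` to be traded
for the isometries `e^{-it𝓛₀}` in everything that follows. -/
theorem expFree_P (t : ℝ) (ρ : TraceClass (S ⊗[ℂ] R)) : M.expFree t (M.P ρ) = M.expS t (M.P ρ) := by
  have : M.expFree t ∘L M.P = M.expS t ∘L M.P := clm_ext_tmul fun a x b y => by
    change M.expFree t (M.P _) = M.expS t (M.P _)
    rw [P_tmul, map_smul, map_smul, expFree_tmul, expS_tmul, op_Ω]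
  exact congrArg (fun A : TraceClass (S ⊗[ℂ] R) →L[ℂ] TraceClass (S ⊗[ℂ] R) => A ρ) this

theorem P_expS (t : ℝ) (ρ : TraceClass (S ⊗[ℂ] R)) : M.P (M.expS t ρ) = M.expS t (M.P ρ) := by
  have : M.P ∘L M.expS t = M.expS t ∘L M.P := clm_ext_tmul fun a x b y => by
    change M.P (M.expS t _) = M.expS t (M.P _)
    rw [P_tmul, map_smul, expS_tmul, expS_tmul, P_tmul]
  exact congrArg (fun A : TraceClass (S ⊗[ℂ] R) →L[ℂ] TraceClass (S ⊗[ℂ] R) => A ρ) this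

end Model

end VanHove

end

noncomputable section

namespace VanHove

/-! ## Sums over compositions -/

section Composition

/-- The product of the weights `-w(a, b)` of the consecutive blocks `[a, b)` of sizes `L`, the first
of which starts at `i`. -/
def blockWeight (w : ℕ → ℕ → ℂ) : List ℕ → ℕ → ℂ
  | [], _ => 1
  | k :: L, i => -w i (i + k) * blockWeight w L (i + k)

theorem blockWeight_append (w : ℕ → ℕ → ℂ) (L : List ℕ) (k i : ℕ) :
    blockWeight w (L ++ [k]) i = blockWeight w L i * -w (i + L.sum) (i + L.sum + k) := by
  induction L generalizing i with
  | nil => simp [blockWeight]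
  | cons a L ih =>
    simp only [List.cons_append, blockWeight, ih, List.sum_cons, mul_assoc, add_assoc]

theorem prod_eq_blockWeight (w : ℕ → ℕ → ℂ) (L : List ℕ) (i : ℕ) :
    ∏ s : Fin L.length, -w (i + (L.take s).sum) (i + (L.take (s + 1)).sum) = blockWeight w L i := by
  induction L generalizing i with
  | nil => simp [blockWeight]
  | cons a L ih =>
    rw [blockWeight, ← ih, List.length_cons, Fin.prod_univ_succ]
    simp [add_assoc]

/-- The signed sum over the compositions of `N` of the products of the weights of the blocks. -/
def compositionSum (w : ℕ → ℕ → ℂ) (N : ℕ) : ℂ := ∑ d : Composition N, blockWeight w d.blocks 0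

theorem compositionSum_zero (w : ℕ → ℕ → ℂ) : compositionSum w 0 = 1 := by
  have : ∀ d : Composition 0, blockWeight w d.blocks 0 = 1 := fun d => by
    have : d.blocks = [] := by
      rw [← List.length_eq_zero_iff]
      exact Nat.le_zero.1 d.length_le
    rw [this]; rfl
  simp [compositionSum, this, composition_card]

/-- A composition of `N` is a composition of some `j < N` followed by a last block of size `N - j`;
the minus sign is the weight convention for that block. -/
theorem compositionSum_eq (w : ℕ → ℕ → ℂ) {N : ℕ} (hN : 0 < N) :
    compositionSum w N = -∑ j ∈ Finset.range N, compositionSum w j * w j N := by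
  have h1 : ∑ j ∈ Finset.range N, compositionSum w j * w j N
      = ∑ x : (j : Fin N) × Composition j, blockWeight w x.2.blocks 0 * w x.1 N := by
    rw [← Fin.sum_univ_eq_sum_range (fun j => compositionSum w j * w j N), Fintype.sum_sigma]
    exact Finset.sum_congr rfl fun j _ => by rw [compositionSum, Finset.sum_mul]
  rw [h1, ← Finset.sum_neg_distrib, compositionSum]
  symm
  let φ : ((j : Fin N) × Composition j) → Composition N := fun x =>
    { blocks := x.2.blocks ++ [N - x.1]
      blocks_pos := by
        intro i hi
        rcases List.mem_append.1 hi with h | h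
        · exact x.2.blocks_pos h
        · have := x.1.2
          rw [List.mem_singleton.1 h]; omega
      blocks_sum := by
        have := x.1.2
        rw [List.sum_append, x.2.blocks_sum, List.sum_singleton]; omega }
  refine Fintype.sum_bijective φ ⟨?_, ?_⟩ _ _ ?_
  · rintro ⟨j, d⟩ ⟨j', d'⟩ h
    have h2 : d.blocks ++ [N - (j : ℕ)] = d'.blocks ++ [N - (j' : ℕ)] :=
      congrArg Composition.blocks h
    have h3 := (List.append_inj' h2 rfl).1
    have h4 : (j : ℕ) = j' := by rw [← d.blocks_sum, ← d'.blocks_sum, h3]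
    obtain rfl : j = j' := Fin.ext h4
    have : d = d' := Composition.ext h3
    rw [this]
  · intro d
    have hne : d.blocks ≠ [] := fun h => by
      have := d.blocks_sum
      rw [h] at this
      simp at this
      omega
    have hsum := d.blocks_sum
    rw [← List.dropLast_append_getLast hne, List.sum_append, List.sum_singleton] at hsum
    have hpos := d.blocks_pos (List.getLast_mem hne)
    refine ⟨⟨⟨d.blocks.dropLast.sum, by omega⟩,
      ⟨d.blocks.dropLast, fun h => d.blocks_pos (List.mem_of_mem_dropLast h), rfl⟩⟩, ?_⟩
    refine Composition.ext ?_
    change d.blocks.dropLast ++ [N - d.blocks.dropLast.sum] = d.blocks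
    conv_rhs => rw [← List.dropLast_append_getLast hne]
    congr 2
    omega
  · rintro ⟨j, d⟩
    change _ = blockWeight w (d.blocks ++ [N - (j : ℕ)]) 0
    have := j.2
    rw [blockWeight_append, d.blocks_sum, zero_add, Nat.add_sub_cancel' j.2.le]
    ring

/-- Blocks of size one have weight zero, so requiring blocks of length at least two loses nothing.
The sign `(-1)^(|d|+1)` is one `-1` for each block and an overall one. -/
theorem sum_composition_filter (w : ℕ → ℕ → ℂ) (hw : ∀ i, w i (i + 1) = 0) (N : ℕ) :
    ∑ d : Composition N with ∀ k ∈ d.blocks, 2 ≤ k,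
      (-1) ^ (d.length + 1) * ∏ s : Fin d.length, w (d.sizeUpTo s) (d.sizeUpTo (s + 1))
      = -compositionSum w N := by
  have key : ∀ d : Composition N, (-1) ^ (d.length + 1) *
      ∏ s : Fin d.length, w (d.sizeUpTo s) (d.sizeUpTo (s + 1)) = -blockWeight w d.blocks 0 := by
    intro d
    rw [← prod_eq_blockWeight, Finset.prod_neg, Finset.card_univ, Fintype.card_fin, pow_succ]
    simp only [zero_add]
    change _ = -((-1) ^ d.length * ∏ s : Fin d.length, w (d.sizeUpTo s) (d.sizeUpTo (s + 1)))
    ring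
  rw [compositionSum, ← Finset.sum_neg_distrib]
  rw [Finset.sum_filter]
  refine Finset.sum_congr rfl fun d _ => ?_
  split_ifs with h
  · exact key d
  · rw [← key]
    symm
    push Not at h
    obtain ⟨k, hk, hk2⟩ := h
    obtain ⟨s, hs⟩ := List.get_of_mem hk
    have h1 : k = 1 := by have := d.blocks_pos hk; omega
    rw [Finset.prod_eq_zero (Finset.mem_univ s), mul_zero]
    have h2 := d.sizeUpTo_succ' s
    have h3 : d.blocksFun s = 1 := by rw [← h1, ← hs]; rfl
    rw [h2, h3]
    exact hw _

end Composition

/-! ## Moments and connected correlations of the reservoir -/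

namespace Model

variable {S R : Type*} [NormedAddCommGroup S] [InnerProductSpace ℂ S]
  [FiniteDimensional ℂ S] [NormedAddCommGroup R] [InnerProductSpace ℂ R] [CompleteSpace R]
  (M : Model S R)

/-- `V(tₖ) ⋯ V(t₁) x` for the list `t₁, …, tₖ`. -/
def evolve (x : R) (l : List ℝ) : R := l.foldl (fun v t => M.Vt t v) x

theorem evolve_append_singleton (x : R) (l : List ℝ) (t : ℝ) :
    M.evolve x (l ++ [t]) = M.Vt t (M.evolve x l) := by
  simp [evolve]

theorem norm_evolve_le (x : R) (l : List ℝ) : ‖M.evolve x l‖ ≤ ‖M.V‖ ^ l.length * ‖x‖ := by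
  induction l generalizing x with
  | nil => simp [evolve]
  | cons t l ih =>
    change ‖M.evolve (M.Vt t x) l‖ ≤ _
    refine (ih _).trans ?_
    rw [List.length_cons, pow_succ, mul_assoc]
    exact mul_le_mul_of_nonneg_left (M.U.norm_heisenberg_apply_le _ _ _) (by positivity)

theorem evolve_add (x : R) (l : List ℝ) (a : ℝ) :
    M.evolve x (l.map (· + a)) = M.U.op (-a) (M.evolve (M.U.op a x) l) := by
  induction l generalizing x with
  | nil => exact (M.U.op_neg_op a x).symm
  | cons t l ih =>
    change M.evolve (M.Vt (t + a) x) (l.map (· + a)) = M.U.op (-a) (M.evolve (M.Vt t _) l)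
    rw [ih, Vt, M.U.heisenberg_add, UnitaryGroup.op_op_neg]

/-- The times `z i`, `j ≤ i < b`, with mark `c`. -/
def side (χ : ℕ → Bool) (z : ℕ → ℝ) (c : Bool) (j b : ℕ) : List ℝ :=
  ((List.range' j (b - j)).filter (χ · = c)).map z

theorem side_succ (χ : ℕ → Bool) (z : ℕ → ℝ) (c : Bool) {j b : ℕ} (h : j ≤ b) :
    side χ z c j (b + 1) = side χ z c j b ++ if χ b = c then [z b] else [] := by
  have h1 : b + 1 - j = (b - j) + 1 := by omega
  rw [side, h1, List.range'_concat, List.filter_append, List.map_append, one_mul,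
    Nat.add_sub_cancel' h]
  congr 1
  by_cases hc : χ b = c <;> simp [hc]

theorem side_self (χ : ℕ → Bool) (z : ℕ → ℝ) (c : Bool) (j : ℕ) : side χ z c j j = [] := by
  simp [side]

theorem side_shift (χ : ℕ → Bool) (z : ℕ → ℝ) (c : Bool) (j b m : ℕ) :
    side (fun i => χ (i + m)) (fun i => z (i + m)) c j b = side χ z c (j + m) (b + m) := by
  simp only [side]
  have h : List.range' (j + m) (b - j) = (List.range' j (b - j)).map (m + ·) := by
    rw [List.map_add_range', add_comm]
  rw [Nat.add_sub_add_right, h, List.filter_map, List.map_map]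
  simp [Function.comp_def, add_comm]

theorem side_congr {χ χ' : ℕ → Bool} {z z' : ℕ → ℝ} (c : Bool) {j b : ℕ}
    (hχ : ∀ i, j ≤ i → i < b → χ i = χ' i) (hz : ∀ i, j ≤ i → i < b → z i = z' i) :
    side χ z c j b = side χ' z' c j b := by
  simp only [side]
  have hm : ∀ i ∈ List.range' j (b - j), j ≤ i ∧ i < b := fun i hi => by
    rw [List.mem_range'_1] at hi; omega
  rw [List.filter_congr (q := fun i => decide (χ' i = c))
    fun i hi => by rw [hχ i (hm i hi).1 (hm i hi).2]]
  refine List.map_congr_left fun i hi => hz i ?_ ?_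
  · exact (hm i (List.mem_of_mem_filter hi)).1
  · exact (hm i (List.mem_of_mem_filter hi)).2

/-- The moment `tr((∏ₖ V(zₖ)) ω)` of the times `z i`, `j ≤ i < b`: first those marked `true`, in
increasing order, then those marked `false`, in decreasing order. -/
def moment (χ : ℕ → Bool) (z : ℕ → ℝ) (j b : ℕ) : ℂ :=
  ⟪M.evolve M.Ω (side χ z true j b), M.evolve M.Ω (side χ z false j b)⟫_ℂ

theorem moment_add (χ : ℕ → Bool) (z : ℕ → ℝ) (a : ℝ) (j b : ℕ) :
    M.moment χ (fun i => z i + a) j b = M.moment χ z j b := by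
  have h : ∀ c, side χ (fun i => z i + a) c j b = (side χ z c j b).map (· + a) := fun c => by
    simp [side, Function.comp_def]
  rw [moment, h, h, evolve_add, evolve_add, op_Ω, UnitaryGroup.inner_op_op]
  rfl

theorem moment_shift (χ : ℕ → Bool) (z : ℕ → ℝ) (j b m : ℕ) :
    M.moment (fun i => χ (i + m)) (fun i => z (i + m)) j b = M.moment χ z (j + m) (b + m) := by
  rw [moment, side_shift, side_shift]; rfl

theorem moment_congr {χ χ' : ℕ → Bool} {z z' : ℕ → ℝ} {j b : ℕ}
    (hχ : ∀ i, j ≤ i → i < b → χ i = χ' i) (hz : ∀ i, j ≤ i → i < b → z i = z' i) :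
    M.moment χ z j b = M.moment χ' z' j b := by
  rw [moment, side_congr true hχ hz, side_congr false hχ hz]; rfl

theorem moment_self (χ : ℕ → Bool) (z : ℕ → ℝ) (j : ℕ) : M.moment χ z j j = 1 := by
  rw [moment, side_self, side_self]; exact M.inner_Ω_Ω

theorem moment_succ_self (χ : ℕ → Bool) (z : ℕ → ℝ) (j : ℕ) : M.moment χ z j (j + 1) = 0 := by
  rw [moment, side_succ _ _ _ le_rfl, side_succ _ _ _ le_rfl, side_self, side_self]
  cases χ j
  · exact M.inner_Vt_Ω _
  · exact (M.inner_Vt _ _ _).trans (M.inner_Vt_Ω _)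

theorem length_side_add (χ : ℕ → Bool) (z : ℕ → ℝ) {j b : ℕ} (h : j ≤ b) :
    (side χ z true j b).length + (side χ z false j b).length = b - j := by
  induction b, h using Nat.le_induction with
  | base => simp [side_self]
  | succ b h ih =>
    rw [side_succ _ _ _ h, side_succ _ _ _ h, List.length_append, List.length_append]
    cases χ b <;> simp <;> omega

theorem norm_moment_le (χ : ℕ → Bool) (z : ℕ → ℝ) {j b : ℕ} (h : j ≤ b) :
    ‖M.moment χ z j b‖ ≤ ‖M.V‖ ^ (b - j) := by
  refine (norm_inner_le_norm _ _).trans ?_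
  have h1 := M.norm_evolve_le M.Ω (side χ z true j b)
  have h2 := M.norm_evolve_le M.Ω (side χ z false j b)
  rw [M.norm_Ω, mul_one] at h1 h2
  calc _ ≤ ‖M.V‖ ^ (side χ z true j b).length * ‖M.V‖ ^ (side χ z false j b).length := by gcongr
    _ = _ := by rw [← pow_add, length_side_add _ _ h]

/-- The connected part of the moment of the times `z i`, `j ≤ i < b`. -/
def conn (χ : ℕ → Bool) (z : ℕ → ℝ) (j : ℕ) (b : ℕ) : ℂ :=
  M.moment χ z j b - ∑ i : Fin b, if j < i then conn χ z j i * M.moment χ z i b else 0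
decreasing_by exact i.2

/-- Solved for the moment, this says that the moment is a sum over the connected block of the
earliest times `j ≤ · < i` times the moment of the rest. Both readings are used: one to recognize
the effect of `Q`, the other to bound moments. -/
theorem conn_eq (χ : ℕ → Bool) (z : ℕ → ℝ) (j b : ℕ) :
    M.conn χ z j b = M.moment χ z j b
      - ∑ i ∈ Finset.Ioo j b, M.conn χ z j i * M.moment χ z i b := by
  rw [conn, Fin.sum_univ_eq_sum_range
    (fun i => if j < i then M.conn χ z j i * M.moment χ z i b else 0) b, ← Finset.sum_filter]
  congr 2
  ext i
  simp only [Finset.mem_filter, Finset.mem_range, Finset.mem_Ioo]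
  tauto

theorem conn_shift (χ : ℕ → Bool) (z : ℕ → ℝ) (j m : ℕ) : ∀ b,
    M.conn (fun i => χ (i + m)) (fun i => z (i + m)) j b = M.conn χ z (j + m) (b + m) := by
  intro b
  induction b using Nat.strong_induction_on with
  | _ b ih =>
    rw [conn_eq, conn_eq, moment_shift, ← Finset.map_add_right_Ioo, Finset.sum_map]
    congr 1
    refine Finset.sum_congr rfl fun i hi => ?_
    rw [ih i (Finset.mem_Ioo.1 hi).2, moment_shift]
    rfl

theorem conn_add (χ : ℕ → Bool) (z : ℕ → ℝ) (a : ℝ) (j : ℕ) : ∀ b,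
    M.conn χ (fun i => z i + a) j b = M.conn χ z j b := by
  intro b
  induction b using Nat.strong_induction_on with
  | _ b ih =>
    rw [conn_eq, conn_eq, moment_add]
    congr 1
    refine Finset.sum_congr rfl fun i hi => ?_
    rw [ih i (Finset.mem_Ioo.1 hi).2, moment_add]

theorem conn_congr {χ χ' : ℕ → Bool} {z z' : ℕ → ℝ} {j : ℕ} : ∀ {b : ℕ},
    (∀ i, j ≤ i → i < b → χ i = χ' i) → (∀ i, j ≤ i → i < b → z i = z' i) →
    M.conn χ z j b = M.conn χ' z' j b := by
  intro b
  induction b using Nat.strong_induction_on with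
  | _ b ih =>
    intro hχ hz
    rw [conn_eq, conn_eq, M.moment_congr hχ hz]
    congr 1
    refine Finset.sum_congr rfl fun i hi => ?_
    rw [Finset.mem_Ioo] at hi
    rw [ih i hi.2 (fun k h1 h2 => hχ k h1 (h2.trans hi.2)) (fun k h1 h2 => hz k h1 (h2.trans hi.2)),
      M.moment_congr (fun k h1 h2 => hχ k (hi.1.le.trans h1) h2)
        (fun k h1 h2 => hz k (hi.1.le.trans h1) h2)]

theorem conn_succ_self (χ : ℕ → Bool) (z : ℕ → ℝ) (j : ℕ) : M.conn χ z j (j + 1) = 0 := by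
  have : Finset.Ioo j (j + 1) = ∅ := by
    ext i; simp
  rw [conn_eq, moment_succ_self, this]
  simp

/-- Both sides satisfy the recursion that splits off the last block. -/
theorem conn_eq_compositionSum (χ : ℕ → Bool) (z : ℕ → ℝ) : ∀ b, 0 < b →
    M.conn χ z 0 b = -compositionSum (M.moment χ z) b := by
  intro b
  induction b using Nat.strong_induction_on with
  | _ b ih =>
    intro hb
    have h1 : Finset.range b = insert 0 (Finset.Ioo 0 b) := by
      ext i
      simp only [Finset.mem_range, Finset.mem_insert, Finset.mem_Ioo]
      omega
    rw [conn_eq, compositionSum_eq _ hb, neg_neg, h1, Finset.sum_insert (by simp),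
      compositionSum_zero, one_mul, sub_eq_add_neg, ← Finset.sum_neg_distrib]
    congr 1
    refine Finset.sum_congr rfl fun i hi => ?_
    rw [Finset.mem_Ioo] at hi
    rw [ih i hi.2 hi.1]
    ring

theorem trace_comp_ω (X : R →L[ℂ] R) : trace (X ∘L M.ω) = ⟪M.Ω, X M.Ω⟫_ℂ := by
  rw [trace, ← (basis R).tsum_inner_mul_inner]
  refine tsum_congr fun k => ?_
  rw [ω, ContinuousLinearMap.comp_apply, InnerProductSpace.rankOne_apply, map_smul,
    inner_smul_right]

theorem φ_eq (t : ℝ) : M.φ t = ⟪M.Vt t M.Ω, M.V M.Ω⟫_ℂ := by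
  rw [φ, ← ContinuousLinearMap.comp_assoc, trace_comp_ω, inner_Vt]
  rfl

theorem inner_prod_map (l : List ℝ) (x y : R) :
    ⟪x, (l.map fun t => M.Vt t).prod y⟫_ℂ = ⟪M.evolve x l, y⟫_ℂ := by
  induction l generalizing x with
  | nil => rfl
  | cons t l ih =>
    change ⟪x, M.Vt t ((l.map fun t => M.Vt t).prod y)⟫_ℂ = ⟪M.evolve (M.Vt t x) l, y⟫_ℂ
    rw [← inner_Vt, ih]

theorem prod_reverse_map (l : List ℝ) (x : R) :
    (l.reverse.map fun t => M.Vt t).prod x = M.evolve x l := by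
  induction l generalizing x with
  | nil => rfl
  | cons t l ih =>
    rw [List.reverse_cons, List.map_append, List.prod_append]
    change (l.reverse.map fun t => M.Vt t).prod (([t].map fun t => M.Vt t).prod x) = _
    rw [ih]
    simp [evolve]

/-- The operators with index in `A` stand on the left in increasing order; moved by self-adjointness
to the bra they act on `Ω` in order of time. The others, in decreasing order, act on the ket in
order of time as well. -/
theorem trace_rearrangedBlock {N : ℕ} (d : Composition N) (s : Fin d.length) (A : Finset (Fin N))
    (z : Fin N → ℝ) {χ : ℕ → Bool} {y : ℕ → ℝ} (hχ : ∀ i : Fin N, χ i = decide (i ∈ A))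
    (hy : ∀ i : Fin N, y i = z i) :
    trace (((rearrangedBlock d s A).map fun k => M.U.heisenberg M.V (z k)).prod ∘L M.ω)
      = M.moment χ y (d.sizeUpTo s) (d.sizeUpTo (s + 1)) := by
  have hr : (List.ofFn (d.embedding s)).map Fin.val
      = List.range' (d.sizeUpTo s) (d.sizeUpTo (s + 1) - d.sizeUpTo s) := by
    rw [d.sizeUpTo_succ' s, Nat.add_sub_cancel_left]
    refine List.ext_getElem (by simp) fun i h1 h2 => ?_
    simp
  have hside : ∀ c : Bool, side χ y c (d.sizeUpTo s) (d.sizeUpTo (s + 1))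
      = ((List.ofFn (d.embedding s)).filter (fun k => decide (k ∈ A) = c)).map z := by
    intro c
    rw [side, ← hr, List.filter_map, List.map_map]
    simp only [Function.comp_def, hχ, hy]
  have ht : (List.ofFn (d.embedding s)).filter (fun k => decide (k ∈ A) = true)
      = (List.ofFn (d.embedding s)).filter (fun k => k ∈ A) :=
    List.filter_congr fun k _ => by simp
  have hf : (List.ofFn (d.embedding s)).filter (fun k => decide (k ∈ A) = false)
      = (List.ofFn (d.embedding s)).filter (fun k => k ∉ A) :=
    List.filter_congr fun k _ => by simp
  have hm : ∀ l : List (Fin N), l.map (fun k => M.U.heisenberg M.V (z k))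
      = (l.map z).map fun t => M.Vt t := fun l => by rw [List.map_map]; rfl
  rw [trace_comp_ω, rearrangedBlock, moment, hside, hside, ht, hf, List.map_append,
    List.prod_append, hm, hm, List.map_reverse]
  change ⟪M.Ω, (List.map (fun t => M.Vt t) _).prod ((List.map (fun t => M.Vt t) _).prod M.Ω)⟫_ℂ = _
  rw [inner_prod_map, prod_reverse_map]

theorem connectedCorrelation_eq_conn (n : ℕ) (A : Finset (Fin (n + 2))) (z : Fin (n + 2) → ℝ)
    {χ : ℕ → Bool} {y : ℕ → ℝ} (hχ : ∀ i : Fin (n + 2), χ i = decide (i ∈ A))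
    (hy : ∀ i : Fin (n + 2), y i = z i) :
    connectedCorrelation M.U M.V M.ω n A z = M.conn χ y 0 (n + 2) := by
  rw [conn_eq_compositionSum _ _ _ _ (by omega),
    ← sum_composition_filter _ (M.moment_succ_self χ y), connectedCorrelation]
  refine Finset.sum_congr rfl fun d _ => ?_
  congr 1
  exact Finset.prod_congr rfl fun s _ => M.trace_rearrangedBlock d s A z hχ hy

end Model

end VanHove

end

noncomputable section

namespace VanHove

namespace Model

variable {S R : Type*} [NormedAddCommGroup S] [InnerProductSpace ℂ S]
  [FiniteDimensional ℂ S] [NormedAddCommGroup R] [InnerProductSpace ℂ R] [CompleteSpace R]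
  (M : Model S R)

/-! ## Expansion of the projected products of Liouvillians -/

/-- `W(tₖ) ⋯ W(t₁) a` for the list `t₁, …, tₖ`. -/
def evolveS (a : S) (l : List ℝ) : S := l.foldl (fun v t => M.Wt t v) a

theorem norm_evolveS_le (a : S) (l : List ℝ) : ‖M.evolveS a l‖ ≤ ‖M.W‖ ^ l.length * ‖a‖ := by
  induction l generalizing a with
  | nil => simp [evolveS]
  | cons t l ih =>
    change ‖M.evolveS (M.Wt t a) l‖ ≤ _
    refine (ih _).trans ?_
    rw [List.length_cons, pow_succ, mul_assoc]
    exact mul_le_mul_of_nonneg_left (M.norm_Wt_apply_le _ _) (by positivity)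

theorem evolveS_append_singleton (a : S) (l : List ℝ) (t : ℝ) :
    M.evolveS a (l ++ [t]) = M.Wt t (M.evolveS a l) := by
  simp [evolveS]

/-- `Q 𝓛(z_{N-1}) Q ⋯ Q 𝓛(z₀) ρ`. -/
def iterQ (z : ℕ → ℝ) (ρ : TraceClass (S ⊗[ℂ] R)) : ℕ → TraceClass (S ⊗[ℂ] R)
  | 0 => ρ
  | N + 1 => M.Q (M.liouI (z N) (iterQ z ρ N))

/-- The marks given by a finite set. -/
def marks (A : Finset ℕ) (i : ℕ) : Bool := decide (i ∈ A)

/-- The coefficient of the terms of `iterQ` whose last projection `P` precedes the time `z j`. -/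
def coeff (A : Finset ℕ) (z : ℕ → ℝ) (j : ℕ) : ℂ :=
  if j = 0 then 1 else -M.conn (marks A) z 0 j

/-- The terms of `iterQ`. -/
def term (a b : S) (A : Finset ℕ) (z : ℕ → ℝ) (j N : ℕ) : TraceClass (S ⊗[ℂ] R) :=
  ketBra (M.evolveS a (side (marks A) z false 0 N) ⊗ₜ M.evolve M.Ω (side (marks A) z false j N))
    (M.evolveS b (side (marks A) z true 0 N) ⊗ₜ M.evolve M.Ω (side (marks A) z true j N))

theorem conn_eq_sum_coeff (A : Finset ℕ) (z : ℕ → ℝ) (N : ℕ) :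
    M.conn (marks A) z 0 (N + 1)
      = ∑ j ∈ Finset.range (N + 1), M.coeff A z j * M.moment (marks A) z j (N + 1) := by
  have h1 : Finset.range (N + 1) = insert 0 (Finset.Ioo 0 (N + 1)) := by
    ext i
    simp only [Finset.mem_range, Finset.mem_insert, Finset.mem_Ioo]
    omega
  rw [conn_eq, h1, Finset.sum_insert (by simp), coeff, if_pos rfl, one_mul, sub_eq_add_neg,
    ← Finset.sum_neg_distrib]
  congr 1
  refine Finset.sum_congr rfl fun i hi => ?_
  rw [Finset.mem_Ioo] at hi
  rw [coeff, if_neg (by omega), neg_mul]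

/-- Projecting resets both reservoir vectors to `Ω` and leaves as a factor the moment of the times
since the previous reset. -/
theorem P_term (a b : S) (A : Finset ℕ) (z : ℕ → ℝ) (j N : ℕ) :
    M.P (M.term a b A z j N) = M.moment (marks A) z j N • M.term a b A z N N := by
  rw [term, P_tmul, term, side_self, side_self]
  rfl

theorem marks_insert_of_lt {A : Finset ℕ} {N i : ℕ} (h : i < N) :
    marks (insert N A) i = marks A i := by
  simp [marks, h.ne]

theorem coeff_insert (A : Finset ℕ) (z : ℕ → ℝ) {j N : ℕ} (h : j ≤ N) :
    M.coeff (insert N A) z j = M.coeff A z j := by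
  rw [coeff, coeff, M.conn_congr (χ := marks (insert N A)) (χ' := marks A) (z := z) (z' := z)
    (fun i _ hi => marks_insert_of_lt (hi.trans_le h)) (fun _ _ _ => rfl)]

theorem liouI_term (a b : S) {A : Finset ℕ} (z : ℕ → ℝ) {j N : ℕ} (h : j ≤ N) (hA : N ∉ A) :
    M.liouI (z N) (M.term a b A z j N)
      = M.term a b A z j (N + 1) - M.term a b (insert N A) z j (N + 1) := by
  have h1 : marks A N = false := by simp [marks, hA]
  have h2 : marks (insert N A) N = true := by simp [marks]
  have h3 : ∀ c j, side (marks (insert N A)) z c j N = side (marks A) z c j N := fun c j =>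
    side_congr c (fun i _ hi => marks_insert_of_lt hi) (fun _ _ _ => rfl)
  rw [term, liouI_tmul, term, term]
  simp only [side_succ _ _ _ h, side_succ _ _ _ (Nat.zero_le N), h1, h2, h3, if_true,
    evolve_append_singleton, evolveS_append_singleton, List.append_nil, Bool.false_eq_true,
    if_false, Bool.true_eq_false]

theorem liouI_sum_term (a b : S) (z : ℕ → ℝ) (N : ℕ) :
    M.liouI (z N) (∑ A ∈ (Finset.range N).powerset, (-1 : ℂ) ^ A.card •
        ∑ j ∈ Finset.range (N + 1), M.coeff A z j • M.term a b A z j N)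
      = ∑ A ∈ (Finset.range (N + 1)).powerset, (-1 : ℂ) ^ A.card •
        ∑ j ∈ Finset.range (N + 1), M.coeff A z j • M.term a b A z j (N + 1) := by
  rw [Finset.range_add_one, Finset.sum_powerset_insert Finset.notMem_range_self, map_sum,
    ← Finset.sum_add_distrib, ← Finset.range_add_one]
  refine Finset.sum_congr rfl fun A hA => ?_
  have hN : N ∉ A := fun h => Finset.notMem_range_self (Finset.mem_powerset.1 hA h)
  rw [Finset.card_insert_of_notMem hN, map_smul, map_sum, pow_succ, mul_neg_one, neg_smul,
    ← sub_eq_add_neg, ← smul_sub, ← Finset.sum_sub_distrib]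
  congr 1
  refine Finset.sum_congr rfl fun j hj => ?_
  have hj' : j ≤ N := Nat.lt_succ_iff.1 (Finset.mem_range.1 hj)
  rw [map_smul, M.liouI_term a b z hj' hN, coeff_insert _ _ _ hj', smul_sub]

theorem P_sum_term (a b : S) (z : ℕ → ℝ) (N : ℕ) :
    M.P (∑ A ∈ (Finset.range (N + 1)).powerset, (-1 : ℂ) ^ A.card •
        ∑ j ∈ Finset.range (N + 1), M.coeff A z j • M.term a b A z j (N + 1))
      = ∑ A ∈ (Finset.range (N + 1)).powerset, (-1 : ℂ) ^ A.card •
        M.conn (marks A) z 0 (N + 1) • M.term a b A z (N + 1) (N + 1) := by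
  rw [map_sum]
  refine Finset.sum_congr rfl fun A _ => ?_
  rw [map_smul, map_sum, conn_eq_sum_coeff, Finset.sum_smul]
  congr 1
  refine Finset.sum_congr rfl fun j _ => ?_
  rw [map_smul, P_term, smul_smul]

/-- The set `A` records the times at which the commutator acts from the right, each with a sign, and
`j` the last time at which the reservoir was reset by a projection. In `Q = 1 - P` the identity
keeps all terms with `j ≤ N`, while `P` sums them, by the recursion for connected correlations, into
a single term with `j = N + 1` and coefficient `-conn`. -/
theorem iterQ_eq (a b : S) (z : ℕ → ℝ) (N : ℕ) :
    M.iterQ z (ketBra (a ⊗ₜ M.Ω) (b ⊗ₜ M.Ω)) N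
      = ∑ A ∈ (Finset.range N).powerset, (-1 : ℂ) ^ A.card •
        ∑ j ∈ Finset.range (N + 1), M.coeff A z j • M.term a b A z j N := by
  induction N with
  | zero => simp [iterQ, coeff, term, side_self, evolve, evolveS]
  | succ N ih =>
    rw [iterQ, ih, liouI_sum_term, Q_apply, P_sum_term, ← Finset.sum_sub_distrib]
    refine Finset.sum_congr rfl fun A _ => ?_
    rw [← smul_sub, Finset.sum_range_succ _ (N + 1), coeff, if_neg (Nat.succ_ne_zero N), neg_smul,
      ← sub_eq_add_neg]

theorem P_liouI_iterQ (a b : S) (z : ℕ → ℝ) (N : ℕ) :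
    M.P (M.liouI (z N) (M.iterQ z (ketBra (a ⊗ₜ M.Ω) (b ⊗ₜ M.Ω)) N))
      = ∑ A ∈ (Finset.range (N + 1)).powerset, (-1 : ℂ) ^ A.card •
        M.conn (marks A) z 0 (N + 1) • M.term a b A z (N + 1) (N + 1) := by
  rw [iterQ_eq, liouI_sum_term, P_sum_term]

/-- After the last projection the reservoir vectors are the unit vector `Ω`, so all dependence on
the reservoir is in the connected correlations. -/
theorem norm_P_liouI_iterQ_le (a b : S) (z : ℕ → ℝ) (N : ℕ) :
    ‖M.P (M.liouI (z N) (M.iterQ z (ketBra (a ⊗ₜ M.Ω) (b ⊗ₜ M.Ω)) N))‖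
      ≤ ‖M.W‖ ^ (N + 1) * (‖a‖ * ‖b‖) *
        ∑ A ∈ (Finset.range (N + 1)).powerset, ‖M.conn (marks A) z 0 (N + 1)‖ := by
  rw [P_liouI_iterQ, Finset.mul_sum]
  refine (norm_sum_le _ _).trans (Finset.sum_le_sum fun A _ => ?_)
  rw [norm_smul, norm_smul, norm_pow, norm_neg, norm_one, one_pow, one_mul, mul_comm]
  refine mul_le_mul_of_nonneg_right ?_ (norm_nonneg _)
  refine (norm_ketBra_le _ _).trans ?_
  rw [TensorProduct.norm_tmul, TensorProduct.norm_tmul, side_self, side_self]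
  change _ * ‖M.Ω‖ * (_ * ‖M.Ω‖) ≤ _
  have hl := length_side_add (marks A) z (Nat.zero_le (N + 1))
  rw [Nat.sub_zero] at hl
  rw [M.norm_Ω, mul_one, mul_one]
  calc _ ≤ (‖M.W‖ ^ (side (marks A) z false 0 (N + 1)).length * ‖a‖)
        * (‖M.W‖ ^ (side (marks A) z true 0 (N + 1)).length * ‖b‖) := by
        gcongr <;> exact M.norm_evolveS_le _ _
    _ = ‖M.W‖ ^ ((side (marks A) z true 0 (N + 1)).length
          + (side (marks A) z false 0 (N + 1)).length) * (‖a‖ * ‖b‖) := by rw [pow_add]; ring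
    _ = _ := by rw [hl]

end Model

end VanHove

end

noncomputable section

namespace VanHove

/-! ## Integrals of chains of functions of differences -/

section Chains

open scoped ENNReal

/-- The extension by zero of a finite sequence. -/
def ext {N : ℕ} (z : Fin N → ℝ) (i : ℕ) : ℝ := if h : i < N then z ⟨i, h⟩ else 0

theorem ext_apply {N : ℕ} (z : Fin N → ℝ) {i : ℕ} (h : i < N) : ext z i = z ⟨i, h⟩ := dif_pos h

theorem ext_val {N : ℕ} (z : Fin N → ℝ) (i : Fin N) : ext z i = z i := ext_apply z i.2

theorem ext_cons_zero {N : ℕ} (x : ℝ) (z : Fin N → ℝ) :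
    ext (Fin.cons x z : Fin (N + 1) → ℝ) 0 = x := by
  simp [ext]

theorem ext_cons_succ {N : ℕ} (x : ℝ) (z : Fin N → ℝ) (i : ℕ) :
    ext (Fin.cons x z : Fin (N + 1) → ℝ) (i + 1) = ext z i := by
  by_cases h : i < N
  · rw [ext_apply _ (Nat.succ_lt_succ h), ext_apply _ h]
    exact Fin.cons_succ (α := fun _ => ℝ) x z ⟨i, h⟩
  · rw [ext, ext, dif_neg h, dif_neg (by omega)]

theorem ext_snoc_of_lt {N : ℕ} (z : Fin N → ℝ) (x : ℝ) {i : ℕ} (h : i < N) :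
    ext (Fin.snoc z x : Fin (N + 1) → ℝ) i = ext z i := by
  rw [ext_apply _ (h.trans (Nat.lt_succ_self N)), ext_apply _ h]
  exact Fin.snoc_castSucc (α := fun _ => ℝ) x z ⟨i, h⟩

theorem ext_snoc_last {N : ℕ} (z : Fin N → ℝ) (x : ℝ) :
    ext (Fin.snoc z x : Fin (N + 1) → ℝ) N = x := by
  rw [ext_apply _ (Nat.lt_succ_self N)]
  exact Fin.snoc_last (α := fun _ => ℝ) x z

@[fun_prop]
theorem continuous_ext {N : ℕ} (i : ℕ) : Continuous fun z : Fin N → ℝ => ext z i := by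
  unfold ext
  split_ifs with h
  · exact continuous_apply _
  · exact continuous_const

@[fun_prop]
theorem measurable_ext {N : ℕ} (i : ℕ) : Measurable fun z : Fin N → ℝ => ext z i :=
  (continuous_ext i).measurable

theorem lintegral_pi_succ {N : ℕ} (μ : Fin (N + 1) → Measure ℝ) [∀ i, SigmaFinite (μ i)]
    {f : (Fin (N + 1) → ℝ) → ℝ≥0∞} (hf : Measurable f) :
    ∫⁻ z, f z ∂Measure.pi μ
      = ∫⁻ z', ∫⁻ x, f (Fin.cons x z') ∂μ 0 ∂Measure.pi (fun i => μ (Fin.succ i)) := by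
  have h := (measurePreserving_piFinSuccAbove μ 0).symm
  rw [← h.lintegral_comp hf]
  have hm : Measurable fun p : ℝ × (Fin N → ℝ) =>
      f ((MeasurableEquiv.piFinSuccAbove (fun _ => ℝ) 0).symm p) :=
    hf.comp (MeasurableEquiv.measurable _)
  refine (lintegral_prod_symm' _ hm).trans ?_
  refine lintegral_congr fun z' => lintegral_congr fun x => ?_
  congr 1
  exact Fin.insertNth_zero' x z'

/-- The chain `F₀(z₀ - z₁) ⋯ F_{c-1}(z_{c-1} - z_c)`. -/
def chain (F : ℕ → ℝ → ℝ≥0∞) (c : ℕ) {N : ℕ} (z : Fin N → ℝ) : ℝ≥0∞ :=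
  ∏ l ∈ Finset.range c, F l (ext z l - ext z (l + 1))

variable {F : ℕ → ℝ → ℝ≥0∞}

theorem measurable_chain (hF : ∀ l, Measurable (F l)) (c N : ℕ) :
    Measurable fun z : Fin N → ℝ => chain F c z :=
  Finset.measurable_prod _ fun l _ => (hF l).comp (by fun_prop)

/-- Integration of a chain, from `z₀` on. -/
theorem lintegral_chain_le (hF : ∀ l, Measurable (F l)) {N c : ℕ} (hc : c < N)
    (μ : Fin N → Measure ℝ) [∀ i, SigmaFinite (μ i)] (hμ : ∀ i, μ i ≤ volume) :
    ∫⁻ z, chain F c z ∂Measure.pi μ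
      ≤ (∏ l ∈ Finset.range c, ∫⁻ x, F l x) * ∏ i ∈ Finset.univ.filter (fun i : Fin N => c ≤ (i : ℕ)), μ i univ := by
  induction c generalizing F N with
  | zero => simp [chain, Measure.pi_univ]
  | succ c ih =>
    obtain ⟨N, rfl⟩ : ∃ n, N = n + 1 := ⟨N - 1, by omega⟩
    rw [lintegral_pi_succ _ (measurable_chain hF _ _)]
    have h1 : ∀ z' : Fin N → ℝ,
        ∫⁻ x, chain F (c + 1) (Fin.cons x z' : Fin (N + 1) → ℝ) ∂μ 0
          ≤ chain (fun l => F (l + 1)) c z' * ∫⁻ x, F 0 x := by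
      intro z'
      simp_rw [chain, Finset.prod_range_succ', ext_cons_succ, ext_cons_zero]
      rw [lintegral_const_mul _ (show Measurable fun x => F 0 (x - ext z' 0) from
        (hF 0).comp (measurable_id.sub_const _))]
      refine mul_le_mul_right ?_ _
      -- The end point `z₀` occurs in one link only; enlarging its measure to Lebesgue measure makes
      -- that link translation invariant.
      refine (lintegral_mono' (hμ 0) le_rfl).trans (le_of_eq ?_)
      exact lintegral_sub_right_eq_self (F 0) _
    refine (lintegral_mono h1).trans ?_
    rw [lintegral_mul_const _ (measurable_chain (fun l => hF (l + 1)) _ _),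
      Finset.prod_range_succ', mul_right_comm]
    gcongr
    refine (ih (fun l => hF (l + 1)) (by omega) (fun i => μ i.succ) fun i => hμ _).trans ?_
    gcongr
    refine le_of_eq ?_
    rw [Finset.prod_filter, Finset.prod_filter, Fin.prod_univ_succ]
    simp

theorem lintegral_chain_le_of_equiv (hF : ∀ l, Measurable (F l)) {N c : ℕ} (hc : c < N)
    {ι : Type*} [Fintype ι] (e : Fin N ≃ ι)
    (μ : ι → Measure ℝ) [∀ i, SigmaFinite (μ i)] (hμ : ∀ i, μ i ≤ volume) :
    ∫⁻ z, chain F c (z ∘ e) ∂Measure.pi μ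
      ≤ (∏ l ∈ Finset.range c, ∫⁻ x, F l x) * ∏ i ∈ Finset.univ.filter (fun i : Fin N => c ≤ (i : ℕ)), μ (e i) univ := by
  have h := measurePreserving_piCongrLeft μ e
  have hm : Measurable fun z : ι → ℝ => chain F c (z ∘ e) :=
    (measurable_chain hF c N).comp (measurable_pi_lambda _ fun i => measurable_pi_apply _)
  rw [← h.lintegral_comp hm]
  refine le_trans (le_of_eq (lintegral_congr fun z => ?_))
    (lintegral_chain_le hF hc (fun i => μ (e i)) fun i => hμ _)
  have : (MeasurableEquiv.piCongrLeft (fun _ => ℝ) e) z ∘ e = z := by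
    ext i
    exact Equiv.piCongrLeft_apply_apply (fun _ => ℝ) e z i
  rw [this]

/-- An injection of an initial segment extends to an enumeration. -/
theorem exists_equiv_of_injOn {ι : Type*} [Fintype ι] {N : ℕ} (hN : Fintype.card ι = N) {c : ℕ}
    {q : ℕ → ι} (hq : InjOn q (Iio c)) : ∃ e : Fin N ≃ ι, ∀ i : Fin N, i < c →
      e i = q i := by
  classical
  obtain ⟨g, hg⟩ := Finset.exists_equiv_extend_of_card_eq (α := Fin N) (β := ι)
    (t := Finset.univ) (by simp [hN]) (s := Finset.univ.filter fun i : Fin N => (i : ℕ) < c)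
    (f := fun i => q i) (Finset.subset_univ _) (fun i hi j hj h => by
      simp only [Finset.coe_filter, Finset.mem_univ, true_and, mem_ofPred_eq] at hi hj
      exact Fin.ext (hq hi hj h))
  refine ⟨g.trans ((Equiv.subtypeUnivEquiv fun _ => Finset.mem_univ _)), fun i hi => ?_⟩
  exact hg i (by simpa using hi)

/-- Symmetrization: the integrals over the ordered region of all the rearrangements of a function
add up to at most its integral. -/
theorem sum_perm_lintegral_le {N : ℕ} (μ : Measure ℝ) [SigmaFinite μ]
    {g : (Fin N → ℝ) → ℝ≥0∞} (hg : Measurable g) :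
    ∑ p : Equiv.Perm (Fin N), ∫⁻ z in {z | StrictMono z}, g (z ∘ p) ∂Measure.pi (fun _ => μ)
      ≤ ∫⁻ z, g z ∂Measure.pi (fun _ => μ) := by
  have hms : MeasurableSet {z : Fin N → ℝ | StrictMono z} := by
    have : {z : Fin N → ℝ | StrictMono z} = ⋂ i, ⋂ j, ⋂ (_ : i < j), {z | z i < z j} := by
      ext z; simp [StrictMono]
    rw [this]
    exact MeasurableSet.iInter fun i => MeasurableSet.iInter fun j => MeasurableSet.iInter fun _ =>
      measurableSet_lt (measurable_pi_apply _) (measurable_pi_apply _)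
  have hcomp : ∀ p : Equiv.Perm (Fin N), Measurable fun z : Fin N → ℝ => z ∘ p := fun p =>
    measurable_pi_lambda _ fun i => measurable_pi_apply _
  have h1 : ∀ p : Equiv.Perm (Fin N),
      ∫⁻ z in {z | StrictMono z}, g (z ∘ p) ∂Measure.pi (fun _ => μ)
        = ∫⁻ y, indicator {y | StrictMono (y ∘ (p.symm : Fin N → Fin N))} g y
          ∂Measure.pi (fun _ => μ) := by
    intro p
    rw [← lintegral_indicator hms]
    have h := measurePreserving_piCongrLeft (fun _ : Fin N => μ) p
    have hm : Measurable (indicator {z : Fin N → ℝ | StrictMono z} fun z => g (z ∘ p)) :=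
      (hg.comp (hcomp p)).indicator hms
    rw [← h.lintegral_comp hm]
    refine lintegral_congr fun y => ?_
    have e1 : (MeasurableEquiv.piCongrLeft (fun _ => ℝ) p) y ∘ p = y := by
      ext i
      exact Equiv.piCongrLeft_apply_apply (fun _ => ℝ) p y i
    have e2 : (MeasurableEquiv.piCongrLeft (fun _ => ℝ) p) y = y ∘ p.symm := by
      conv_rhs => rw [← e1]
      ext i; simp
    by_cases hy : StrictMono (y ∘ p.symm)
    · rw [indicator_of_mem (by rw [mem_ofPred_eq, e2]; exact hy), e1, indicator_of_mem hy]
    · rw [indicator_of_notMem (by rw [mem_ofPred_eq, e2]; exact hy), indicator_of_notMem hy]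
  simp_rw [h1]
  have hm2 : ∀ p : Equiv.Perm (Fin N), Measurable
      (indicator {y : Fin N → ℝ | StrictMono (y ∘ (p.symm : Fin N → Fin N))} g) := fun p =>
    hg.indicator (hcomp p.symm hms)
  rw [← lintegral_finsetSum _ fun p _ => hm2 p]
  refine lintegral_mono fun y => ?_
  -- At most one permutation sorts `y`, so the transformed regions are disjoint. This is why the
  -- number of permutations does not enter the bound.
  by_cases h : ∃ p : Equiv.Perm (Fin N), StrictMono (y ∘ (p.symm : Fin N → Fin N))
  · obtain ⟨p, hp⟩ := h
    rw [Finset.sum_eq_single p]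
    · exact indicator_le_self _ _ _
    · intro p' _ hne
      refine indicator_of_notMem (fun hp' => hne ?_) _
      have hp' : StrictMono (y ∘ (p'.symm : Fin N → Fin N)) := hp'
      have hyi : Function.Injective y := by
        have := hp.injective
        rwa [Function.Injective.of_comp_iff' _ p.symm.bijective] at this
      have hr : range (y ∘ (p.symm : Fin N → Fin N)) = range (y ∘ (p'.symm : Fin N → Fin N)) := by
        rw [range_comp, range_comp, p.symm.surjective.range_eq, p'.symm.surjective.range_eq]
      have := (hp.range_inj hp').1 hr
      have h2 : p.symm = p'.symm := Equiv.ext fun i => hyi (congrFun this i)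
      exact (Equiv.symm_bijective.injective h2).symm
    · simp
  · push Not at h
    rw [Finset.sum_eq_zero fun p _ => indicator_of_notMem (h p) _]
    exact zero_le

/-- The integral of a translation invariant function over the hyperplane `z₀ = 0`. -/
theorem lintegral_cons_zero_mul {N : ℕ} {h : (Fin (N + 1) → ℝ) → ℝ≥0∞} (hm : Measurable h)
    (hinv : ∀ z a, h (fun i => z i + a) = h z) {I : Set ℝ} (hI : MeasurableSet I) :
    (∫⁻ z : Fin N → ℝ, h (Fin.cons 0 z)) * volume I = ∫⁻ z in {z | z 0 ∈ I}, h z := by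
  have hms : MeasurableSet {z : Fin (N + 1) → ℝ | z 0 ∈ I} := measurable_pi_apply 0 hI
  have hcons : Measurable fun p : ℝ × (Fin N → ℝ) => (Fin.cons p.1 p.2 : Fin (N + 1) → ℝ) := by
    refine measurable_pi_lambda _ fun i => ?_
    refine Fin.cases ?_ (fun i => ?_) i
    · exact measurable_fst
    · exact (measurable_pi_apply i).comp measurable_snd
  have hm2 : Measurable fun p : ℝ × (Fin N → ℝ) => h (Fin.cons p.1 p.2) := hm.comp hcons
  rw [← lintegral_indicator hms]
  have hpi := lintegral_pi_succ (fun _ => volume) (hm.indicator hms)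
  simp only [← volume_pi] at hpi
  rw [hpi]
  have h1 : ∀ x : ℝ, ∫⁻ z : Fin N → ℝ, h (Fin.cons x z) = ∫⁻ z : Fin N → ℝ, h (Fin.cons 0 z) := by
    intro x
    rw [← lintegral_add_right_eq_self (fun z : Fin N → ℝ => h (Fin.cons x z)) (fun _ => x)]
    refine lintegral_congr fun z => ?_
    rw [← hinv (Fin.cons 0 z) x]
    congr 1
    ext i
    refine Fin.cases ?_ (fun i => ?_) i <;> simp
  have h2 : ∀ (z' : Fin N → ℝ) (x : ℝ),
      indicator {z : Fin (N + 1) → ℝ | z 0 ∈ I} h (Fin.cons x z')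
        = indicator I (fun _ => h (Fin.cons x z')) x := by
    intro z' x
    by_cases hx : x ∈ I
    · rw [indicator_of_mem (by simpa using hx), indicator_of_mem hx]
    · rw [indicator_of_notMem (by simpa using hx), indicator_of_notMem hx]
  simp_rw [h2]
  rw [lintegral_lintegral_swap]
  · have h3 : ∀ x : ℝ, ∫⁻ z' : Fin N → ℝ, indicator I (fun _ => h (Fin.cons x z')) x
        = indicator I (fun _ => ∫⁻ z : Fin N → ℝ, h (Fin.cons 0 z)) x := by
      intro x
      by_cases hx : x ∈ I
      · simp_rw [indicator_of_mem hx]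
        exact h1 x
      · simp_rw [indicator_of_notMem hx]
        simp
    have h4 := lintegral_congr (μ := volume) h3
    rw [h4, lintegral_indicator hI, setLIntegral_const]
  · have : Measurable fun p : (Fin N → ℝ) × ℝ =>
        indicator {p : (Fin N → ℝ) × ℝ | p.2 ∈ I} (fun p => h (Fin.cons p.2 p.1)) p :=
      (hm2.comp measurable_swap).indicator (measurable_snd hI)
    exact this.aemeasurable

end Chains

/-! ## A Cauchy–Schwarz inequality -/

section CauchySchwarz

open scoped ENNReal

variable {H : Type*} [NormedAddCommGroup H] [InnerProductSpace ℂ H] [CompleteSpace H]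

/-- With phases `s` such that `s ⟪ξ, η⟫ = |⟪ξ, η⟫|`, the integral on the left is `⟪ξ, v⟫` for `v = ∫
s η`, and expanding `‖v‖²` gives the double integral of correlations. Decay of correlations between
the vectors thus becomes decay of averages in weak form. -/
theorem lintegral_enorm_inner_sq_le {Y : Type*} [MeasurableSpace Y] {μ : Measure Y} {η : Y → H}
    (hη : Integrable η μ) (ξ : H) :
    (∫⁻ y, ‖⟪ξ, η y⟫_ℂ‖ₑ ∂μ) ^ 2 ≤ ‖ξ‖ₑ ^ 2 * ∫⁻ y, ∫⁻ y', ‖⟪η y, η y'⟫_ℂ‖ₑ ∂μ ∂μ := by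
  set a : Y → ℂ := fun y => ⟪ξ, η y⟫_ℂ with ha
  have hai : Integrable a μ := hη.const_inner ξ
  set s : Y → ℂ := fun y => (starRingEnd ℂ) (a y) / ‖a y‖ with hs
  have hsm : AEStronglyMeasurable s μ := by
    have h1 := hai.aestronglyMeasurable
    have h2 : AEMeasurable s μ :=
      (Complex.continuous_conj.measurable.comp_aemeasurable h1.aemeasurable).div
        (Complex.measurable_ofReal.comp_aemeasurable h1.norm.aemeasurable)
    exact h2.aestronglyMeasurable
  have hs1 : ∀ y, ‖s y‖ ≤ 1 := fun y => by
    simp only [hs, norm_div, RCLike.norm_conj, Complex.norm_real, norm_norm]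
    exact div_self_le_one _
  have hsa : ∀ y, s y * a y = ‖a y‖ := fun y => by
    simp only [hs]
    rw [div_mul_eq_mul_div, ← Complex.normSq_eq_conj_mul_self, Complex.normSq_eq_norm_sq]
    push_cast
    rcases eq_or_ne (‖a y‖ : ℂ) 0 with h | h
    · simp [h]
    · field_simp
  have hsη : Integrable (fun y => s y • η y) μ :=
    hη.bdd_smul 1 hsm (Eventually.of_forall hs1)
  set v := ∫ y, s y • η y ∂μ with hv
  have hinner : ∀ w : H, ‖⟪w, v⟫_ℂ‖ₑ ≤ ∫⁻ y, ‖⟪w, η y⟫_ℂ‖ₑ ∂μ := by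
    intro w
    rw [hv, ← integral_inner hsη]
    refine (enorm_integral_le_lintegral_enorm _).trans (lintegral_mono fun y => ?_)
    rw [inner_smul_right, enorm_mul]
    refine mul_le_of_le_one_left zero_le ?_
    rw [← ofReal_norm, ← ENNReal.ofReal_one]
    exact ENNReal.ofReal_le_ofReal (hs1 y)
  have h1 : ∫⁻ y, ‖a y‖ₑ ∂μ = ‖⟪ξ, v⟫_ℂ‖ₑ := by
    rw [hv, ← integral_inner hsη]
    have : ∀ y, ⟪ξ, s y • η y⟫_ℂ = ((‖a y‖ : ℝ) : ℂ) := fun y => by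
      rw [inner_smul_right, ← hsa]
    simp_rw [this]
    rw [integral_complex_ofReal, ← ofReal_integral_norm_eq_lintegral_enorm hai,
      ← ofReal_norm, Complex.norm_real,
      Real.norm_of_nonneg (integral_nonneg fun _ => norm_nonneg _)]
  have h2 : ‖v‖ₑ ^ 2 ≤ ∫⁻ y, ∫⁻ y', ‖⟪η y, η y'⟫_ℂ‖ₑ ∂μ ∂μ := by
    calc ‖v‖ₑ ^ 2 = ‖⟪v, v⟫_ℂ‖ₑ := by
          rw [inner_self_eq_norm_sq_to_K, enorm_pow]
          congr 1
          rw [← ofReal_norm, ← ofReal_norm]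
          simp
      _ ≤ ∫⁻ y, ‖⟪v, η y⟫_ℂ‖ₑ ∂μ := hinner v
      _ ≤ _ := lintegral_mono fun y => by
          rw [← inner_conj_symm, RCLike.enorm_conj]
          exact hinner (η y)
  calc (∫⁻ y, ‖a y‖ₑ ∂μ) ^ 2 = ‖⟪ξ, v⟫_ℂ‖ₑ ^ 2 := by rw [h1]
    _ ≤ (‖ξ‖ₑ * ‖v‖ₑ) ^ 2 := by
        gcongr
        rw [← ofReal_norm, ← ofReal_norm, ← ofReal_norm,
          ← ENNReal.ofReal_mul (norm_nonneg _)]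
        exact ENNReal.ofReal_le_ofReal (norm_inner_le_norm _ _)
    _ ≤ _ := by rw [mul_pow]; gcongr

end CauchySchwarz

end VanHove

end

noncomputable section

namespace VanHove

namespace Model

open scoped ENNReal

variable {S R : Type*} [NormedAddCommGroup S] [InnerProductSpace ℂ S]
  [FiniteDimensional ℂ S] [NormedAddCommGroup R] [InnerProductSpace ℂ R] [CompleteSpace R]
  (M : Model S R)

/-! ## Continuity and boundedness of the correlation functions -/

section Continuity

variable {X : Type*} [TopologicalSpace X] {w : X → ℕ → ℝ}

theorem continuous_evolve_side (hw : ∀ i, Continuous fun x => w x i) (χ : ℕ → Bool) (c : Bool)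
    (x₀ : R) {j b : ℕ} (h : j ≤ b) : Continuous fun x => M.evolve x₀ (side χ (w x) c j b) := by
  induction b, h using Nat.le_induction with
  | base => simpa only [side_self] using continuous_const
  | succ b h ih =>
    simp_rw [side_succ χ _ c h]
    split_ifs
    · simp_rw [evolve_append_singleton]
      exact (M.U.isBoundedFamily_heisenberg M.V).continuous_apply (hw b) ih
    · simpa only [List.append_nil] using ih

theorem continuous_moment (hw : ∀ i, Continuous fun x => w x i) (χ : ℕ → Bool) {j b : ℕ}
    (h : j ≤ b) : Continuous fun x => M.moment χ (w x) j b :=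
  (M.continuous_evolve_side hw χ true M.Ω h).inner (M.continuous_evolve_side hw χ false M.Ω h)

theorem continuous_conn (hw : ∀ i, Continuous fun x => w x i) (χ : ℕ → Bool) {j b : ℕ}
    (h : j ≤ b) : Continuous fun x => M.conn χ (w x) j b := by
  induction b using Nat.strong_induction_on with
  | _ b ih =>
    simp_rw [M.conn_eq χ _ j b]
    refine (M.continuous_moment hw χ h).sub (continuous_finsetSum _ fun i hi => ?_)
    rw [Finset.mem_Ioo] at hi
    exact (ih i hi.2 hi.1.le).mul (M.continuous_moment hw χ hi.2.le)

end Continuity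

theorem exists_norm_moment_le (N : ℕ) : ∃ B : ℝ, 0 ≤ B ∧ ∀ (χ : ℕ → Bool) (z : ℕ → ℝ) (j b : ℕ),
    j ≤ b → b ≤ N → ‖M.moment χ z j b‖ ≤ B := by
  refine ⟨(1 + ‖M.V‖) ^ N, by positivity, fun χ z j b h hb => (M.norm_moment_le χ z h).trans ?_⟩
  calc ‖M.V‖ ^ (b - j) ≤ (1 + ‖M.V‖) ^ (b - j) := by gcongr; linarith
    _ ≤ _ := pow_le_pow_right₀ (by linarith [norm_nonneg M.V]) (by omega)

theorem exists_norm_conn_le (N : ℕ) : ∃ B : ℝ, 0 ≤ B ∧ ∀ (χ : ℕ → Bool) (z : ℕ → ℝ) (j b : ℕ),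
    j ≤ b → b ≤ N → ‖M.conn χ z j b‖ ≤ B := by
  induction N with
  | zero =>
    refine ⟨1, zero_le_one, fun χ z j b h hb => ?_⟩
    obtain ⟨rfl, rfl⟩ : j = 0 ∧ b = 0 := by omega
    rw [conn_eq, moment_self]
    simp
  | succ N ih =>
    obtain ⟨B, hB, h⟩ := ih
    obtain ⟨B', hB', h'⟩ := M.exists_norm_moment_le (N + 1)
    refine ⟨max B (B' + (N + 1) * (B * B')), le_max_of_le_left hB, fun χ z j b hj hb => ?_⟩
    rcases hb.eq_or_lt with rfl | hb
    · refine le_max_of_le_right ?_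
      rw [conn_eq]
      refine (norm_sub_le _ _).trans (add_le_add (h' _ _ _ _ hj le_rfl) ?_)
      refine (norm_sum_le_of_le _ (f := fun i => M.conn χ z j i * M.moment χ z i (N + 1))
        (n := fun _ => B * B') fun i hi => ?_).trans ?_
      · rw [Finset.mem_Ioo] at hi
        rw [norm_mul]
        exact mul_le_mul (h _ _ _ _ hi.1.le (by omega)) (h' _ _ _ _ hi.2.le le_rfl)
          (norm_nonneg _) hB
      · rw [Finset.sum_const, nsmul_eq_mul]
        gcongr
        rw [Nat.card_Ioo]
        exact_mod_cast (by omega : N + 1 - j - 1 ≤ N + 1)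
    · exact le_max_of_le_left (h _ _ _ _ hj (by omega))

/-! ## Majorants -/

theorem inner_Vt_Vt (s t : ℝ) : ⟪M.Vt s M.Ω, M.Vt t M.Ω⟫_ℂ = M.φ (s - t) := by
  have h : ∀ r, M.Vt r M.Ω = M.U.op (-t) (M.Vt (r - t) M.Ω) := fun r => by
    have := M.U.heisenberg_add M.V (r - t) t M.Ω
    rwa [sub_add_cancel, op_Ω] at this
  rw [φ_eq, h s, h t, UnitaryGroup.inner_op_op, sub_self]
  congr 1
  rw [UnitaryGroup.heisenberg_apply, op_Ω, neg_zero, UnitaryGroup.op_zero_apply]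

/-- The one-point functions vanish, and by self-adjointness the four markings of two times give
`φ(z₀ - z₁)` or its conjugate. -/
theorem norm_conn_two (χ : ℕ → Bool) (z : ℕ → ℝ) :
    ‖M.conn χ z 0 2‖ = ‖M.φ (z 0 - z 1)‖ := by
  have h1 : Finset.Ioo 0 2 = {1} := rfl
  have h2 : M.conn χ z 0 2 = M.moment χ z 0 2 := by
    rw [conn_eq, h1, Finset.sum_singleton, conn_succ_self, zero_mul, sub_zero]
  have h3 : ∀ c, side χ z c 0 2 = (if χ 0 = c then [z 0] else []) ++ if χ 1 = c then [z 1] else [] :=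
    fun c => by
      rw [side_succ χ z c zero_le_one, show (1 : ℕ) = 0 + 1 from rfl, side_succ χ z c le_rfl, side_self,
        List.nil_append]
  rw [h2, moment, h3, h3]
  cases χ 0 <;> cases χ 1
  · change ‖⟪M.Ω, M.Vt _ (M.Vt _ _)⟫_ℂ‖ = _
    rw [← inner_Vt, ← inner_conj_symm, RCLike.norm_conj, inner_Vt_Vt]
  · change ‖⟪M.Vt _ _, M.Vt _ _⟫_ℂ‖ = _
    rw [← inner_conj_symm, RCLike.norm_conj, inner_Vt_Vt]
  · change ‖⟪M.Vt _ _, M.Vt _ _⟫_ℂ‖ = _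
    rw [inner_Vt_Vt]
  · change ‖⟪M.Vt _ (M.Vt _ _), M.Ω⟫_ℂ‖ = _
    rw [inner_Vt, inner_Vt_Vt]

/-- An integrable function whose chains bound the connected correlation functions. -/
structure IsMajorant (F : ℝ → ℝ≥0∞) (C : ℝ) : Prop where
  measurable : Measurable F
  even : ∀ s, F (-s) = F s
  lintegral_ne_top : ∫⁻ s, F s ≠ ∞
  nonneg : 0 ≤ C
  enorm_φ_le : ∀ s, ‖M.φ s‖ₑ ≤ F s
  enorm_conn_le : ∀ (n : ℕ) (χ : ℕ → Bool) (z : ℕ → ℝ), MonotoneOn z (Iio (n + 2)) →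
    ‖M.conn χ z 0 (n + 2)‖ₑ ≤ ENNReal.ofReal (C ^ (n + 2) / (n / 2).factorial) *
      ∑ p : Equiv.Perm (Fin (n + 2)), chain (fun _ => F) ((n + 1) / 2 + 1) fun i => z (p i)

theorem exists_isMajorant (hφ : Integrable M.φ) (hcl : ClusteringProperty M.U M.V M.ω) :
    ∃ F C, M.IsMajorant F C := by
  obtain ⟨f, hf, ⟨ε, hε, -, hint⟩, C, hC, hcl⟩ := hcl
  -- The weight is at least `1`.
  have hfi : Integrable f := by
    have h1 : ∀ s : ℝ, (1 : ℝ) ≤ (1 + |s|) ^ ε := fun s =>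
      Real.one_le_rpow (by linarith [abs_nonneg s]) hε.le
    have hc : Continuous fun s : ℝ => ((1 + |s|) ^ ε)⁻¹ :=
      ((by fun_prop : Continuous fun s : ℝ => 1 + |s|).rpow_const fun s => Or.inr hε.le).inv₀
        fun s => (zero_lt_one.trans_le (h1 s)).ne'
    have := hint.mul_bdd (c := 1) hc.aestronglyMeasurable (Eventually.of_forall fun s => by
      rw [norm_inv, Real.norm_of_nonneg (zero_le_one.trans (h1 s))]
      exact inv_le_one_of_one_le₀ (h1 s))
    refine this.congr (Eventually.of_forall fun s => ?_)
    exact mul_inv_cancel_right₀ (zero_lt_one.trans_le (h1 s)).ne' _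
  have hgi : Integrable fun s => f s + ‖M.φ s‖ := hfi.add hφ.norm
  -- The bounds are needed at every point, while `f` and `φ` are measurable only up to null sets;
  -- hence a lower semicontinuous majorant, whose integral exceeds theirs by at most one.
  obtain ⟨F, hlt, hF, hFi⟩ := exists_lt_lowerSemicontinuous_lintegral_ge_of_aemeasurable
    (μ := volume) (fun s => (f s + ‖M.φ s‖).toNNReal) hgi.aestronglyMeasurable.aemeasurable.real_toNNReal
    one_ne_zero
  have hg : ∀ s, ENNReal.ofReal (f s + ‖M.φ s‖) ≤ F s := fun s => (hlt s).le
  have hfF : ∀ s, ENNReal.ofReal (f s) ≤ F s + F (-s) := fun s =>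
    (ENNReal.ofReal_le_ofReal (by linarith [norm_nonneg (M.φ s)])).trans
      ((hg s).trans le_self_add)
  have hφF : ∀ s, ‖M.φ s‖ₑ ≤ F s + F (-s) := fun s => by
    rw [← ofReal_norm]
    exact (ENNReal.ofReal_le_ofReal (by linarith [hf s])).trans ((hg s).trans le_self_add)
  have hFt : ∫⁻ s, F s ≠ ∞ := by
    refine ne_top_of_le_ne_top ?_ hFi
    exact ENNReal.add_ne_top.2 ⟨hgi.lintegral_lt_top.ne, ENNReal.one_ne_top⟩
  -- Symmetrization allows chains to be read backwards; `C ≥ 1` makes the prefactor at least one in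
  -- the case `n = 0`, where the bound comes from `φ`.
  refine ⟨fun s => F s + F (-s), max C 1, hF.measurable.add (hF.measurable.comp measurable_neg),
    fun s => by rw [neg_neg, add_comm], ?_, by positivity, hφF, fun n χ z hz => ?_⟩
  · rw [lintegral_add_left hF.measurable, lintegral_neg_eq_self]
    exact ENNReal.add_ne_top.2 ⟨hFt, hFt⟩
  rcases Nat.eq_zero_or_pos n with rfl | hn
  · rw [← ofReal_norm, norm_conn_two, ofReal_norm]
    refine (hφF _).trans ?_
    have h1 : (1 : ℝ≥0∞) ≤ ENNReal.ofReal (max C 1 ^ (0 + 2) / (0 / 2).factorial) := by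
      rw [← ENNReal.ofReal_one]
      refine ENNReal.ofReal_le_ofReal ?_
      simpa using (le_max_right C 1).trans (le_abs_self _)
    refine le_trans ?_ (le_mul_of_one_le_left zero_le h1)
    refine le_trans ?_ (Finset.single_le_sum (fun _ _ => zero_le)
      (Finset.mem_univ (1 : Equiv.Perm (Fin (0 + 2)))))
    simp [chain, ext]
  set A : Finset (Fin (n + 2)) := Finset.univ.filter fun i => χ i = true with hA
  have h := hcl n hn A (fun i => z i - z 0) (by simp) (fun i j hij => by
    simpa using hz (show (i : ℕ) < n + 2 from i.2) (show (j : ℕ) < n + 2 from j.2) hij)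
  rw [M.connectedCorrelation_eq_conn n A _ (χ := χ) (y := fun i => z i + -z 0)
    (fun i => by simp [hA]) (fun i => (sub_eq_add_neg _ _).symm), M.conn_add] at h
  rw [← ofReal_norm]
  refine (ENNReal.ofReal_le_ofReal h).trans ?_
  rw [ENNReal.ofReal_mul (by positivity)]
  gcongr
  · exact le_max_left _ _
  rw [ENNReal.ofReal_sum_of_nonneg fun p _ => Finset.prod_nonneg fun l _ => hf _]
  refine (Finset.sum_le_sum_of_subset (Finset.filter_subset _ _)).trans
    (Finset.sum_le_sum fun p _ => ?_)
  rw [ENNReal.ofReal_prod_of_nonneg fun l _ => hf _, chain, ← Fin.prod_univ_eq_prod_range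
    (fun l => F (ext (fun i => z (p i)) l - ext (fun i => z (p i)) (l + 1))
      + F (-(ext (fun i => z (p i)) l - ext (fun i => z (p i)) (l + 1)))) ((n + 1) / 2 + 1)]
  refine Finset.prod_le_prod' fun l _ => ?_
  refine (hfF _).trans (le_of_eq ?_)
  rw [ext_apply _ (show (l : ℕ) < n + 2 by omega), ext_apply _ (show (l : ℕ) + 1 < n + 2 by omega)]
  simp

variable {M} {F : ℝ → ℝ≥0∞} {C : ℝ}

/-- The bound on the connected correlation functions of a block of times. -/
theorem IsMajorant.enorm_conn_block_le (hF : M.IsMajorant F C) (χ : ℕ → Bool) (z : ℕ → ℝ)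
    (j n : ℕ) (hz : MonotoneOn z (Ico j (j + n + 2))) :
    ‖M.conn χ z j (j + n + 2)‖ₑ ≤ ENNReal.ofReal (C ^ (n + 2) / (n / 2).factorial) *
      ∑ p : Equiv.Perm (Fin (n + 2)), chain (fun _ => F) ((n + 1) / 2 + 1)
        fun i => z (j + p i) := by
  have h := hF.enorm_conn_le n (fun i => χ (i + j)) (fun i => z (i + j)) fun i hi k hk hik =>
    hz ⟨by omega, by have := mem_Iio.1 hi; omega⟩ ⟨by omega, by have := mem_Iio.1 hk; omega⟩
      (by omega)
  rw [conn_shift, zero_add] at h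
  rw [show j + n + 2 = n + 2 + j by ring]
  simpa only [add_comm] using h

theorem measurable_enorm_conn (M : Model S R) (χ : ℕ → Bool) (N : ℕ) :
    Measurable fun z : Fin N → ℝ => ‖M.conn χ (ext z) 0 N‖ₑ :=
  (M.continuous_conn (fun i => continuous_ext i) χ (Nat.zero_le N)).measurable.enorm

end Model

/-! ## Ordered regions -/

section Ordered

open scoped ENNReal

/-- The increasing sequences with `z_N < z₀ + T`. -/
def ordered (N : ℕ) (T : ℝ) : Set (Fin (N + 1) → ℝ) :=
  {z | StrictMono z ∧ z (Fin.last N) < z 0 + T}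

theorem measurableSet_strictMono (N : ℕ) : MeasurableSet {z : Fin N → ℝ | StrictMono z} := by
  have : {z : Fin N → ℝ | StrictMono z} = ⋂ i, ⋂ j, ⋂ (_ : i < j), {z | z i < z j} := by
    ext z; simp [StrictMono]
  rw [this]
  exact MeasurableSet.iInter fun i => MeasurableSet.iInter fun j => MeasurableSet.iInter fun _ =>
    measurableSet_lt (measurable_pi_apply _) (measurable_pi_apply _)

theorem measurableSet_ordered (N : ℕ) (T : ℝ) : MeasurableSet (ordered N T) :=
  (measurableSet_strictMono _).inter
    (measurableSet_lt (measurable_pi_apply _)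
      (show Measurable fun z : Fin (N + 1) → ℝ => z 0 + T by fun_prop))

theorem ordered_add {N : ℕ} {T : ℝ} {z : Fin (N + 1) → ℝ} (a : ℝ) :
    (fun i => z i + a) ∈ ordered N T ↔ z ∈ ordered N T := by
  simp only [ordered, mem_ofPred_eq, StrictMono, add_lt_add_iff_right, add_right_comm]

theorem restrict_pi_eq {N : ℕ} (I : Fin N → Set ℝ) :
    (volume : Measure (Fin N → ℝ)).restrict (univ.pi I)
      = Measure.pi fun i => volume.restrict (I i) := by
  rw [volume_pi, Measure.restrict_pi_pi]

/-- Averaging over the first time of a translation invariant function on an ordered region. -/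
theorem lintegral_ordered_mul_le {N : ℕ} {g : (Fin (N + 1) → ℝ) → ℝ≥0∞} (hm : Measurable g)
    (hinv : ∀ z a, g (fun i => z i + a) = g z) (T L : ℝ)
    {I : Fin (N + 1) → Set ℝ} (hI : ∀ i, MeasurableSet (I i))
    (hsub : ∀ z ∈ ordered N T, z 0 ∈ Ioo 0 L → g z ≠ 0 → ∀ i, z i ∈ I i) :
    (∫⁻ z : Fin N → ℝ, (ordered N T).indicator g (Fin.cons 0 z)) * ENNReal.ofReal L
      ≤ ∫⁻ z in {z | StrictMono z}, g z ∂Measure.pi fun i => volume.restrict (I i) := by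
  have h := lintegral_cons_zero_mul (h := (ordered N T).indicator g)
    (hm.indicator (measurableSet_ordered N T)) (fun z a => by
      by_cases hz : z ∈ ordered N T
      · rw [indicator_of_mem hz, indicator_of_mem ((ordered_add a).2 hz), hinv]
      · rw [indicator_of_notMem hz, indicator_of_notMem (fun h => hz ((ordered_add a).1 h))])
    (measurableSet_Ioo (a := (0 : ℝ)) (b := L))
  have h0m : MeasurableSet {z : Fin (N + 1) → ℝ | z 0 ∈ Ioo 0 L} :=
    measurable_pi_apply 0 measurableSet_Ioo
  rw [Real.volume_Ioo, sub_zero] at h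
  rw [h, ← restrict_pi_eq, Measure.restrict_restrict (measurableSet_strictMono _),
    ← lintegral_indicator h0m,
    ← lintegral_indicator ((measurableSet_strictMono _).inter
      (MeasurableSet.pi countable_univ fun i _ => hI i))]
  refine lintegral_mono fun z => ?_
  by_cases h0 : z 0 ∈ Ioo 0 L
  · rw [indicator_of_mem (s := {z : Fin (N + 1) → ℝ | z 0 ∈ Ioo 0 L}) h0]
    by_cases hz : z ∈ ordered N T
    · rw [indicator_of_mem hz]
      by_cases hg : g z = 0
      · rw [hg]; exact zero_le
      · rw [indicator_of_mem]
        exact ⟨hz.1, fun i _ => hsub z hz h0 hg i⟩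
    · rw [indicator_of_notMem hz]
      exact zero_le
  · rw [indicator_of_notMem (s := {z : Fin (N + 1) → ℝ | z 0 ∈ Ioo 0 L}) h0]
    exact zero_le

theorem mem_Ioo_of_mem_ordered {N : ℕ} {T L : ℝ} {z : Fin (N + 1) → ℝ} (hz : z ∈ ordered N T)
    (h0 : z 0 ∈ Ioo 0 L) (i : Fin (N + 1)) : z i ∈ Ioo 0 (T + L) := by
  have h1 := hz.1.monotone (Fin.zero_le i)
  have h2 := hz.1.monotone (Fin.le_last i)
  have h3 := hz.2
  exact ⟨by linarith [h0.1], by linarith [h0.2]⟩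

end Ordered

/-! ### The first bound on the integrated connected correlations -/

namespace Model

open scoped ENNReal

variable {S R : Type*} [NormedAddCommGroup S] [InnerProductSpace ℂ S]
  [FiniteDimensional ℂ S] [NormedAddCommGroup R] [InnerProductSpace ℂ R] [CompleteSpace R]
  {M : Model S R} {F : ℝ → ℝ≥0∞} {C : ℝ}

/-- The integral of `|𝒢ₙ|` over `0 = z₀ < z₁ < ⋯ < z_{n+1} < T`. -/
def connIntegral (M : Model S R) (χ : ℕ → Bool) (n : ℕ) (T : ℝ) : ℝ≥0∞ :=
  ∫⁻ z : Fin (n + 1) → ℝ, (ordered (n + 1) T).indicator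
    (fun z => ‖M.conn χ (ext z) 0 (n + 2)‖ₑ) (Fin.cons 0 z)

theorem ext_add_of_lt {N : ℕ} (z : Fin N → ℝ) (a : ℝ) {i : ℕ} (h : i < N) :
    ext (fun i => z i + a) i = ext z i + a := by
  rw [ext_apply _ h, ext_apply _ h]

theorem conn_ext_add (M : Model S R) (χ : ℕ → Bool) {N : ℕ} (z : Fin N → ℝ) (a : ℝ) :
    M.conn χ (ext fun i => z i + a) 0 N = M.conn χ (ext z) 0 N := by
  rw [← M.conn_add χ (ext z) a]
  exact M.conn_congr (fun _ _ _ => rfl) fun i _ hi => ext_add_of_lt z a hi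

theorem IsMajorant.enorm_conn_ext_le (hF : M.IsMajorant F C) (χ : ℕ → Bool) {n : ℕ}
    {z : Fin (n + 2) → ℝ} (hz : Monotone z) :
    ‖M.conn χ (ext z) 0 (n + 2)‖ₑ ≤ ENNReal.ofReal (C ^ (n + 2) / (n / 2).factorial) *
      ∑ p : Equiv.Perm (Fin (n + 2)), chain (fun _ => F) ((n + 1) / 2 + 1) (z ∘ p) := by
  refine (hF.enorm_conn_le n χ (ext z) fun i hi k hk hik => ?_).trans (le_of_eq ?_)
  · rw [ext_apply _ hi, ext_apply _ hk]
    exact hz hik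
  · simp_rw [ext_val]
    rfl

/-- Averaging over `z₀ ∈ (0, T)` frees all `n + 2` times in `(0, 2T)`, and symmetrization absorbs
the sum over permutations. Of these times, `[(n+1)/2] + 1` are integrated against links, leaving
`[n/2] + 1` volume factors; one of them is the factor `T` on the left. -/
theorem IsMajorant.connIntegral_mul_le (hF : M.IsMajorant F C) (χ : ℕ → Bool) (n : ℕ) (T : ℝ) :
    M.connIntegral χ n T * ENNReal.ofReal T
      ≤ ENNReal.ofReal (C ^ (n + 2) / (n / 2).factorial) *
        ((∫⁻ s, F s) ^ ((n + 1) / 2 + 1) * ENNReal.ofReal (2 * T) ^ (n / 2 + 1)) := by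
  have hFm : ∀ l : ℕ, Measurable ((fun _ => F) l) := fun _ => hF.measurable
  refine (lintegral_ordered_mul_le (I := fun _ => Ioo 0 (2 * T)) (M.measurable_enorm_conn χ (n + 2))
    (fun z a => by rw [conn_ext_add]) T T (fun _ => measurableSet_Ioo)
    (fun z hz h0 _ i => two_mul T ▸ mem_Ioo_of_mem_ordered hz h0 i)).trans ?_
  refine (setLIntegral_mono' (measurableSet_strictMono _)
    fun z hz => hF.enorm_conn_ext_le χ (StrictMono.monotone hz)).trans ?_
  have hpm : ∀ p : Equiv.Perm (Fin (n + 2)), Measurable fun z : Fin (n + 2) → ℝ =>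
      chain (fun _ => F) ((n + 1) / 2 + 1) (z ∘ p) := fun p =>
    (measurable_chain hFm _ _).comp (measurable_pi_lambda _ fun i => measurable_pi_apply _)
  rw [lintegral_const_mul _ (Finset.measurable_sum _ fun p _ => hpm p)]
  gcongr
  rw [lintegral_finsetSum _ fun p _ => hpm p]
  refine (sum_perm_lintegral_le _ (measurable_chain hFm _ _)).trans ?_
  refine (lintegral_chain_le hFm (by omega) _ fun _ => Measure.restrict_le_self).trans ?_
  rw [Finset.prod_const, Finset.prod_const, Finset.card_range, Measure.restrict_apply_univ,
    Real.volume_Ioo, sub_zero]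
  have : (Finset.univ.filter fun i : Fin (n + 2) => (n + 1) / 2 + 1 ≤ (i : ℕ)).card
      = n / 2 + 1 := by
    have h : (Finset.univ.filter fun i : Fin (n + 2) => (n + 1) / 2 + 1 ≤ (i : ℕ))
        = Finset.Ici ⟨(n + 1) / 2 + 1, by omega⟩ := by
      ext i
      simp [Fin.le_def]
    rw [h, Fin.card_Ici]
    simp only
    omega
  rw [this]

end Model

end VanHove

end

noncomputable section

namespace VanHove

/-! ## Ordering the times of a moment -/

namespace Model

open scoped ENNReal

variable {S R : Type*} [NormedAddCommGroup S] [InnerProductSpace ℂ S]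
  [FiniteDimensional ℂ S] [NormedAddCommGroup R] [InnerProductSpace ℂ R] [CompleteSpace R]
  (M : Model S R)

theorem side_ext (χ : ℕ → Bool) {N : ℕ} (v : Fin N → ℝ) (c : Bool) {j : ℕ} (hj : j ≤ N) :
    side χ (ext v) c j N
      = ((List.finRange N).filter fun i : Fin N => decide (j ≤ (i : ℕ) ∧ χ i = c)).map v := by
  have h1 : List.range' j (N - j) = (List.range N).filter (j ≤ ·) := by
    have : List.range N = List.range' 0 j ++ List.range' j (N - j) := by
      have h := List.range'_append_1 (s := 0) (m := j) (n := N - j)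
      rw [zero_add, Nat.add_sub_cancel' hj] at h
      rw [h, List.range_eq_range']
    rw [this, List.filter_append, List.filter_eq_nil_iff.2, List.filter_eq_self.2, List.nil_append]
    · intro i hi
      rw [List.mem_range'_1] at hi
      simpa using hi.1
    · intro i hi
      rw [List.mem_range'_1] at hi
      simp only [decide_eq_true_eq]
      omega
  have h2 : (ext v) ∘ (fun i : Fin N => (i : ℕ)) = v := funext fun i => ext_val v i
  rw [side, h1, ← List.map_coe_finRange_eq_range, List.filter_map, List.filter_map, List.map_map,
    h2, List.filter_filter]
  congr 2
  ext i
  simp [and_comm]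

/-- The inner product of two time-ordered vectors is a moment of the merged times. -/
theorem exists_merge {q : ℕ} {y y' : Fin q → ℝ} (hy : Monotone y) (hy' : Monotone y') :
    ∃ (e : Fin (2 * q) ≃ Fin q ⊕ Fin q) (χ : ℕ → Bool), Monotone (Sum.elim y y' ∘ e) ∧
      M.moment χ (ext (Sum.elim y y' ∘ e)) 0 (2 * q)
        = ⟪M.evolve M.Ω (List.ofFn y), M.evolve M.Ω (List.ofFn y')⟫_ℂ := by
  set u : Fin q ⊕ Fin q → ℝ := Sum.elim y y' with hu
  set e₁ : Fin (2 * q) ≃ Fin q ⊕ Fin q := (finCongr (two_mul q)).trans finSumFinEquiv.symm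
  -- All `2q` times are sorted together; the mark remembers which family a time came from.
  set e : Fin (2 * q) ≃ Fin q ⊕ Fin q := (Tuple.sort (u ∘ e₁)).trans e₁ with he
  have hmono : Monotone (u ∘ e) := Tuple.monotone_sort (u ∘ e₁)
  set χ : ℕ → Bool := fun m => if h : m < 2 * q then (e ⟨m, h⟩).isLeft else false with hχ
  have hχe : ∀ i : Fin (2 * q), χ i = (e i).isLeft := fun i => by simp [hχ]
  have hperm : ((List.finRange (2 * q)).map e).Perm
      ((List.finRange q).map Sum.inl ++ (List.finRange q).map Sum.inr) := by
    refine (List.perm_ext_iff_of_nodup ((List.nodup_finRange _).map e.injective) ?_).2 fun x => ?_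
    · refine List.nodup_append.2 ⟨(List.nodup_finRange _).map Sum.inl_injective,
        (List.nodup_finRange _).map Sum.inr_injective, fun a ha b hb => ?_⟩
      simp only [List.mem_map] at ha hb
      obtain ⟨i, -, rfl⟩ := ha
      obtain ⟨k, -, rfl⟩ := hb
      simp
    · have h1 : x ∈ (List.finRange (2 * q)).map e :=
        List.mem_map.2 ⟨e.symm x, List.mem_finRange _, e.apply_symm_apply x⟩
      have h2 : x ∈ (List.finRange q).map Sum.inl ++ (List.finRange q).map Sum.inr := by
        rcases x with x | x <;> simp
      exact ⟨fun _ => h2, fun _ => h1⟩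
  have hsort : ∀ c : Bool, (side χ (ext (u ∘ e)) c 0 (2 * q)).Pairwise (· ≤ ·) := by
    intro c
    rw [side_ext χ _ c (Nat.zero_le _)]
    refine List.Pairwise.map _ (fun a b h => hmono (le_of_lt h))
      ((List.pairwise_lt_finRange _).filter _)
  -- Both lists are sorted, and they are rearrangements of each other as lists of real numbers; so
  -- they agree, even where times coincide.
  have hside : ∀ c : Bool, side χ (ext (u ∘ e)) c 0 (2 * q) = List.ofFn (if c then y else y') := by
    intro c
    refine List.Perm.eq_of_pairwise (le := (· ≤ ·)) (fun a b _ _ h1 h2 => le_antisymm h1 h2)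
      (hsort c) ?_ ?_
    · rw [List.pairwise_ofFn]
      intro i k hik
      cases c
      · exact hy' hik.le
      · exact hy hik.le
    · have h1 : side χ (ext (u ∘ e)) c 0 (2 * q)
          = (((List.finRange (2 * q)).map e).filter fun x => x.isLeft == c).map u := by
        rw [side_ext χ _ c (Nat.zero_le _), List.filter_map, List.map_map]
        congr 2
        ext i
        rw [Function.comp_apply, hχe]
        cases (e i).isLeft <;> cases c <;> simp
      rw [h1]
      refine ((hperm.filter _).map u).trans (List.Perm.of_eq ?_)
      rw [List.ofFn_eq_map]
      cases c <;> simp [List.filter_map, Function.comp_def, hu]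
  refine ⟨e, χ, hmono, ?_⟩
  rw [moment, hside, hside]
  rfl

end Model

/-! ## Chains that reach a marked point -/

section MarkedChains

open scoped ENNReal

theorem measurable_comp_equiv {ι : Type*} {N : ℕ} (e : Fin N ≃ ι) :
    Measurable fun u : ι → ℝ => u ∘ e :=
  measurable_pi_lambda _ fun _ => measurable_pi_apply _

variable {ι : Type*} [Fintype ι]

open Classical in
/-- The sum of the chains, of at least two points, that contain a marked point. -/
def markedChains (F : ℝ → ℝ≥0∞) (N : ℕ) (far : ι → Prop) (u : ι → ℝ) : ℝ≥0∞ :=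
  ∑ c ∈ Finset.range N, ∑ e : Fin N ≃ ι,
    if 1 ≤ c ∧ ∃ l : Fin N, (l : ℕ) ≤ c ∧ far (e l) then chain (fun _ => F) c (u ∘ e) else 0

theorem chain_le_markedChains {F : ℝ → ℝ≥0∞} {N : ℕ} {far : ι → Prop} (u : ι → ℝ) {c : ℕ}
    (hc : c < N) (hc1 : 1 ≤ c) (e : Fin N ≃ ι) (hfar : ∃ l : Fin N, (l : ℕ) ≤ c ∧ far (e l)) :
    chain (fun _ => F) c (u ∘ e) ≤ markedChains F N far u := by
  classical
  refine le_trans ?_ (Finset.single_le_sum (fun _ _ => zero_le) (Finset.mem_range.2 hc))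
  refine le_trans ?_ (Finset.single_le_sum (fun _ _ => zero_le) (Finset.mem_univ e))
  rw [if_pos ⟨hc1, hfar⟩]

/-- A chain depends only on the first `c + 1` points that it visits, so an injective list of points
may be completed to an enumeration of all of `ι`. -/
theorem chain_comp_le_markedChains {F : ℝ → ℝ≥0∞} {N : ℕ} (hN : Fintype.card ι = N)
    {far : ι → Prop} (u : ι → ℝ) {m c : ℕ} (hc : c < m) (hmN : m ≤ N) (hc1 : 1 ≤ c) {q : Fin m → ι}
    (hq : Function.Injective q) (hfar : ∃ l : Fin m, (l : ℕ) ≤ c ∧ far (q l)) :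
    chain (fun _ => F) c (u ∘ q) ≤ markedChains F N far u := by
  set q' : ℕ → ι := fun l => if h : l < m then q ⟨l, h⟩ else q ⟨0, by omega⟩ with hq'
  have hql : ∀ l (h : l < m), q' l = q ⟨l, h⟩ := fun l h => dif_pos h
  obtain ⟨e, he⟩ := exists_equiv_of_injOn hN (c := c + 1) (q := q') fun a ha b hb hab => by
    rw [mem_Iio] at ha hb
    rw [hql a (by omega), hql b (by omega)] at hab
    simpa using hq hab
  have heq : ∀ l, l ≤ c → ext (u ∘ e) l = ext (u ∘ q) l := fun l hl => by
    rw [ext_apply _ (by omega), ext_apply _ (show l < m by omega), Function.comp_apply,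
      he ⟨l, by omega⟩ (Nat.lt_succ_of_le hl), hql _ (show l < m by omega)]
    rfl
  have h1 : chain (fun _ => F) c (u ∘ q) = chain (fun _ => F) c (u ∘ e) :=
    Finset.prod_congr rfl fun l hl => by
      rw [Finset.mem_range] at hl
      rw [heq l hl.le, heq (l + 1) hl]
  rw [h1]
  refine chain_le_markedChains u (by omega) hc1 e ?_
  obtain ⟨l, hl, hf⟩ := hfar
  refine ⟨⟨l, by omega⟩, hl, ?_⟩
  rw [he _ (Nat.lt_succ_of_le hl), hql _ l.2]
  exact hf

/-- The chain consumes `c` integrations, leaving the masses of the points at positions `c` and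
beyond. A marked point at a position below `c` has been integrated out, so its unused factor `b ≥ L`
pays for `L`. If the marked point is the end point `c` itself, the chain is reversed, by evenness of
`F`, so that it comes first. -/
theorem lintegral_marked_chain_mul_le {F : ℝ → ℝ≥0∞} (hF : Measurable F)
    (heven : ∀ s, F (-s) = F s) {N : ℕ} {far : ι → Prop} {μ : ι → Measure ℝ}
    [∀ i, SigmaFinite (μ i)] (hμ : ∀ i, μ i ≤ volume) {b : ι → ℝ≥0∞} (hb : ∀ i, μ i univ ≤ b i)
    (hb1 : ∀ i, 1 ≤ b i) {L : ℝ≥0∞} (hL : ∀ i, far i → L ≤ b i) {c : ℕ} (hc : c < N) (hc1 : 1 ≤ c)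
    (e : Fin N ≃ ι) {l : Fin N} (hl : (l : ℕ) ≤ c) (hfar : far (e l)) :
    (∫⁻ u, chain (fun _ => F) c (u ∘ e) ∂Measure.pi μ) * L ≤ (∫⁻ s, F s) ^ c * ∏ i, b i := by
  classical
  have main : ∀ (e : Fin N ≃ ι) (l : Fin N), (l : ℕ) < c → far (e l) →
      (∫⁻ u, chain (fun _ => F) c (u ∘ e) ∂Measure.pi μ) * L ≤ (∫⁻ s, F s) ^ c * ∏ i, b i := by
    intro e l hl hfar
    refine (mul_le_mul_left (lintegral_chain_le_of_equiv (F := fun _ => F) (fun _ => hF) hc e μ hμ)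
      L).trans ?_
    rw [Finset.prod_const, Finset.card_range, mul_assoc]
    gcongr
    calc (∏ i ∈ Finset.univ.filter (fun i : Fin N => c ≤ (i : ℕ)), μ (e i) univ) * L
        ≤ (∏ i ∈ Finset.univ.filter (fun i : Fin N => c ≤ (i : ℕ)), b (e i)) * b (e l) :=
          mul_le_mul' (Finset.prod_le_prod' fun i _ => hb _) (hL _ hfar)
      _ = ∏ i ∈ insert l (Finset.univ.filter (fun i : Fin N => c ≤ (i : ℕ))), b (e i) := by
          rw [Finset.prod_insert (by simpa using hl), mul_comm]
      _ ≤ ∏ i, b (e i) := Finset.prod_le_prod_of_subset_of_one_le' (Finset.subset_univ _)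
          fun i _ _ => hb1 _
      _ = ∏ i, b i := e.prod_comp b
  rcases hl.lt_or_eq with hl | hl
  · exact main e l hl hfar
  have hN : Fintype.card ι = N := by rw [← Fintype.card_congr e, Fintype.card_fin]
  obtain ⟨e', he'⟩ := exists_equiv_of_injOn hN (c := c + 1)
    (q := fun k => e ⟨c - k, by omega⟩) fun a ha b hb hab => by
      rw [mem_Iio] at ha hb
      have := e.injective hab
      rw [Fin.mk.injEq] at this
      omega
  have heq : ∀ (u : ι → ℝ) k, k ≤ c → ext (u ∘ e') k = ext (u ∘ e) (c - k) := fun u k hk => by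
    rw [ext_apply _ (show k < N by omega), ext_apply _ (show c - k < N by omega),
      Function.comp_apply, he' _ (Nat.lt_succ_of_le hk)]
    rfl
  have hch : ∀ u : ι → ℝ, chain (fun _ => F) c (u ∘ e) = chain (fun _ => F) c (u ∘ e') := by
    intro u
    rw [chain, chain, ← Finset.prod_range_reflect]
    refine Finset.prod_congr rfl fun k hk => ?_
    rw [Finset.mem_range] at hk
    rw [heq u k hk.le, heq u (k + 1) hk, ← heven, neg_sub]
    congr 3 <;> omega
  simp_rw [hch]
  refine main e' ⟨0, by omega⟩ hc1 ?_
  rw [he' _ (Nat.succ_pos c)]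
  convert hfar using 3
  simp [hl]

theorem exists_lintegral_markedChains_mul_le {F : ℝ → ℝ≥0∞} (hF : Measurable F)
    (heven : ∀ s, F (-s) = F s) (hFi : ∫⁻ s, F s ≠ ∞) (ι : Type*) [Fintype ι] (N : ℕ)
    (far : ι → Prop) : ∃ K : ℝ≥0∞, K ≠ ∞ ∧ ∀ (μ : ι → Measure ℝ) [∀ i, SigmaFinite (μ i)],
      (∀ i, μ i ≤ volume) → ∀ b : ι → ℝ≥0∞, (∀ i, μ i univ ≤ b i) → (∀ i, 1 ≤ b i) → ∀ L : ℝ≥0∞,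
      (∀ i, far i → L ≤ b i) →
      (∫⁻ u, markedChains F N far u ∂Measure.pi μ) * L ≤ K * ∏ i, b i := by
  classical
  refine ⟨∑ c ∈ Finset.range N, ∑ e : Fin N ≃ ι, (∫⁻ s, F s) ^ c,
    ENNReal.sum_ne_top.2 fun c _ => ENNReal.sum_ne_top.2 fun _ _ => ENNReal.pow_ne_top hFi,
    fun μ _ hμ b hb hb1 L hL => ?_⟩
  have hm : ∀ (c : ℕ) (e : Fin N ≃ ι), Measurable fun u : ι → ℝ =>
      if 1 ≤ c ∧ ∃ l : Fin N, (l : ℕ) ≤ c ∧ far (e l) then chain (fun _ => F) c (u ∘ e) else 0 := by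
    intro c e
    split_ifs
    · exact (measurable_chain (fun _ => hF) _ _).comp (measurable_comp_equiv e)
    · exact measurable_const
  have hint : ∫⁻ u, markedChains F N far u ∂Measure.pi μ
      = ∑ c ∈ Finset.range N, ∑ e : Fin N ≃ ι, ∫⁻ u,
        (if 1 ≤ c ∧ ∃ l : Fin N, (l : ℕ) ≤ c ∧ far (e l) then chain (fun _ => F) c (u ∘ e) else 0)
          ∂Measure.pi μ := by
    simp only [markedChains]
    rw [lintegral_finsetSum _ fun c _ => Finset.measurable_sum _ fun e _ => hm c e]
    exact Finset.sum_congr rfl fun c _ => lintegral_finsetSum _ fun e _ => hm c e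
  rw [hint, Finset.sum_mul, Finset.sum_mul]
  refine Finset.sum_le_sum fun c hc => ?_
  rw [Finset.sum_mul, Finset.sum_mul]
  refine Finset.sum_le_sum fun e _ => ?_
  by_cases h : 1 ≤ c ∧ ∃ l : Fin N, (l : ℕ) ≤ c ∧ far (e l)
  · obtain ⟨hc1, l, hl, hfar⟩ := h
    simp only [if_pos (show 1 ≤ c ∧ ∃ l : Fin N, (l : ℕ) ≤ c ∧ far (e l) from ⟨hc1, l, hl, hfar⟩)]
    exact lintegral_marked_chain_mul_le hF heven hμ hb hb1 hL (Finset.mem_range.1 hc) hc1 e hl hfar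
  · simp [if_neg h]

end MarkedChains

end VanHove

end

noncomputable section

namespace VanHove

namespace Model

open scoped ENNReal

variable {S R : Type*} [NormedAddCommGroup S] [InnerProductSpace ℂ S]
  [FiniteDimensional ℂ S] [NormedAddCommGroup R] [InnerProductSpace ℂ R] [CompleteSpace R]
  {M : Model S R} {F : ℝ → ℝ≥0∞} {C : ℝ}

/-! ## Moments with at least as many marked as unmarked times -/

/-- The weight `w` counts the unmarked times. The chains in the bound visit more than half of the
times of the block, so if at least half of these are marked, each chain meets a marked one. -/
theorem IsMajorant.enorm_conn_le_markedChains (hF : M.IsMajorant F C) {N : ℕ} {ι : Type*}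
    [Fintype ι] (hι : Fintype.card ι = N) {far : ι → Prop} {u : ι → ℝ} {e₀ : Fin N ≃ ι}
    (hmono : Monotone (u ∘ e₀)) (χ : ℕ → Bool) {w : ℕ → ℕ}
    (hw : ∀ i : Fin N, ¬far (e₀ i) → w i = 1) {j i : ℕ} (hji : j < i) (hi : i ≤ N)
    (hcount : 2 * ∑ k ∈ Finset.Ico j i, w k ≤ i - j) :
    ‖M.conn χ (ext (u ∘ e₀)) j i‖ₑ
      ≤ (∑ n ∈ Finset.range N, ENNReal.ofReal (C ^ (n + 2) / (n / 2).factorial)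
        * (n + 2).factorial) * markedChains F N far u := by
  rcases Nat.lt_or_ge (j + 1) i with h | h
  swap
  · obtain rfl : i = j + 1 := by omega
    rw [conn_succ_self, enorm_zero]
    exact zero_le
  obtain ⟨n, rfl⟩ : ∃ n, i = j + n + 2 := ⟨i - j - 2, by omega⟩
  have hm : MonotoneOn (ext (u ∘ e₀)) (Ico j (j + n + 2)) := fun a ha b hb hab => by
    rw [ext_apply _ (ha.2.trans_le hi), ext_apply _ (hb.2.trans_le hi)]
    exact hmono hab
  refine (hF.enorm_conn_block_le χ _ j n hm).trans ?_
  have hchain : ∀ p : Equiv.Perm (Fin (n + 2)),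
      chain (fun _ => F) ((n + 1) / 2 + 1) (fun i => ext (u ∘ e₀) (j + p i))
        ≤ markedChains F N far u := by
    intro p
    have hlt : ∀ i : Fin (n + 2), j + (p i : ℕ) < N := fun i => by have := (p i).2; omega
    have h1 : (fun i => ext (u ∘ e₀) (j + p i)) = u ∘ fun i => e₀ ⟨j + p i, hlt i⟩ :=
      funext fun i => ext_apply _ (hlt i)
    rw [h1]
    refine chain_comp_le_markedChains hι u (by omega) (by omega) (by omega) (fun a b hab => ?_) ?_
    · have := e₀.injective hab
      rw [Fin.mk.injEq, add_right_inj] at this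
      exact p.injective (Fin.ext this)
    -- The chain visits `(n+1)/2 + 2` distinct times, and twice this number exceeds `n + 2`.
    · by_contra! hnear
      have hsub : (Finset.univ.filter fun l : Fin (n + 2) => (l : ℕ) ≤ (n + 1) / 2 + 1).image
          (fun l => j + (p l : ℕ)) ⊆ Finset.Ico j (j + n + 2) := by
        intro x hx
        simp only [Finset.mem_image] at hx
        obtain ⟨l, -, rfl⟩ := hx
        have := (p l).2
        rw [Finset.mem_Ico]
        omega
      have h2 := Finset.sum_le_sum_of_subset (f := w) hsub
      have h3 : ∑ k ∈ (Finset.univ.filter fun l : Fin (n + 2) => (l : ℕ) ≤ (n + 1) / 2 + 1).image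
          (fun l => j + (p l : ℕ)), w k = (n + 1) / 2 + 2 := by
        rw [Finset.sum_image fun a _ b _ hab => p.injective (Fin.ext (by simpa using hab)),
          Finset.sum_congr rfl (g := fun _ => 1) fun l hl =>
            hw ⟨j + p l, hlt l⟩ (hnear l (Finset.mem_filter.1 hl).2)]
        have h4 : (Finset.univ.filter fun l : Fin (n + 2) => (l : ℕ) ≤ (n + 1) / 2 + 1)
            = Finset.Iic ⟨(n + 1) / 2 + 1, by omega⟩ := by
          ext l
          simp [Fin.le_def]
        rw [Finset.sum_const, smul_eq_mul, mul_one, h4, Fin.card_Iic]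
      omega
  calc _ ≤ ENNReal.ofReal (C ^ (n + 2) / (n / 2).factorial) *
        ∑ _p : Equiv.Perm (Fin (n + 2)), markedChains F N far u := by
        gcongr with p _
        exact hchain p
    _ = (ENNReal.ofReal (C ^ (n + 2) / (n / 2).factorial) * (n + 2).factorial)
        * markedChains F N far u := by
        rw [Finset.sum_const, Finset.card_univ, Fintype.card_perm, Fintype.card_fin, nsmul_eq_mul,
          mul_assoc]
    _ ≤ _ := by
        gcongr
        exact Finset.single_le_sum (f := fun n : ℕ => ENNReal.ofReal (C ^ (n + 2) /
          (n / 2).factorial) * ((n + 2).factorial : ℝ≥0∞)) (fun _ _ => zero_le)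
          (Finset.mem_range.2 (by omega))

/-- Split the moment into the connected block of its earliest times and the moment of the rest.
Marked times make up at least half of one of the two: if of the block, the block is bounded by
marked chains and the rest by a constant; otherwise the roles are exchanged, and `m`, a bound on the
number of remaining times, decreases. -/
theorem IsMajorant.exists_enorm_moment_le (hF : M.IsMajorant F C) (N m : ℕ) :
    ∃ B : ℝ≥0∞, B ≠ ∞ ∧ ∀ {ι : Type} [Fintype ι] (_ : Fintype.card ι = N) {far : ι → Prop}
      {u : ι → ℝ} {e₀ : Fin N ≃ ι} (_ : Monotone (u ∘ e₀)) (χ : ℕ → Bool) {w : ℕ → ℕ}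
      (_ : ∀ i : Fin N, ¬far (e₀ i) → w i = 1) {j : ℕ} (_ : j < N) (_ : N - j ≤ m)
      (_ : 2 * ∑ k ∈ Finset.Ico j N, w k ≤ N - j),
      ‖M.moment χ (ext (u ∘ e₀)) j N‖ₑ ≤ B * markedChains F N far u := by
  induction m with
  | zero => exact ⟨0, ENNReal.zero_ne_top, fun _ _ _ _ _ _ _ _ h1 h2 => by omega⟩
  | succ m ih =>
    obtain ⟨B, hB, ih⟩ := ih
    obtain ⟨b, hb0, hb⟩ := M.exists_norm_conn_le N
    obtain ⟨b', hb0', hb'⟩ := M.exists_norm_moment_le N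
    set A : ℝ≥0∞ := ∑ n ∈ Finset.range N, ENNReal.ofReal (C ^ (n + 2) / (n / 2).factorial)
        * (n + 2).factorial with hA
    have hAt : A ≠ ∞ := ENNReal.sum_ne_top.2 fun n _ =>
      ENNReal.mul_ne_top ENNReal.ofReal_ne_top (ENNReal.natCast_ne_top _)
    have hc : ∀ χ z j i, j ≤ i → i ≤ N → ‖M.conn χ z j i‖ₑ ≤ ENNReal.ofReal b :=
      fun χ z j i h1 h2 => by
        rw [← ofReal_norm]; exact ENNReal.ofReal_le_ofReal (hb χ z j i h1 h2)
    have hm : ∀ χ z j i, j ≤ i → i ≤ N → ‖M.moment χ z j i‖ₑ ≤ ENNReal.ofReal b' :=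
      fun χ z j i h1 h2 => by
        rw [← ofReal_norm]; exact ENNReal.ofReal_le_ofReal (hb' χ z j i h1 h2)
    refine ⟨A + N * (A * ENNReal.ofReal b' + ENNReal.ofReal b * B), ?_, ?_⟩
    · finiteness
    intro ι _ hι far u e₀ hmono χ w hw j hj hjm hcount
    have h1 : M.moment χ (ext (u ∘ e₀)) j N = M.conn χ (ext (u ∘ e₀)) j N
        + ∑ i ∈ Finset.Ioo j N, M.conn χ (ext (u ∘ e₀)) j i * M.moment χ (ext (u ∘ e₀)) i N := by
      rw [M.conn_eq χ _ j N]
      ring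
    have hterm : ∀ i ∈ Finset.Ioo j N,
        ‖M.conn χ (ext (u ∘ e₀)) j i * M.moment χ (ext (u ∘ e₀)) i N‖ₑ
          ≤ (A * ENNReal.ofReal b' + ENNReal.ofReal b * B) * markedChains F N far u := by
      intro i hi
      rw [Finset.mem_Ioo] at hi
      rw [enorm_mul, add_mul]
      by_cases hci : 2 * ∑ k ∈ Finset.Ico j i, w k ≤ i - j
      · refine le_add_right ?_
        rw [mul_right_comm]
        exact mul_le_mul' (hF.enorm_conn_le_markedChains hι hmono χ hw hi.1 hi.2.le hci)
          (hm _ _ _ _ hi.2.le le_rfl)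
      · refine le_add_left ?_
        rw [mul_assoc]
        refine mul_le_mul' (hc _ _ _ _ hi.1.le hi.2.le) (ih hι hmono χ hw hi.2 (by omega) ?_)
        have := Finset.sum_Ico_consecutive w hi.1.le hi.2.le
        omega
    rw [h1, add_mul]
    refine (enorm_add_le _ _).trans (add_le_add
      (hF.enorm_conn_le_markedChains hι hmono χ hw hj le_rfl hcount) ?_)
    refine (enorm_sum_le _ _).trans ((Finset.sum_le_sum hterm).trans ?_)
    rw [Finset.sum_const, nsmul_eq_mul, mul_assoc]
    gcongr
    rw [Nat.card_Ioo]
    omega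

/-- Pairs of time-ordered families of times, at least half of them marked. -/
theorem IsMajorant.exists_enorm_inner_evolve_le (hF : M.IsMajorant F C) (q : ℕ) (hq : 0 < q)
    (far : Fin q → Prop) [DecidablePred far]
    (hcount : 2 * (Finset.univ.filter fun i => ¬far i).card ≤ q) :
    ∃ B : ℝ≥0∞, B ≠ ∞ ∧ ∀ y y' : Fin q → ℝ, Monotone y → Monotone y' →
      ‖⟪M.evolve M.Ω (List.ofFn y), M.evolve M.Ω (List.ofFn y')⟫_ℂ‖ₑ
        ≤ B * markedChains F (2 * q) (Sum.elim far far) (Sum.elim y y') := by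
  classical
  obtain ⟨B, hB, h⟩ := hF.exists_enorm_moment_le (2 * q) (2 * q)
  refine ⟨B, hB, fun y y' hy hy' => ?_⟩
  obtain ⟨e, χ, hmono, heq⟩ := M.exists_merge hy hy'
  rw [← heq]
  set w₀ : Fin q ⊕ Fin q → ℕ := fun x => if Sum.elim far far x then 0 else 1 with hw₀
  set w : ℕ → ℕ := fun m => if h : m < 2 * q then w₀ (e ⟨m, h⟩) else 0 with hw
  have hwe : ∀ i : Fin (2 * q), w i = w₀ (e i) := fun i => by simp [hw]
  have hone : ∑ i, (if far i then 0 else 1) = (Finset.univ.filter fun i => ¬far i).card := by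
    rw [Finset.card_filter]
    exact Finset.sum_congr rfl fun i _ => by by_cases hi : far i <;> simp [hi]
  -- The two copies carry the same marks, so the proportion of marked times is preserved by
  -- doubling.
  have hsum : ∑ k ∈ Finset.Ico 0 (2 * q), w k
      = 2 * (Finset.univ.filter fun i => ¬far i).card := by
    rw [Nat.Ico_zero_eq_range, ← Fin.sum_univ_eq_sum_range]
    simp_rw [hwe]
    rw [e.sum_comp w₀, Fintype.sum_sum_type, two_mul, ← hone]
    congr 1 <;> exact Finset.sum_congr rfl fun i _ => by
      by_cases hi : far i <;> simp [hw₀, hi]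
  refine h (far := Sum.elim far far) (by simp [two_mul]) hmono χ (w := w) (fun i hi => ?_)
    (by omega) (by omega) (by omega)
  rw [hwe]
  exact if_neg hi

end Model

end VanHove

end

noncomputable section

namespace VanHove

/-! ### Splitting the times between the two sides of a moment -/

section Split

open scoped ENNReal

/-- Fubini's theorem for a splitting of the variables. -/
theorem lintegral_pi_sum {α β ι : Type*} [Fintype α] [Fintype β] [Fintype ι] (e : α ⊕ β ≃ ι)
    (μ : ι → Measure ℝ) [∀ i, SigmaFinite (μ i)] {f : (ι → ℝ) → ℝ≥0∞} (hf : Measurable f) :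
    ∫⁻ z, f z ∂Measure.pi μ
      = ∫⁻ w : β → ℝ, ∫⁻ y : α → ℝ, f (Sum.elim y w ∘ e.symm)
          ∂Measure.pi (fun a => μ (e (Sum.inl a))) ∂Measure.pi fun b => μ (e (Sum.inr b)) := by
  have h1 := measurePreserving_piCongrLeft μ e
  have h2 := measurePreserving_sumPiEquivProdPi_symm fun x => μ (e x)
  rw [← h1.lintegral_comp hf, ← h2.lintegral_comp (f := fun z => f (MeasurableEquiv.piCongrLeft (fun _ => ℝ) e z))
    (hf.comp h1.measurable)]
  refine (lintegral_prod_symm' _ ((hf.comp h1.measurable).comp h2.measurable)).trans ?_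
  refine lintegral_congr fun w => lintegral_congr fun y => ?_
  refine congrArg f (?_ : MeasurableEquiv.piCongrLeft (fun _ => ℝ) e
    ((MeasurableEquiv.sumPiEquivProdPi fun _ : α ⊕ β => ℝ).symm (y, w)) = _)
  have h3 : (MeasurableEquiv.sumPiEquivProdPi fun _ : α ⊕ β => ℝ).symm (y, w) = Sum.elim y w := by
    ext x
    rcases x with x | x <;> rfl
  ext i
  conv_lhs => rw [← e.apply_symm_apply i]
  refine (Equiv.piCongrLeft_apply_apply (fun _ => ℝ) e _ _).trans ?_
  rw [h3]
  rfl

theorem measurable_markedChains {F : ℝ → ℝ≥0∞} (hF : Measurable F) {ι : Type*} [Fintype ι] (N : ℕ)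
    (far : ι → Prop) : Measurable (markedChains F N far) := by
  classical
  refine Finset.measurable_sum _ fun c _ => Finset.measurable_sum _ fun e _ => ?_
  split_ifs
  · exact (measurable_chain (fun _ => hF) _ _).comp (measurable_comp_equiv e)
  · exact measurable_const

/-- One of the two sides has, with the last time, at least as many late as early times. -/
theorem exists_side_count {k : ℕ} (hk : 1 ≤ k) (χ : ℕ → Bool) {j : ℕ} (hj : j < 2 * k + 2) :
    ∃ c : Bool, 2 * ((Finset.range (2 * k + 2)).filter fun i =>
        (j ≤ i ∧ Function.update χ (2 * k + 1) c i = c) ∧ i < k + 2).card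
      ≤ ((Finset.range (2 * k + 2)).filter fun i =>
        j ≤ i ∧ Function.update χ (2 * k + 1) c i = c).card ∧
      0 < ((Finset.range (2 * k + 2)).filter fun i =>
        j ≤ i ∧ Function.update χ (2 * k + 1) c i = c).card := by
  have hupd : ∀ c, ∀ i ∈ Finset.range (2 * k + 1), Function.update χ (2 * k + 1) c i = χ i :=
    fun c i hi => Function.update_of_ne (Finset.mem_range.1 hi).ne _ _
  have hr : ∀ c, ((Finset.range (2 * k + 2)).filter fun i =>
        (j ≤ i ∧ Function.update χ (2 * k + 1) c i = c) ∧ i < k + 2).card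
      = ((Finset.range (2 * k + 1)).filter fun i => (j ≤ i ∧ i < k + 2) ∧ χ i = c).card := by
    intro c
    rw [Finset.range_add_one, Finset.filter_insert, if_neg (by omega)]
    congr 1
    refine Finset.filter_congr fun i hi => ?_
    rw [hupd c i hi]
    tauto
  have ht : ∀ c, ((Finset.range (2 * k + 2)).filter fun i =>
        j ≤ i ∧ Function.update χ (2 * k + 1) c i = c).card
      = ((Finset.range (2 * k + 1)).filter fun i => j ≤ i ∧ χ i = c).card + 1 := by
    intro c
    rw [Finset.range_add_one, Finset.filter_insert,
      if_pos ⟨by omega, by simp⟩, Finset.card_insert_of_notMem (by simp)]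
    congr 2
    refine Finset.filter_congr fun i hi => ?_
    rw [hupd c i hi]
  have hadd : ∀ p : ℕ → Prop, ∀ [DecidablePred p],
      ((Finset.range (2 * k + 1)).filter fun i => p i ∧ χ i = true).card
        + ((Finset.range (2 * k + 1)).filter fun i => p i ∧ χ i = false).card
        = ((Finset.range (2 * k + 1)).filter p).card := by
    intro p _
    rw [← Finset.filter_filter, ← Finset.filter_filter,
      ← Finset.card_filter_add_card_filter_not (s := (Finset.range (2 * k + 1)).filter p)
        (fun i => χ i = true)]
    simp
  have h1 : ((Finset.range (2 * k + 1)).filter fun i => j ≤ i ∧ i < k + 2).card ≤ k + 2 - j := by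
    rw [← Nat.card_Ico]
    refine Finset.card_le_card fun i hi => ?_
    rw [Finset.mem_filter] at hi
    exact Finset.mem_Ico.2 hi.2
  have h2 : ((Finset.range (2 * k + 1)).filter fun i => j ≤ i).card = 2 * k + 1 - j := by
    rw [← Nat.card_Ico]
    congr 1
    ext i
    simp [and_comm]
  have h3 := hadd (fun i => j ≤ i ∧ i < k + 2)
  have h4 := hadd (fun i => j ≤ i)
  have h0 : ∀ c, 0 < ((Finset.range (2 * k + 2)).filter fun i =>
        j ≤ i ∧ Function.update χ (2 * k + 1) c i = c).card := fun c => by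
    rw [ht]; omega
  -- If both sides failed, adding the two strict inequalities would give, for `j ≤ k + 2`, `(2k + 1
  -- - j) + 4 ≤ 2(k + 2 - j)`, which is impossible; beyond that no early time is left. Counting the
  -- last time on either side as desired is essential: the `+ 1` of each side closes the gap.
  by_contra! hcon
  have ha : ∀ c, ((Finset.range (2 * k + 1)).filter fun i => j ≤ i ∧ χ i = c).card + 1
      < 2 * ((Finset.range (2 * k + 1)).filter fun i => (j ≤ i ∧ i < k + 2) ∧ χ i = c).card := by
    intro c
    by_contra! hle
    have := hcon c (by rw [hr, ht]; exact hle)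
    have := h0 c
    omega
  have hat := ha true
  have haf := ha false
  omega

end Split

namespace Model

open scoped ENNReal

variable {S R : Type*} [NormedAddCommGroup S] [InnerProductSpace ℂ S]
  [FiniteDimensional ℂ S] [NormedAddCommGroup R] [InnerProductSpace ℂ R] [CompleteSpace R]
  {M : Model S R} {F : ℝ → ℝ≥0∞} {C : ℝ}

theorem continuous_evolve_ofFn (M : Model S R) (q : ℕ) :
    Continuous fun y : Fin q → ℝ => M.evolve M.Ω (List.ofFn y) := by
  have h : ∀ y : Fin q → ℝ, List.ofFn y = side (fun _ => true) (ext y) true 0 q := fun y => by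
    rw [side_ext _ _ _ (Nat.zero_le q), List.filter_eq_self.2 (by simp), List.ofFn_eq_map]
  simp_rw [h]
  exact M.continuous_evolve_side (fun i => continuous_ext i) _ _ _ (Nat.zero_le q)

/-- The average over time-ordered families, at least half of them marked, of an evolved state is
small in the weak sense. -/
theorem IsMajorant.exists_lintegral_inner_evolve_mul_le (hF : M.IsMajorant F C) (q : ℕ)
    (hq : 0 < q) (far : Fin q → Prop) [DecidablePred far]
    (hcount : 2 * (Finset.univ.filter fun i => ¬far i).card ≤ q) :
    ∃ K : ℝ≥0∞, K ≠ ∞ ∧ ∀ (μ : Fin q → Measure ℝ) [∀ i, IsFiniteMeasure (μ i)],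
      (∀ i, μ i ≤ volume) → ∀ b : Fin q → ℝ≥0∞, (∀ i, μ i univ ≤ b i) → (∀ i, 1 ≤ b i) →
      ∀ r : ℝ≥0∞, (∀ i, far i → r ^ 2 ≤ b i) → ∀ ξ : R,
      (∫⁻ y in {y | StrictMono y}, ‖⟪ξ, M.evolve M.Ω (List.ofFn y)⟫_ℂ‖ₑ ∂Measure.pi μ) * r
        ≤ K * ‖ξ‖ₑ * ∏ i, b i := by
  obtain ⟨B, hB, hin⟩ := hF.exists_enorm_inner_evolve_le q hq far hcount
  obtain ⟨K, hK, hmc⟩ := exists_lintegral_markedChains_mul_le hF.measurable hF.even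
    hF.lintegral_ne_top (Fin q ⊕ Fin q) (2 * q) (Sum.elim far far)
  refine ⟨max (B * K) 1, by finiteness, fun μ _ hμ b hb hb1 r hr ξ => ?_⟩
  set ν := (Measure.pi μ).restrict {y : Fin q → ℝ | StrictMono y} with hν
  have hη : Integrable (fun y : Fin q → ℝ => M.evolve M.Ω (List.ofFn y)) ν := by
    refine Integrable.of_bound (M.continuous_evolve_ofFn q).aestronglyMeasurable
      (‖M.V‖ ^ q * ‖M.Ω‖) (Eventually.of_forall fun y => ?_)
    simpa using M.norm_evolve_le M.Ω (List.ofFn y)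
  have h1 := lintegral_enorm_inner_sq_le hη ξ
  have h2 : ∫⁻ y, ∫⁻ y', ‖⟪M.evolve M.Ω (List.ofFn y), M.evolve M.Ω (List.ofFn y')⟫_ℂ‖ₑ ∂ν ∂ν
      ≤ B * ∫⁻ u, markedChains F (2 * q) (Sum.elim far far) u
        ∂Measure.pi fun x => μ (Sum.elim id id x) := by
    have hmm := measurable_markedChains hF.measurable (2 * q) (Sum.elim far far)
    have h3 : ∫⁻ y, ∫⁻ y', ‖⟪M.evolve M.Ω (List.ofFn y), M.evolve M.Ω (List.ofFn y')⟫_ℂ‖ₑ ∂ν ∂ν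
        ≤ ∫⁻ y, ∫⁻ y', B * markedChains F (2 * q) (Sum.elim far far) (Sum.elim y y') ∂ν ∂ν := by
      refine setLIntegral_mono' (measurableSet_strictMono q) fun y hy => ?_
      refine setLIntegral_mono' (measurableSet_strictMono q) fun y' hy' => ?_
      exact hin y y' (StrictMono.monotone hy) (StrictMono.monotone hy')
    -- Once the correlation is bounded by marked chains, the order of the times is no longer needed,
    -- and the pair `(y, y')` becomes a single family indexed by the disjoint union.
    have h4 : ∫⁻ y, ∫⁻ y', B * markedChains F (2 * q) (Sum.elim far far) (Sum.elim y y') ∂ν ∂ν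
        ≤ ∫⁻ y, ∫⁻ y', B * markedChains F (2 * q) (Sum.elim far far) (Sum.elim y y')
          ∂Measure.pi μ ∂Measure.pi μ :=
      (lintegral_mono' Measure.restrict_le_self fun y =>
        lintegral_mono' Measure.restrict_le_self fun y' => le_rfl)
    refine h3.trans (h4.trans (le_of_eq ?_))
    have hm : Measurable fun p : (Fin q → ℝ) × (Fin q → ℝ) =>
        B * markedChains F (2 * q) (Sum.elim far far) (Sum.elim p.2 p.1) := by
      refine measurable_const.mul (hmm.comp (measurable_pi_lambda _ fun x => ?_))
      rcases x with x | x
      · exact (measurable_pi_apply x).comp measurable_snd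
      · exact (measurable_pi_apply x).comp measurable_fst
    rw [← lintegral_const_mul _ hmm,
      lintegral_pi_sum (Equiv.refl (Fin q ⊕ Fin q)) _ (hmm.const_mul B),
      lintegral_lintegral_swap]
    · rfl
    · exact (hm.comp measurable_swap).aemeasurable
  set P := ∏ i, b i with hP
  set X := ∫⁻ y, ‖⟪ξ, M.evolve M.Ω (List.ofFn y)⟫_ℂ‖ₑ ∂ν with hX
  have h5 : (∫⁻ u, markedChains F (2 * q) (Sum.elim far far) u
      ∂Measure.pi fun x => μ (Sum.elim id id x)) * r ^ 2 ≤ K * (P * P) := by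
    have := hmc (fun x => μ (Sum.elim id id x)) (fun x => hμ _) (fun x => b (Sum.elim id id x))
      (fun x => hb _) (fun x => hb1 _) (r ^ 2) (fun x hx => by
        rcases x with x | x
        · exact hr x hx
        · exact hr x hx)
    rwa [Fintype.prod_sum_type] at this
  -- Cauchy–Schwarz produces `B * K` under a square root; the bound `B * K ≤ max (B * K) 1 ^ 2`
  -- makes it a perfect square. The doubled family has gained `r ^ 2`, the single one gains `r`.
  have h6 : (X * r) ^ 2 ≤ (max (B * K) 1 * ‖ξ‖ₑ * P) ^ 2 := by
    calc (X * r) ^ 2 = X ^ 2 * r ^ 2 := mul_pow _ _ _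
      _ ≤ (‖ξ‖ₑ ^ 2 * (B * ∫⁻ u, markedChains F (2 * q) (Sum.elim far far) u
        ∂Measure.pi fun x => μ (Sum.elim id id x))) * r ^ 2 := by
          gcongr
          exact h1.trans (by gcongr)
      _ = ‖ξ‖ₑ ^ 2 * B * ((∫⁻ u, markedChains F (2 * q) (Sum.elim far far) u
        ∂Measure.pi fun x => μ (Sum.elim id id x)) * r ^ 2) := by ring
      _ ≤ ‖ξ‖ₑ ^ 2 * B * (K * (P * P)) := by gcongr
      _ = (B * K) * (‖ξ‖ₑ * P) ^ 2 := by ring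
      _ ≤ (max (B * K) 1) ^ 2 * (‖ξ‖ₑ * P) ^ 2 := by
          gcongr
          calc B * K ≤ max (B * K) 1 := le_max_left _ _
            _ ≤ _ := by
              rw [sq]
              exact le_mul_of_one_le_left zero_le (le_max_right _ _)
      _ = _ := by ring
  exact (ENNReal.pow_le_pow_left_iff two_ne_zero).1 h6

/-- The latest operator acts last on its side, hence stands next to the inner product and can be
moved to the other side by self-adjointness. -/
theorem moment_update_last (M : Model S R) (χ : ℕ → Bool) (z : ℕ → ℝ) (c : Bool) {j b : ℕ}
    (h : j ≤ b) : M.moment (Function.update χ b c) z j (b + 1) = M.moment χ z j (b + 1) := by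
  have hs : ∀ c', side (Function.update χ b c) z c' j b = side χ z c' j b := fun c' =>
    side_congr c' (fun i _ hi => Function.update_of_ne hi.ne _ _) fun _ _ _ => rfl
  simp only [moment, side_succ _ _ _ h, hs, Function.update_self]
  cases c <;> cases χ b <;> simp [evolve_append_singleton, inner_Vt]

/-- The average over ordered times of a moment is small if the last times are spread out. -/
theorem IsMajorant.exists_lintegral_moment_mul_le (hF : M.IsMajorant F C) {k : ℕ} (hk : 1 ≤ k)
    (χ : ℕ → Bool) {j : ℕ} (hj : j < 2 * k + 2) :
    ∃ K : ℝ≥0∞, K ≠ ∞ ∧ ∀ (μ : Fin (2 * k + 2) → Measure ℝ) [∀ i, IsFiniteMeasure (μ i)],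
      (∀ i, μ i ≤ volume) → ∀ b : Fin (2 * k + 2) → ℝ≥0∞, (∀ i, μ i univ ≤ b i) →
      (∀ i, 1 ≤ b i) → ∀ r : ℝ≥0∞, (∀ i : Fin (2 * k + 2), k + 2 ≤ (i : ℕ) → r ^ 2 ≤ b i) →
      (∫⁻ z in {z | StrictMono z}, ‖M.moment χ (ext z) j (2 * k + 2)‖ₑ ∂Measure.pi μ) * r
        ≤ K * ∏ i, b i := by
  -- The side to be averaged is the one with enough late times; `l` lists its times and `lc` those
  -- of the other side.
  obtain ⟨c, hcount, hpos⟩ := exists_side_count hk χ hj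
  set χ' := Function.update χ (2 * k + 1) c with hχ'
  set p : Bool → Fin (2 * k + 2) → Bool := fun c' i => decide (j ≤ (i : ℕ) ∧ χ' i = c') with hp
  set l := (List.finRange (2 * k + 2)).filter (p c) with hl
  set lc := (List.finRange (2 * k + 2)).filter (p (!c)) with hlc
  have hnd : l.Nodup := (List.nodup_finRange _).filter _
  have hmem : ∀ i, i ∈ l ↔ (j ≤ (i : ℕ) ∧ χ' i = c) := fun i => by simp [hl, hp]
  have hmemc : ∀ i, i ∈ lc → i ∉ l := fun i hi => by
    rw [hmem]
    simp only [hlc, hp, List.mem_filter, decide_eq_true_eq] at hi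
    rw [hi.2.2]
    simp
  have hget : StrictMono l.get := by
    have h1 : l.Pairwise (· < ·) := (List.pairwise_lt_finRange _).filter _
    exact fun a b hab => List.pairwise_iff_get.1 h1 a b hab
  have htoF : l.toFinset = Finset.univ.filter fun i : Fin (2 * k + 2) => j ≤ (i : ℕ) ∧ χ' i = c := by
    ext i
    rw [List.mem_toFinset, hmem]
    simp
  have hcard : ∀ P : ℕ → Prop, ∀ [DecidablePred P],
      (Finset.univ.filter fun i : Fin (2 * k + 2) => P i).card
        = ((Finset.range (2 * k + 2)).filter P).card := by
    intro P _
    rw [Finset.card_filter, Finset.card_filter,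
      Fin.sum_univ_eq_sum_range (fun i => if P i then 1 else 0)]
  have hlen : l.length = ((Finset.range (2 * k + 2)).filter fun i => j ≤ i ∧ χ' i = c).card := by
    rw [← List.toFinset_card_of_nodup hnd, htoF, hcard fun i => j ≤ i ∧ χ' i = c]
  have hnear : (Finset.univ.filter fun i : Fin l.length => ¬k + 2 ≤ ((l.get i : Fin _) : ℕ)).card
      ≤ ((Finset.range (2 * k + 2)).filter fun i => (j ≤ i ∧ χ' i = c) ∧ i < k + 2).card := by
    rw [← hcard fun i => (j ≤ i ∧ χ' i = c) ∧ i < k + 2]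
    refine Finset.card_le_card_of_injOn l.get (fun i hi => ?_) (hget.injective.injOn)
    simp only [Finset.coe_filter, Finset.mem_univ, true_and, mem_ofPred_eq] at hi ⊢
    exact ⟨(hmem _).1 (l.get_mem i), by omega⟩
  obtain ⟨K, hK, hmain⟩ := hF.exists_lintegral_inner_evolve_mul_le l.length (by rwa [hlen])
    (fun i => k + 2 ≤ ((l.get i : Fin _) : ℕ)) (by omega)
  set e : Fin l.length ⊕ {x // ¬x ∈ l} ≃ Fin (2 * k + 2) :=
    (Equiv.sumCongr (hnd.getEquiv l) (Equiv.refl _)).trans (Equiv.sumCompl (· ∈ l)) with he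
  have hel : ∀ i, e (Sum.inl i) = l.get i := fun i => rfl
  have hsymm : ∀ i, e.symm (l.get i) = Sum.inl i := fun i => by rw [← hel, e.symm_apply_apply]
  have her : ∀ x, e (Sum.inr x) = x := fun x => rfl
  set V := ENNReal.ofReal (‖M.V‖ ^ lc.length * ‖M.Ω‖) with hV
  refine ⟨K * V, by finiteness, fun μ _ hμ b hb hb1 r hr => ?_⟩
  have hz : ∀ (y : Fin l.length → ℝ) (w : {x // ¬x ∈ l} → ℝ),
      l.map (Sum.elim y w ∘ e.symm) = List.ofFn y := fun y w => by
    have h1 : ∀ f : Fin (2 * k + 2) → ℝ, l.map f = List.ofFn (f ∘ l.get) := fun f => by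
      rw [← List.map_ofFn, List.ofFn_get]
    rw [h1]
    congr 1
    ext i
    change Sum.elim y w (e.symm (l.get i)) = y i
    rw [hsymm]
    rfl
  have hzc : ∀ (y y' : Fin l.length → ℝ) (w : {x // ¬x ∈ l} → ℝ),
      lc.map (Sum.elim y w ∘ e.symm) = lc.map (Sum.elim y' w ∘ e.symm) := fun y y' w => by
    refine List.map_congr_left fun i hi => ?_
    have h1 := her ⟨i, hmemc i hi⟩
    simp only at h1
    rw [Function.comp_apply, Function.comp_apply, ← h1]
    simp
  -- The vector of the other side depends only on the variables `w` that are frozen; the value `0`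
  -- given to the variables in `l` is immaterial.
  set ξ : ({x // ¬x ∈ l} → ℝ) → R := fun w =>
    M.evolve M.Ω (lc.map (Sum.elim 0 w ∘ e.symm)) with hξ
  have hξn : ∀ w, ‖ξ w‖ₑ ≤ V := fun w => by
    rw [← ofReal_norm]
    refine ENNReal.ofReal_le_ofReal ((M.norm_evolve_le _ _).trans (le_of_eq ?_))
    rw [List.length_map]
  have hmom : ∀ y w, ‖M.moment χ (ext (Sum.elim y w ∘ e.symm)) j (2 * k + 2)‖ₑ
      = ‖⟪ξ w, M.evolve M.Ω (List.ofFn y)⟫_ℂ‖ₑ := by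
    intro y w
    rw [← M.moment_update_last χ _ c (show j ≤ 2 * k + 1 by omega), moment,
      side_ext _ _ _ (by omega), side_ext _ _ _ (by omega)]
    have e1 : M.evolve M.Ω (List.map (Sum.elim y w ∘ e.symm)
        ((List.finRange (2 * k + 2)).filter (p c))) = M.evolve M.Ω (List.ofFn y) := by
      rw [← hz y w]
    have e2 : M.evolve M.Ω (List.map (Sum.elim y w ∘ e.symm)
        ((List.finRange (2 * k + 2)).filter (p (!c)))) = ξ w := by
      rw [hξ]
      simp only
      rw [← hzc y 0 w]
    change ‖⟪M.evolve M.Ω (List.map _ (List.filter (p true) _)),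
      M.evolve M.Ω (List.map _ (List.filter (p false) _))⟫_ℂ‖ₑ = _
    rcases Bool.eq_false_or_eq_true c with hc | hc
    swap
    · rw [hc] at e1 e2
      rw [show (!false) = true from rfl] at e2
      exact congrArg _ (congrArg₂ _ e2 e1)
    · rw [hc] at e1 e2
      rw [show (!true) = false from rfl] at e2
      rw [← inner_conj_symm, RCLike.enorm_conj]
      exact congrArg _ (congrArg₂ _ e2 e1)
  have hfm : Measurable fun z : Fin (2 * k + 2) → ℝ => ‖M.moment χ (ext z) j (2 * k + 2)‖ₑ :=
    (M.continuous_moment (fun i => continuous_ext i) χ hj.le).measurable.enorm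
  rw [← lintegral_indicator (measurableSet_strictMono _),
    lintegral_pi_sum e μ (hfm.indicator (measurableSet_strictMono _))]
  refine (lintegral_mul_const_le _ _).trans ?_
  have hw : ∀ w : {x // ¬x ∈ l} → ℝ, (∫⁻ y : Fin l.length → ℝ, indicator {z | StrictMono z}
        (fun z => ‖M.moment χ (ext z) j (2 * k + 2)‖ₑ) (Sum.elim y w ∘ e.symm)
          ∂Measure.pi fun a => μ (e (Sum.inl a))) * r
      ≤ K * V * ∏ i, b (e (Sum.inl i)) := by
    intro w
    refine le_trans ?_ ((hmain (fun a => μ (e (Sum.inl a))) (fun _ => hμ _)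
      (fun a => b (e (Sum.inl a))) (fun _ => hb _) (fun _ => hb1 _) r (fun i hi => hr _ hi)
      (ξ w)).trans ?_)
    · refine mul_le_mul_left ?_ r
      rw [← lintegral_indicator (measurableSet_strictMono _)]
      refine lintegral_mono fun y => ?_
      by_cases hs : StrictMono (Sum.elim y w ∘ e.symm)
      · have hy : StrictMono y := by
          have h1 : y = (Sum.elim y w ∘ e.symm) ∘ l.get := by
            ext i
            change y i = Sum.elim y w (e.symm (l.get i))
            rw [hsymm]
            rfl
          rw [h1]
          exact hs.comp hget
        rw [indicator_of_mem (s := {z : Fin (2 * k + 2) → ℝ | StrictMono z}) hs,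
          indicator_of_mem (s := {z : Fin l.length → ℝ | StrictMono z}) hy, hmom]
      · rw [indicator_of_notMem (s := {z : Fin (2 * k + 2) → ℝ | StrictMono z}) hs]
        exact zero_le
    · gcongr
      exact hξn w
  refine (lintegral_mono hw).trans ?_
  rw [lintegral_const, Measure.pi_univ, ← e.prod_comp b, Fintype.prod_sum_type, mul_assoc]
  gcongr
  exact hb _

end Model

end VanHove

end

noncomputable section

namespace VanHove

namespace Model

open scoped ENNReal

variable {S R : Type*} [NormedAddCommGroup S] [InnerProductSpace ℂ S]
  [FiniteDimensional ℂ S] [NormedAddCommGroup R] [InnerProductSpace ℂ R] [CompleteSpace R]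

/-! ## The dependence on the first time -/

section FirstTime

variable (M : Model S R)

theorem side_not (χ : ℕ → Bool) (z : ℕ → ℝ) (c : Bool) (j b : ℕ) :
    side (fun i => !χ i) z c j b = side χ z (!c) j b := by
  simp only [side, Bool.not_eq_eq_eq_not]

theorem moment_not (χ : ℕ → Bool) (z : ℕ → ℝ) (j b : ℕ) :
    M.moment (fun i => !χ i) z j b = (starRingEnd ℂ) (M.moment χ z j b) := by
  rw [moment, moment, inner_conj_symm, side_not, side_not]
  rfl

theorem conn_not (χ : ℕ → Bool) (z : ℕ → ℝ) (j b : ℕ) :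
    M.conn (fun i => !χ i) z j b = (starRingEnd ℂ) (M.conn χ z j b) := by
  induction b using Nat.strong_induction_on with
  | _ b ih =>
    rw [conn_eq, conn_eq, map_sub, map_sum, moment_not]
    congr 1
    refine Finset.sum_congr rfl fun i hi => ?_
    rw [ih i (Finset.mem_Ioo.1 hi).2, moment_not, map_mul]

theorem exists_evolve_side_update {χ : ℕ → Bool} (hχ : χ 0 = false) (z : ℕ → ℝ) {b : ℕ}
    (hb : 1 ≤ b) : ∃ v : R, ‖v‖ ≤ (1 + ‖M.V‖) ^ b ∧
      ∀ x, M.evolve M.Ω (side χ (Function.update z 0 x) true 0 b) = v := by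
  have h1 : (1 : ℝ) ≤ 1 + ‖M.V‖ := by linarith [norm_nonneg M.V]
  induction b, hb using Nat.le_induction with
  | base =>
    refine ⟨M.Ω, by rw [M.norm_Ω]; exact one_le_pow₀ h1, fun x => ?_⟩
    rw [show (1 : ℕ) = 0 + 1 from rfl, side_succ _ _ _ le_rfl, side_self, hχ]
    rfl
  | succ b hb ih =>
    obtain ⟨v, hv, h⟩ := ih
    have hz : ∀ x, Function.update z 0 x b = z b := fun x =>
      Function.update_of_ne (by omega) _ _
    cases hc : χ b
    · refine ⟨v, hv.trans (pow_le_pow_right₀ h1 (Nat.le_succ b)), fun x => ?_⟩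
      rw [side_succ _ _ _ (Nat.zero_le b), hc, if_neg (by simp), List.append_nil, h]
    · refine ⟨M.Vt (z b) v, ?_, fun x => ?_⟩
      · refine (M.U.norm_heisenberg_apply_le _ _ _).trans ?_
        rw [pow_succ']
        exact mul_le_mul (by linarith) hv (norm_nonneg _) (by linarith)
      · rw [side_succ _ _ _ (Nat.zero_le b), hc, if_pos rfl, evolve_append_singleton, h, hz]

/-- The operators that act after `V(x)` are moved one by one to the other argument by
self-adjointness, until `V(x) Ω` stands alone. -/
theorem exists_inner_evolve_side_update {χ : ℕ → Bool} (hχ : χ 0 = false) (z : ℕ → ℝ) {b : ℕ}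
    (hb : 1 ≤ b) (w : R) : ∃ μ : R, ‖μ‖ ≤ (1 + ‖M.V‖) ^ b * ‖w‖ ∧
      ∀ x, ⟪w, M.evolve M.Ω (side χ (Function.update z 0 x) false 0 b)⟫_ℂ
        = ⟪μ, M.Vt x M.Ω⟫_ℂ := by
  have h1 : (1 : ℝ) ≤ 1 + ‖M.V‖ := by linarith [norm_nonneg M.V]
  induction b, hb using Nat.le_induction generalizing w with
  | base =>
    refine ⟨w, le_mul_of_one_le_left (norm_nonneg _) (one_le_pow₀ h1), fun x => ?_⟩
    rw [show (1 : ℕ) = 0 + 1 from rfl, side_succ _ _ _ le_rfl, side_self, hχ,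
      Function.update_self]
    rfl
  | succ b hb ih =>
    have hz : ∀ x, Function.update z 0 x b = z b := fun x =>
      Function.update_of_ne (by omega) _ _
    cases hc : χ b
    · obtain ⟨μ, hμ, h⟩ := ih (M.Vt (z b) w)
      refine ⟨μ, hμ.trans ?_, fun x => ?_⟩
      · rw [pow_succ, mul_assoc]
        refine mul_le_mul_of_nonneg_left ?_ (by positivity)
        refine (M.U.norm_heisenberg_apply_le _ _ _).trans ?_
        exact mul_le_mul_of_nonneg_right (by linarith) (norm_nonneg _)
      · rw [side_succ _ _ _ (Nat.zero_le b), hc, if_pos rfl, evolve_append_singleton, hz,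
          ← inner_Vt, h]
    · obtain ⟨μ, hμ, h⟩ := ih w
      refine ⟨μ, hμ.trans ?_, fun x => ?_⟩
      · exact mul_le_mul_of_nonneg_right (pow_le_pow_right₀ h1 (Nat.le_succ b)) (norm_nonneg _)
      · rw [side_succ _ _ _ (Nat.zero_le b), hc, if_neg (by simp), List.append_nil, h]

/-- The connected correlation function is linear in `V(z₀)Ω`. -/
theorem exists_conn_update_eq (N : ℕ) : ∃ B : ℝ, 0 ≤ B ∧ ∀ χ : ℕ → Bool, χ 0 = false →
    ∀ (z : ℕ → ℝ) (b : ℕ), 1 ≤ b → b ≤ N → ∃ ζ : R, ‖ζ‖ ≤ B ∧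
      ∀ x, M.conn χ (Function.update z 0 x) 0 b = ⟪ζ, M.Vt x M.Ω⟫_ℂ := by
  induction N with
  | zero => exact ⟨0, le_rfl, fun χ _ z b h1 h2 => by omega⟩
  | succ N ih =>
    obtain ⟨B, hB, ih⟩ := ih
    obtain ⟨B', hB', hm⟩ := M.exists_norm_moment_le (N + 1)
    set A := (1 + ‖M.V‖) ^ (N + 1) with hA
    refine ⟨max B (A * A + (N + 1) * (B' * B)), le_max_of_le_left hB,
      fun χ hχ z b hb1 hb => ?_⟩
    rcases hb.lt_or_eq with hb | rfl
    · obtain ⟨ζ, hζ, h⟩ := ih χ hχ z b hb1 (by omega)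
      exact ⟨ζ, hζ.trans (le_max_left _ _), h⟩
    obtain ⟨v, hv, hv'⟩ := M.exists_evolve_side_update hχ z hb1
    obtain ⟨μ, hμ, hμ'⟩ := M.exists_inner_evolve_side_update hχ z hb1 v
    have hex : ∀ i, ∃ ζ : R, i ∈ Finset.Ioo 0 (N + 1) → ‖ζ‖ ≤ B ∧
        ∀ x, M.conn χ (Function.update z 0 x) 0 i = ⟪ζ, M.Vt x M.Ω⟫_ℂ := by
      intro i
      by_cases hi : i ∈ Finset.Ioo 0 (N + 1)
      · obtain ⟨ζ, h⟩ := ih χ hχ z i (Finset.mem_Ioo.1 hi).1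
          (Nat.lt_succ_iff.1 (Finset.mem_Ioo.1 hi).2)
        exact ⟨ζ, fun _ => h⟩
      · exact ⟨0, fun h => absurd h hi⟩
    choose ζ hζ using hex
    refine ⟨μ - ∑ i ∈ Finset.Ioo 0 (N + 1),
      (starRingEnd ℂ) (M.moment χ z i (N + 1)) • ζ i, ?_, fun x => ?_⟩
    · refine le_max_of_le_right ((norm_sub_le _ _).trans (add_le_add ?_ ?_))
      · exact hμ.trans (mul_le_mul_of_nonneg_left hv (by positivity))
      · refine (norm_sum_le_of_le _ (n := fun _ => B' * B) fun i hi => ?_).trans ?_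
        · rw [norm_smul, RCLike.norm_conj]
          exact mul_le_mul (hm _ _ _ _ (Finset.mem_Ioo.1 hi).2.le le_rfl) (hζ i hi).1
            (norm_nonneg _) hB'
        · rw [Finset.sum_const, nsmul_eq_mul, Nat.card_Ioo]
          gcongr
          exact_mod_cast (by omega : N + 1 - 0 - 1 ≤ N + 1)
    · rw [conn_eq, inner_sub_left, sum_inner, moment, hv', hμ']
      congr 1
      refine Finset.sum_congr rfl fun i hi => ?_
      rw [inner_smul_left, Complex.conj_conj, (hζ i hi).2, mul_comm]
      congr 1
      refine M.moment_congr (fun _ _ _ => rfl) fun k hk _ => Function.update_of_ne ?_ _ _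
      have := (Finset.mem_Ioo.1 hi).1
      omega

/-- If the first time is marked `true`, all marks are exchanged, which conjugates the correlation
and preserves its norm. -/
theorem exists_enorm_conn_update_eq (N : ℕ) : ∃ B : ℝ, 0 ≤ B ∧ ∀ (χ : ℕ → Bool) (z : ℕ → ℝ)
    (b : ℕ), 1 ≤ b → b ≤ N → ∃ ζ : R, ‖ζ‖ ≤ B ∧
      ∀ x, ‖M.conn χ (Function.update z 0 x) 0 b‖ₑ = ‖⟪ζ, M.Vt x M.Ω⟫_ℂ‖ₑ := by
  obtain ⟨B, hB, h⟩ := M.exists_conn_update_eq N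
  refine ⟨B, hB, fun χ z b h1 h2 => ?_⟩
  cases hc : χ 0
  · obtain ⟨ζ, hζ, h3⟩ := h χ hc z b h1 h2
    exact ⟨ζ, hζ, fun x => by rw [h3]⟩
  · obtain ⟨ζ, hζ, h3⟩ := h (fun i => !χ i) (by simp [hc]) z b h1 h2
    refine ⟨ζ, hζ, fun x => ?_⟩
    rw [← h3, conn_not, RCLike.enorm_conj]

end FirstTime

variable {M : Model S R} {F : ℝ → ℝ≥0∞} {C : ℝ}

/-- The correlations of the vectors `V(x) Ω` are `φ(x - x')`, so the double integral in the
Cauchy–Schwarz inequality is of order `T`, and the weak average of order `√T`. -/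
theorem IsMajorant.lintegral_inner_Vt_le (hF : M.IsMajorant F C) (ζ : R) {T : ℝ} (hT : 0 ≤ T) :
    ∫⁻ x in Ioo 0 (2 * T), ‖⟪ζ, M.Vt x M.Ω⟫_ℂ‖ₑ
      ≤ max (2 * ∫⁻ s, F s) 1 * ‖ζ‖ₑ * ENNReal.ofReal √T := by
  have hc : Continuous fun x => M.Vt x M.Ω :=
    (M.U.isBoundedFamily_heisenberg M.V).continuous M.Ω
  have hi : Integrable (fun x => M.Vt x M.Ω) (volume.restrict (Ioo 0 (2 * T))) :=
    Integrable.of_bound hc.aestronglyMeasurable (‖M.V‖ * ‖M.Ω‖)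
      (Eventually.of_forall fun x => M.U.norm_heisenberg_apply_le _ _ _)
  have h1 := lintegral_enorm_inner_sq_le hi ζ
  have hr : ENNReal.ofReal √T ^ 2 = ENNReal.ofReal T := by
    rw [← ENNReal.ofReal_pow (Real.sqrt_nonneg T), Real.sq_sqrt hT]
  have h2 : ∫⁻ y in Ioo 0 (2 * T), ∫⁻ y' in Ioo 0 (2 * T), ‖⟪M.Vt y M.Ω, M.Vt y' M.Ω⟫_ℂ‖ₑ
      ≤ 2 * (∫⁻ s, F s) * ENNReal.ofReal √T ^ 2 := by
    have h3 : ∀ y : ℝ, ∫⁻ y' in Ioo 0 (2 * T), ‖⟪M.Vt y M.Ω, M.Vt y' M.Ω⟫_ℂ‖ₑ ≤ ∫⁻ s, F s := by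
      intro y
      calc _ ≤ ∫⁻ y' in Ioo 0 (2 * T), F (y - y') := lintegral_mono fun y' => by
            rw [inner_Vt_Vt]; exact hF.enorm_φ_le _
        _ ≤ ∫⁻ y', F (y - y') := lintegral_mono' Measure.restrict_le_self le_rfl
        _ = ∫⁻ s, F s := lintegral_sub_left_eq_self F y
    refine (lintegral_mono h3).trans ?_
    rw [setLIntegral_const, Real.volume_Ioo, sub_zero, hr, ENNReal.ofReal_mul zero_le_two]
    simp only [ENNReal.ofReal_ofNat]
    exact le_of_eq (by ring)
  refine (ENNReal.pow_le_pow_left_iff two_ne_zero).1 (h1.trans ?_)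
  calc _ ≤ ‖ζ‖ₑ ^ 2 * (2 * (∫⁻ s, F s) * ENNReal.ofReal √T ^ 2) := by gcongr
    _ = (2 * ∫⁻ s, F s) * (‖ζ‖ₑ * ENNReal.ofReal √T) ^ 2 := by ring
    _ ≤ max (2 * ∫⁻ s, F s) 1 ^ 2 * (‖ζ‖ₑ * ENNReal.ofReal √T) ^ 2 := by
        gcongr
        refine (le_max_left _ 1).trans ?_
        rw [sq]
        exact le_mul_of_one_le_left zero_le (le_max_right _ _)
    _ = _ := by ring

/-! ## Clustered times -/

/-- The sequences in which `k + 2` consecutive times, starting with `z_a`, are at distance at most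
`D` from each other. -/
def clustered (k : ℕ) (D : ℝ) (a : ℕ) : Set (Fin (2 * k + 2) → ℝ) :=
  {z | ∀ i ∈ Finset.range (k + 1), |ext z (a + i) - ext z (a + i + 1)| ≤ D}

theorem measurableSet_clustered (k : ℕ) (D : ℝ) (a : ℕ) : MeasurableSet (clustered k D a) := by
  have : clustered k D a = ⋂ i ∈ Finset.range (k + 1),
      {z : Fin (2 * k + 2) → ℝ | |ext z (a + i) - ext z (a + i + 1)| ≤ D} := by
    ext z; simp [clustered]
  rw [this]
  refine Finset.measurableSet_biInter _ fun i _ => ?_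
  exact (isClosed_le (by fun_prop) continuous_const).measurableSet

theorem clustered_add {k : ℕ} {D : ℝ} {a : ℕ} (ha : a ≤ k) (z : Fin (2 * k + 2) → ℝ) (x : ℝ) :
    (fun i => z i + x) ∈ clustered k D a ↔ z ∈ clustered k D a := by
  simp only [clustered, mem_ofPred_eq]
  refine forall₂_congr fun i hi => ?_
  rw [Finset.mem_range] at hi
  rw [ext_add_of_lt _ _ (by omega), ext_add_of_lt _ _ (by omega), add_sub_add_right_eq_sub]

/-- A long chain of ordered times without clusters has a long link. -/
theorem exists_long_link {k : ℕ} {δ : ℝ} {z : Fin (2 * k + 2) → ℝ} (hz : Monotone z)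
    (hoff : ∀ a ≤ k, z ∉ clustered k ((k + 1) * δ) a) (p : Equiv.Perm (Fin (2 * k + 2))) :
    ∃ l ∈ Finset.range (k + 1), δ < |ext (z ∘ p) l - ext (z ∘ p) (l + 1)| := by
  by_contra! hcon
  -- If no link were longer than `δ`, all the `k + 2` points visited by the chain would lie within
  -- `(k + 1)δ` of each other.
  have hdist : ∀ i m, i + m ≤ k + 1 → |ext (z ∘ p) i - ext (z ∘ p) (i + m)| ≤ m * δ := by
    intro i m
    induction m with
    | zero => simp
    | succ m ih =>
      intro h
      have h1 := ih (by omega)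
      have h2 := hcon (i + m) (Finset.mem_range.2 (by omega))
      push_cast
      calc _ ≤ |ext (z ∘ p) i - ext (z ∘ p) (i + m)|
            + |ext (z ∘ p) (i + m) - ext (z ∘ p) (i + (m + 1))| := abs_sub_le _ _ _
        _ ≤ m * δ + δ := add_le_add h1 h2
        _ = _ := by ring
  have hδ : 0 ≤ δ := (abs_nonneg _).trans (hcon 0 (by simp))
  have hdist' : ∀ i m : Fin (2 * k + 2), (i : ℕ) ≤ k + 1 → (m : ℕ) ≤ k + 1 →
      z (p i) - z (p m) ≤ (k + 1) * δ := by
    have key : ∀ i m : ℕ, i ≤ m → m ≤ k + 1 →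
        |ext (z ∘ p) i - ext (z ∘ p) m| ≤ (k + 1) * δ := by
      intro i m him hm
      have h := hdist i (m - i) (by omega)
      rw [Nat.add_sub_cancel' him] at h
      refine h.trans (mul_le_mul_of_nonneg_right ?_ hδ)
      exact_mod_cast (by omega : m - i ≤ k + 1)
    intro i m hi hm
    have e1 : z (p i) = ext (z ∘ p) i := (ext_val (z ∘ p) i).symm
    have e2 : z (p m) = ext (z ∘ p) m := (ext_val (z ∘ p) m).symm
    rw [e1, e2]
    rcases le_total (i : ℕ) m with h | h
    · exact (le_abs_self _).trans (key _ _ h hm)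
    · rw [← neg_sub]
      exact (neg_le_abs _).trans (key _ _ h hi)
  -- The `k + 2` visited indices force `max - min ≥ k + 1`. By monotonicity the consecutive times
  -- from the smallest index on then form a cluster, and the smallest index is at most `k`.
  set s : Finset (Fin (2 * k + 2)) :=
    (Finset.Iic (⟨k + 1, by omega⟩ : Fin (2 * k + 2))).image p with hs
  have hcard : s.card = k + 2 := by
    rw [hs, Finset.card_image_of_injective _ p.injective, Fin.card_Iic]
  have hne : s.Nonempty := Finset.card_pos.1 (by omega)
  have hsub : s ⊆ Finset.Icc (s.min' hne) (s.max' hne) := fun x hx =>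
    Finset.mem_Icc.2 ⟨s.min'_le x hx, s.le_max' x hx⟩
  have hle := Finset.card_le_card hsub
  rw [hcard, Fin.card_Icc] at hle
  have hspan : z (s.max' hne) - z (s.min' hne) ≤ (k + 1) * δ := by
    have h1 := s.max'_mem hne
    have h2 := s.min'_mem hne
    simp only [hs, Finset.mem_image, Finset.mem_Iic, Fin.le_def] at h1 h2
    obtain ⟨i, hi, hi'⟩ := h1
    obtain ⟨m, hm, hm'⟩ := h2
    rw [← hi', ← hm']
    exact hdist' i m hi hm
  have hmax := (s.max' hne).2
  refine hoff (s.min' hne) (by omega) fun i hi => ?_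
  rw [Finset.mem_range] at hi
  rw [ext_apply _ (by omega), ext_apply _ (by omega), abs_sub_comm, abs_of_nonneg]
  · have h1 : z ⟨s.min' hne + i + 1, by omega⟩ ≤ z (s.max' hne) :=
      hz (Fin.le_def.2 (by simp only; omega))
    have h2 : z (s.min' hne) ≤ z ⟨s.min' hne + i, by omega⟩ :=
      hz (Fin.le_def.2 (by simp only; omega))
    linarith
  · exact sub_nonneg.2 (hz (Fin.le_def.2 (by simp only; omega)))

end Model

end VanHove

end

noncomputable section

namespace VanHove

/-! ### Spread and clustered contributions to the integrated correlations -/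

namespace Model

open scoped ENNReal

variable {S R : Type*} [NormedAddCommGroup S] [InnerProductSpace ℂ S]
  [FiniteDimensional ℂ S] [NormedAddCommGroup R] [InnerProductSpace ℂ R] [CompleteSpace R]
  {M : Model S R} {F : ℝ → ℝ≥0∞} {C : ℝ}

/-- The part of `connIntegral` from a set of times. -/
def connIntegralOn (M : Model S R) (χ : ℕ → Bool) (k : ℕ) (s : Set (Fin (2 * k + 2) → ℝ))
    (T : ℝ) : ℝ≥0∞ :=
  ∫⁻ z : Fin (2 * k + 1) → ℝ, (ordered (2 * k + 1) T).indicator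
    (s.indicator fun z => ‖M.conn χ (ext z) 0 (2 * k + 2)‖ₑ) (Fin.cons 0 z)

/-- The sequences without clusters. -/
def spread (k : ℕ) (D : ℝ) : Set (Fin (2 * k + 2) → ℝ) := ⋂ a ∈ Finset.range (k + 1), (clustered k D a)ᶜ

theorem measurableSet_spread (k : ℕ) (D : ℝ) : MeasurableSet (spread k D) :=
  Finset.measurableSet_biInter _ fun a _ => (measurableSet_clustered k D a).compl

theorem connIntegral_le (M : Model S R) (χ : ℕ → Bool) (k : ℕ) (D T : ℝ) :
    M.connIntegral χ (2 * k) T ≤ M.connIntegralOn χ k (spread k D) T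
      + ∑ a ∈ Finset.range (k + 1), M.connIntegralOn χ k (clustered k D a) T := by
  have hcons : Measurable fun z : Fin (2 * k + 1) → ℝ => (Fin.cons 0 z : Fin (2 * k + 2) → ℝ) := by
    refine measurable_pi_lambda _ fun i => ?_
    refine Fin.cases ?_ (fun i => ?_) i
    · exact measurable_const
    · exact measurable_pi_apply i
  have hm : ∀ s : Set (Fin (2 * k + 2) → ℝ), MeasurableSet s → Measurable
      fun z : Fin (2 * k + 1) → ℝ => (ordered (2 * k + 1) T).indicator
        (s.indicator fun z => ‖M.conn χ (ext z) 0 (2 * k + 2)‖ₑ) (Fin.cons 0 z) := fun s hs =>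
    (((M.measurable_enorm_conn χ (2 * k + 2)).indicator hs).indicator
      (measurableSet_ordered _ _)).comp hcons
  simp only [connIntegralOn]
  rw [← lintegral_finsetSum _ fun a _ => hm _ (measurableSet_clustered k D a),
    ← lintegral_add_left (hm _ (measurableSet_spread k D))]
  refine lintegral_mono fun z => ?_
  by_cases ho : (Fin.cons 0 z : Fin (2 * k + 1 + 1) → ℝ) ∈ ordered (2 * k + 1) T
  swap
  · rw [indicator_of_notMem ho]
    exact zero_le
  simp only [indicator_of_mem ho]
  by_cases hs : (Fin.cons 0 z : Fin (2 * k + 1 + 1) → ℝ) ∈ spread k D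
  · exact le_add_right (le_of_eq (indicator_of_mem (s := spread k D) hs
      fun z : Fin (2 * k + 2) → ℝ => ‖M.conn χ (ext z) 0 (2 * k + 2)‖ₑ).symm)
  · refine le_add_left ?_
    simp only [spread, mem_iInter, not_forall, mem_compl_iff, not_not] at hs
    obtain ⟨a, ha, hs⟩ := hs
    refine le_trans (le_of_eq ?_) (Finset.single_le_sum (fun _ _ => zero_le) ha)
    exact (indicator_of_mem (s := clustered k D a) hs
      fun z : Fin (2 * k + 2) → ℝ => ‖M.conn χ (ext z) 0 (2 * k + 2)‖ₑ).symm

theorem spread_add {k : ℕ} {D : ℝ} (z : Fin (2 * k + 2) → ℝ) (x : ℝ) :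
    (fun i => z i + x) ∈ spread k D ↔ z ∈ spread k D := by
  simp only [spread, mem_iInter, mem_compl_iff]
  refine forall₂_congr fun a ha => not_congr (clustered_add ?_ z x)
  rw [Finset.mem_range] at ha
  omega

theorem connIntegralOn_mul_le (M : Model S R) (χ : ℕ → Bool) {k : ℕ}
    {s : Set (Fin (2 * k + 2) → ℝ)} (hs : MeasurableSet s)
    (hadd : ∀ (z : Fin (2 * k + 2) → ℝ) x, (fun i => z i + x) ∈ s ↔ z ∈ s) (T L : ℝ)
    {I : Fin (2 * k + 2) → Set ℝ} (hI : ∀ i, MeasurableSet (I i))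
    (hsub : ∀ z ∈ ordered (2 * k + 1) T, z 0 ∈ Ioo 0 L → z ∈ s → ∀ i, z i ∈ I i) :
    M.connIntegralOn χ k s T * ENNReal.ofReal L
      ≤ ∫⁻ z in {z | StrictMono z}, s.indicator (fun z => ‖M.conn χ (ext z) 0 (2 * k + 2)‖ₑ) z
          ∂Measure.pi fun i => volume.restrict (I i) := by
  refine lintegral_ordered_mul_le ((M.measurable_enorm_conn χ (2 * k + 2)).indicator hs)
    (fun z x => ?_) T L hI fun z hz h0 hne => hsub z hz h0 (mem_of_indicator_ne_zero hne)
  by_cases hz : z ∈ s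
  · rw [indicator_of_mem hz, indicator_of_mem ((hadd z x).2 hz), conn_ext_add]
  · rw [indicator_of_notMem hz, indicator_of_notMem fun h => hz ((hadd z x).1 h)]

/-- Without clusters every chain has a link longer than `δ`, whose integral is a tail of that of
`F`. The bound has the same power of `T` as before, with a factor that is small uniformly in `T`;
`k` is fixed, so the number of permutations may be lost here. -/
theorem IsMajorant.connIntegralOn_spread_le (hF : M.IsMajorant F C) (χ : ℕ → Bool) (k : ℕ)
    (δ T : ℝ) : M.connIntegralOn χ k (spread k ((k + 1) * δ)) T * ENNReal.ofReal T
      ≤ ENNReal.ofReal (C ^ (2 * k + 2) / (2 * k / 2).factorial) *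
        ((2 * k + 2).factorial * ((k + 1) * ((∫⁻ s, {s | δ < |s|}.indicator F s)
          * (∫⁻ s, F s) ^ k * ENNReal.ofReal (2 * T) ^ (k + 1)))) := by
  -- In `G l₀` the link `l₀` is replaced by the tail of `F`. Which link is long depends on `z` and
  -- `p`, so the bound sums over all `l₀`.
  set G : ℕ → ℕ → ℝ → ℝ≥0∞ := fun l₀ l => if l = l₀ then {s | δ < |s|}.indicator F else F with hG
  have hδm : MeasurableSet {s : ℝ | δ < |s|} :=
    (isOpen_lt continuous_const continuous_abs).measurableSet
  have hGm : ∀ l₀ l, Measurable (G l₀ l) := fun l₀ l => by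
    simp only [hG]
    split_ifs
    · exact hF.measurable.indicator hδm
    · exact hF.measurable
  refine (M.connIntegralOn_mul_le χ (measurableSet_spread k _) spread_add T T
    (I := fun _ => Ioo 0 (2 * T)) (fun _ => measurableSet_Ioo)
    (fun z hz h0 _ i => two_mul T ▸ mem_Ioo_of_mem_ordered hz h0 i)).trans ?_
  have hpt : ∀ z : Fin (2 * k + 2) → ℝ, StrictMono z →
      (spread k ((k + 1) * δ)).indicator (fun z => ‖M.conn χ (ext z) 0 (2 * k + 2)‖ₑ) z
        ≤ ENNReal.ofReal (C ^ (2 * k + 2) / (2 * k / 2).factorial) *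
          ∑ p : Equiv.Perm (Fin (2 * k + 2)), ∑ l₀ ∈ Finset.range (k + 1),
            chain (G l₀) (k + 1) (z ∘ p) := by
    intro z hz
    by_cases hs : z ∈ spread k ((k + 1) * δ)
    swap
    · rw [indicator_of_notMem hs]
      exact zero_le
    rw [indicator_of_mem hs]
    refine (hF.enorm_conn_ext_le χ hz.monotone).trans ?_
    gcongr with p _
    have hoff : ∀ a ≤ k, z ∉ clustered k ((k + 1) * δ) a := fun a ha => by
      simp only [spread, mem_iInter, mem_compl_iff] at hs
      exact hs a (Finset.mem_range.2 (by omega))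
    obtain ⟨l₀, hl₀, hlong⟩ := exists_long_link hz.monotone hoff p
    refine le_trans (le_of_eq ?_) (Finset.single_le_sum (fun _ _ => zero_le) hl₀)
    rw [show (2 * k + 1) / 2 + 1 = k + 1 by omega]
    refine Finset.prod_congr rfl fun l _ => ?_
    simp only [hG]
    split_ifs with h
    · subst h
      rw [indicator_of_mem]
      exact hlong
    · rfl
  refine (setLIntegral_mono' (measurableSet_strictMono _) hpt).trans ?_
  refine (lintegral_mono' Measure.restrict_le_self le_rfl).trans ?_
  have hpm : ∀ (p : Equiv.Perm (Fin (2 * k + 2))) l₀, Measurable fun z : Fin (2 * k + 2) → ℝ =>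
      chain (G l₀) (k + 1) (z ∘ p) := fun p l₀ =>
    (measurable_chain (hGm l₀) _ _).comp (measurable_comp_equiv p)
  rw [lintegral_const_mul _ (Finset.measurable_sum _ fun p _ =>
    Finset.measurable_sum _ fun l₀ _ => hpm p l₀)]
  gcongr
  rw [lintegral_finsetSum _ fun p _ => Finset.measurable_sum _ fun l₀ _ => hpm p l₀]
  have hterm : ∀ (p : Equiv.Perm (Fin (2 * k + 2))), ∀ l₀ ∈ Finset.range (k + 1),
      ∫⁻ z, chain (G l₀) (k + 1) (z ∘ p) ∂Measure.pi (fun _ => volume.restrict (Ioo 0 (2 * T)))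
        ≤ (∫⁻ s, {s | δ < |s|}.indicator F s) * (∫⁻ s, F s) ^ k
          * ENNReal.ofReal (2 * T) ^ (k + 1) := by
    intro p l₀ hl₀
    refine (lintegral_chain_le_of_equiv (hGm l₀) (by omega) p _
      fun _ => Measure.restrict_le_self).trans ?_
    refine mul_le_mul' (le_of_eq ?_) (le_of_eq ?_)
    · rw [← Finset.mul_prod_erase _ _ hl₀, Finset.prod_congr rfl (g := fun _ => ∫⁻ s, F s),
        Finset.prod_const, Finset.card_erase_of_mem hl₀, Finset.card_range]
      · simp [hG]
      · intro l hl
        simp [hG, (Finset.mem_erase.1 hl).1]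
    · rw [Finset.prod_const, Measure.restrict_apply_univ, Real.volume_Ioo, sub_zero]
      congr 1
      have h : (Finset.univ.filter fun i : Fin (2 * k + 2) => k + 1 ≤ (i : ℕ))
          = Finset.Ici ⟨k + 1, by omega⟩ := by
        ext i
        simp [Fin.le_def]
      rw [h, Fin.card_Ici]
      simp only
      omega
  have hsum : ∀ p : Equiv.Perm (Fin (2 * k + 2)),
      ∫⁻ z, ∑ l₀ ∈ Finset.range (k + 1), chain (G l₀) (k + 1) (z ∘ p)
        ∂Measure.pi (fun _ => volume.restrict (Ioo 0 (2 * T)))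
      ≤ (k + 1) * ((∫⁻ s, {s | δ < |s|}.indicator F s) * (∫⁻ s, F s) ^ k
          * ENNReal.ofReal (2 * T) ^ (k + 1)) := by
    intro p
    rw [lintegral_finsetSum _ fun l₀ _ => hpm p l₀]
    refine (Finset.sum_le_sum (hterm p)).trans (le_of_eq ?_)
    rw [Finset.sum_const, Finset.card_range, nsmul_eq_mul]
    push_cast
    rfl
  refine (Finset.sum_le_sum fun p _ => hsum p).trans (le_of_eq ?_)
  rw [Finset.sum_const, Finset.card_univ, Fintype.card_perm, Fintype.card_fin, nsmul_eq_mul]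

/-- The cluster does not contain `z₀`, so the integral over `z₀` can be done first at fixed other
times; linearity in `V(z₀) Ω` makes it `O(√T)`. The cluster then removes `k + 1` of the other `2k +
1` times, leaving `Tᵏ`. -/
theorem IsMajorant.exists_connIntegralOn_clustered_succ_le (hF : M.IsMajorant F C) (χ : ℕ → Bool)
    (k : ℕ) (D : ℝ) {a : ℕ} (ha : a + 1 ≤ k) : ∃ K : ℝ≥0∞, K ≠ ∞ ∧ ∀ T, 0 ≤ T →
      M.connIntegralOn χ k (clustered k D (a + 1)) T * ENNReal.ofReal T
        ≤ K * ENNReal.ofReal T ^ k * ENNReal.ofReal √T := by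
  obtain ⟨B, hB, hlin⟩ := M.exists_enorm_conn_update_eq (2 * k + 2)
  set A := max (2 * ∫⁻ s, F s) 1 * ENNReal.ofReal B with hA
  have hAt : A ≠ ∞ := by
    have := hF.lintegral_ne_top
    finiteness
  -- The indicator of a bounded link lets the cluster condition be integrated as a chain.
  set J : ℝ → ℝ≥0∞ := {s | |s| ≤ D}.indicator fun _ => 1 with hJ
  have hJset : {s : ℝ | |s| ≤ D} = Icc (-D) D := by ext s; simp [abs_le]
  have hJm : Measurable J := measurable_const.indicator (by rw [hJset]; exact measurableSet_Icc)
  have hJi : ∫⁻ s, J s ≠ ∞ := by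
    rw [hJ, hJset, lintegral_indicator measurableSet_Icc, setLIntegral_const, Real.volume_Icc]
    finiteness
  refine ⟨A * ((∫⁻ s, J s) ^ (k + 1) * 2 ^ k), by finiteness, fun T hT => ?_⟩
  refine (M.connIntegralOn_mul_le χ (measurableSet_clustered k D (a + 1)) (clustered_add ha) T T
    (I := fun _ => Ioo 0 (2 * T)) (fun _ => measurableSet_Ioo)
    (fun z hz h0 _ i => two_mul T ▸ mem_Ioo_of_mem_ordered hz h0 i)).trans ?_
  refine (lintegral_mono' Measure.restrict_le_self le_rfl).trans ?_
  rw [lintegral_pi_succ _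
    ((M.measurable_enorm_conn χ (2 * k + 2)).indicator (measurableSet_clustered k D (a + 1)))]
  -- The enumeration starts with the `k + 2` clustered times. Their indices start at `a` rather than
  -- `a + 1`, because `z₀` has been removed.
  obtain ⟨e, he⟩ := exists_equiv_of_injOn (ι := Fin (2 * k + 1)) (Fintype.card_fin _) (c := k + 2)
    (q := fun l => if h : a + l < 2 * k + 1 then ⟨a + l, h⟩ else 0) fun x hx y hy hxy => by
      rw [mem_Iio] at hx hy
      simp only at hxy
      rw [dif_pos (by omega), dif_pos (by omega), Fin.mk.injEq] at hxy
      omega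
  have hext : ∀ (z : Fin (2 * k + 1) → ℝ) l, l < k + 2 → ext (z ∘ e) l = ext z (a + l) := by
    intro z l hl
    rw [ext_apply _ (show l < 2 * k + 1 by omega), ext_apply _ (show a + l < 2 * k + 1 by omega),
      Function.comp_apply, he _ hl, dif_pos (show a + l < 2 * k + 1 by omega)]
  have hinner : ∀ z : Fin (2 * k + 1) → ℝ, ∫⁻ x in Ioo 0 (2 * T),
      (clustered k D (a + 1)).indicator (fun z => ‖M.conn χ (ext z) 0 (2 * k + 2)‖ₑ)
        (Fin.cons x z : Fin (2 * k + 2) → ℝ)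
      ≤ A * ENNReal.ofReal √T * chain (fun _ => J) (k + 1) (z ∘ e) := by
    intro z
    by_cases hz : ∀ l ∈ Finset.range (k + 1), |ext z (a + l) - ext z (a + l + 1)| ≤ D
    · have hch : chain (fun _ => J) (k + 1) (z ∘ e) = 1 := by
        refine Finset.prod_eq_one fun l hl => ?_
        have h1 := hz l hl
        rw [Finset.mem_range] at hl
        rw [hext _ _ (by omega), hext _ _ (by omega)]
        exact indicator_of_mem (s := {s : ℝ | |s| ≤ D}) h1 _
      obtain ⟨ζ, hζ, hζ'⟩ := hlin χ (ext (Fin.cons 0 z : Fin (2 * k + 2) → ℝ)) (2 * k + 2)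
        (by omega) le_rfl
      have hupd : ∀ x : ℝ, ext (Fin.cons x z : Fin (2 * k + 2) → ℝ)
          = Function.update (ext (Fin.cons 0 z : Fin (2 * k + 2) → ℝ)) 0 x := by
        intro x
        ext i
        rcases i with _ | i
        · rw [Function.update_self, ext_cons_zero]
        · rw [Function.update_of_ne (Nat.succ_ne_zero i), ext_cons_succ, ext_cons_succ]
      rw [hch, mul_one]
      calc _ ≤ ∫⁻ x in Ioo 0 (2 * T), ‖⟪ζ, M.Vt x M.Ω⟫_ℂ‖ₑ := lintegral_mono fun x => by
            refine (indicator_le_self _ _ _).trans (le_of_eq ?_)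
            rw [hupd, hζ']
        _ ≤ max (2 * ∫⁻ s, F s) 1 * ‖ζ‖ₑ * ENNReal.ofReal √T := hF.lintegral_inner_Vt_le ζ hT
        _ ≤ _ := by
            rw [hA]
            gcongr
            rw [← ofReal_norm]
            exact ENNReal.ofReal_le_ofReal hζ
    · have h0 : ∀ x : ℝ, (Fin.cons x z : Fin (2 * k + 2) → ℝ) ∉ clustered k D (a + 1) := by
        intro x h
        refine hz fun l hl => ?_
        have h1 := h l hl
        rw [add_right_comm, ext_cons_succ, ext_cons_succ] at h1
        exact h1
      simp only [indicator_of_notMem (h0 _), lintegral_zero]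
      exact zero_le
  refine (lintegral_mono hinner).trans ?_
  have hJm' : ∀ l : ℕ, Measurable ((fun _ => J) l) := fun _ => hJm
  have hcm : Measurable fun z : Fin (2 * k + 1) → ℝ => chain (fun _ => J) (k + 1) (z ∘ e) :=
    (measurable_chain hJm' _ _).comp (measurable_comp_equiv e)
  rw [lintegral_const_mul _ hcm]
  have h1 := lintegral_chain_le_of_equiv hJm' (show k + 1 < 2 * k + 1 by omega) e
    (fun _ => volume.restrict (Ioo 0 (2 * T))) fun _ => Measure.restrict_le_self
  have h2 : (Finset.univ.filter fun i : Fin (2 * k + 1) => k + 1 ≤ (i : ℕ)).card = k := by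
    have h : (Finset.univ.filter fun i : Fin (2 * k + 1) => k + 1 ≤ (i : ℕ))
        = Finset.Ici ⟨k + 1, by omega⟩ := by
      ext i
      simp [Fin.le_def]
    rw [h, Fin.card_Ici]
    simp only
    omega
  rw [Finset.prod_const, Finset.prod_const, h2, Finset.card_range, Measure.restrict_apply_univ,
    Real.volume_Ioo, sub_zero, ENNReal.ofReal_mul zero_le_two, mul_pow] at h1
  simp only [ENNReal.ofReal_ofNat] at h1
  calc _ ≤ A * ENNReal.ofReal √T * ((∫⁻ s, J s) ^ (k + 1) * (2 ^ k * ENNReal.ofReal T ^ k)) := by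
        gcongr
    _ = _ := by ring

/-- The times `z₀, …, z_{k+1}` stay in a bounded interval, and only the `k` later ones range over a
length of order `T`, which gives `Tᵏ`. The extra `√T` comes from the moments into which the
connected correlation is expanded, each of which has a side where late times are not outnumbered. -/
theorem IsMajorant.exists_connIntegralOn_clustered_zero_le (hF : M.IsMajorant F C) (χ : ℕ → Bool)
    {k : ℕ} (hk : 1 ≤ k) {D : ℝ} (hD : 0 ≤ D) : ∃ K : ℝ≥0∞, K ≠ ∞ ∧ ∀ T, 1 ≤ T →
      M.connIntegralOn χ k (clustered k D 0) T * ENNReal.ofReal √T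
        ≤ K * ENNReal.ofReal T ^ k := by
  obtain ⟨Bc, hBc, hconn⟩ := M.exists_norm_conn_le (2 * k + 2)
  have hex : ∀ j : ℕ, ∃ K : ℝ≥0∞, j < 2 * k + 2 → K ≠ ∞ ∧
      ∀ (μ : Fin (2 * k + 2) → Measure ℝ) [∀ i, IsFiniteMeasure (μ i)],
      (∀ i, μ i ≤ volume) → ∀ b : Fin (2 * k + 2) → ℝ≥0∞, (∀ i, μ i univ ≤ b i) →
      (∀ i, 1 ≤ b i) → ∀ r : ℝ≥0∞, (∀ i : Fin (2 * k + 2), k + 2 ≤ (i : ℕ) → r ^ 2 ≤ b i) →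
      (∫⁻ z in {z | StrictMono z}, ‖M.moment χ (ext z) j (2 * k + 2)‖ₑ ∂Measure.pi μ) * r
        ≤ K * ∏ i, b i := by
    intro j
    by_cases hj : j < 2 * k + 2
    · obtain ⟨K, hK⟩ := hF.exists_lintegral_moment_mul_le hk χ hj
      exact ⟨K, fun _ => hK⟩
    · exact ⟨0, fun h => absurd h hj⟩
  choose K hK using hex
  -- Averaging is over `z₀ ∈ (0, 1)`, and the `k + 1` gaps of the cluster are at most `D`; so the
  -- early times lie in `(0, E)`.
  set E : ℝ := 1 + (k + 1) * D with hE
  have hE1 : 1 ≤ E := by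
    have : 0 ≤ (k + 1) * D := by positivity
    linarith
  refine ⟨(∑ j ∈ Finset.range (2 * k + 2), (1 + ENNReal.ofReal Bc) * K j)
    * (ENNReal.ofReal E ^ (k + 2) * 2 ^ k), ?_, fun T hT => ?_⟩
  · have : ∑ j ∈ Finset.range (2 * k + 2), (1 + ENNReal.ofReal Bc) * K j ≠ ∞ :=
      ENNReal.sum_ne_top.2 fun j hj => by
        have := (hK j (Finset.mem_range.1 hj)).1
        finiteness
    finiteness
  set I : Fin (2 * k + 2) → Set ℝ := fun i => if (i : ℕ) < k + 2 then Ioo 0 E else Ioo 0 (T + 1)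
    with hI
  have hIm : ∀ i, MeasurableSet (I i) := fun i => by
    simp only [hI]
    split_ifs <;> exact measurableSet_Ioo
  have h0 := M.connIntegralOn_mul_le χ (measurableSet_clustered k D 0) (clustered_add (Nat.zero_le k))
    T 1 hIm (fun z hz hz0 hcl i => by
      simp only [hI]
      have hall := mem_Ioo_of_mem_ordered hz hz0 i
      split_ifs with hi
      swap
      · exact hall
      refine ⟨hall.1, ?_⟩
      have hstep : ∀ m : ℕ, m ≤ k + 1 → ext z m ≤ z 0 + m * D := by
        intro m
        induction m with
        | zero =>
          intro _
          rw [ext_apply _ (show 0 < 2 * k + 2 by omega)]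
          simp
        | succ m ih =>
          intro hm
          have h1 := hcl m (Finset.mem_range.2 (by omega))
          rw [zero_add] at h1
          have h2 := (abs_le.1 h1).1
          have h3 := ih (by omega)
          push_cast
          linarith
      have h1 := hstep i (by omega)
      rw [ext_val] at h1
      have h2 : (i : ℝ) * D ≤ (k + 1) * D := by
        gcongr
        exact_mod_cast (by omega : (i : ℕ) ≤ k + 1)
      have h3 := hz0.2
      simp only [hE]
      linarith)
  rw [ENNReal.ofReal_one, mul_one] at h0
  set μ : Fin (2 * k + 2) → Measure ℝ := fun i => volume.restrict (I i) with hμ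
  -- For `T ≥ 1` the interval `(0, T + 1)` of a late time has length at most `2T`, and `2T` also
  -- dominates `(√T)²`.
  set b : Fin (2 * k + 2) → ℝ≥0∞ := fun i =>
    if (i : ℕ) < k + 2 then ENNReal.ofReal E else ENNReal.ofReal (2 * T) with hb
  have hμb : ∀ i, μ i univ ≤ b i := fun i => by
    simp only [hμ, hb, hI, Measure.restrict_apply_univ]
    split_ifs <;> rw [Real.volume_Ioo, sub_zero]
    exact ENNReal.ofReal_le_ofReal (by linarith)
  have : ∀ i, IsFiniteMeasure (μ i) := fun i => ⟨lt_of_le_of_lt (hμb i) (by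
    simp only [hb]
    split_ifs <;> exact ENNReal.ofReal_lt_top)⟩
  have hb1 : ∀ i, 1 ≤ b i := fun i => by
    simp only [hb]
    split_ifs <;> rw [← ENNReal.ofReal_one] <;> exact ENNReal.ofReal_le_ofReal (by linarith)
  have hr : ∀ i : Fin (2 * k + 2), k + 2 ≤ (i : ℕ) → ENNReal.ofReal √T ^ 2 ≤ b i := fun i hi => by
    simp only [hb]
    rw [if_neg (by omega), ← ENNReal.ofReal_pow (Real.sqrt_nonneg T),
      Real.sq_sqrt (by linarith)]
    exact ENNReal.ofReal_le_ofReal (by linarith)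
  have hprod : ∏ i, b i = ENNReal.ofReal E ^ (k + 2) * (2 ^ k * ENNReal.ofReal T ^ k) := by
    simp only [hb]
    rw [Fin.prod_univ_eq_prod_range
      (fun i => if i < k + 2 then ENNReal.ofReal E else ENNReal.ofReal (2 * T)) (2 * k + 2),
      show 2 * k + 2 = (k + 2) + k by ring, Finset.prod_range_add,
      Finset.prod_congr rfl (g := fun _ => ENNReal.ofReal E) fun i hi => if_pos (Finset.mem_range.1 hi),
      Finset.prod_congr (s₂ := Finset.range k) rfl (g := fun _ => ENNReal.ofReal (2 * T))
        fun i hi => if_neg (by omega),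
      Finset.prod_const, Finset.prod_const, Finset.card_range, Finset.card_range,
      ENNReal.ofReal_mul zero_le_two, mul_pow]
    simp only [ENNReal.ofReal_ofNat]
  have hmm : ∀ j ∈ Finset.range (2 * k + 2), Measurable fun z : Fin (2 * k + 2) → ℝ =>
      (1 + ENNReal.ofReal Bc) * ‖M.moment χ (ext z) j (2 * k + 2)‖ₑ := fun j hj =>
    (M.continuous_moment (fun i => continuous_ext i) χ
      (Finset.mem_range.1 hj).le).measurable.enorm.const_mul _
  -- The recursion writes the connected correlation as moments of final segments `j ≤ · < 2k + 2`
  -- with bounded coefficients: `1` for `j = 0`, and at most `Bc` otherwise.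
  have hpt : ∀ z : Fin (2 * k + 2) → ℝ,
      (clustered k D 0).indicator (fun z => ‖M.conn χ (ext z) 0 (2 * k + 2)‖ₑ) z
        ≤ ∑ j ∈ Finset.range (2 * k + 2),
          (1 + ENNReal.ofReal Bc) * ‖M.moment χ (ext z) j (2 * k + 2)‖ₑ := by
    intro z
    refine (indicator_le_self _ _ _).trans ?_
    rw [conn_eq]
    refine (enorm_sub_le).trans ?_
    rw [Finset.sum_range_eq_add_Ico _ (by omega)]
    refine add_le_add (le_mul_of_one_le_left zero_le le_self_add) ?_
    refine (enorm_sum_le _ _).trans ?_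
    have hIoo : Finset.Ioo 0 (2 * k + 2) = Finset.Ico 1 (2 * k + 2) := by
      ext i
      simp only [Finset.mem_Ioo, Finset.mem_Ico]
      omega
    rw [hIoo]
    refine Finset.sum_le_sum fun i hi => ?_
    rw [enorm_mul]
    gcongr
    refine le_add_left ?_
    rw [← ofReal_norm]
    exact ENNReal.ofReal_le_ofReal (hconn _ _ _ _ (Nat.zero_le i) (Finset.mem_Ico.1 hi).2.le)
  calc _ ≤ (∫⁻ z in {z | StrictMono z}, ∑ j ∈ Finset.range (2 * k + 2),
          (1 + ENNReal.ofReal Bc) * ‖M.moment χ (ext z) j (2 * k + 2)‖ₑ ∂Measure.pi μ)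
            * ENNReal.ofReal √T := by
        gcongr
        exact h0.trans (lintegral_mono hpt)
    _ = ∑ j ∈ Finset.range (2 * k + 2), (1 + ENNReal.ofReal Bc)
          * ((∫⁻ z in {z | StrictMono z}, ‖M.moment χ (ext z) j (2 * k + 2)‖ₑ ∂Measure.pi μ)
            * ENNReal.ofReal √T) := by
        rw [lintegral_finsetSum' _ fun j hj => (hmm j hj).aemeasurable, Finset.sum_mul]
        refine Finset.sum_congr rfl fun j hj => ?_
        rw [lintegral_const_mul _ (M.continuous_moment (fun i => continuous_ext i) χ
          (Finset.mem_range.1 hj).le).measurable.enorm, mul_assoc]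
    _ ≤ ∑ j ∈ Finset.range (2 * k + 2), (1 + ENNReal.ofReal Bc) * (K j * ∏ i, b i) := by
        refine Finset.sum_le_sum fun j hj => mul_le_mul_right ?_ _
        exact (hK j (Finset.mem_range.1 hj)).2 μ (fun i => Measure.restrict_le_self) b hμb hb1 _ hr
    _ = _ := by
        rw [hprod, Finset.sum_mul, Finset.sum_mul]
        exact Finset.sum_congr rfl fun j _ => by ring

/-- The contribution to `connIntegral` beyond its scaling behaviour vanishes in the limit. -/
theorem IsMajorant.tendsto_connIntegral (hF : M.IsMajorant F C) (χ : ℕ → Bool) {k : ℕ}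
    (hk : 1 ≤ k) :
    Tendsto (fun T => M.connIntegral χ (2 * k) T / ENNReal.ofReal T ^ k) atTop (𝓝 0) := by
  set A : ℝ≥0∞ := ENNReal.ofReal (C ^ (2 * k + 2) / (2 * k / 2).factorial) *
        ((2 * k + 2).factorial * ((k + 1) * ((∫⁻ s, F s) ^ k * 2 ^ (k + 1)))) with hA
  have hAt : A ≠ ∞ := by
    have := hF.lintegral_ne_top
    finiteness
  have htail : Tendsto (fun m : ℕ => A * ∫⁻ s, {s | (m : ℝ) < |s|}.indicator F s) atTop (𝓝 0) := by
    have h1 : Tendsto (fun m : ℕ => ∫⁻ s, {s | (m : ℝ) < |s|}.indicator F s) atTop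
        (𝓝 (∫⁻ _ : ℝ, 0)) := by
      refine tendsto_lintegral_of_dominated_convergence F (fun m => hF.measurable.indicator
        (isOpen_lt continuous_const continuous_abs).measurableSet)
        (fun m => Eventually.of_forall fun s => indicator_le_self _ _ _) hF.lintegral_ne_top
        (Eventually.of_forall fun s => ?_)
      refine tendsto_const_nhds.congr' ?_
      filter_upwards [eventually_ge_atTop ⌈|s|⌉₊] with m hm
      refine (indicator_of_notMem ?_ _).symm
      simp only [mem_ofPred_eq, not_lt]
      exact (Nat.le_ceil _).trans (by exact_mod_cast hm)
    rw [lintegral_zero] at h1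
    simpa using ENNReal.Tendsto.const_mul h1 (Or.inr hAt)
  rw [ENNReal.tendsto_nhds_zero] at htail ⊢
  intro ε hε
  -- The order of the choices matters: the link length `m`, and with it `D`, is fixed by the tail of
  -- `F`; only then is `T` sent to infinity, with constants for the clusters that depend on `D`.
  obtain ⟨m, hm⟩ := (htail (ε / 2) (ENNReal.half_pos hε.ne')).exists
  set D : ℝ := (k + 1) * m with hD
  have hcl : ∀ a, ∃ K : ℝ≥0∞, a ∈ Finset.range (k + 1) → K ≠ ∞ ∧ ∀ T, 1 ≤ T →
      M.connIntegralOn χ k (clustered k D a) T * ENNReal.ofReal √T ≤ K * ENNReal.ofReal T ^ k := by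
    intro a
    by_cases ha : a ∈ Finset.range (k + 1)
    swap
    · exact ⟨0, fun h => absurd h ha⟩
    rw [Finset.mem_range] at ha
    rcases a with _ | a
    · obtain ⟨K, hK, h⟩ := hF.exists_connIntegralOn_clustered_zero_le χ hk
        (show 0 ≤ D by positivity)
      exact ⟨K, fun _ => ⟨hK, h⟩⟩
    · obtain ⟨K, hK, h⟩ := hF.exists_connIntegralOn_clustered_succ_le χ k D (a := a) (by omega)
      refine ⟨K, fun _ => ⟨hK, fun T hT => ?_⟩⟩
      have h1 := h T (by linarith)
      have hs : ENNReal.ofReal T = ENNReal.ofReal √T * ENNReal.ofReal √T := by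
        rw [← ENNReal.ofReal_mul (Real.sqrt_nonneg T), Real.mul_self_sqrt (by linarith)]
      have hs0 : ENNReal.ofReal √T ≠ 0 := by
        rw [Ne, ENNReal.ofReal_eq_zero, not_le]
        exact Real.sqrt_pos.2 (by linarith)
      have h2 : M.connIntegralOn χ k (clustered k D (a + 1)) T * ENNReal.ofReal √T
          * ENNReal.ofReal √T ≤ K * ENNReal.ofReal T ^ k * ENNReal.ofReal √T := by
        rw [mul_assoc, ← hs]
        exact h1
      exact (ENNReal.mul_le_mul_iff_left hs0 ENNReal.ofReal_ne_top).1 h2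
  choose K hK using hcl
  set Ks := ∑ a ∈ Finset.range (k + 1), K a with hKs
  have hKst : Ks ≠ ∞ := ENNReal.sum_ne_top.2 fun a ha => (hK a ha).1
  have hlast : Tendsto (fun T : ℝ => Ks / ENNReal.ofReal √T) atTop (𝓝 0) := by
    have h1 : Tendsto (fun T : ℝ => ENNReal.ofReal √T) atTop (𝓝 ∞) :=
      ENNReal.tendsto_ofReal_atTop.comp Real.tendsto_sqrt_atTop
    simpa using ENNReal.Tendsto.const_div h1 (Or.inr hKst)
  rw [ENNReal.tendsto_nhds_zero] at hlast
  filter_upwards [hlast (ε / 2) (ENNReal.half_pos hε.ne'), eventually_ge_atTop 1] with T hT hT1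
  have hT0 : ENNReal.ofReal T ≠ 0 := by
    rw [Ne, ENNReal.ofReal_eq_zero, not_le]; linarith
  have hs0 : ENNReal.ofReal √T ≠ 0 := by
    rw [Ne, ENNReal.ofReal_eq_zero, not_le]
    exact Real.sqrt_pos.2 (by linarith)
  have hTk : ENNReal.ofReal T ^ k ≠ 0 := pow_ne_zero _ hT0
  have hTk' : ENNReal.ofReal T ^ k ≠ ∞ := ENNReal.pow_ne_top ENNReal.ofReal_ne_top
  rw [ENNReal.div_le_iff hTk hTk', ← ENNReal.add_halves ε, add_mul]
  refine (M.connIntegral_le χ k D T).trans (add_le_add ?_ ?_)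
  · have h1 := hF.connIntegralOn_spread_le χ k m T
    have h2 : M.connIntegralOn χ k (spread k D) T * ENNReal.ofReal T
        ≤ (A * ∫⁻ s, {s | (m : ℝ) < |s|}.indicator F s) * ENNReal.ofReal T ^ k
          * ENNReal.ofReal T := by
      refine h1.trans (le_of_eq ?_)
      rw [ENNReal.ofReal_mul zero_le_two, hA]
      simp only [ENNReal.ofReal_ofNat]
      ring
    refine ((ENNReal.mul_le_mul_iff_left hT0 ENNReal.ofReal_ne_top).1 h2).trans ?_
    gcongr
  · have h1 : ∀ a ∈ Finset.range (k + 1), M.connIntegralOn χ k (clustered k D a) T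
        ≤ K a * ENNReal.ofReal T ^ k / ENNReal.ofReal √T := fun a ha => by
      rw [ENNReal.le_div_iff_mul_le (Or.inl hs0) (Or.inl ENNReal.ofReal_ne_top)]
      exact (hK a ha).2 T hT1
    refine (Finset.sum_le_sum h1).trans ?_
    calc ∑ a ∈ Finset.range (k + 1), K a * ENNReal.ofReal T ^ k / ENNReal.ofReal √T
        = Ks / ENNReal.ofReal √T * ENNReal.ofReal T ^ k := by
          rw [hKs, div_eq_mul_inv, Finset.sum_mul, Finset.sum_mul]
          exact Finset.sum_congr rfl fun a _ => by rw [div_eq_mul_inv]; ring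
      _ ≤ _ := by gcongr

end Model

end VanHove

end

noncomputable section

namespace VanHove

open scoped ENNReal

/-! ## The Dyson series as integrals over ordered regions -/

section Simplex

theorem lintegral_pi_snoc {N : ℕ} {f : (Fin (N + 1) → ℝ) → ℝ≥0∞} (hf : Measurable f) :
    ∫⁻ z, f z = ∫⁻ s, ∫⁻ z' : Fin N → ℝ, f (Fin.snoc z' s) := by
  have h := (volume_preserving_piFinSuccAbove (fun _ : Fin (N + 1) => ℝ) (Fin.last N)).symm
  rw [← h.lintegral_comp hf]
  have hm : Measurable fun p : ℝ × (Fin N → ℝ) =>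
      f ((MeasurableEquiv.piFinSuccAbove (fun _ => ℝ) (Fin.last N)).symm p) :=
    hf.comp (MeasurableEquiv.measurable _)
  refine (lintegral_prod _ hm.aemeasurable).trans ?_
  refine lintegral_congr fun s => lintegral_congr fun z' => ?_
  congr 1
  exact Fin.insertNth_last' s z'

theorem snoc_mem_ordered {N : ℕ} {w : Fin (N + 1) → ℝ} {s t : ℝ} (hw : w ∈ ordered N s)
    (h0 : w 0 = 0) (hs : s < t) : (Fin.snoc w s : Fin (N + 2) → ℝ) ∈ ordered (N + 1) t := by
  obtain ⟨hm, hl⟩ := hw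
  rw [h0, zero_add] at hl
  have e0 : (Fin.snoc w s : Fin (N + 2) → ℝ) 0 = 0 := by
    rw [← h0]
    exact Fin.snoc_castSucc (α := fun _ => ℝ) s w 0
  refine ⟨fun i j hij => ?_, ?_⟩
  · induction i using Fin.lastCases with
    | last => exact absurd hij (Fin.le_last j).not_gt
    | cast i =>
      induction j using Fin.lastCases with
      | last =>
        rw [Fin.snoc_castSucc, Fin.snoc_last]
        exact (hm.monotone (Fin.le_last i)).trans_lt hl
      | cast j =>
        rw [Fin.snoc_castSucc, Fin.snoc_castSucc]
        exact hm (Fin.castSucc_lt_castSucc_iff.1 hij)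
  · rw [Fin.snoc_last, e0, zero_add]
    exact hs

theorem ordered_mono {N : ℕ} {T T' : ℝ} (h : T ≤ T') : ordered N T ⊆ ordered N T' :=
  fun z hz => ⟨hz.1, hz.2.trans_le (by linarith)⟩

/-- The induction step for the Dyson series: the outermost integration variable becomes the last
time of an ordered sequence that starts at `z₀ = 0`. -/
theorem enorm_integral_le_ordered {E : Type*} [NormedAddCommGroup E] [NormedSpace ℝ E] {N : ℕ}
    {g : ℝ → E} {G : (Fin (N + 2) → ℝ) → ℝ≥0∞} (hG : Measurable G) {c : ℝ≥0∞}
    (h : ∀ s, 0 < s → ‖g s‖ₑ ≤ c * ∫⁻ z : Fin N → ℝ,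
      (ordered N s).indicator (fun w => G (Fin.snoc w s)) (Fin.cons 0 z)) {T : ℝ} (hT : 0 < T) :
    ‖∫ s in (0 : ℝ)..T, g s‖ₑ
      ≤ c * ∫⁻ z : Fin (N + 1) → ℝ, (ordered (N + 1) T).indicator G (Fin.cons 0 z) := by
  have hm : Measurable fun z : Fin (N + 1) → ℝ =>
      (ordered (N + 1) T).indicator G (Fin.cons 0 z) :=
    (hG.indicator (measurableSet_ordered _ _)).comp (by fun_prop)
  rw [lintegral_pi_snoc hm, intervalIntegral.integral_of_le hT.le, integral_Ioc_eq_integral_Ioo]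
  refine (enorm_integral_le_lintegral_enorm _).trans ?_
  have hm' : Measurable fun s : ℝ => ∫⁻ z' : Fin N → ℝ,
      (ordered (N + 1) T).indicator G (Fin.cons 0 (Fin.snoc z' s : Fin (N + 1) → ℝ)) := by
    refine Measurable.lintegral_prod_right' (f := fun p : ℝ × (Fin N → ℝ) =>
      (ordered (N + 1) T).indicator G (Fin.cons 0 (Fin.snoc p.2 p.1 : Fin (N + 1) → ℝ)))
      (hm.comp ?_)
    refine measurable_pi_lambda _ fun i => ?_
    induction i using Fin.lastCases with
    | last => simpa only [Fin.snoc_last] using measurable_fst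
    | cast i =>
      simp only [Fin.snoc_castSucc]
      exact (measurable_pi_apply i).comp measurable_snd
  rw [← lintegral_const_mul _ hm']
  refine (setLIntegral_mono' measurableSet_Ioo fun s hs => (h s hs.1).trans ?_).trans
    (setLIntegral_le_lintegral _ _)
  gcongr with z'
  by_cases hz : (Fin.cons 0 z' : Fin (N + 1) → ℝ) ∈ ordered N s
  · rw [indicator_of_mem hz, Fin.cons_snoc_eq_snoc_cons, indicator_of_mem]
    exact snoc_mem_ordered hz rfl hs.2
  · rw [indicator_of_notMem hz]
    exact zero_le

end Simplex

namespace Model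

variable {S R : Type*} [NormedAddCommGroup S] [InnerProductSpace ℂ S]
  [FiniteDimensional ℂ S] [NormedAddCommGroup R] [InnerProductSpace ℂ R] [CompleteSpace R]
  (M : Model S R)

theorem iterQ_congr {z z' : ℕ → ℝ} (ρ : TraceClass (S ⊗[ℂ] R)) {N : ℕ}
    (h : ∀ i < N, z i = z' i) : M.iterQ z ρ N = M.iterQ z' ρ N := by
  induction N with
  | zero => rfl
  | succ N ih => rw [iterQ, iterQ, ih fun i hi => h i (hi.trans (Nat.lt_succ_self N)),
      h N (Nat.lt_succ_self N)]

theorem Q_iterQ (z : ℕ → ℝ) (ρ : TraceClass (S ⊗[ℂ] R)) (N : ℕ) :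
    M.Q (M.iterQ z ρ (N + 1)) = M.iterQ z ρ (N + 1) := M.Q_Q _

theorem isBoundedFamily_liouI : IsBoundedFamily M.liouI ‖M.liouSR‖ :=
  M.isC0Group_expFree.isBoundedFamily_interaction M.norm_expFree_le _

theorem continuous_iterQ {X : Type*} [TopologicalSpace X] {w : X → ℕ → ℝ}
    (hw : ∀ i, Continuous fun x => w x i) (ρ : TraceClass (S ⊗[ℂ] R)) (N : ℕ) :
    Continuous fun x => M.iterQ (w x) ρ N := by
  induction N with
  | zero => exact continuous_const
  | succ N ih => exact M.Q.continuous.comp (M.isBoundedFamily_liouI.continuous_apply (hw N) ih)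

/-- The perturbation `-iλ Q 𝓛(s) Q` in the interaction picture. -/
abbrev pertQ (lam : ℝ) : ℝ → TraceClass (S ⊗[ℂ] R) →L[ℂ] TraceClass (S ⊗[ℂ] R) :=
  interaction M.expFree ((-(Complex.I * (lam : ℂ))) • (M.Q ∘L M.liouSR ∘L M.Q))

theorem pertQ_apply (lam s : ℝ) (ρ : TraceClass (S ⊗[ℂ] R)) :
    M.pertQ lam s ρ = (-(Complex.I * (lam : ℂ))) • M.Q (M.liouI s (M.Q ρ)) := by
  simp only [pertQ, liouI, interaction, ContinuousLinearMap.comp_apply,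
    smul_apply, map_smul, Q_expFree]

theorem isBoundedFamily_pertQ (lam : ℝ) : IsBoundedFamily (M.pertQ lam)
    ‖(-(Complex.I * (lam : ℂ))) • (M.Q ∘L M.liouSR ∘L M.Q)‖ :=
  M.isC0Group_expFree.isBoundedFamily_interaction M.norm_expFree_le _

/-- The operator `Φ` is arbitrary so that the induction can absorb the outermost factors into it.
Norms are taken only after `Φ`, hence after the last projection `P`, has been applied; otherwise the
cancellations in the connected correlations would be lost. -/
theorem enorm_dyson_pertQ_le (lam : ℝ) (ρ : TraceClass (S ⊗[ℂ] R)) (n : ℕ)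
    (Φ : TraceClass (S ⊗[ℂ] R) →L[ℂ] TraceClass (S ⊗[ℂ] R)) {t : ℝ} (ht : 0 < t) :
    ‖Φ (dyson (M.pertQ lam) (M.Q (M.liouI 0 ρ)) n t)‖ₑ
      ≤ ‖lam‖ₑ ^ n * ∫⁻ z : Fin n → ℝ, (ordered n t).indicator
        (fun w => ‖Φ (M.iterQ (ext w) ρ (n + 1))‖ₑ) (Fin.cons 0 z) := by
  induction n generalizing Φ t with
  | zero =>
    rw [pow_zero, one_mul]
    have h : ∀ z : Fin 0 → ℝ, (ordered 0 t).indicator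
        (fun w => ‖Φ (M.iterQ (ext w) ρ (0 + 1))‖ₑ) (Fin.cons 0 z)
          = ‖Φ (M.Q (M.liouI 0 ρ))‖ₑ := fun z => by
      rw [indicator_of_mem]
      · simp [iterQ, ext]
      · refine ⟨fun i j hij => ?_, by simpa using ht⟩
        omega
    simp_rw [h]
    simp [dyson, volume_pi]
  | succ n ih =>
    simp only [dyson]
    have hA := M.isBoundedFamily_pertQ lam
    rw [← Φ.intervalIntegral_comp_comm ((hA.continuous_apply (g := fun s => s)
      continuous_id (hA.continuous_dyson _ n)).intervalIntegrable _ _)]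
    refine enorm_integral_le_ordered (G := fun w => ‖Φ (M.iterQ (ext w) ρ (n + 2))‖ₑ)
      (Φ.continuous.comp (M.continuous_iterQ continuous_ext ρ _)).enorm.measurable
      (fun s hs => ?_) ht
    rw [pertQ_apply, map_smul, enorm_smul]
    have h1 : ‖-(Complex.I * (lam : ℂ))‖ₑ = ‖lam‖ₑ := by
      rw [← ofReal_norm, ← ofReal_norm]; simp
    rw [h1, pow_succ', mul_assoc]
    refine mul_le_mul_right ?_ _
    refine (ih (Φ ∘L M.Q ∘L M.liouI s ∘L M.Q) hs).trans (le_of_eq ?_)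
    refine congrArg (_ * ·) (lintegral_congr fun z =>
      congrArg (fun f => (ordered n s).indicator f (Fin.cons 0 z)) (funext fun w => ?_))
    simp only [ContinuousLinearMap.comp_apply]
    rw [Q_iterQ, iterQ.eq_2 M _ ρ (n + 1), ext_snoc_last,
      M.iterQ_congr (z := ext (Fin.snoc w s : Fin (n + 2) → ℝ)) (z' := ext w) ρ
        fun i hi => ext_snoc_of_lt w s hi]

/-- The norm of the Dyson terms of the memory kernel. -/
theorem enorm_integral_dyson_le (lam : ℝ) (a b : S) (n : ℕ) {T : ℝ} (hT : 0 < T) :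
    ‖∫ s in (0 : ℝ)..T, M.P (M.liouI s (M.Q (dyson (M.pertQ lam)
        (M.Q (M.liouI 0 (ketBra (a ⊗ₜ M.Ω) (b ⊗ₜ M.Ω)))) n s)))‖ₑ
      ≤ ‖lam‖ₑ ^ n * (ENNReal.ofReal (‖M.W‖ ^ (n + 2) * (‖a‖ * ‖b‖)) *
        ∑ A ∈ (Finset.range (n + 2)).powerset, M.connIntegral (marks A) n T) := by
  set ρ := ketBra (a ⊗ₜ[ℂ] M.Ω) (b ⊗ₜ[ℂ] M.Ω)
  have hG : Measurable fun w : Fin (n + 2) → ℝ =>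
      ‖M.P (M.liouI (ext w (n + 1)) (M.iterQ (ext w) ρ (n + 1)))‖ₑ :=
    (M.P.continuous.comp (M.isBoundedFamily_liouI.continuous_apply (continuous_ext _)
      (M.continuous_iterQ continuous_ext ρ _))).enorm.measurable
  refine (enorm_integral_le_ordered hG (c := ‖lam‖ₑ ^ n) (fun s hs => ?_) hT).trans ?_
  · refine (M.enorm_dyson_pertQ_le lam ρ n (M.P ∘L M.liouI s ∘L M.Q) hs).trans (le_of_eq ?_)
    refine congrArg (_ * ·) (lintegral_congr fun z =>
      congrArg (fun f => (ordered n s).indicator f (Fin.cons 0 z)) (funext fun w => ?_))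
    simp only [ContinuousLinearMap.comp_apply]
    rw [Q_iterQ, ext_snoc_last,
      M.iterQ_congr (z := ext (Fin.snoc w s : Fin (n + 2) → ℝ)) (z' := ext w) ρ
        fun i hi => ext_snoc_of_lt w s hi]
  · refine mul_le_mul_right ?_ _
    have hm : ∀ A : Finset ℕ, Measurable fun z : Fin (n + 1) → ℝ =>
        (ordered (n + 1) T).indicator (fun z => ‖M.conn (marks A) (ext z) 0 (n + 2)‖ₑ)
          (Fin.cons 0 z) := fun A =>
      ((M.measurable_enorm_conn _ _).indicator (measurableSet_ordered _ _)).comp (by fun_prop)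
    simp only [connIntegral]
    rw [← lintegral_finsetSum _ fun A _ => hm A,
      ← lintegral_const_mul _ (Finset.measurable_sum _ fun A _ => hm A)]
    refine lintegral_mono fun z => ?_
    by_cases hz : (Fin.cons 0 z : Fin (n + 2) → ℝ) ∈ ordered (n + 1) T
    · simp only [indicator_of_mem hz]
      rw [← ofReal_norm]
      refine (ENNReal.ofReal_le_ofReal (M.norm_P_liouI_iterQ_le a b _ (n + 1))).trans ?_
      rw [ENNReal.ofReal_mul (by positivity),
        ENNReal.ofReal_sum_of_nonneg fun _ _ => norm_nonneg _]
      simp only [ofReal_norm]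
      rfl
    · simp only [indicator_of_notMem hz]
      exact zero_le

theorem connIntegral_mono (χ : ℕ → Bool) (n : ℕ) {T T' : ℝ} (h : T ≤ T') :
    M.connIntegral χ n T ≤ M.connIntegral χ n T' :=
  lintegral_mono fun _ => indicator_le_indicator_of_subset (ordered_mono h) (fun _ => zero_le) _

end Model

end VanHove

end

noncomputable section

namespace VanHove

open scoped ENNReal

namespace Model

variable {S R : Type*} [NormedAddCommGroup S] [InnerProductSpace ℂ S]
  [FiniteDimensional ℂ S] [NormedAddCommGroup R] [InnerProductSpace ℂ R] [CompleteSpace R]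
  (M : Model S R)

/-! ## Operators on the range of `P` -/

section Basis

variable {ι : Type*} [Fintype ι] (b : OrthonormalBasis ι ℂ S)

/-- The matrix elements of the partial trace. -/
def matrixCoeff (R : Type*) [NormedAddCommGroup R] [InnerProductSpace ℂ R] [CompleteSpace R]
    (b : OrthonormalBasis ι ℂ S) (i j : ι) : TraceClass (S ⊗[ℂ] R) →L[ℂ] ℂ :=
  innerSL ℂ (b i) ∘L ContinuousLinearMap.apply ℂ S (b j) ∘L partialTrace S R

/-- The matrix units `|bᵢ ⊗ Ω⟩⟨bⱼ ⊗ Ω|`. -/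
def matrixUnit (i j : ι) : TraceClass (S ⊗[ℂ] R) := ketBra (b i ⊗ₜ M.Ω) (b j ⊗ₜ M.Ω)

theorem P_eq_sum (ρ : TraceClass (S ⊗[ℂ] R)) :
    M.P ρ = ∑ i, ∑ j, matrixCoeff R b i j ρ • M.matrixUnit b i j := by
  have h : partialTrace S R ρ
      = ∑ i, ∑ j, matrixCoeff R b i j ρ • InnerProductSpace.rankOne ℂ (b i) (b j) := by
    refine ContinuousLinearMap.ext fun v => ?_
    simp only [sum_apply, smul_apply, InnerProductSpace.rankOne_apply, matrixCoeff]
    conv_lhs => rw [← b.sum_repr' (partialTrace S R ρ v)]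
    refine Finset.sum_congr rfl fun i _ => ?_
    simp_rw [smul_smul, ← Finset.sum_smul]
    congr 1
    conv_lhs => rw [← b.sum_repr' v]
    simp only [map_sum, map_smul, inner_sum, inner_smul_right]
    exact Finset.sum_congr rfl fun j _ => mul_comm _ _
  change tensorState M.Ω (partialTrace S R ρ) = _
  rw [h]
  simp only [map_sum, map_smul, tensorState_rankOne]
  rfl

variable {M}

/-- An operator with `X P = X` is determined by finitely many vectors. Norm estimates and norm
continuity of such operators are thereby reduced to strong ones. -/
theorem eq_sum_smulRight {X : TraceClass (S ⊗[ℂ] R) →L[ℂ] TraceClass (S ⊗[ℂ] R)}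
    (hX : X ∘L M.P = X) :
    X = ∑ i, ∑ j, (matrixCoeff R b i j).smulRight (X (M.matrixUnit b i j)) := by
  refine ContinuousLinearMap.ext fun ρ => ?_
  conv_lhs => rw [← hX]
  rw [ContinuousLinearMap.comp_apply, P_eq_sum M b]
  simp [sum_apply, map_sum]

theorem norm_le_sum_matrixUnit {X : TraceClass (S ⊗[ℂ] R) →L[ℂ] TraceClass (S ⊗[ℂ] R)}
    (hX : X ∘L M.P = X) :
    ‖X‖ ≤ ∑ i, ∑ j, ‖matrixCoeff R b i j‖ * ‖X (M.matrixUnit b i j)‖ := by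
  conv_lhs => rw [eq_sum_smulRight b hX]
  refine (norm_sum_le _ _).trans (Finset.sum_le_sum fun i _ => ?_)
  refine (norm_sum_le _ _).trans (Finset.sum_le_sum fun j _ => ?_)
  rw [ContinuousLinearMap.norm_smulRight_apply]

theorem continuous_of_comp_P {X : Type*} [TopologicalSpace X]
    {Y : X → TraceClass (S ⊗[ℂ] R) →L[ℂ] TraceClass (S ⊗[ℂ] R)} (hY : ∀ x, Y x ∘L M.P = Y x)
    (hc : ∀ ρ, Continuous fun x => Y x ρ) : Continuous Y := by
  have h : Y = fun x => ∑ i, ∑ j, (matrixCoeff R (stdOrthonormalBasis ℂ S) i j).smulRight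
      (Y x (M.matrixUnit (stdOrthonormalBasis ℂ S) i j)) :=
    funext fun x => eq_sum_smulRight _ (hY x)
  rw [h]
  refine continuous_finsetSum _ fun i _ => continuous_finsetSum _ fun j _ => ?_
  exact (ContinuousLinearMap.smulRightL ℂ (TraceClass (S ⊗[ℂ] R)) (TraceClass (S ⊗[ℂ] R))
    (matrixCoeff R (stdOrthonormalBasis ℂ S) i j)).continuous.comp (hc _)

end Basis

/-! ## The memory kernel -/

theorem liouI_zero : M.liouI 0 = M.liouSR := by
  refine ContinuousLinearMap.ext fun ρ => ?_
  simp [liouI, interaction, M.isC0Group_expFree.zero]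

/-- The propagator of the projected perturbation. -/
abbrev propQ (lam t : ℝ) : TraceClass (S ⊗[ℂ] R) →L[ℂ] TraceClass (S ⊗[ℂ] R) :=
  propagator (M.isBoundedFamily_pertQ lam) t

theorem expQ_eq (lam t : ℝ) : M.expQ lam t = M.expFree t ∘L M.propQ lam t := by
  rw [expQ, perturbedGroup_eq_dysonGroup M.isC0Group_expFree M.norm_expFree_le]
  rfl

theorem memoryIntegrand_apply (lam s : ℝ) (ρ : TraceClass (S ⊗[ℂ] R)) :
    M.memoryIntegrand lam s ρ
      = M.P (M.liouI s (M.Q (M.propQ lam s (M.Q (M.liouI 0 (M.P ρ)))))) := by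
  rw [liouI_zero]
  simp only [memoryIntegrand, expQ_eq, ContinuousLinearMap.comp_apply, liouI, interaction,
    Q_expFree]

theorem limitIntegrand_apply (s : ℝ) (ρ : TraceClass (S ⊗[ℂ] R)) :
    M.limitIntegrand s ρ = M.P (M.liouI s (M.Q (M.liouI 0 (M.P ρ)))) := by
  rw [liouI_zero]
  rfl

theorem memoryIntegrand_comp_P (lam s : ℝ) :
    M.memoryIntegrand lam s ∘L M.P = M.memoryIntegrand lam s := by
  refine ContinuousLinearMap.ext fun ρ => ?_
  rw [ContinuousLinearMap.comp_apply, memoryIntegrand_apply, memoryIntegrand_apply, P_P]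

theorem limitIntegrand_comp_P (s : ℝ) : M.limitIntegrand s ∘L M.P = M.limitIntegrand s := by
  refine ContinuousLinearMap.ext fun ρ => ?_
  rw [ContinuousLinearMap.comp_apply, limitIntegrand_apply, limitIntegrand_apply, P_P]

theorem continuous_propQ_apply (lam : ℝ) (ρ : TraceClass (S ⊗[ℂ] R)) :
    Continuous fun s => M.propQ lam s ρ :=
  continuous_iff_continuousAt.2 fun s =>
    (hasDerivAt_propagator (M.isBoundedFamily_pertQ lam) ρ s).continuousAt

theorem continuous_memoryIntegrand (lam : ℝ) : Continuous (M.memoryIntegrand lam) := by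
  refine continuous_of_comp_P (M.memoryIntegrand_comp_P lam) fun ρ => ?_
  simp_rw [memoryIntegrand_apply]
  exact M.P.continuous.comp (M.isBoundedFamily_liouI.continuous_apply (g := fun s => s)
    continuous_id (M.Q.continuous.comp (M.continuous_propQ_apply lam _)))

theorem continuous_limitIntegrand : Continuous M.limitIntegrand := by
  refine continuous_of_comp_P M.limitIntegrand_comp_P fun ρ => ?_
  simp_rw [limitIntegrand_apply]
  exact M.P.continuous.comp (M.isBoundedFamily_liouI.continuous _)

theorem exists_norm_limitIntegrand_le : ∃ c : ℝ, ∀ s, ‖M.limitIntegrand s‖ ≤ c * ‖M.φ (-s)‖ := by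
  set b := stdOrthonormalBasis ℂ S
  -- The `4` counts the subsets of the two times, all of which contribute `|φ(-s)|`.
  refine ⟨∑ i, ∑ j, ‖matrixCoeff R b i j‖ * (‖M.W‖ ^ 2 * 4), fun s => ?_⟩
  refine (norm_le_sum_matrixUnit b (M.limitIntegrand_comp_P s)).trans ?_
  rw [Finset.sum_mul]
  refine Finset.sum_le_sum fun i _ => ?_
  rw [Finset.sum_mul]
  refine Finset.sum_le_sum fun j _ => ?_
  rw [mul_assoc]
  refine mul_le_mul_of_nonneg_left ?_ (norm_nonneg _)
  have h := M.norm_P_liouI_iterQ_le (b i) (b j) (fun n => if n = 0 then 0 else s) 1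
  have hc : ∀ A ∈ (Finset.range (1 + 1)).powerset,
      ‖M.conn (marks A) (fun n => if n = 0 then 0 else s) 0 (1 + 1)‖ = ‖M.φ (-s)‖ :=
    fun A _ => by rw [norm_conn_two]; simp
  rw [Finset.sum_congr rfl hc, Finset.sum_const, Finset.card_powerset, Finset.card_range] at h
  rw [limitIntegrand_apply, matrixUnit, P_Ω]
  refine (le_of_eq ?_).trans (h.trans (le_of_eq ?_))
  · simp [iterQ]
  · simp; ring

theorem integrable_limitIntegrand (hφ : Integrable M.φ) : Integrable M.limitIntegrand := by
  obtain ⟨c, hc⟩ := M.exists_norm_limitIntegrand_le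
  exact Integrable.mono' (hφ.comp_neg.norm.const_mul c)
    M.continuous_limitIntegrand.aestronglyMeasurable (ae_of_all _ hc)

theorem memoryKernel_apply (lam τ : ℝ) (ρ : TraceClass (S ⊗[ℂ] R)) :
    M.memoryKernel lam τ ρ = ∫ s in (0 : ℝ)..(τ / lam ^ 2), M.memoryIntegrand lam s ρ :=
  ContinuousLinearMap.intervalIntegral_apply
    ((M.continuous_memoryIntegrand lam).intervalIntegrable _ _) ρ

/-- The Dyson series of the propagator converges uniformly on compact intervals, so it may be
integrated term by term. Its term of order zero is the integral of `limitIntegrand`. -/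
theorem hasSum_memoryKernel (lam τ : ℝ) (ρ : TraceClass (S ⊗[ℂ] R)) :
    HasSum (fun n => ∫ s in (0 : ℝ)..(τ / lam ^ 2), M.P (M.liouI s (M.Q (dyson (M.pertQ lam)
        (M.Q (M.liouI 0 (M.P ρ))) n s)))) (M.memoryKernel lam τ ρ) := by
  rw [memoryKernel_apply]
  simp_rw [memoryIntegrand_apply]
  have hA' : IsBoundedFamily (fun s => M.P ∘L M.liouI s ∘L M.Q)
      (‖M.P‖ * (‖M.liouSR‖ * ‖M.Q‖)) := by
    refine ⟨fun ρ => M.P.continuous.comp (M.isBoundedFamily_liouI.continuous _), fun s => ?_⟩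
    refine (ContinuousLinearMap.opNorm_comp_le _ _).trans ?_
    gcongr
    refine (ContinuousLinearMap.opNorm_comp_le _ _).trans ?_
    gcongr
    exact M.isBoundedFamily_liouI.bound s
  exact (M.isBoundedFamily_pertQ lam).hasSum_integral_dyson (M.Q (M.liouI 0 (M.P ρ))) hA' _

/-- The bound on the terms of the memory kernel. -/
def termBound (n : ℕ) (T : ℝ) : ℝ≥0∞ :=
  ENNReal.ofReal (‖M.W‖ ^ (n + 2)) *
    ∑ A ∈ (Finset.range (n + 2)).powerset, M.connIntegral (marks A) n T

theorem termBound_mono (n : ℕ) {T T' : ℝ} (h : T ≤ T') : M.termBound n T ≤ M.termBound n T' :=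
  mul_le_mul_right (Finset.sum_le_sum fun _ _ => M.connIntegral_mono _ _ h) _

theorem enorm_memoryKernel_sub_le {ι : Type*} [Fintype ι] (b : OrthonormalBasis ι ℂ S) (i j : ι)
    {lam τ : ℝ} (hτ : 0 < τ / lam ^ 2) :
    ‖(M.memoryKernel lam τ - ∫ s in (0 : ℝ)..(τ / lam ^ 2), M.limitIntegrand s)
        (M.matrixUnit b i j)‖ₑ
      ≤ ∑' n, ‖lam‖ₑ ^ (n + 1) * M.termBound (n + 1) (τ / lam ^ 2) := by
  have h := M.hasSum_memoryKernel lam τ (M.matrixUnit b i j)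
  have hP : M.P (M.matrixUnit b i j) = ketBra (b i ⊗ₜ M.Ω) (b j ⊗ₜ M.Ω) := M.P_Ω _ _
  have h0 : (∫ s in (0 : ℝ)..(τ / lam ^ 2), M.limitIntegrand s) (M.matrixUnit b i j)
      = ∫ s in (0 : ℝ)..(τ / lam ^ 2), M.P (M.liouI s (M.Q (dyson (M.pertQ lam)
        (M.Q (M.liouI 0 (M.P (M.matrixUnit b i j)))) 0 s))) := by
    rw [ContinuousLinearMap.intervalIntegral_apply
      (M.continuous_limitIntegrand.intervalIntegrable _ _)]
    simp_rw [limitIntegrand_apply, dyson, Q_Q]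
  rw [sub_apply, h0, ← h.tsum_eq, h.summable.tsum_eq_zero_add, add_sub_cancel_left]
  refine (enorm_tsum_le_tsum_enorm).trans (ENNReal.tsum_le_tsum fun n => ?_)
  rw [hP]
  refine (M.enorm_integral_dyson_le lam (b i) (b j) (n + 1) hτ).trans (le_of_eq ?_)
  rw [b.norm_eq_one, b.norm_eq_one, mul_one, mul_one]
  rfl

end Model

end VanHove

end

noncomputable section

namespace VanHove

open scoped ENNReal

/-! ### Size and limits of the terms of the series -/

theorem summable_of_even_of_odd {f : ℕ → ℝ} (he : Summable fun k => f (2 * k))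
    (ho : Summable fun k => f (2 * k + 1)) : Summable f :=
  (he.hasSum.even_add_odd ho.hasSum).summable

theorem summable_pow_div_factorial_half (D : ℝ) :
    Summable fun n : ℕ => D ^ (n + 2) / (n / 2).factorial := by
  refine summable_of_even_of_odd
    (((Real.summable_pow_div_factorial (D ^ 2)).mul_left (D ^ 2)).congr fun k => ?_)
    (((Real.summable_pow_div_factorial (D ^ 2)).mul_left (D ^ 3)).congr fun k => ?_)
  · rw [Nat.mul_div_cancel_left k two_pos]
    ring
  · rw [show (2 * k + 1) / 2 = k by omega]
    ring

namespace Model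

variable {S R : Type*} [NormedAddCommGroup S] [InnerProductSpace ℂ S]
  [FiniteDimensional ℂ S] [NormedAddCommGroup R] [InnerProductSpace ℂ R] [CompleteSpace R]
  {M : Model S R} {F : ℝ → ℝ≥0∞} {C : ℝ}

theorem IsMajorant.connIntegral_le (hF : M.IsMajorant F C) (χ : ℕ → Bool) (n : ℕ) {T : ℝ}
    (hT : 0 < T) :
    M.connIntegral χ n T ≤ ENNReal.ofReal (C ^ (n + 2) / (n / 2).factorial *
      ((∫⁻ s, F s).toReal ^ ((n + 1) / 2 + 1) * 2 ^ (n / 2 + 1)) * T ^ (n / 2)) := by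
  have hT0 : ENNReal.ofReal T ≠ 0 := by
    rw [Ne, ENNReal.ofReal_eq_zero, not_le]
    exact hT
  have hC := hF.nonneg
  refine (ENNReal.mul_le_mul_iff_left hT0 ENNReal.ofReal_ne_top).1
    ((hF.connIntegral_mul_le χ n T).trans (le_of_eq ?_))
  rw [← ENNReal.ofReal_mul (by positivity)]
  conv_lhs => rw [← ENNReal.ofReal_toReal hF.lintegral_ne_top]
  rw [← ENNReal.ofReal_pow (by positivity), ← ENNReal.ofReal_pow (by positivity),
    ← ENNReal.ofReal_mul (by positivity), ← ENNReal.ofReal_mul (by positivity)]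
  congr 1
  rw [mul_pow, pow_succ T]
  ring

/-- The van Hove scaling: `|λ|ⁿ (τ/λ²)^{[n/2]} = |λ|^{n mod 2} τ^{[n/2]}`, while all other factors
are exponential in `n` except for the factorial. -/
theorem IsMajorant.exists_termBound_le (hF : M.IsMajorant F C) (τ : ℝ) :
    ∃ D : ℝ, ∀ (n : ℕ) (lam : ℝ), lam ≠ 0 → |lam| ≤ 1 → 0 < τ →
      ‖lam‖ₑ ^ n * M.termBound n (τ / lam ^ 2)
        ≤ ENNReal.ofReal (|lam| ^ (n % 2)) *
          ENNReal.ofReal (D ^ (n + 2) / (n / 2).factorial) := by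
  set l := (∫⁻ s, F s).toReal with hl
  have hl0 : 0 ≤ l := ENNReal.toReal_nonneg
  have hC := hF.nonneg
  -- Every base is raised to at least one, so that all exponents can be increased to `n + 2`; the
  -- first `2` counts the markings, the second one absorbs the intervals of length `2T`.
  refine ⟨(1 + ‖M.W‖) * 2 * (1 + C) * (1 + l) * 2 * (1 + |τ|), fun n lam h0 h1 hτ => ?_⟩
  have hl2 : 0 < lam ^ 2 := by positivity
  have hw := norm_nonneg M.W
  have hcon : ∀ A ∈ (Finset.range (n + 2)).powerset, M.connIntegral (marks A) n (τ / lam ^ 2)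
      ≤ ENNReal.ofReal (C ^ (n + 2) / (n / 2).factorial *
        (l ^ ((n + 1) / 2 + 1) * 2 ^ (n / 2 + 1)) * (τ / lam ^ 2) ^ (n / 2)) := fun A _ =>
    hF.connIntegral_le _ _ (div_pos hτ hl2)
  have hlam : ‖lam‖ₑ = ENNReal.ofReal |lam| := Real.enorm_eq_ofReal_abs lam
  calc ‖lam‖ₑ ^ n * M.termBound n (τ / lam ^ 2)
      ≤ ENNReal.ofReal |lam| ^ n * (ENNReal.ofReal (‖M.W‖ ^ (n + 2)) * (2 ^ (n + 2) *
        ENNReal.ofReal (C ^ (n + 2) / (n / 2).factorial *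
        (l ^ ((n + 1) / 2 + 1) * 2 ^ (n / 2 + 1)) * (τ / lam ^ 2) ^ (n / 2)))) := by
        rw [hlam, termBound]
        gcongr
        refine (Finset.sum_le_sum hcon).trans (le_of_eq ?_)
        rw [Finset.sum_const, Finset.card_powerset, Finset.card_range, nsmul_eq_mul]
        norm_cast
    _ = ENNReal.ofReal (|lam| ^ n * (‖M.W‖ ^ (n + 2) * (2 ^ (n + 2) *
        (C ^ (n + 2) / (n / 2).factorial *
        (l ^ ((n + 1) / 2 + 1) * 2 ^ (n / 2 + 1)) * (τ / lam ^ 2) ^ (n / 2))))) := by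
        rw [ENNReal.ofReal_mul (p := |lam| ^ n) (by positivity),
          ENNReal.ofReal_mul (p := ‖M.W‖ ^ (n + 2)) (by positivity),
          ENNReal.ofReal_mul (p := 2 ^ (n + 2)) (by positivity),
          ENNReal.ofReal_pow (p := |lam|) (by positivity),
          ENNReal.ofReal_pow (p := (2 : ℝ)) (by positivity)]
        simp only [ENNReal.ofReal_ofNat]
    _ ≤ _ := by
        rw [← ENNReal.ofReal_mul (by positivity)]
        refine ENNReal.ofReal_le_ofReal ?_
        have e1 : |lam| ^ n = |lam| ^ (n % 2) * (lam ^ 2) ^ (n / 2) := by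
          rw [← sq_abs, ← pow_mul, ← pow_add, Nat.mod_add_div]
        rw [e1, div_pow]
        have hl2' : (lam ^ 2) ^ (n / 2) ≠ 0 := by positivity
        have p1 : ‖M.W‖ ^ (n + 2) ≤ (1 + ‖M.W‖) ^ (n + 2) := by gcongr; linarith
        have p2 : C ^ (n + 2) ≤ (1 + C) ^ (n + 2) := by gcongr; linarith
        have p3 : l ^ ((n + 1) / 2 + 1) ≤ (1 + l) ^ (n + 2) :=
          (pow_le_pow_left₀ hl0 (by linarith) _).trans
            (pow_le_pow_right₀ (by linarith) (by omega))
        have p4 : (2 : ℝ) ^ (n / 2 + 1) ≤ 2 ^ (n + 2) :=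
          pow_le_pow_right₀ (by norm_num) (by omega)
        have p5 : τ ^ (n / 2) ≤ (1 + |τ|) ^ (n + 2) := by
          rw [abs_of_pos hτ]
          exact (pow_le_pow_left₀ hτ.le (by linarith) _).trans
            (pow_le_pow_right₀ (by linarith) (by omega))
        calc _ = |lam| ^ (n % 2) * (‖M.W‖ ^ (n + 2) * 2 ^ (n + 2) * C ^ (n + 2)
              * l ^ ((n + 1) / 2 + 1) * 2 ^ (n / 2 + 1) * τ ^ (n / 2) / (n / 2).factorial) := by
              field_simp
          _ ≤ |lam| ^ (n % 2) * ((1 + ‖M.W‖) ^ (n + 2) * 2 ^ (n + 2) * (1 + C) ^ (n + 2)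
              * (1 + l) ^ (n + 2) * 2 ^ (n + 2) * (1 + |τ|) ^ (n + 2) / (n / 2).factorial) := by
              gcongr
          _ = _ := by
              congr 2
              simp only [mul_pow]

theorem tendsto_div_sq_atTop {τ : ℝ} (hτ : 0 < τ) :
    Tendsto (fun lam : ℝ => τ / lam ^ 2) (𝓝[≠] 0) atTop := by
  have h1 : Tendsto (fun lam : ℝ => lam ^ 2) (𝓝[≠] 0) (𝓝[>] 0) := by
    refine tendsto_nhdsWithin_iff.2 ⟨?_, ?_⟩
    · have : ContinuousAt (fun lam : ℝ => lam ^ 2) 0 := by fun_prop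
      simpa using this.tendsto.mono_left nhdsWithin_le_nhds
    · filter_upwards [self_mem_nhdsWithin] with lam h
      have : lam ≠ 0 := h
      exact mem_Ioi.2 (by positivity)
  simpa [div_eq_mul_inv] using (tendsto_inv_nhdsGT_zero.comp h1).const_mul_atTop hτ

theorem eventually_abs_le_one : ∀ᶠ lam : ℝ in 𝓝[≠] 0, lam ≠ 0 ∧ |lam| ≤ 1 := by
  have h : ∀ᶠ lam : ℝ in 𝓝 0, |lam| < 1 := by
    have : ContinuousAt (fun lam : ℝ => |lam|) 0 := by fun_prop
    exact this.eventually (gt_mem_nhds (by simp))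
  filter_upwards [self_mem_nhdsWithin, h.filter_mono nhdsWithin_le_nhds] with lam h1 h2
  exact ⟨h1, h2.le⟩

/-- For odd order there is a power of `λ` to spare. For even order `2k ≥ 2` the powers balance
exactly, and the improved estimate `o(Tᵏ)` is needed. -/
theorem IsMajorant.tendsto_termBound (hF : M.IsMajorant F C) {τ : ℝ} (hτ : 0 < τ) (n : ℕ) :
    Tendsto (fun lam : ℝ => ‖lam‖ₑ ^ (n + 1) * M.termBound (n + 1) (τ / lam ^ 2)) (𝓝[≠] 0)
      (𝓝 0) := by
  rcases Nat.even_or_odd' (n + 1) with ⟨k, hk | hk⟩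
  · have hk1 : 1 ≤ k := by omega
    have h1 : Tendsto (fun lam : ℝ => ENNReal.ofReal (τ ^ k) *
        (ENNReal.ofReal (‖M.W‖ ^ (2 * k + 2)) * ∑ A ∈ (Finset.range (2 * k + 2)).powerset,
          M.connIntegral (marks A) (2 * k) (τ / lam ^ 2) / ENNReal.ofReal (τ / lam ^ 2) ^ k))
        (𝓝[≠] 0) (𝓝 (ENNReal.ofReal (τ ^ k) * (ENNReal.ofReal (‖M.W‖ ^ (2 * k + 2)) *
          ∑ A ∈ (Finset.range (2 * k + 2)).powerset, 0))) := by
      refine ENNReal.Tendsto.const_mul (ENNReal.Tendsto.const_mul (tendsto_finsetSum _ fun A _ =>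
        (hF.tendsto_connIntegral (marks A) hk1).comp (tendsto_div_sq_atTop hτ))
          (Or.inr ENNReal.ofReal_ne_top)) (Or.inr ENNReal.ofReal_ne_top)
    rw [Finset.sum_const_zero, mul_zero, mul_zero] at h1
    refine h1.congr' ?_
    filter_upwards [self_mem_nhdsWithin] with lam h0
    have h0' : lam ≠ 0 := h0
    rw [hk, termBound, ← ENNReal.ofReal_pow (by positivity)]
    simp_rw [div_eq_mul_inv (M.connIntegral _ _ _)]
    rw [← Finset.sum_mul, ← ENNReal.ofReal_inv_of_pos (by positivity), Real.enorm_eq_ofReal_abs,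
      ← ENNReal.ofReal_pow (abs_nonneg _), pow_mul |lam|, sq_abs]
    have e : ENNReal.ofReal ((lam ^ 2) ^ k)
        = ENNReal.ofReal (τ ^ k) * ENNReal.ofReal (((τ / lam ^ 2) ^ k)⁻¹) := by
      rw [← ENNReal.ofReal_mul (by positivity)]
      congr 1
      rw [div_pow]
      field_simp
    rw [e]
    ring
  · obtain ⟨D, hD⟩ := hF.exists_termBound_le τ
    have h1 : Tendsto (fun lam : ℝ => ENNReal.ofReal (|lam| ^ 1) *
        ENNReal.ofReal (D ^ (n + 1 + 2) / ((n + 1) / 2).factorial)) (𝓝[≠] 0) (𝓝 (0 *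
          ENNReal.ofReal (D ^ (n + 1 + 2) / ((n + 1) / 2).factorial))) := by
      refine ENNReal.Tendsto.mul_const ?_ (Or.inr ENNReal.ofReal_ne_top)
      have : Continuous fun lam : ℝ => ENNReal.ofReal (|lam| ^ 1) :=
        ENNReal.continuous_ofReal.comp (by fun_prop)
      simpa using (this.tendsto 0).mono_left nhdsWithin_le_nhds
    rw [zero_mul] at h1
    refine tendsto_of_tendsto_of_tendsto_of_le_of_le' tendsto_const_nhds h1
      (Eventually.of_forall fun _ => zero_le) ?_
    filter_upwards [eventually_abs_le_one] with lam h
    have := hD (n + 1) lam h.1 h.2 hτ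
    rwa [show (n + 1) % 2 = 1 by omega] at this

theorem IsMajorant.tendsto_tsum_termBound (hF : M.IsMajorant F C) {τ : ℝ} (hτ : 0 < τ) :
    Tendsto (fun lam : ℝ => ∑' n, ‖lam‖ₑ ^ (n + 1) * M.termBound (n + 1) (τ / lam ^ 2)) (𝓝[≠] 0)
      (𝓝 0) := by
  obtain ⟨D, hD⟩ := hF.exists_termBound_le τ
  have h := tendsto_lintegral_filter_of_dominated_convergence (μ := Measure.count) (l := 𝓝[≠] 0)
    (F := fun (lam : ℝ) (n : ℕ) => ‖lam‖ₑ ^ (n + 1) * M.termBound (n + 1) (τ / lam ^ 2))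
    (f := fun _ => 0)
    (fun n : ℕ => ENNReal.ofReal (|D ^ (n + 1 + 2) / ((n + 1) / 2).factorial|))
    (Eventually.of_forall fun _ => measurable_from_top) ?_ ?_
    (ae_of_all _ fun n => hF.tendsto_termBound hτ n)
  · simpa only [lintegral_count, tsum_zero] using h
  · filter_upwards [eventually_abs_le_one] with lam h
    refine ae_of_all _ fun n => (hD (n + 1) lam h.1 h.2 hτ).trans ?_
    calc _ ≤ 1 * ENNReal.ofReal (|D ^ (n + 1 + 2) / ((n + 1) / 2).factorial|) := by
          gcongr
          · rw [← ENNReal.ofReal_one]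
            exact ENNReal.ofReal_le_ofReal (pow_le_one₀ (abs_nonneg _) h.2)
          · exact le_abs_self _
      _ = _ := one_mul _
  · rw [lintegral_count]
    have hs := ((summable_nat_add_iff 1).2 (summable_pow_div_factorial_half D)).abs
    exact hs.tsum_ofReal_ne_top

/-! ## Convergence of the memory kernel -/

theorem memoryKernel_comp_P (lam τ : ℝ) :
    M.memoryKernel lam τ ∘L M.P = M.memoryKernel lam τ := by
  refine ContinuousLinearMap.ext fun ρ => ?_
  rw [ContinuousLinearMap.comp_apply, memoryKernel_apply, memoryKernel_apply]
  refine intervalIntegral.integral_congr fun s _ => ?_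
  change (M.memoryIntegrand lam s ∘L M.P) ρ = _
  rw [memoryIntegrand_comp_P]

theorem integral_limitIntegrand_comp_P (T : ℝ) :
    (∫ s in (0 : ℝ)..T, M.limitIntegrand s) ∘L M.P = ∫ s in (0 : ℝ)..T, M.limitIntegrand s := by
  refine ContinuousLinearMap.ext fun ρ => ?_
  have h := M.continuous_limitIntegrand.intervalIntegrable (μ := volume) 0 T
  rw [ContinuousLinearMap.comp_apply, ContinuousLinearMap.intervalIntegral_apply h,
    ContinuousLinearMap.intervalIntegral_apply h]
  refine intervalIntegral.integral_congr fun s _ => ?_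
  change (M.limitIntegrand s ∘L M.P) ρ = _
  rw [limitIntegrand_comp_P]

theorem IsMajorant.eventually_norm_memoryKernel_sub_le (hF : M.IsMajorant F C) {τ₁ : ℝ}
    (hτ₁ : 0 < τ₁) {ε : ℝ} (hε : 0 < ε) :
    ∀ᶠ lam in 𝓝[≠] 0, ∀ τ ∈ Icc 0 τ₁,
      ‖M.memoryKernel lam τ - ∫ s in (0 : ℝ)..(τ / lam ^ 2), M.limitIntegrand s‖ ≤ ε := by
  set b := stdOrthonormalBasis ℂ S
  set c : ℝ := ∑ i, ∑ j, ‖matrixCoeff R b i j‖ with hc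
  have hc0 : 0 ≤ c := Finset.sum_nonneg fun i _ => Finset.sum_nonneg fun j _ => norm_nonneg _
  have h := (hF.tendsto_tsum_termBound hτ₁).eventually (ge_mem_nhds
    (ENNReal.ofReal_pos.2 (show 0 < ε / (c + 1) by positivity)))
  filter_upwards [h, self_mem_nhdsWithin] with lam h0 hne τ hτ
  have hne' : lam ≠ 0 := hne
  rcases hτ.1.eq_or_lt with rfl | hτ0
  · simp [memoryKernel, hε.le]
  have hpos : 0 < τ / lam ^ 2 := by positivity
  refine (norm_le_sum_matrixUnit (M := M) b ?_).trans ?_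
  · rw [ContinuousLinearMap.sub_comp, memoryKernel_comp_P, integral_limitIntegrand_comp_P]
  calc _ ≤ ∑ i, ∑ j, ‖matrixCoeff R b i j‖ * (ε / (c + 1)) := by
        refine Finset.sum_le_sum fun i _ => Finset.sum_le_sum fun j _ => ?_
        refine mul_le_mul_of_nonneg_left ?_ (norm_nonneg _)
        rw [← ENNReal.ofReal_le_ofReal_iff (by positivity), ofReal_norm]
        -- The bounds increase with the time, so the one at `τ₁` serves all `τ ≤ τ₁`.
        refine (M.enorm_memoryKernel_sub_le b i j hpos).trans (le_trans ?_ h0)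
        refine ENNReal.tsum_le_tsum fun n => mul_le_mul_right (M.termBound_mono _ ?_) _
        gcongr
        exact hτ.2
    _ = c * (ε / (c + 1)) := by simp_rw [← Finset.sum_mul, hc]
    _ ≤ ε := by
        rw [mul_div_assoc', div_le_iff₀ (by positivity)]
        nlinarith

theorem tendstoUniformlyOn_memoryKernel (hφ : Integrable M.φ) (hF : M.IsMajorant F C) {τ₀ τ₁ : ℝ}
    (h0 : 0 < τ₀) (h01 : τ₀ < τ₁) :
    TendstoUniformlyOn M.memoryKernel (fun _ => M.limitKernel) (𝓝[≠] 0) (Icc τ₀ τ₁) := by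
  rw [Metric.tendstoUniformlyOn_iff]
  intro ε hε
  have h1 := hF.eventually_norm_memoryKernel_sub_le (h0.trans h01) (show 0 < ε / 3 by positivity)
  have h2 := intervalIntegral_tendsto_integral_Ioi 0
    (M.integrable_limitIntegrand hφ).integrableOn tendsto_id
  obtain ⟨T, hT⟩ := eventually_atTop.1
    (h2.eventually (Metric.ball_mem_nhds _ (show 0 < ε / 3 by positivity)))
  -- Since `τ ≥ τ₀ > 0`, the upper limit `τ/λ²` exceeds `T` uniformly in `τ`.
  filter_upwards [h1, (tendsto_div_sq_atTop h0).eventually_ge_atTop T, self_mem_nhdsWithin]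
    with lam h3 h4 hne τ hτ
  have hne' : lam ≠ 0 := hne
  have h5 := hT (τ / lam ^ 2) (h4.trans (by gcongr; exact hτ.1))
  have h6 := h3 τ ⟨h0.le.trans hτ.1, hτ.2⟩
  rw [← dist_eq_norm] at h6
  rw [dist_comm]
  refine (dist_triangle _ (∫ s in (0 : ℝ)..(τ / lam ^ 2), M.limitIntegrand s) _).trans_lt ?_
  have h5' : dist (∫ s in (0 : ℝ)..(τ / lam ^ 2), M.limitIntegrand s) M.limitKernel < ε / 3 := h5
  linarith

theorem exists_norm_memoryKernel_le (hφ : Integrable M.φ) (hF : M.IsMajorant F C) {τ₁ : ℝ}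
    (h1 : 0 < τ₁) :
    ∃ c : ℝ, 0 ≤ c ∧ ∀ᶠ lam in 𝓝[≠] 0, ∀ τ ∈ Icc 0 τ₁, ‖M.memoryKernel lam τ‖ ≤ c := by
  refine ⟨1 + ∫ s, ‖M.limitIntegrand s‖, by positivity, ?_⟩
  filter_upwards [hF.eventually_norm_memoryKernel_sub_le h1 one_pos] with lam h τ hτ
  have h2 := norm_add_le (M.memoryKernel lam τ - ∫ s in (0 : ℝ)..(τ / lam ^ 2), M.limitIntegrand s)
    (∫ s in (0 : ℝ)..(τ / lam ^ 2), M.limitIntegrand s)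
  rw [sub_add_cancel] at h2
  refine h2.trans (add_le_add (h τ hτ) ?_)
  rw [intervalIntegral.integral_of_le (div_nonneg hτ.1 (sq_nonneg _))]
  refine (norm_integral_le_integral_norm _).trans ?_
  exact setIntegral_le_integral (M.integrable_limitIntegrand hφ).norm
    (ae_of_all _ fun _ => norm_nonneg _)

end Model

end VanHove

end

noncomputable section

namespace VanHove

/-! ## Duhamel's formula and integrals over triangles -/

section Duhamel

variable {B : Type*} [NormedAddCommGroup B] [NormedSpace ℂ B]

theorem hasDerivAt_clm_comp (X : B →L[ℂ] B) {y : ℝ → B} {y' : B} {t : ℝ}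
    (h : HasDerivAt y y' t) : HasDerivAt (fun t => X (y t)) (X y') t :=
  (X.restrictScalars ℝ).hasFDerivAt.comp_hasDerivAt t h

theorem IsC0Group.continuous_apply {T : ℝ → B →L[ℂ] B} (hT : IsC0Group T) {c : ℝ → ℝ}
    (hc : Continuous c) (hb : ∀ t, ‖T t‖ ≤ c t) {X : Type*} [TopologicalSpace X] {g : X → ℝ}
    (hg : Continuous g) {y : X → B} (hy : Continuous y) : Continuous fun x => T (g x) (y x) := by
  refine continuous_iff_continuousAt.2 fun x => ?_
  refine tendsto_clm_apply_of_bound (c := fun x => T (g x)) (c₀ := T (g x)) (M := c (g x) + 1)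
    (((hT.continuous (y x)).comp hg).tendsto x) ?_ (hy.tendsto x)
  filter_upwards [(hc.comp hg).continuousAt.eventually (gt_mem_nhds (lt_add_one (c (g x))))]
    with s hs
  exact (hb _).trans hs.le

/-- Variation of constants: the difference of the two sides solves the homogeneous equation with
initial value zero. Only a right inverse `J` of the propagator is needed. -/
theorem IsBoundedFamily.eq_propagator_integral [CompleteSpace B] {A : ℝ → B →L[ℂ] B} {M : ℝ}
    (hA : IsBoundedFamily A M) {J : ℝ → B →L[ℂ] B} (hJ : ∀ t x, propagator hA t (J t x) = x)
    {q f : ℝ → B} (hf : Continuous fun t => J t (f t)) (h0 : q 0 = 0)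
    (hq : ∀ t, HasDerivAt q (A t (q t) + f t) t) (t : ℝ) :
    q t = propagator hA t (∫ u in (0 : ℝ)..t, J u (f u)) := by
  set w := fun t => propagator hA t (∫ u in (0 : ℝ)..t, J u (f u)) with hw
  have hw' : ∀ t, HasDerivAt w (A t (w t) + f t) t := fun t => by
    have h1 : HasDerivAt (fun t => ∫ u in (0 : ℝ)..t, J u (f u)) (J t (f t)) t :=
      intervalIntegral.integral_hasDerivAt_right (hf.intervalIntegrable 0 t)
        (hf.stronglyMeasurableAtFilter _ _) hf.continuousAt
    have hb : ∀ᶠ s in 𝓝 t, ‖propagator hA s‖ ≤ Real.exp (M * |t|) + 1 := by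
      have : ContinuousAt (fun s : ℝ => Real.exp (M * |s|)) t := by fun_prop
      filter_upwards [this.eventually (gt_mem_nhds (lt_add_one _))] with s hs
      exact (norm_propagator_le hA s).trans hs.le
    have h2 := hasDerivAt_clm_apply_of_bound (c := propagator hA) hb
      (hasDerivAt_propagator hA _ t).continuousAt (hasDerivAt_propagator hA _ t) h1
    rwa [hJ] at h2
  have h := hA.ode_unique (y := fun t => q t - w t) (z := fun _ => 0) (fun t => ?_)
    (fun t => by simpa using hasDerivAt_const t (0 : B)) (by simp [h0, hw])
  · exact sub_eq_zero.1 (congrFun h t)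
  · refine ((hq t).sub (hw' t)).congr_deriv ?_
    rw [map_sub]
    abel

theorem integral_integral_triangle {E : Type*} [NormedAddCommGroup E] [NormedSpace ℝ E]
    {F : ℝ → ℝ → E} (hF : Continuous (Function.uncurry F)) {t : ℝ} (ht : 0 ≤ t) :
    ∫ s in (0 : ℝ)..t, ∫ u in (0 : ℝ)..s, F s u = ∫ u in (0 : ℝ)..t, ∫ s in u..t, F s u := by
  set D : Set (ℝ × ℝ) := {p | p.2 < p.1}
  have hD : MeasurableSet D := measurableSet_lt measurable_snd measurable_fst
  have hint : Integrable (Function.uncurry fun s u => D.indicator (Function.uncurry F) (s, u))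
      ((volume.restrict (Ioc 0 t)).prod (volume.restrict (Ioc 0 t))) := by
    rw [Measure.prod_restrict]
    have h1 : IntegrableOn (Function.uncurry F) (Icc 0 t ×ˢ Icc 0 t) (volume.prod volume) :=
      hF.continuousOn.integrableOn_compact (isCompact_Icc.prod isCompact_Icc)
    exact (h1.mono_set (prod_mono Ioc_subset_Icc_self Ioc_subset_Icc_self)).indicator hD
  have h := integral_integral_swap hint
  rw [intervalIntegral.integral_of_le ht, intervalIntegral.integral_of_le ht]
  refine Eq.trans ?_ (h.trans ?_)
  · refine setIntegral_congr_fun measurableSet_Ioc fun s hs => ?_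
    change ∫ u in (0 : ℝ)..s, F s u = ∫ u in Ioc 0 t, (Iio s).indicator (F s) u
    rw [intervalIntegral.integral_of_le hs.1.le, integral_Ioc_eq_integral_Ioo,
      integral_indicator measurableSet_Iio, Measure.restrict_restrict measurableSet_Iio]
    congr 2
    ext u
    simp only [mem_Ioo, mem_inter_iff, mem_Iio, mem_Ioc]
    exact ⟨fun h => ⟨h.2, h.1, h.2.le.trans hs.2⟩, fun h => ⟨h.2.1, h.1⟩⟩
  · refine setIntegral_congr_fun measurableSet_Ioc fun u hu => ?_
    change ∫ s in Ioc 0 t, (Ioi u).indicator (fun s => F s u) s = ∫ s in u..t, F s u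
    rw [intervalIntegral.integral_of_le hu.2,
      integral_indicator measurableSet_Ioi, Measure.restrict_restrict measurableSet_Ioi]
    congr 2
    ext s
    simp only [mem_inter_iff, mem_Ioi, mem_Ioc]
    exact ⟨fun h => ⟨h.1, h.2.2⟩, fun h => ⟨h.1, hu.1.trans h.1, h.2⟩⟩

end Duhamel

namespace Model

variable {S R : Type*} [NormedAddCommGroup S] [InnerProductSpace ℂ S]
  [FiniteDimensional ℂ S] [NormedAddCommGroup R] [InnerProductSpace ℂ R] [CompleteSpace R]
  (M : Model S R)

/-! ## The Volterra equation of the reduced dynamics -/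

/-- The perturbation `-iλ 𝓛(s)` in the interaction picture. -/
abbrev pertFull (lam : ℝ) : ℝ → TraceClass (S ⊗[ℂ] R) →L[ℂ] TraceClass (S ⊗[ℂ] R) :=
  interaction M.expFree ((-(Complex.I * (lam : ℂ))) • M.liouSR)

theorem pertFull_apply (lam s : ℝ) (ρ : TraceClass (S ⊗[ℂ] R)) :
    M.pertFull lam s ρ = (-(Complex.I * (lam : ℂ))) • M.liouI s ρ := by
  simp only [pertFull, liouI, interaction, ContinuousLinearMap.comp_apply, smul_apply, map_smul]

theorem isBoundedFamily_pertFull (lam : ℝ) : IsBoundedFamily (M.pertFull lam)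
    ‖(-(Complex.I * (lam : ℂ))) • M.liouSR‖ :=
  M.isC0Group_expFree.isBoundedFamily_interaction M.norm_expFree_le _

/-- The solution of the interaction picture equation with initial value `P ρ`. -/
def state (lam : ℝ) (ρ : TraceClass (S ⊗[ℂ] R)) (t : ℝ) : TraceClass (S ⊗[ℂ] R) :=
  propagator (M.isBoundedFamily_pertFull lam) t (M.P ρ)

theorem hasDerivAt_state (lam : ℝ) (ρ : TraceClass (S ⊗[ℂ] R)) (t : ℝ) :
    HasDerivAt (M.state lam ρ) ((-(Complex.I * (lam : ℂ))) • M.liouI t (M.state lam ρ t)) t := by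
  have h := hasDerivAt_propagator (M.isBoundedFamily_pertFull lam) (M.P ρ) t
  rw [pertFull_apply] at h
  exact h

theorem continuous_state (lam : ℝ) (ρ : TraceClass (S ⊗[ℂ] R)) : Continuous (M.state lam ρ) :=
  continuous_iff_continuousAt.2 fun t => (M.hasDerivAt_state lam ρ t).continuousAt

theorem state_zero (lam : ℝ) (ρ : TraceClass (S ⊗[ℂ] R)) : M.state lam ρ 0 = M.P ρ := by
  rw [state, propagator_zero]
  rfl

/-- On the range of `P` the system evolution is the free one, which cancels the free factor of the
full evolution; what remains is the interaction picture. -/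
theorem reducedDynamics_apply (lam τ : ℝ) (ρ : TraceClass (S ⊗[ℂ] R)) :
    M.reducedDynamics lam τ ρ = M.P (M.state lam ρ (τ / lam ^ 2)) := by
  rw [reducedDynamics, expFull, perturbedGroup_eq_dysonGroup M.isC0Group_expFree M.norm_expFree_le]
  simp only [ContinuousLinearMap.comp_apply, dysonGroup]
  rw [← expFree_P, ← P_expFree, M.isC0Group_expFree.neg_apply_apply]
  rfl

theorem P_add_Q (ρ : TraceClass (S ⊗[ℂ] R)) : M.P ρ + M.Q ρ = ρ := by
  rw [Q_apply, add_sub_cancel]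

theorem hasDerivAt_P_state (lam : ℝ) (ρ : TraceClass (S ⊗[ℂ] R)) (t : ℝ) :
    HasDerivAt (fun t => M.P (M.state lam ρ t))
      ((-(Complex.I * (lam : ℂ))) • M.P (M.liouI t (M.Q (M.state lam ρ t)))) t := by
  refine (hasDerivAt_clm_comp M.P (M.hasDerivAt_state lam ρ t)).congr_deriv ?_
  rw [map_smul]
  conv_lhs => rw [← M.P_add_Q (M.state lam ρ t), map_add, map_add, P_liouI_P, zero_add]

theorem hasDerivAt_Q_state (lam : ℝ) (ρ : TraceClass (S ⊗[ℂ] R)) (t : ℝ) :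
    HasDerivAt (fun t => M.Q (M.state lam ρ t)) (M.pertQ lam t (M.Q (M.state lam ρ t))
      + (-(Complex.I * (lam : ℂ))) • M.Q (M.liouI t (M.P (M.state lam ρ t)))) t := by
  refine (hasDerivAt_clm_comp M.Q (M.hasDerivAt_state lam ρ t)).congr_deriv ?_
  rw [map_smul, pertQ_apply, Q_Q, ← smul_add, ← map_add, ← map_add, add_comm, P_add_Q]

/-- The group `e^{-it(𝓛₀ + λ Q 𝓛_SR Q)}`, as a strongly continuous group. -/
theorem isC0Group_expQ (lam : ℝ) : IsC0Group (M.expQ lam) := by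
  have h : M.expQ lam = dysonGroup M.isC0Group_expFree M.norm_expFree_le
      ((-(Complex.I * (lam : ℂ))) • (M.Q ∘L M.liouSR ∘L M.Q)) := funext fun t => M.expQ_eq lam t
  rw [h]
  exact isC0Group_dysonGroup _ _ _

theorem continuous_expQ_apply (lam : ℝ) {X : Type*} [TopologicalSpace X] {g : X → ℝ}
    (hg : Continuous g) {y : X → TraceClass (S ⊗[ℂ] R)} (hy : Continuous y) :
    Continuous fun x => M.expQ lam (g x) (y x) := by
  refine (M.isC0Group_expQ lam).continuous_apply (c := fun t => Real.exp
    (‖(-(Complex.I * (lam : ℂ))) • (M.Q ∘L M.liouSR ∘L M.Q)‖ * |t|)) (by fun_prop)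
    (fun t => ?_) hg hy
  rw [expQ_eq]
  exact norm_dysonGroup_le M.isC0Group_expFree M.norm_expFree_le _ t

theorem isBoundedFamily_expFree : IsBoundedFamily M.expFree 1 :=
  M.isC0Group_expFree.isBoundedFamily M.norm_expFree_le

theorem propQ_inverse (lam t : ℝ) (ρ : TraceClass (S ⊗[ℂ] R)) :
    M.propQ lam t ((M.expQ lam (-t) ∘L M.expFree t) ρ) = ρ := by
  have h : M.expFree t (M.propQ lam t (M.expQ lam (-t) (M.expFree t ρ))) = M.expFree t ρ := by
    have h1 := (M.isC0Group_expQ lam).apply_neg_apply t (M.expFree t ρ)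
    rw [expQ_eq] at h1
    exact h1
  have h2 := congrArg (M.expFree (-t)) h
  rwa [M.isC0Group_expFree.neg_apply_apply, M.isC0Group_expFree.neg_apply_apply] at h2

theorem continuous_liouI_apply (ρ : ℝ → TraceClass (S ⊗[ℂ] R)) (h : Continuous ρ) :
    Continuous fun t => M.liouI t (ρ t) :=
  M.isBoundedFamily_liouI.continuous_apply continuous_id h

theorem expFree_liouI (t : ℝ) (ρ : TraceClass (S ⊗[ℂ] R)) :
    M.expFree t (M.liouI t ρ) = M.liouSR (M.expFree t ρ) :=
  M.isC0Group_expFree.apply_neg_apply t _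

/-- The memory term of the equation of motion. -/
theorem P_liouI_Q_state (lam : ℝ) (ρ : TraceClass (S ⊗[ℂ] R)) (t : ℝ) :
    (-(Complex.I * (lam : ℂ))) • M.P (M.liouI t (M.Q (M.state lam ρ t)))
      = (-(lam ^ 2 : ℝ)) • ∫ u in (0 : ℝ)..t, M.expFree (-u) (M.memoryIntegrand lam (t - u)
          (M.expFree u (M.P (M.state lam ρ u)))) := by
  set f := fun t => (-(Complex.I * (lam : ℂ))) • M.Q (M.liouI t (M.P (M.state lam ρ t))) with hf
  have hfc : Continuous f := (continuous_const_smul _).comp (M.Q.continuous.comp (M.continuous_liouI_apply _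
    (M.P.continuous.comp (M.continuous_state lam ρ))))
  have hJ : Continuous fun t => (M.expQ lam (-t) ∘L M.expFree t) (f t) :=
    M.continuous_expQ_apply lam continuous_neg
      (M.isBoundedFamily_expFree.continuous_apply continuous_id hfc)
  have h := (M.isBoundedFamily_pertQ lam).eq_propagator_integral
    (J := fun t => M.expQ lam (-t) ∘L M.expFree t) (M.propQ_inverse lam) hJ
    (q := fun t => M.Q (M.state lam ρ t)) (by rw [state_zero, Q_P])
    (M.hasDerivAt_Q_state lam ρ) t
  have h' : M.Q (M.state lam ρ t) = M.Q (M.propQ lam t (∫ u in (0 : ℝ)..t,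
      (M.expQ lam (-u) ∘L M.expFree u) (f u))) := by
    rw [← Q_Q]
    exact congrArg M.Q h
  rw [h']
  have hc := ((-(Complex.I * (lam : ℂ))) • (M.P ∘L M.liouI t ∘L M.Q ∘L
    M.propQ lam t)).intervalIntegral_comp_comm (hJ.intervalIntegrable (μ := volume) 0 t)
  refine Eq.trans hc.symm ?_
  rw [← intervalIntegral.integral_smul]
  refine intervalIntegral.integral_congr fun u _ => ?_
  -- The free factor turns the propagator back into the group `expQ`, and the group law combines the
  -- times `t` and `-u`.
  have e1 : M.expFree t (M.Q (M.propQ lam t (M.expQ lam (-u) (M.expFree u (f u)))))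
      = M.Q (M.expQ lam (t - u) (M.expFree u (f u))) := by
    rw [← Q_expFree]
    have : M.expFree t (M.propQ lam t (M.expQ lam (-u) (M.expFree u (f u))))
        = M.expQ lam t (M.expQ lam (-u) (M.expFree u (f u))) := by rw [expQ_eq M lam t]; rfl
    rw [this, ← (M.isC0Group_expQ lam).apply_add, sub_eq_add_neg]
  have e2 : M.expFree u (f u) = (-(Complex.I * (lam : ℂ))) •
      M.Q (M.liouSR (M.P (M.expFree u (M.P (M.state lam ρ u))))) := by
    rw [hf]
    simp only [map_smul]
    rw [← Q_expFree, expFree_liouI, P_expFree, P_P]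
  -- The free evolution over `t` is split as `u + (t - u)`; the part `t - u` belongs to the memory
  -- integrand, the part `u` to the conjugation.
  have e3 : ∀ y, M.P (M.expFree (-t) y) = M.expFree (-u) (M.P (M.expFree (-(t - u)) y)) := by
    intro y
    rw [← P_expFree, ← M.isC0Group_expFree.apply_add]
    congr 3
    ring
  change (-(Complex.I * (lam : ℂ))) • M.P (M.expFree (-t) (M.liouSR (M.expFree t (M.Q
    (M.propQ lam t (M.expQ lam (-u) (M.expFree u (f u)))))))) = _
  rw [e1, e2, e3]
  simp only [map_smul, smul_smul, memoryIntegrand, ContinuousLinearMap.comp_apply]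
  have e4 : -(Complex.I * (lam : ℂ)) * -(Complex.I * (lam : ℂ)) = ((-(lam ^ 2) : ℝ) : ℂ) := by
    push_cast
    linear_combination (lam : ℂ) ^ 2 * Complex.I_sq
  rw [e4, Complex.coe_smul]

theorem continuous_memoryIntegrand_conj (lam : ℝ) (ρ : TraceClass (S ⊗[ℂ] R)) :
    Continuous (Function.uncurry fun s u : ℝ => M.expFree (-u) (M.memoryIntegrand lam (s - u)
      (M.expFree u (M.P (M.state lam ρ u))))) := by
  refine M.isBoundedFamily_expFree.continuous_apply (by fun_prop) ?_
  refine ((M.continuous_memoryIntegrand lam).comp (by fun_prop)).clm_apply ?_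
  exact M.isBoundedFamily_expFree.continuous_apply continuous_snd
    (M.P.continuous.comp ((M.continuous_state lam ρ).comp continuous_snd))

/-- The equation of motion is integrated and the order of integration exchanged over the triangle `0
< u < s < t`; the inner integral over `s - u` is then the memory kernel. -/
theorem P_state_eq (lam : ℝ) (ρ : TraceClass (S ⊗[ℂ] R)) {t : ℝ} (ht : 0 ≤ t) :
    M.P (M.state lam ρ t) = M.P ρ - (lam ^ 2 : ℝ) • ∫ u in (0 : ℝ)..t, M.expFree (-u)
      ((∫ s in (0 : ℝ)..(t - u), M.memoryIntegrand lam s)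
        (M.expFree u (M.P (M.state lam ρ u)))) := by
  have hcont : Continuous fun t =>
      (-(Complex.I * (lam : ℂ))) • M.P (M.liouI t (M.Q (M.state lam ρ t))) :=
    (continuous_const_smul _).comp (M.P.continuous.comp (M.continuous_liouI_apply _
      (M.Q.continuous.comp (M.continuous_state lam ρ))))
  have h := intervalIntegral.integral_eq_sub_of_hasDerivAt
    (fun s _ => M.hasDerivAt_P_state lam ρ s) (hcont.intervalIntegrable 0 t)
  simp_rw [P_liouI_Q_state] at h
  rw [intervalIntegral.integral_smul,
    integral_integral_triangle (M.continuous_memoryIntegrand_conj lam ρ) ht, state_zero, P_P] at h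
  rw [sub_eq_add_neg, ← neg_smul, ← sub_eq_iff_eq_add', ← h]
  congr 1
  refine intervalIntegral.integral_congr fun u _ => ?_
  have h1 := intervalIntegral.integral_comp_sub_right (a := u) (b := t)
    (fun s => M.memoryIntegrand lam s) u
  rw [sub_self] at h1
  have hc : Continuous fun s => M.memoryIntegrand lam (s - u) :=
    (M.continuous_memoryIntegrand lam).comp (by fun_prop)
  change _ = M.expFree (-u) _
  rw [← h1, ContinuousLinearMap.intervalIntegral_apply (hc.intervalIntegrable _ _),
    ← ContinuousLinearMap.intervalIntegral_comp_comm]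
  exact (hc.clm_apply continuous_const).intervalIntegrable _ _

/-- The Volterra equation for the reduced dynamics. -/
theorem reducedDynamics_eq {lam τ : ℝ} (h0 : lam ≠ 0) (hτ : 0 ≤ τ) (ρ : TraceClass (S ⊗[ℂ] R)) :
    M.reducedDynamics lam τ ρ = M.P ρ - ∫ σ in (0 : ℝ)..τ, M.expFree (-(σ / lam ^ 2))
      (M.memoryKernel lam (τ - σ) (M.expFree (σ / lam ^ 2) (M.reducedDynamics lam σ ρ))) := by
  have hl : lam ^ 2 ≠ 0 := pow_ne_zero 2 h0
  rw [reducedDynamics_apply, M.P_state_eq lam ρ (div_nonneg hτ (sq_nonneg _))]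
  -- The substitution `u = σ/λ²` uses up the factor `λ²`.
  have h := intervalIntegral.integral_comp_div (a := 0) (b := τ) (fun u => M.expFree (-u)
      ((∫ s in (0 : ℝ)..(τ / lam ^ 2 - u), M.memoryIntegrand lam s)
        (M.expFree u (M.P (M.state lam ρ u))))) hl
  rw [zero_div] at h
  rw [← h]
  simp_rw [reducedDynamics_apply, memoryKernel, sub_div]

theorem continuous_reducedDynamics (lam : ℝ) (ρ : TraceClass (S ⊗[ℂ] R)) :
    Continuous fun τ => M.reducedDynamics lam τ ρ := by
  simp_rw [reducedDynamics_apply]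
  exact M.P.continuous.comp ((M.continuous_state lam ρ).comp (by fun_prop))

end Model

end VanHove

end

noncomputable section

namespace VanHove

/-! ## Averages of trigonometric polynomials -/

section Averaging

variable {E : Type*} [NormedAddCommGroup E] [NormedSpace ℂ E]

/-- The mean `k` is `x` at zero frequency and `0` otherwise; after subtracting it, an exponential
has a bounded primitive. -/
theorem exists_primitive_exp_smul (ω : ℝ) (x : E) : ∃ (k : E) (z : ℝ → E) (c : ℝ),
    ∀ t : ℝ, HasDerivAt z (Complex.exp (Complex.I * t * ω) • x - k) t ∧ ‖z t‖ ≤ c := by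
  rcases eq_or_ne ω 0 with rfl | hω
  · exact ⟨x, fun _ => 0, 0, fun t => ⟨by simpa using hasDerivAt_const t (0 : E), by simp⟩⟩
  have hω' : (ω : ℂ) ≠ 0 := by exact_mod_cast hω
  refine ⟨0, fun t => (Complex.exp (Complex.I * t * ω) / (Complex.I * ω)) • x,
    ‖(Complex.I * (ω : ℂ))⁻¹‖ * ‖x‖, fun t => ⟨?_, ?_⟩⟩
  · have h1 : HasDerivAt (fun t : ℝ => Complex.I * (t : ℂ) * ω) (Complex.I * ω) t := by
      simpa using ((Complex.ofRealCLM.hasDerivAt (x := t)).const_mul Complex.I).mul_const (ω : ℂ)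
    have h2 := (h1.cexp.div_const (Complex.I * ω)).smul_const x
    rw [mul_div_cancel_right₀ _ (mul_ne_zero Complex.I_ne_zero hω')] at h2
    rw [sub_zero]
    exact h2
  · rw [norm_smul, norm_div, norm_inv, Complex.norm_exp]
    simp [div_eq_mul_inv]

theorem exists_primitive_sum_exp_smul {α : Type*} [Fintype α] (ω : α → ℝ) (x : α → E) :
    ∃ (k : E) (z : ℝ → E) (c : ℝ), ∀ t : ℝ,
      HasDerivAt z (∑ i, Complex.exp (Complex.I * t * ω i) • x i - k) t ∧ ‖z t‖ ≤ c := by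
  choose k z c h using fun i => exists_primitive_exp_smul (ω i) (x i)
  refine ⟨∑ i, k i, fun t => ∑ i, z i t, ∑ i, c i, fun t => ⟨?_, ?_⟩⟩
  · rw [← Finset.sum_sub_distrib]
    exact HasDerivAt.fun_sum fun i _ => (h i t).1
  · exact (norm_sum_le _ _).trans (Finset.sum_le_sum fun i _ => (h i t).2)

/-- The average differs from `k` by `(z T - z 0) / T`. -/
theorem tendsto_average_of_primitive [CompleteSpace E] {y z : ℝ → E} {k : E} {c : ℝ}
    (hy : Continuous y) (h : ∀ t : ℝ, HasDerivAt z (y t - k) t ∧ ‖z t‖ ≤ c) :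
    Tendsto (fun T : ℝ => T⁻¹ • ∫ s in (0 : ℝ)..T, y s) atTop (𝓝 k) := by
  have h1 : Tendsto (fun T : ℝ => k + T⁻¹ • (z T - z 0)) atTop (𝓝 (k + 0)) := by
    refine tendsto_const_nhds.add ?_
    have h2 : Tendsto (fun T : ℝ => T⁻¹ * (2 * c)) atTop (𝓝 0) := by
      simpa using tendsto_inv_atTop_zero.mul_const (2 * c)
    refine squeeze_zero_norm' ?_ h2
    filter_upwards [eventually_ge_atTop 0] with T hT
    rw [norm_smul, Real.norm_eq_abs, abs_of_nonneg (inv_nonneg.2 hT)]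
    refine mul_le_mul_of_nonneg_left ((norm_sub_le _ _).trans ?_) (inv_nonneg.2 hT)
    linarith [(h T).2, (h 0).2]
  rw [add_zero] at h1
  refine h1.congr' ?_
  filter_upwards [eventually_gt_atTop 0] with T hT
  have h3 := intervalIntegral.integral_eq_sub_of_hasDerivAt (fun t _ => (h t).1)
    ((hy.sub continuous_const).intervalIntegrable 0 T)
  rw [intervalIntegral.integral_sub (hy.intervalIntegrable _ _)
    (continuous_const.intervalIntegrable _ _), intervalIntegral.integral_const, sub_zero] at h3
  rw [← h3, smul_sub, smul_smul, inv_mul_cancel₀ hT.ne', one_smul, add_sub_cancel]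

/-- Grönwall's inequality in integral form. -/
theorem le_mul_exp_of_le_add_integral {y : ℝ → ℝ} (hy : Continuous y) {a c b : ℝ} (hc : 0 ≤ c)
    (h : ∀ t ∈ Icc 0 b, y t ≤ a + c * ∫ s in (0 : ℝ)..t, y s) {t : ℝ} (ht : t ∈ Icc 0 b) :
    y t ≤ a * Real.exp (c * t) := by
  set w : ℝ → ℝ := fun t => Real.exp (-(c * t)) * (a + c * ∫ s in (0 : ℝ)..t, y s) with hw
  have hd : ∀ t, HasDerivAt w (-(c * 1) * Real.exp (-(c * t)) * (a + c * ∫ s in (0 : ℝ)..t, y s)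
      + Real.exp (-(c * t)) * (c * y t)) t := fun t => by
    have h1 : HasDerivAt (fun t => ∫ s in (0 : ℝ)..t, y s) (y t) t :=
      intervalIntegral.integral_hasDerivAt_right (hy.intervalIntegrable 0 t)
        (hy.stronglyMeasurableAtFilter _ _) hy.continuousAt
    have h2 : HasDerivAt (fun t => Real.exp (-(c * t))) (-(c * 1) * Real.exp (-(c * t))) t := by
      have := (((hasDerivAt_id t).const_mul c).neg).exp
      rw [mul_comm] at this
      exact this
    exact h2.mul ((h1.const_mul c).const_add a)
  have hanti : AntitoneOn w (Icc 0 b) := by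
    refine antitoneOn_of_deriv_nonpos (convex_Icc 0 b)
      (fun x _ => (hd x).continuousAt.continuousWithinAt)
      (fun x _ => (hd x).differentiableAt.differentiableWithinAt) fun x hx => ?_
    rw [(hd x).deriv]
    have h3 := h x (interior_subset hx)
    have h4 := mul_nonneg (mul_nonneg hc (Real.exp_pos (-(c * x))).le) (sub_nonneg.2 h3)
    linarith
  have h5 := hanti (left_mem_Icc.2 (ht.1.trans ht.2)) ht ht.1
  have h6 : w 0 = a := by simp [hw]
  rw [h6] at h5
  refine (h t ht).trans ?_
  have h7 : a + c * ∫ s in (0 : ℝ)..t, y s = w t * Real.exp (c * t) := by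
    rw [hw]
    simp only
    rw [mul_right_comm, ← Real.exp_add, neg_add_cancel, Real.exp_zero, one_mul]
  rw [h7]
  exact mul_le_mul_of_nonneg_right h5 (Real.exp_pos _).le

theorem exp_apply_of_apply_eq_smul [CompleteSpace E] {A : E →L[ℂ] E} {c : ℂ} {v : E}
    (h : A v = c • v) : NormedSpace.exp A v = Complex.exp c • v := by
  have h1 := (NormedSpace.exp_series_hasSum_exp' (𝕂 := ℂ) A).mapL
    (ContinuousLinearMap.apply ℂ E v)
  have h2 := (NormedSpace.exp_series_hasSum_exp' (𝕂 := ℂ) c).smul_const v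
  rw [← Complex.exp_eq_exp_ℂ] at h2
  have h3 : ∀ n : ℕ, (A ^ n) v = c ^ n • v := fun n => by
    induction n with
    | zero => simp
    | succ n ih => rw [pow_succ', mul_apply_eq_comp, ih, map_smul, h,
        smul_smul, pow_succ]
  refine h1.unique ?_
  convert h2 using 2 with n
  simp [h3, smul_smul]

end Averaging

namespace Model

variable {S R : Type*} [NormedAddCommGroup S] [InnerProductSpace ℂ S]
  [FiniteDimensional ℂ S] [NormedAddCommGroup R] [InnerProductSpace ℂ R] [CompleteSpace R]
  (M : Model S R)

/-! ## The averaged kernel -/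

/-- An orthonormal basis of eigenvectors of the Hamiltonian of the system. -/
abbrev eigenbasis : OrthonormalBasis (Fin (Module.finrank ℂ S)) ℂ S :=
  M.hamS_symm.eigenvectorBasis rfl

/-- The eigenvalues of the Hamiltonian of the system. -/
abbrev energy (i : Fin (Module.finrank ℂ S)) : ℝ := M.hamS_symm.eigenvalues rfl i

theorem expH_eigenbasis (t : ℝ) (i : Fin (Module.finrank ℂ S)) :
    M.expH t (M.eigenbasis i) = Complex.exp (-(Complex.I * t * M.energy i)) • M.eigenbasis i := by
  rw [expH]
  refine exp_apply_of_apply_eq_smul ?_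
  have h : M.hamS (M.eigenbasis i) = (M.energy i : ℂ) • M.eigenbasis i :=
    M.hamS_symm.apply_eigenvectorBasis rfl i
  rw [smul_apply, h, smul_smul, neg_mul]

theorem expFree_matrixUnit (t : ℝ) (i j : Fin (Module.finrank ℂ S)) :
    M.expFree t (M.matrixUnit M.eigenbasis i j)
      = Complex.exp (-(Complex.I * t * (M.energy i - M.energy j))) •
        M.matrixUnit M.eigenbasis i j := by
  rw [matrixUnit, expFree_tmul, op_Ω, expH_eigenbasis, expH_eigenbasis,
    ← TensorProduct.smul_tmul', ← TensorProduct.smul_tmul', ketBra_smul_left, ketBra_smul_right,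
    smul_smul, ← Complex.exp_conj, ← Complex.exp_add]
  congr 2
  simp only [map_neg, map_mul, Complex.conj_I, Complex.conj_ofReal]
  ring

/-- In the matrix units of an eigenbasis of `H_S` the free evolution is diagonal. Conjugation
multiplies each of the finitely many matrix elements of `K` by an exponential whose frequency is a
difference of Bohr frequencies. -/
theorem exists_primitive_conj {K : TraceClass (S ⊗[ℂ] R) →L[ℂ] TraceClass (S ⊗[ℂ] R)}
    (h1 : M.P ∘L K = K) (h2 : K ∘L M.P = K) :
    ∃ (k : TraceClass (S ⊗[ℂ] R) →L[ℂ] TraceClass (S ⊗[ℂ] R))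
      (z : ℝ → TraceClass (S ⊗[ℂ] R) →L[ℂ] TraceClass (S ⊗[ℂ] R)) (c : ℝ), ∀ t : ℝ,
        HasDerivAt z (M.expFree (-t) ∘L K ∘L M.expFree t - k) t ∧ ‖z t‖ ≤ c := by
  set b := M.eigenbasis with hb
  set ω : (Fin (Module.finrank ℂ S) × Fin (Module.finrank ℂ S)) ×
      (Fin (Module.finrank ℂ S) × Fin (Module.finrank ℂ S)) → ℝ := fun p =>
    (M.energy p.2.1 - M.energy p.2.2) - (M.energy p.1.1 - M.energy p.1.2)
  obtain ⟨k, z, c, h⟩ := exists_primitive_sum_exp_smul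
    (E := TraceClass (S ⊗[ℂ] R) →L[ℂ] TraceClass (S ⊗[ℂ] R)) ω fun p =>
    (matrixCoeff R b p.1.1 p.1.2).smulRight
      (matrixCoeff R b p.2.1 p.2.2 (K (M.matrixUnit b p.1.1 p.1.2)) •
        M.matrixUnit b p.2.1 p.2.2)
  refine ⟨k, z, c, fun t => ⟨?_, (h t).2⟩⟩
  refine (h t).1.congr_deriv (congrArg (· - k) (Eq.symm (ContinuousLinearMap.ext fun ρ => ?_)))
  have e1 : ∀ y, K y = M.P (K y) := fun y => (DFunLike.congr_fun h1 y).symm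
  have e2 : ∀ y, K y = K (M.P y) := fun y => (DFunLike.congr_fun h2 y).symm
  rw [ContinuousLinearMap.comp_apply, ContinuousLinearMap.comp_apply, e2, P_expFree,
    P_eq_sum M b ρ]
  simp only [map_sum, map_smul, expFree_matrixUnit, hb]
  rw [sum_apply, Fintype.sum_prod_type, Fintype.sum_prod_type]
  refine Finset.sum_congr rfl fun i _ => Finset.sum_congr rfl fun j _ => ?_
  rw [e1, P_eq_sum M M.eigenbasis, Fintype.sum_prod_type]
  simp only [map_sum, map_smul, expFree_matrixUnit, Finset.smul_sum, smul_apply,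
    ContinuousLinearMap.smulRight_apply, smul_smul]
  refine Finset.sum_congr rfl fun k _ => Finset.sum_congr rfl fun l _ => ?_
  congr 1
  have e3 : Complex.exp (Complex.I * t * (ω ((i, j), (k, l)) : ℝ))
      = Complex.exp (-(Complex.I * t * (M.energy i - M.energy j)))
        * Complex.exp (-(Complex.I * (-t : ℝ) * (M.energy k - M.energy l))) := by
    rw [← Complex.exp_add]
    congr 1
    simp only [ω]
    push_cast
    ring
  rw [e3]
  ring

theorem limitKernel_apply (hφ : Integrable M.φ) (ρ : TraceClass (S ⊗[ℂ] R)) :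
    M.limitKernel ρ = ∫ s in Ioi (0 : ℝ), M.limitIntegrand s ρ :=
  ContinuousLinearMap.integral_apply (M.integrable_limitIntegrand hφ).integrableOn ρ

theorem limitKernel_comp_P (hφ : Integrable M.φ) : M.limitKernel ∘L M.P = M.limitKernel := by
  refine ContinuousLinearMap.ext fun ρ => ?_
  rw [ContinuousLinearMap.comp_apply, M.limitKernel_apply hφ, M.limitKernel_apply hφ]
  refine integral_congr_ae (ae_of_all _ fun s => ?_)
  change (M.limitIntegrand s ∘L M.P) ρ = _
  rw [limitIntegrand_comp_P]

theorem P_comp_limitKernel (hφ : Integrable M.φ) : M.P ∘L M.limitKernel = M.limitKernel := by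
  refine ContinuousLinearMap.ext fun ρ => ?_
  have hi : IntegrableOn (fun s => M.limitIntegrand s ρ) (Ioi 0) :=
    ((M.integrable_limitIntegrand hφ).integrableOn).apply_continuousLinearMap ρ
  rw [ContinuousLinearMap.comp_apply, M.limitKernel_apply hφ,
    ← ContinuousLinearMap.integral_comp_comm _ hi]
  refine integral_congr_ae (ae_of_all _ fun s => ?_)
  simp only [limitIntegrand_apply, P_P]

theorem expS_conj {K : TraceClass (S ⊗[ℂ] R) →L[ℂ] TraceClass (S ⊗[ℂ] R)}
    (h1 : M.P ∘L K = K) (h2 : K ∘L M.P = K) (s : ℝ) :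
    M.expS (-s) ∘L K ∘L M.expS s = M.expFree (-s) ∘L K ∘L M.expFree s := by
  refine ContinuousLinearMap.ext fun ρ => ?_
  have e1 : ∀ y, K y = M.P (K y) := fun y => (DFunLike.congr_fun h1 y).symm
  have e2 : ∀ y, K y = K (M.P y) := fun y => (DFunLike.congr_fun h2 y).symm
  simp only [ContinuousLinearMap.comp_apply]
  rw [e2, P_expS, ← expFree_P, ← P_expFree, ← e2, e1, ← expFree_P]

theorem continuous_conj {K : TraceClass (S ⊗[ℂ] R) →L[ℂ] TraceClass (S ⊗[ℂ] R)}
    (h2 : K ∘L M.P = K) : Continuous fun s => M.expFree (-s) ∘L K ∘L M.expFree s := by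
  refine continuous_of_comp_P (M := M) (fun s => ?_) fun ρ => ?_
  · refine ContinuousLinearMap.ext fun ρ => ?_
    simp only [ContinuousLinearMap.comp_apply]
    rw [← P_expFree]
    exact congrArg _ (DFunLike.congr_fun h2 _)
  · exact M.isBoundedFamily_expFree.continuous_apply continuous_neg
      (K.continuous.comp (M.isC0Group_expFree.continuous ρ))

end Model

end VanHove

end

noncomputable section

namespace VanHove

open scoped ENNReal

theorem neg_ofReal_smul {E : Type*} [NormedAddCommGroup E] [NormedSpace ℂ E] (k : E) (τ : ℝ) :
    (-(τ : ℂ)) • k = τ • (-k) := by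
  rw [neg_smul, smul_neg, Complex.coe_smul]

namespace Model

variable {S R : Type*} [NormedAddCommGroup S] [InnerProductSpace ℂ S]
  [FiniteDimensional ℂ S] [NormedAddCommGroup R] [InnerProductSpace ℂ R] [CompleteSpace R]
  (M : Model S R)

/-! ## Convergence of the reduced dynamics -/

/-- The semigroup `e^{-τ k} P`. -/
def semigroup (k : TraceClass (S ⊗[ℂ] R) →L[ℂ] TraceClass (S ⊗[ℂ] R)) (τ : ℝ) :
    TraceClass (S ⊗[ℂ] R) →L[ℂ] TraceClass (S ⊗[ℂ] R) :=
  NormedSpace.exp ((-(τ : ℂ)) • k) ∘L M.P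

variable {k : TraceClass (S ⊗[ℂ] R) →L[ℂ] TraceClass (S ⊗[ℂ] R)}

theorem hasDerivAt_semigroup (τ : ℝ) (ρ : TraceClass (S ⊗[ℂ] R)) :
    HasDerivAt (fun τ => M.semigroup k τ ρ) (-(k (M.semigroup k τ ρ))) τ := by
  have h2 := (hasDerivAt_exp_smul_const' (-k) τ).clm_apply_const (M.P ρ)
  simp_rw [← neg_ofReal_smul] at h2
  exact h2

theorem semigroup_zero (ρ : TraceClass (S ⊗[ℂ] R)) : M.semigroup k 0 ρ = M.P ρ := by
  simp [semigroup]

theorem continuous_semigroup (ρ : TraceClass (S ⊗[ℂ] R)) :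
    Continuous fun τ => M.semigroup k τ ρ :=
  continuous_iff_continuousAt.2 fun τ => (M.hasDerivAt_semigroup τ ρ).continuousAt

theorem semigroup_eq (τ : ℝ) (ρ : TraceClass (S ⊗[ℂ] R)) :
    M.semigroup k τ ρ = M.P ρ - ∫ σ in (0 : ℝ)..τ, k (M.semigroup k σ ρ) := by
  have h := intervalIntegral.integral_eq_sub_of_hasDerivAt
    (fun σ _ => M.hasDerivAt_semigroup (k := k) σ ρ)
    ((k.continuous.comp (M.continuous_semigroup ρ)).neg.intervalIntegrable 0 τ)
  rw [intervalIntegral.integral_neg, semigroup_zero] at h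
  rw [sub_eq_add_neg, h, add_sub_cancel]

theorem exists_norm_semigroup_le (k : TraceClass (S ⊗[ℂ] R) →L[ℂ] TraceClass (S ⊗[ℂ] R))
    (τ₁ : ℝ) : ∃ c : ℝ, 0 ≤ c ∧ ∀ τ ∈ Icc 0 τ₁, ‖M.semigroup k τ‖ ≤ c := by
  have hc : Continuous fun τ : ℝ => M.semigroup k τ := by
    have h : Continuous fun τ : ℝ => NormedSpace.exp ((-(τ : ℂ)) • k) := by
      have h1 : Continuous fun τ : ℝ => NormedSpace.exp (τ • (-k)) :=
        continuous_iff_continuousAt.2 fun τ => (hasDerivAt_exp_smul_const' (-k) τ).continuousAt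
      exact h1.congr fun τ => congrArg _ (neg_ofReal_smul k τ).symm
    exact h.clm_comp continuous_const
  obtain ⟨c, h⟩ := isCompact_Icc.exists_bound_of_continuousOn (s := Icc 0 τ₁) hc.continuousOn
  exact ⟨max c 0, le_max_right _ _, fun τ hτ => (h τ hτ).trans (le_max_left _ _)⟩

theorem continuous_memoryKernel (lam : ℝ) : Continuous (M.memoryKernel lam) :=
  (intervalIntegral.continuous_primitive
    (fun _ _ => (M.continuous_memoryIntegrand lam).intervalIntegrable _ _) 0).comp
      (continuous_id.div_const _)

theorem norm_expFree_apply_le (t : ℝ) (ρ : TraceClass (S ⊗[ℂ] R)) : ‖M.expFree t ρ‖ ≤ ‖ρ‖ := by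
  simpa using (M.expFree t).le_of_opNorm_le (M.norm_expFree_le t) ρ

theorem norm_expFree_conj_apply_le (s : ℝ)
    (X : TraceClass (S ⊗[ℂ] R) →L[ℂ] TraceClass (S ⊗[ℂ] R)) (ρ : TraceClass (S ⊗[ℂ] R)) :
    ‖M.expFree (-s) (X (M.expFree s ρ))‖ ≤ ‖X‖ * ‖ρ‖ :=
  (M.norm_expFree_apply_le _ _).trans ((X.le_opNorm _).trans
    (mul_le_mul_of_nonneg_left (M.norm_expFree_apply_le _ _) (norm_nonneg _)))

/-- The integral of a rapidly oscillating term against the semigroup. -/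
theorem norm_integral_conj_sub_le {K : TraceClass (S ⊗[ℂ] R) →L[ℂ] TraceClass (S ⊗[ℂ] R)}
    {z : ℝ → TraceClass (S ⊗[ℂ] R) →L[ℂ] TraceClass (S ⊗[ℂ] R)} {c : ℝ}
    (hz : ∀ t : ℝ, HasDerivAt z (M.expFree (-t) ∘L K ∘L M.expFree t - k) t ∧ ‖z t‖ ≤ c)
    {lam : ℝ} (h0 : lam ≠ 0) {τ v : ℝ} (hτ : 0 ≤ τ) {ρ : TraceClass (S ⊗[ℂ] R)}
    (hv : ∀ σ ∈ Icc 0 τ, ‖M.semigroup k σ ρ‖ ≤ v) :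
    ‖∫ σ in (0 : ℝ)..τ, (M.expFree (-(σ / lam ^ 2)) (K (M.expFree (σ / lam ^ 2)
        (M.semigroup k σ ρ))) - k (M.semigroup k σ ρ))‖ ≤ lam ^ 2 * c * v * (2 + ‖k‖ * τ) := by
  have hl : 0 < lam ^ 2 := by positivity
  have hc : 0 ≤ c := (norm_nonneg _).trans (hz 0).2
  have hv0 : 0 ≤ v := (norm_nonneg _).trans (hv 0 (left_mem_Icc.2 hτ))
  -- After rescaling of time the primitive of the oscillating term is of size `λ²`; it is paired
  -- with the semigroup, whose derivative is bounded, in an integration by parts.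
  have hd : ∀ σ : ℝ, HasDerivAt (fun σ => (lam ^ 2) • z (σ / lam ^ 2))
      (M.expFree (-(σ / lam ^ 2)) ∘L K ∘L M.expFree (σ / lam ^ 2) - k) σ := fun σ => by
    have h1 := (hz (σ / lam ^ 2)).1.scomp σ ((hasDerivAt_id σ).div_const (lam ^ 2))
    have h2 := h1.const_smul (lam ^ 2)
    rw [smul_smul, mul_one_div_cancel hl.ne', one_smul] at h2
    exact h2
  have hZ : ∀ σ, ‖(lam ^ 2) • z (σ / lam ^ 2)‖ ≤ lam ^ 2 * c := fun σ => by
    rw [norm_smul, Real.norm_eq_abs, abs_of_pos hl]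
    exact mul_le_mul_of_nonneg_left (hz _).2 hl.le
  set Z := fun σ => (lam ^ 2) • z (σ / lam ^ 2) with hZdef
  have hZc : Continuous Z := continuous_iff_continuousAt.2 fun σ => (hd σ).continuousAt
  have hvc := M.continuous_semigroup (k := k) ρ
  have hprod : ∀ σ : ℝ, HasDerivAt (fun σ => Z σ (M.semigroup k σ ρ))
      ((M.expFree (-(σ / lam ^ 2)) (K (M.expFree (σ / lam ^ 2) (M.semigroup k σ ρ)))
        - k (M.semigroup k σ ρ)) + Z σ (-(k (M.semigroup k σ ρ)))) σ := fun σ =>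
    hasDerivAt_clm_apply_of_bound (Eventually.of_forall hZ)
      ((hZc.clm_apply continuous_const).tendsto σ) ((hd σ).clm_apply_const _)
      (M.hasDerivAt_semigroup σ ρ)
  have hc1 : Continuous fun σ => M.expFree (-(σ / lam ^ 2)) (K (M.expFree (σ / lam ^ 2)
      (M.semigroup k σ ρ))) - k (M.semigroup k σ ρ) := by
    refine Continuous.sub ?_ (k.continuous.comp hvc)
    exact M.isBoundedFamily_expFree.continuous_apply (by fun_prop) (K.continuous.comp
      (M.isBoundedFamily_expFree.continuous_apply (by fun_prop) hvc))
  have hc2 : Continuous fun σ => Z σ (-(k (M.semigroup k σ ρ))) :=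
    hZc.clm_apply (k.continuous.comp hvc).neg
  have h := intervalIntegral.integral_eq_sub_of_hasDerivAt (fun σ _ => hprod σ)
    ((hc1.add hc2).intervalIntegrable 0 τ)
  rw [intervalIntegral.integral_add (hc1.intervalIntegrable _ _) (hc2.intervalIntegrable _ _)] at h
  rw [eq_sub_of_add_eq h]
  have b1 : ∀ σ ∈ Icc 0 τ, ‖Z σ (M.semigroup k σ ρ)‖ ≤ lam ^ 2 * c * v := fun σ hσ =>
    (ContinuousLinearMap.le_of_opNorm_le _ (hZ σ) _).trans
      (mul_le_mul_of_nonneg_left (hv σ hσ) (by positivity))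
  have b2 : ‖∫ σ in (0 : ℝ)..τ, Z σ (-(k (M.semigroup k σ ρ)))‖
      ≤ lam ^ 2 * c * (‖k‖ * v) * |τ - 0| := by
    refine intervalIntegral.norm_integral_le_of_norm_le_const fun σ hσ => ?_
    rw [uIoc_of_le hτ] at hσ
    refine (ContinuousLinearMap.le_of_opNorm_le _ (hZ σ) _).trans
      (mul_le_mul_of_nonneg_left ?_ (by positivity))
    rw [norm_neg]
    exact (k.le_opNorm _).trans
      (mul_le_mul_of_nonneg_left (hv σ (Ioc_subset_Icc_self hσ)) (norm_nonneg _))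
  rw [sub_zero, abs_of_nonneg hτ] at b2
  have b3 := norm_sub_le (Z τ (M.semigroup k τ ρ) - Z 0 (M.semigroup k 0 ρ))
    (∫ σ in (0 : ℝ)..τ, Z σ (-(k (M.semigroup k σ ρ))))
  have b4 := norm_sub_le (Z τ (M.semigroup k τ ρ)) (Z 0 (M.semigroup k 0 ρ))
  have b5 := b1 τ (right_mem_Icc.2 hτ)
  have b6 := b1 0 (left_mem_Icc.2 hτ)
  refine b3.trans ?_
  linear_combination b4 + b5 + b6 + b2

/-- Subtracting the two integral equations leaves three terms: the kernel `K^λ` acting on the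
difference, to be closed by Grönwall; the error `K^λ - K` on the semigroup, bounded in `L¹`; and the
oscillation of the conjugated `K` about its mean. -/
theorem norm_reducedDynamics_sub_le {K : TraceClass (S ⊗[ℂ] R) →L[ℂ] TraceClass (S ⊗[ℂ] R)}
    {z : ℝ → TraceClass (S ⊗[ℂ] R) →L[ℂ] TraceClass (S ⊗[ℂ] R)} {c : ℝ}
    (hz : ∀ t : ℝ, HasDerivAt z (M.expFree (-t) ∘L K ∘L M.expFree t - k) t ∧ ‖z t‖ ≤ c)
    {lam : ℝ} (h0 : lam ≠ 0) {τ₁ v κ : ℝ} (hv0 : 0 ≤ v)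
    (hv : ∀ τ ∈ Icc 0 τ₁, ‖M.semigroup k τ‖ ≤ v)
    (hκ0 : 0 ≤ κ) (hκ : ∀ τ ∈ Icc 0 τ₁, ‖M.memoryKernel lam τ‖ ≤ κ) {τ : ℝ} (hτ : τ ∈ Icc 0 τ₁) :
    ‖M.reducedDynamics lam τ - M.semigroup k τ‖
      ≤ ((∫ σ in (0 : ℝ)..τ₁, ‖M.memoryKernel lam σ - K‖) * v
          + lam ^ 2 * c * v * (2 + ‖k‖ * τ₁)) * Real.exp (κ * τ₁) := by
  have hc : 0 ≤ c := (norm_nonneg _).trans (hz 0).2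
  have hτ₁ : 0 ≤ τ₁ := hτ.1.trans hτ.2
  set I := ∫ σ in (0 : ℝ)..τ₁, ‖M.memoryKernel lam σ - K‖ with hI
  have hI0 : 0 ≤ I := intervalIntegral.integral_nonneg hτ₁ fun _ _ => norm_nonneg _
  refine ContinuousLinearMap.opNorm_le_bound _ (by positivity) fun ρ => ?_
  have huc := M.continuous_reducedDynamics lam ρ
  have hvc := M.continuous_semigroup (k := k) ρ
  have hmc := M.continuous_memoryKernel lam
  set y := fun τ => M.reducedDynamics lam τ ρ - M.semigroup k τ ρ with hy
  have hyc : Continuous y := huc.sub hvc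
  have hvρ : ∀ σ ∈ Icc 0 τ₁, ‖M.semigroup k σ ρ‖ ≤ v * ‖ρ‖ := fun σ hσ =>
    ContinuousLinearMap.le_of_opNorm_le _ (hv σ hσ) ρ
  have key : ∀ t ∈ Icc 0 τ₁, ‖y t‖ ≤ (I * v + lam ^ 2 * c * v * (2 + ‖k‖ * τ₁)) * ‖ρ‖
      + κ * ∫ σ in (0 : ℝ)..t, ‖y σ‖ := by
    intro t ht
    have hconj : ∀ {X : ℝ → TraceClass (S ⊗[ℂ] R) →L[ℂ] TraceClass (S ⊗[ℂ] R)}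
        {w : ℝ → TraceClass (S ⊗[ℂ] R)}, Continuous X → Continuous w → Continuous fun σ =>
          M.expFree (-(σ / lam ^ 2)) (X σ (M.expFree (σ / lam ^ 2) (w σ))) := fun hX hw =>
      M.isBoundedFamily_expFree.continuous_apply (by fun_prop) (hX.clm_apply
        (M.isBoundedFamily_expFree.continuous_apply (by fun_prop) hw))
    have hX : Continuous fun σ => M.memoryKernel lam (t - σ) := hmc.comp (by fun_prop)
    have c1 := hconj hX hyc
    have c2 : Continuous fun σ => M.expFree (-(σ / lam ^ 2))
        ((M.memoryKernel lam (t - σ) - K) (M.expFree (σ / lam ^ 2) (M.semigroup k σ ρ))) :=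
      hconj (hX.sub (continuous_const (y := K))) hvc
    have c3 : Continuous fun σ => M.expFree (-(σ / lam ^ 2)) (K (M.expFree (σ / lam ^ 2)
        (M.semigroup k σ ρ))) - k (M.semigroup k σ ρ) :=
      (hconj (continuous_const (y := K)) hvc).sub (k.continuous.comp hvc)
    have c4 : Continuous fun σ => k (M.semigroup k σ ρ) := k.continuous.comp hvc
    have e : y t = -((∫ σ in (0 : ℝ)..t, M.expFree (-(σ / lam ^ 2))
          (M.memoryKernel lam (t - σ) (M.expFree (σ / lam ^ 2) (y σ))))
        + (∫ σ in (0 : ℝ)..t, M.expFree (-(σ / lam ^ 2))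
          ((M.memoryKernel lam (t - σ) - K) (M.expFree (σ / lam ^ 2) (M.semigroup k σ ρ))))
        + ∫ σ in (0 : ℝ)..t, (M.expFree (-(σ / lam ^ 2)) (K (M.expFree (σ / lam ^ 2)
          (M.semigroup k σ ρ))) - k (M.semigroup k σ ρ))) := by
      rw [← intervalIntegral.integral_add (c1.intervalIntegrable _ _)
        (c2.intervalIntegrable _ _), ← intervalIntegral.integral_add
        ((show Continuous fun σ => _ + _ from c1.add c2).intervalIntegrable _ _) (c3.intervalIntegrable _ _)]
      simp only [hy]
      rw [M.reducedDynamics_eq h0 ht.1, M.semigroup_eq t, sub_sub_sub_cancel_left, ← neg_sub,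
        ← intervalIntegral.integral_sub ((hconj hX huc).intervalIntegrable _ _)
          (c4.intervalIntegrable _ _)]
      congr 1
      refine intervalIntegral.integral_congr fun σ _ => ?_
      simp only [map_sub, sub_apply]
      abel
    have b1 : ‖∫ σ in (0 : ℝ)..t, M.expFree (-(σ / lam ^ 2))
        (M.memoryKernel lam (t - σ) (M.expFree (σ / lam ^ 2) (y σ)))‖
          ≤ κ * ∫ σ in (0 : ℝ)..t, ‖y σ‖ := by
      rw [← intervalIntegral.integral_const_mul]
      refine intervalIntegral.norm_integral_le_of_norm_le ht.1 (ae_of_all _ fun σ hσ => ?_)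
        ((hyc.norm.const_mul κ).intervalIntegrable _ _)
      refine (M.norm_expFree_conj_apply_le _ _ _).trans
        (mul_le_mul_of_nonneg_right (hκ _ ⟨?_, ?_⟩) (norm_nonneg _))
      · linarith [hσ.2]
      · linarith [hσ.1, ht.2]
    have b2 : ‖∫ σ in (0 : ℝ)..t, M.expFree (-(σ / lam ^ 2))
        ((M.memoryKernel lam (t - σ) - K) (M.expFree (σ / lam ^ 2) (M.semigroup k σ ρ)))‖
          ≤ I * (v * ‖ρ‖) := by
      have h1 : ‖∫ σ in (0 : ℝ)..t, M.expFree (-(σ / lam ^ 2))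
          ((M.memoryKernel lam (t - σ) - K) (M.expFree (σ / lam ^ 2) (M.semigroup k σ ρ)))‖
          ≤ ∫ σ in (0 : ℝ)..t, ‖M.memoryKernel lam (t - σ) - K‖ * (v * ‖ρ‖) := by
        refine intervalIntegral.norm_integral_le_of_norm_le ht.1 (ae_of_all _ fun σ hσ => ?_)
          (((hX.sub continuous_const).norm.mul_const _).intervalIntegrable _ _)
        refine (M.norm_expFree_conj_apply_le _ _ _).trans
          (mul_le_mul_of_nonneg_left (hvρ σ ⟨hσ.1.le, hσ.2.trans ht.2⟩) (norm_nonneg _))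
      refine h1.trans ?_
      rw [intervalIntegral.integral_mul_const]
      refine mul_le_mul_of_nonneg_right ?_ (by positivity)
      rw [intervalIntegral.integral_comp_sub_left (fun σ => ‖M.memoryKernel lam σ - K‖) t,
        sub_self, sub_zero]
      exact intervalIntegral.integral_mono_interval le_rfl ht.1 ht.2
        (ae_of_all _ fun _ => norm_nonneg _)
        ((hmc.sub continuous_const).norm.intervalIntegrable _ _)
    have b3 := M.norm_integral_conj_sub_le hz h0 ht.1
      (fun σ hσ => hvρ σ ⟨hσ.1, hσ.2.trans ht.2⟩)
    have b4 : lam ^ 2 * c * (v * ‖ρ‖) * (2 + ‖k‖ * t)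
        ≤ lam ^ 2 * c * (v * ‖ρ‖) * (2 + ‖k‖ * τ₁) := by
      have := ht.2
      gcongr
    rw [e, norm_neg]
    refine (norm_add₃_le).trans ?_
    linear_combination b1 + b2 + b3 + b4
  have hg := le_mul_exp_of_le_add_integral hyc.norm hκ0 key hτ
  change ‖y τ‖ ≤ _
  refine hg.trans ?_
  rw [mul_right_comm]
  have := hτ.2
  gcongr

variable {M} {F : ℝ → ℝ≥0∞} {C : ℝ}

/-- Uniform convergence is available only away from `σ = 0`; the bound on `K^λ` over the whole of
`[0, τ₁]` dominates near `0`, so the `L¹` norm still tends to zero. -/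
theorem tendsto_integral_norm_memoryKernel_sub (hφ : Integrable M.φ) (hF : M.IsMajorant F C)
    {τ₁ : ℝ} (h1 : 0 < τ₁) :
    Tendsto (fun lam => ∫ σ in (0 : ℝ)..τ₁, ‖M.memoryKernel lam σ - M.limitKernel‖) (𝓝[≠] 0)
      (𝓝 0) := by
  obtain ⟨κ, hκ0, hκ⟩ := exists_norm_memoryKernel_le hφ hF h1
  have h := intervalIntegral.tendsto_integral_filter_of_dominated_convergence (μ := volume)
    (l := 𝓝[≠] 0) (a := 0) (b := τ₁)
    (F := fun lam σ => ‖M.memoryKernel lam σ - M.limitKernel‖) (f := fun _ => (0 : ℝ))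
    (fun _ => κ + ‖M.limitKernel‖)
    (Eventually.of_forall fun lam =>
      ((M.continuous_memoryKernel lam).sub continuous_const).norm.aestronglyMeasurable) ?_
    (by simp) ?_
  · simpa using h
  · filter_upwards [hκ] with lam h
    refine ae_of_all _ fun σ hσ => ?_
    rw [uIoc_of_le h1.le] at hσ
    rw [norm_norm]
    exact (norm_sub_le _ _).trans (add_le_add_left (h σ (Ioc_subset_Icc_self hσ)) _)
  · refine ae_of_all _ fun σ hσ => ?_
    rw [uIoc_of_le h1.le] at hσ
    have h2 := (tendstoUniformlyOn_memoryKernel hφ hF hσ.1 (lt_add_one σ)).tendsto_at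
      (left_mem_Icc.2 (lt_add_one σ).le)
    exact tendsto_iff_norm_sub_tendsto_zero.1 h2

theorem tendstoUniformlyOn_reducedDynamics (hφ : Integrable M.φ) (hF : M.IsMajorant F C)
    {z : ℝ → TraceClass (S ⊗[ℂ] R) →L[ℂ] TraceClass (S ⊗[ℂ] R)} {c : ℝ}
    (hz : ∀ t : ℝ, HasDerivAt z (M.expFree (-t) ∘L M.limitKernel ∘L M.expFree t - k) t
      ∧ ‖z t‖ ≤ c) {τ₁ : ℝ} (h1 : 0 < τ₁) :
    TendstoUniformlyOn M.reducedDynamics (M.semigroup k) (𝓝[≠] 0) (Icc 0 τ₁) := by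
  obtain ⟨κ, hκ0, hκ⟩ := exists_norm_memoryKernel_le hφ hF h1
  obtain ⟨v, hv0, hv⟩ := M.exists_norm_semigroup_le k τ₁
  have hsq : Tendsto (fun lam : ℝ => lam ^ 2) (𝓝[≠] 0) (𝓝 0) := by
    have : Continuous fun lam : ℝ => lam ^ 2 := by fun_prop
    simpa using (this.tendsto 0).mono_left nhdsWithin_le_nhds
  have ha : Tendsto (fun lam : ℝ =>
      ((∫ σ in (0 : ℝ)..τ₁, ‖M.memoryKernel lam σ - M.limitKernel‖) * v
        + lam ^ 2 * c * v * (2 + ‖k‖ * τ₁)) * Real.exp (κ * τ₁)) (𝓝[≠] 0) (𝓝 0) := by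
    have := ((((tendsto_integral_norm_memoryKernel_sub hφ hF h1).mul_const v).add
      (((hsq.mul_const c).mul_const v).mul_const (2 + ‖k‖ * τ₁)))).mul_const (Real.exp (κ * τ₁))
    simpa using this
  rw [Metric.tendstoUniformlyOn_iff]
  intro ε hε
  filter_upwards [ha.eventually (gt_mem_nhds hε), hκ, self_mem_nhdsWithin] with lam h2 h3 h4 τ hτ
  rw [dist_comm, dist_eq_norm]
  exact (M.norm_reducedDynamics_sub_le hz h4 hv0 hv hκ0 h3 hτ).trans_lt
    h2

end Model

end VanHove

theorem mainTheorem1 {S R : Type*}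
    [NormedAddCommGroup S] [InnerProductSpace ℂ S] [FiniteDimensional ℂ S]
    [NormedAddCommGroup R] [InnerProductSpace ℂ R] [CompleteSpace R]
    [TopologicalSpace.SeparableSpace R]
    (M : VanHove.Model S R) (hφ : Integrable M.φ)
    (hcl : VanHove.ClusteringProperty M.U M.V M.ω) :
    (∀ lam τ : ℝ, IntervalIntegrable (M.memoryIntegrand lam) volume 0 (τ / lam ^ 2)) ∧
    IntegrableOn M.limitIntegrand (Ioi 0) ∧
    (∀ τ₀ τ₁ : ℝ, 0 < τ₀ → τ₀ < τ₁ →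
      TendstoUniformlyOn M.memoryKernel (fun _ => M.limitKernel) (𝓝[≠] 0) (Icc τ₀ τ₁)) ∧
    ∃ Knat : VanHove.TraceClass (S ⊗[ℂ] R) →L[ℂ] VanHove.TraceClass (S ⊗[ℂ] R),
      Tendsto (M.timeAverage M.limitKernel) atTop (𝓝 Knat) ∧
      ∀ τ₁ : ℝ, 0 < τ₁ →
        TendstoUniformlyOn M.reducedDynamics
          (fun τ => NormedSpace.exp ((-(τ : ℂ)) • Knat) ∘L M.P) (𝓝[≠] 0) (Icc 0 τ₁) := by
  obtain ⟨F, C, hF⟩ := VanHove.Model.exists_isMajorant M hφ hcl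
  have h1 := M.P_comp_limitKernel hφ
  have h2 := M.limitKernel_comp_P hφ
  obtain ⟨k, z, c, hz⟩ := M.exists_primitive_conj h1 h2
  refine ⟨fun lam τ => (M.continuous_memoryIntegrand lam).intervalIntegrable _ _,
    (M.integrable_limitIntegrand hφ).integrableOn,
    fun τ₀ τ₁ h0 h01 => VanHove.Model.tendstoUniformlyOn_memoryKernel hφ hF h0 h01, k, ?_,
    fun τ₁ hτ₁ => VanHove.Model.tendstoUniformlyOn_reducedDynamics hφ hF hz hτ₁⟩
  have h := VanHove.tendsto_average_of_primitive (M.continuous_conj h2) hz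
  simp_rw [← M.expS_conj h1 h2] at h
  exact h

end
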